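/- Let $M^4=\{(q,p)\in\mathbb{RP}^2\times\mathbb{RP}^{2*} : q\notin p\}$ be the manifold of non-incident point-line pairs of the real projective plane, an open submanifold of $\mathbb{RP}^2\times\mathbb{RP}^{2*}$; in homogeneous coordinates (column vectors $\mathbf q$, row vectors $\mathbf p$) non-incidence reads $\mathbf p\mathbf q\neq0$. There is a unique pseudo-Riemannian metric $g$ on $M^4$ (the *dancing metric*) for which the projection $(\mathbf q,\mathbf p)\mapsto([\mathbf q],[\mathbf p])$ from $Q^5=\{\mathbf p\mathbf q=1\}$, with the metric induced from $-2\,d\mathbf p\,d\mathbf q$ on $\mathbb R^{3}\times\mathbb R^{3*}$, is a pseudo-Riemannian submersion. Let $K(q',p')=(q',-p')$ on $TM^4=T_q\mathbb{RP}^2\oplus T_p\mathbb{RP}^{2*}$. Orient $M^4$ by the bases $(e_1,e_2,f_1,f_2)$ with $e_a\in T_q\mathbb{RP}^2$, $f_b\in T_p\mathbb{RP}^{2*}$, $g(e_a,f_b)=\delta_{ab}$ (this is well defined; these bases have volume $1$). Let $\mathcal W^\pm$ be the restriction of the Weyl operator to (anti-)self-dual 2-forms; a 2-plane is called (anti-)self-dual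 if the 2-form $\theta^1\wedge\theta^2$, for a basis $\theta^1,\theta^2$ of its annihilator, is. 1. $\mathrm{SL}_3(\mathbb R)$ acts smoothly and transitively on $M^4$ by $A\cdot([\mathbf q],[\mathbf p])=([A\mathbf q],[\mathbf pA^{-1}])$, by isometries of $g$. The stabilizer of $([e_3],[e^3])$ is $H=\{\mathrm{diag}(A,(\det A)^{-1}) : A\in\mathrm{GL}_2(\mathbb R)\}\simeq\mathrm{GL}_2(\mathbb R)$, so $M^4\cong\mathrm{SL}_3(\mathbb R)/H$ (as a manifold: $\mathrm{SL}_3(\mathbb R)/H\to M^4$ is a homeomorphism and the orbit map has smooth local sections). $(M^4,g)$ is a symmetric space: $H$ is the fixed point group of an involutive automorphism of $\mathrm{SL}_3(\mathbb R)$, and each $m\in M^4$ is fixed by an isometry with differential $-\mathrm{id}$ at $m$. $(g,K)$ is a para-Kähler structure ($K^2=1$, eigenspaces of $K$ of equal dimension, $g(Ku,Kv)=-g(u,v)$, $\nabla K=0$), it is $\mathrm{SL}_3(\mathbb R)$-invariant, and the isotropy representation identifies $H$ with the group of linear automorphisms of the tangent space at $([e_3],[e^3])$ preserving $g$ and $K$.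 2. $(M^4,g)$ is geodesically complete, Einstein, of signature $(2,2)$, and irreducible in the sense that it is nowhere locally a product: no non-empty open set carries a parallel non-degenerate distribution of rank $1$, $2$ or $3$. It is self-dual, i.e. $\mathcal W^-\equiv0$, but not conformally flat; $\mathcal W^+$ vanishes at no point and is everywhere of Petrov type D (the conics $\beta\wedge\beta=0$ and $\beta\wedge\mathcal W^+\beta=0$ in the complexified projective plane of self-dual 2-forms meet in exactly two points, each of multiplicity two). 3. The two complementary distributions $T_q\mathbb{RP}^2\oplus0$ and $0\oplus T_p\mathbb{RP}^{2*}$ are smooth of rank 2, null, self-dual, parallel and integrable. Their leaves are the fibres of the projections $M^4\to\mathbb{RP}^{2*}$ and $M^4\to\mathbb{RP}^2$ respectively, which are surjective submersions and locally trivial with fibre $\mathbb R^2$; these leaves are totally geodesic self-dual null surfaces. 4. Let $\mathbb I^3=\{(\bar q,\bar p):\bar q\in\bar p\}$ be the variety of incident pairs, a closed 3-dimensional submanifold of $\mathbb{RP}^2\times\mathbb{RP}^{2*}$. For $(\bar q,\bar p)\in\mathbb I^3$, the set $\Sigma_{\bar q,\bar p}=\{(q,p)\in M^4: q\in\bar p,\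 \bar q\in p\}$ is a connected embedded surface which is totally geodesic, null and anti-self-dual, and different incident pairs give different surfaces. -/

import Mathlib

set_option maxSynthPendingDepth 3

open Set Filter Topology Manifold ContDiff
open scoped LinearAlgebra.Projectivization Matrix

/-- The real projective plane, points being given by homogeneous coordinates in `ℝ³`. -/
abbrev RP2 : Type := ℙ ℝ (Fin 3 → ℝ)

namespace RP2

instance : TopologicalSpace RP2 :=
  inferInstanceAs (TopologicalSpace (Quotient (projectivizationSetoid ℝ (Fin 3 → ℝ))))

/-- The class map `ℝ³ ∖ {0} → RP²`. -/
noncomputable def proj (v : {v : Fin 3 → ℝ // v ≠ 0}) : RP2 := Projectivization.mk' ℝ v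

theorem isQuotientMap_proj : IsQuotientMap proj := isQuotientMap_quot_mk

theorem rep_mk (v : Fin 3 → ℝ) (hv : v ≠ 0) :
    ∃ a : ℝ, a ≠ 0 ∧ (Projectivization.mk ℝ v hv).rep = a • v := by
  obtain ⟨a, ha⟩ := Projectivization.exists_smul_eq_mk_rep ℝ v hv
  exact ⟨a, a.ne_zero, ha.symm⟩

/-- The affine coordinates `(q_j / q_k)_{j ≠ k}`. -/
noncomputable def affineCoord (k : Fin 3) (q : RP2) : Fin 2 → ℝ :=
  fun j => q.rep (k.succAbove j) / q.rep k

/-- The point with homogeneous coordinates `q_k = 1` and `(q_j)_{j ≠ k} = x`. -/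
noncomputable def affinePoint (k : Fin 3) (x : Fin 2 → ℝ) : RP2 :=
  Projectivization.mk ℝ (k.insertNth (α := fun _ => ℝ) 1 x) (fun h => by
    have := congrFun h k
    simp at this)

theorem affineCoord_mk (k : Fin 3) (v : Fin 3 → ℝ) (hv : v ≠ 0) (j : Fin 2) :
    affineCoord k (Projectivization.mk ℝ v hv) j = v (k.succAbove j) / v k := by
  obtain ⟨a, ha, h⟩ := rep_mk v hv
  simp only [affineCoord, h, Pi.smul_apply, smul_eq_mul]
  exact mul_div_mul_left _ _ ha

theorem rep_mk_ne_zero_iff (k : Fin 3) (v : Fin 3 → ℝ) (hv : v ≠ 0) :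
    (Projectivization.mk ℝ v hv).rep k ≠ 0 ↔ v k ≠ 0 := by
  obtain ⟨a, ha, h⟩ := rep_mk v hv
  simp [h, ha]

theorem affinePoint_affineCoord (k : Fin 3) (q : RP2) (hq : q.rep k ≠ 0) :
    affinePoint k (affineCoord k q) = q := by
  conv_rhs => rw [← q.mk_rep]
  rw [affinePoint, Projectivization.mk_eq_mk_iff']
  refine ⟨(q.rep k)⁻¹, ?_⟩
  funext i
  refine Fin.succAboveCases k ?_ (fun j => ?_) i
  · simp [hq]
  · simp [affineCoord, div_eq_inv_mul]

theorem isOpen_source (k : Fin 3) : IsOpen {q : RP2 | q.rep k ≠ 0} := by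
  rw [← isQuotientMap_proj.isOpen_preimage]
  have : proj ⁻¹' {q : RP2 | q.rep k ≠ 0} = {v | v.1 k ≠ 0} := by
    ext ⟨v, hv⟩
    exact rep_mk_ne_zero_iff k v hv
  rw [this]
  exact isOpen_ne_fun ((continuous_apply k).comp continuous_subtype_val) continuous_const

theorem continuousOn_affineCoord (k : Fin 3) :
    ContinuousOn (affineCoord k) {q : RP2 | q.rep k ≠ 0} := by
  rw [isQuotientMap_proj.continuousOn_isOpen_iff (isOpen_source k)]
  have h : ∀ v : {v : Fin 3 → ℝ // v ≠ 0}, (affineCoord k ∘ proj) v =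
      fun j => v.1 (k.succAbove j) / v.1 k := by
    rintro ⟨v, hv⟩
    funext j
    exact affineCoord_mk k v hv j
  refine ContinuousOn.congr (f := fun v => fun j => v.1 (k.succAbove j) / v.1 k) ?_
    (fun v _ => h v)
  refine continuousOn_pi.2 fun j => ContinuousOn.div
    ((continuous_apply _).comp continuous_subtype_val).continuousOn
    ((continuous_apply _).comp continuous_subtype_val).continuousOn ?_
  rintro ⟨v, hv⟩ h'
  exact (rep_mk_ne_zero_iff k v hv).1 h'

theorem continuous_affinePoint (k : Fin 3) : Continuous (affinePoint k) := by
  have : Continuous fun x : Fin 2 → ℝ =>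
      (⟨k.insertNth (α := fun _ => ℝ) 1 x, fun h => by
        have := congrFun h k
        simp at this⟩ : {v : Fin 3 → ℝ // v ≠ 0}) :=
    Continuous.subtype_mk (Continuous.finInsertNth (A := fun _ => ℝ) k continuous_const continuous_id) _
  exact isQuotientMap_proj.continuous.comp this

theorem affineCoord_affinePoint (k l : Fin 3) (x : Fin 2 → ℝ) (j : Fin 2) :
    affineCoord l (affinePoint k x) j =
      k.insertNth (α := fun _ => ℝ) 1 x (l.succAbove j) /
        k.insertNth (α := fun _ => ℝ) 1 x l :=
  affineCoord_mk _ _ _ _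

/-- The `k`-th standard affine chart of the projective plane. -/
noncomputable def affineChart (k : Fin 3) : OpenPartialHomeomorph RP2 (Fin 2 → ℝ) where
  toFun := affineCoord k
  invFun := affinePoint k
  source := {q | q.rep k ≠ 0}
  target := univ
  map_source' _ _ := mem_univ _
  map_target' x _ := by
    show (affinePoint k x).rep k ≠ 0
    rw [affinePoint, rep_mk_ne_zero_iff]
    simp
  left_inv' q hq := affinePoint_affineCoord k q hq
  right_inv' x _ := by
    funext j
    rw [affineCoord_affinePoint]
    simp
  open_source := isOpen_source k
  open_target := isOpen_univ
  continuousOn_toFun := continuousOn_affineCoord k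
  continuousOn_invFun := (continuous_affinePoint k).continuousOn

/-- The index of the preferred affine chart at a point. -/
noncomputable def chartIndex (q : RP2) : Fin 3 :=
  open Classical in if q.rep 2 ≠ 0 then 2 else if q.rep 1 ≠ 0 then 1 else 0

theorem chartIndex_spec (q : RP2) : q.rep (chartIndex q) ≠ 0 := by
  unfold chartIndex
  split_ifs with h2 h1
  · exact h2
  · exact h1
  · intro h0
    apply q.rep_nonzero
    push Not at h1 h2
    funext i
    fin_cases i <;> assumption

noncomputable instance : ChartedSpace (Fin 2 → ℝ) RP2 where
  atlas := range affineChart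
  chartAt q := affineChart (chartIndex q)
  mem_chart_source q := chartIndex_spec q
  chart_mem_atlas _ := mem_range_self _

instance : IsManifold 𝓘(ℝ, Fin 2 → ℝ) ∞ RP2 := by
  apply isManifold_of_contDiffOn
  rintro _ _ ⟨k, rfl⟩ ⟨l, rfl⟩
  simp only [modelWithCornersSelf_coe, modelWithCornersSelf_coe_symm, Function.comp_id,
    Function.id_comp, preimage_id, range_id, inter_univ]
  rw [contDiffOn_pi]
  intro j
  have hins : ∀ i : Fin 3, ContDiff ℝ ∞
      (fun x : Fin 2 → ℝ => k.insertNth (α := fun _ => ℝ) 1 x i) := by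
    intro i
    refine Fin.succAboveCases k ?_ (fun j => ?_) i
    · simpa using contDiff_const
    · simpa using contDiff_apply ℝ ℝ j
  refine ContDiffOn.congr (f := fun x => k.insertNth (α := fun _ => ℝ) 1 x (l.succAbove j) /
        k.insertNth (α := fun _ => ℝ) 1 x l) ?_ (fun x _ => affineCoord_affinePoint k l x j)
  refine (hins _).contDiffOn.div (hins _).contDiffOn ?_
  intro x hx
  have : (affinePoint k x).rep l ≠ 0 := by
    have := hx.2
    simpa [affineChart] using this
  rw [affinePoint, rep_mk_ne_zero_iff] at this
  exact this

end RP2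

/-! ### Non-incident point-line pairs -/

/-- The dual projective plane. A line is given by the homogeneous coordinates `p` of a linear form on
`ℝ³` (a row vector); the point `[q]` lies on the line `[p]` if and only if `p q = 0`. -/
abbrev RP2Dual : Type := RP2

/-- The point `x.1` lies on the line `x.2`. -/
def Incident (x : RP2 × RP2Dual) : Prop := x.2.rep ⬝ᵥ x.1.rep = 0

theorem incident_mk_iff (q p : Fin 3 → ℝ) (hq : q ≠ 0) (hp : p ≠ 0) :
    Incident (Projectivization.mk ℝ q hq, Projectivization.mk ℝ p hp) ↔ p ⬝ᵥ q = 0 := by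
  obtain ⟨a, ha, h⟩ := RP2.rep_mk q hq
  obtain ⟨b, hb, h'⟩ := RP2.rep_mk p hp
  simp [Incident, h, h', ha, hb]

theorem RP2.insertNth_affineCoord (k : Fin 3) (q : RP2) (hq : q.rep k ≠ 0) :
    k.insertNth (α := fun _ => ℝ) 1 (RP2.affineCoord k q) = (q.rep k)⁻¹ • q.rep := by
  funext i
  refine Fin.succAboveCases k ?_ (fun j => ?_) i
  · simp [hq]
  · simp [RP2.affineCoord, div_eq_inv_mul]

theorem isOpen_nonIncident : IsOpen {x : RP2 × RP2Dual | ¬ Incident x} := by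
  let S : Fin 3 → Fin 3 → Set (RP2 × RP2Dual) := fun k l =>
    {q : RP2 | q.rep k ≠ 0} ×ˢ {p : RP2 | p.rep l ≠ 0}
  let F : Fin 3 → Fin 3 → RP2 × RP2Dual → ℝ := fun k l x =>
    l.insertNth (α := fun _ => ℝ) 1 (RP2.affineCoord l x.2) ⬝ᵥ
      k.insertNth (α := fun _ => ℝ) 1 (RP2.affineCoord k x.1)
  have hS : ∀ k l, IsOpen (S k l) := fun k l => (RP2.isOpen_source k).prod (RP2.isOpen_source l)
  have hc : ∀ k : Fin 3, ContinuousOn (fun q : RP2 =>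
      k.insertNth (α := fun _ => ℝ) 1 (RP2.affineCoord k q)) {q : RP2 | q.rep k ≠ 0} := fun k =>
    (Continuous.finInsertNth (A := fun _ => ℝ) k continuous_const continuous_id).comp_continuousOn
      (RP2.continuousOn_affineCoord k)
  have hF : ∀ k l, ContinuousOn (F k l) (S k l) := by
    intro k l
    have h1 : ContinuousOn (fun x : RP2 × RP2Dual =>
        l.insertNth (α := fun _ => ℝ) 1 (RP2.affineCoord l x.2)) (S k l) :=
      (hc l).comp continuousOn_snd (fun x hx => hx.2)
    have h2 : ContinuousOn (fun x : RP2 × RP2Dual =>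
        k.insertNth (α := fun _ => ℝ) 1 (RP2.affineCoord k x.1)) (S k l) :=
      (hc k).comp continuousOn_fst (fun x hx => hx.1)
    exact continuousOn_finsetSum _ fun i _ =>
      ((continuousOn_pi.1 h1) i).mul ((continuousOn_pi.1 h2) i)
  have key : {x : RP2 × RP2Dual | ¬ Incident x} = ⋃ k, ⋃ l, S k l ∩ F k l ⁻¹' {0}ᶜ := by
    ext ⟨q, p⟩
    simp only [mem_iUnion, mem_ofPred_eq]
    have h : ∀ k l, (q, p) ∈ S k l → (F k l (q, p) ≠ 0 ↔ ¬ Incident (q, p)) := by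
      intro k l hkl
      have e1 := RP2.insertNth_affineCoord k q hkl.1
      have e2 := RP2.insertNth_affineCoord l p hkl.2
      have n1 : q.rep k ≠ 0 := hkl.1
      have n2 : p.rep l ≠ 0 := hkl.2
      simp only [F, e1, e2, Incident]
      simp [n1, n2]
    constructor
    · intro hx
      have hm : (q, p) ∈ S (RP2.chartIndex q) (RP2.chartIndex p) :=
        ⟨RP2.chartIndex_spec q, RP2.chartIndex_spec p⟩
      exact ⟨_, _, hm, (h _ _ hm).2 hx⟩
    · rintro ⟨k, l, hm, hf⟩
      exact (h _ _ hm).1 hf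
  rw [key]
  exact isOpen_iUnion fun k => isOpen_iUnion fun l =>
    (hF k l).isOpen_inter_preimage (hS k l) isOpen_compl_singleton

/-- The open set of non-incident point-line pairs in `RP² × RP²*`. -/
def nonIncident : TopologicalSpace.Opens (RP2 × RP2Dual) :=
  ⟨{x | ¬ Incident x}, isOpen_nonIncident⟩

/-- The manifold `M⁴` of non-incident point-line pairs, an open submanifold of `RP² × RP²*`. Its
tangent space at `(q, p)` is `T_q RP² × T_p RP²*` by construction. -/
abbrev M4 : Type := nonIncident

/-- The model `ℝ² × ℝ²` of `RP² × RP²*` and of `M⁴`. -/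
noncomputable abbrev I4 : ModelWithCorners ℝ ((Fin 2 → ℝ) × (Fin 2 → ℝ)) (ModelProd (Fin 2 → ℝ) (Fin 2 → ℝ)) :=
  𝓘(ℝ, Fin 2 → ℝ).prod 𝓘(ℝ, Fin 2 → ℝ)

namespace M4

/-- The projection `M⁴ → RP²`. -/
def point (m : M4) : RP2 := m.1.1

/-- The projection `M⁴ → RP²*`. -/
def line (m : M4) : RP2Dual := m.1.2

/-- The base point `([e₃], [e³])`. -/
noncomputable def base : M4 :=
  ⟨(Projectivization.mk ℝ ![0, 0, 1] (fun h => by simpa using congrFun h 2),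
    Projectivization.mk ℝ ![0, 0, 1] (fun h => by simpa using congrFun h 2)), by
    show ¬ Incident _
    rw [incident_mk_iff]
    simp⟩

/-- The map `(q, p) ↦ ([q], [p])` defined for `p q ≠ 0` (with a dummy value elsewhere). -/
noncomputable def ofHomogeneous (z : (Fin 3 → ℝ) × (Fin 3 → ℝ)) : M4 :=
  open Classical in
  if h : z.2 ⬝ᵥ z.1 ≠ 0 then
    ⟨(Projectivization.mk ℝ z.1 (fun h0 => h (by simp [h0])),
      Projectivization.mk ℝ z.2 (fun h0 => h (by simp [h0]))),
      fun hi => h ((incident_mk_iff _ _ _ _).1 hi)⟩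
  else base

open Matrix.SpecialLinearGroup in
theorem not_incident_smul (A : Matrix.SpecialLinearGroup (Fin 3) ℝ) (x : RP2 × RP2Dual)
    (hx : ¬ Incident x) : ¬ Incident (A • x.1, A⁻¹.transpose • x.2) := by
  obtain ⟨q, p⟩ := x
  induction q using Projectivization.ind with | _ q hq
  induction p using Projectivization.ind with | _ p hp
  rw [incident_mk_iff] at hx
  simp only [Projectivization.smul_mk]
  rw [incident_mk_iff]
  have : (A⁻¹.transpose • p) ⬝ᵥ (A • q) = p ⬝ᵥ q := by
    show ((A⁻¹ : Matrix.SpecialLinearGroup (Fin 3) ℝ).1.transpose *ᵥ p) ⬝ᵥ (A.1 *ᵥ q) = _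
    rw [Matrix.mulVec_transpose, ← Matrix.dotProduct_mulVec, Matrix.mulVec_mulVec]
    have : (A⁻¹ : Matrix.SpecialLinearGroup (Fin 3) ℝ).1 * A.1 = 1 := by
      exact congrArg Subtype.val (inv_mul_cancel A)
    rw [this, Matrix.one_mulVec]
  rwa [this]

/-- The action of `SL₃(ℝ)` on `M⁴`, induced from `(q, p) ↦ (A q, p A⁻¹)`. -/
noncomputable instance : MulAction (Matrix.SpecialLinearGroup (Fin 3) ℝ) M4 where
  smul A m := ⟨(A • m.1.1, A⁻¹.transpose • m.1.2), not_incident_smul A m.1 m.2⟩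
  one_smul m := by
    have h : ((1 : Matrix.SpecialLinearGroup (Fin 3) ℝ)⁻¹).transpose = 1 := by
      rw [inv_one]
      exact Subtype.ext Matrix.transpose_one
    refine Subtype.ext (Prod.ext ?_ ?_)
    · exact one_smul _ m.1.1
    · show ((1 : Matrix.SpecialLinearGroup (Fin 3) ℝ)⁻¹).transpose • m.1.2 = m.1.2
      rw [h, one_smul]
  mul_smul A B m := by
    have h : ((A * B)⁻¹).transpose = A⁻¹.transpose * B⁻¹.transpose := by
      rw [mul_inv_rev]
      exact Subtype.ext (Matrix.transpose_mul _ _)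
    refine Subtype.ext (Prod.ext ?_ ?_)
    · exact mul_smul A B m.1.1
    · show ((A * B)⁻¹).transpose • m.1.2 = A⁻¹.transpose • (B⁻¹.transpose • m.1.2)
      rw [h, mul_smul]

end M4

/-! ### Pseudo-Riemannian geometry -/

section Geometry

variable {E : Type*} [NormedAddCommGroup E] [NormedSpace ℝ E]
  {H : Type*} [TopologicalSpace H] {I : ModelWithCorners ℝ E H}
  {M : Type*} [TopologicalSpace M] [ChartedSpace H M]

variable (I M) in
/-- Fields of bilinear forms on the tangent spaces of `M` (covariant 2-tensors). -/
abbrev BilinField : Type _ := ∀ m : M, TangentSpace I m →L[ℝ] TangentSpace I m →L[ℝ] ℝ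

/-- `g` is a smooth pseudo-Riemannian metric. -/
structure IsPseudoRiemannian [IsManifold I ∞ M] (g : BilinField I M) : Prop where
  symm : ∀ m v w, g m v w = g m w v
  nondegenerate : ∀ m v, (∀ w, g m v w = 0) → v = 0
  smooth : ContMDiff I (I.prod 𝓘(ℝ, E →L[ℝ] E →L[ℝ] ℝ)) ∞
    (fun m => Bundle.TotalSpace.mk' (E →L[ℝ] E →L[ℝ] ℝ) m (g m))

/-- The quadratic form `v ↦ g(v, v)` on a tangent space. -/
noncomputable def metricQuadraticForm (g : BilinField I M) (m : M) :
    QuadraticForm ℝ (TangentSpace I m) :=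
  LinearMap.BilinMap.toQuadraticMap
    ((ContinuousLinearMap.coeLM ℝ).comp (g m).toLinearMap)

/-- The signature is `(r, s)` at every point. -/
def HasSignature (g : BilinField I M) (r s : ℕ) : Prop :=
  ∀ m, sigPos (metricQuadraticForm g m) = r ∧ sigNeg (metricQuadraticForm g m) = s

/-- The metric written in the preferred chart at `c`, at the point `x` of the model space. -/
noncomputable def chartMetric (g : BilinField I M) (c : M) (x : E) : E →L[ℝ] E →L[ℝ] ℝ :=
  let A : E →L[ℝ] E := mfderiv 𝓘(ℝ, E) I (extChartAt I c).symm x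
  let B : E →L[ℝ] E →L[ℝ] ℝ := g ((extChartAt I c).symm x)
  B.bilinearComp A A

/-- For a (point dependent) bilinear form `L`, the map
`(u, v) ↦ (w ↦ ½ (∂_u L(v, w) + ∂_v L(u, w) - ∂_w L(u, v)))`. -/
noncomputable def koszulForm (L : E → E →L[ℝ] E →L[ℝ] ℝ) (x : E) : E →L[ℝ] E →L[ℝ] E →L[ℝ] ℝ :=
  let D : E →L[ℝ] E →L[ℝ] E →L[ℝ] ℝ := fderiv ℝ L x
  (1 / 2 : ℝ) • (D + D.flip -
    (ContinuousLinearMap.flipₗᵢ ℝ E E ℝ).toContinuousLinearEquiv.toContinuousLinearMap ∘L D.flip)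

/-- The Christoffel symbols `(u, v) ↦ Γ(u, v)` of the Levi-Civita connection in the preferred chart
at `c`; they are determined by `g(Γ(u, v), w) = ½ (∂_u g(v, w) + ∂_v g(u, w) - ∂_w g(u, v))`. -/
noncomputable def christoffel (g : BilinField I M) (c : M) (x : E) : E →L[ℝ] E →L[ℝ] E :=
  (ContinuousLinearMap.compL ℝ E (E →L[ℝ] ℝ) E (chartMetric g c x).inverse) ∘L
    koszulForm (chartMetric g c) x

/-- The Riemann curvature `(u, v, w) ↦ R(u, v) w` in the preferred chart at `c`, that is
`R(u, v) = ∂_u Γ(v, ·) - ∂_v Γ(u, ·) + Γ(u, Γ(v, ·)) - Γ(v, Γ(u, ·))`. -/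
noncomputable def chartCurvature (g : BilinField I M) (c : M) (x : E) :
    E →L[ℝ] E →L[ℝ] E →L[ℝ] E :=
  let D : E →L[ℝ] E →L[ℝ] E →L[ℝ] E := fderiv ℝ (christoffel g c) x
  let Q : E →L[ℝ] E →L[ℝ] E →L[ℝ] E :=
    (ContinuousLinearMap.compL ℝ E E E).bilinearComp (christoffel g c x) (christoffel g c x)
  D - D.flip + Q - Q.flip

/-- The Riemann curvature tensor `R(u, v) w` at `m` (in Mathlib the tangent space at `m` is the model
space `E`, by means of the preferred chart at `m`). -/
noncomputable def curvature (g : BilinField I M) (m : M) : E →L[ℝ] E →L[ℝ] E →L[ℝ] E :=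
  chartCurvature g m (extChartAt I m m)

/-- The metric at `m` as a bilinear form on the model space. -/
def metricAt (g : BilinField I M) (m : M) : E →L[ℝ] E →L[ℝ] ℝ := g m

/-- The trace of an endomorphism. -/
noncomputable def trL [FiniteDimensional ℝ E] : (E →L[ℝ] E) →L[ℝ] ℝ :=
  LinearMap.toContinuousLinearMap
    ((LinearMap.trace ℝ E).comp (ContinuousLinearMap.coeLM ℝ : (E →L[ℝ] E) →ₗ[ℝ] E →ₗ[ℝ] E))

/-- The Ricci tensor `Ric(v, w) = tr (u ↦ R(u, v) w)`. -/
noncomputable def ricci [FiniteDimensional ℝ E] (g : BilinField I M) (m : M) :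
    E →L[ℝ] E →L[ℝ] ℝ :=
  (ContinuousLinearMap.compL ℝ E (E →L[ℝ] E) ℝ trL) ∘L
    (ContinuousLinearMap.flipₗᵢ ℝ E E E).toContinuousLinearEquiv.toContinuousLinearMap ∘L
      (curvature g m).flip

/-- The scalar curvature. -/
noncomputable def scalarCurvature [FiniteDimensional ℝ E] (g : BilinField I M) (m : M) : ℝ :=
  trL ((metricAt g m).inverse ∘L ricci g m)

/-- The Einstein condition `Ric = c g` with a constant `c`. -/
def IsEinstein [FiniteDimensional ℝ E] (g : BilinField I M) : Prop :=
  ∃ c : ℝ, ∀ m, ricci g m = c • metricAt g m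

/-- The Schouten tensor `½ (Ric - s/6 g)` in dimension four. -/
noncomputable def schouten [FiniteDimensional ℝ E] (g : BilinField I M) (m : M) :
    E →L[ℝ] E →L[ℝ] ℝ :=
  (1 / 2 : ℝ) • (ricci g m - (scalarCurvature g m / 6) • metricAt g m)

/-- The Weyl tensor in dimension four, as the endomorphism
`W(u, v) z = R(u, v) z - (g(v, z) P u + P(v, z) u - g(u, z) P v - P(u, z) v)`,
where `P` is the Schouten tensor. -/
noncomputable def weyl [FiniteDimensional ℝ E] (g : BilinField I M) (m : M) (u v : E) :
    E →L[ℝ] E :=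
  let h := metricAt g m
  let P := schouten g m
  curvature g m u v -
    ((h v).smulRight (h.inverse (P u)) + (P v).smulRight u
      - (h u).smulRight (h.inverse (P v)) - (P u).smulRight v)

/-- `g` is locally conformal to a flat metric. -/
def IsConformallyFlat (g : BilinField I M) : Prop :=
  ∀ m : M, ∃ U : Set M, IsOpen U ∧ m ∈ U ∧ ∃ f : M → ℝ, ContMDiffOn I 𝓘(ℝ, ℝ) ∞ f U ∧
    (∀ x ∈ U, 0 < f x) ∧ ∀ x ∈ U, curvature (fun y => f y • g y) x = 0

/-! #### Covariant derivatives, distributions -/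

/-- The vector field `X` is smooth on `U`. -/
def SmoothFieldOn [IsManifold I ∞ M] (X : ∀ m : M, TangentSpace I m) (U : Set M) : Prop :=
  ContMDiffOn I I.tangent ∞ (fun m => (⟨m, X m⟩ : TangentBundle I M)) U

/-- The Levi-Civita covariant derivative `(∇_u X)(m)`. -/
noncomputable def covDeriv (g : BilinField I M) (X : ∀ m : M, TangentSpace I m) (m : M)
    (u : TangentSpace I m) : TangentSpace I m :=
  let X' : E → E := VectorField.mpullback 𝓘(ℝ, E) I (extChartAt I m).symm X
  let x : E := extChartAt I m m
  (fderiv ℝ X' x u + christoffel g m x u (X' x) : E)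

/-- `D` is a smooth distribution of rank `k` on the open set `U`. -/
def IsDistributionOn [IsManifold I ∞ M] (D : ∀ m : M, Submodule ℝ (TangentSpace I m)) (k : ℕ)
    (U : Set M) : Prop :=
  ∀ m ∈ U, Module.finrank ℝ (D m) = k ∧ ∃ V ⊆ U, IsOpen V ∧ m ∈ V ∧
    ∃ X : Fin k → ∀ m : M, TangentSpace I m, (∀ i, SmoothFieldOn (X i) V) ∧
      ∀ x ∈ V, Submodule.span ℝ (range fun i => X i x) = D x

/-- `D` is parallel on `U`: covariant derivatives of sections of `D` are sections of `D`. -/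
def IsParallelOn [IsManifold I ∞ M] (g : BilinField I M)
    (D : ∀ m : M, Submodule ℝ (TangentSpace I m)) (U : Set M) : Prop :=
  ∀ V ⊆ U, IsOpen V → ∀ X : ∀ m : M, TangentSpace I m, SmoothFieldOn X V →
    (∀ x ∈ V, X x ∈ D x) → ∀ x ∈ V, ∀ u, covDeriv g X x u ∈ D x

/-- `D` is closed under Lie brackets. -/
def IsInvolutive [IsManifold I ∞ M] (D : ∀ m : M, Submodule ℝ (TangentSpace I m)) : Prop :=
  ∀ V : Set M, IsOpen V → ∀ X Y : ∀ m : M, TangentSpace I m, SmoothFieldOn X V →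
    SmoothFieldOn Y V → (∀ x ∈ V, X x ∈ D x) → (∀ x ∈ V, Y x ∈ D x) →
      ∀ x ∈ V, VectorField.mlieBracket I X Y x ∈ D x

/-- `g` is (locally) irreducible in the sense of not splitting locally as a product: no non-empty
open set carries a parallel non-degenerate distribution of rank `k`, `0 < k < dim M`. -/
def IsIndecomposable [IsManifold I ∞ M] (g : BilinField I M) : Prop :=
  ∀ U : Set M, IsOpen U → U.Nonempty → ∀ k : ℕ, 0 < k → k < Module.finrank ℝ E →
    ∀ D : ∀ m : M, Submodule ℝ (TangentSpace I m), IsDistributionOn D k U → IsParallelOn g D U →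
      ¬ ∀ m ∈ U, ∀ v ∈ D m, (∀ w ∈ D m, g m v w = 0) → v = 0

/-- The leaf of `D` through `m`: the points reached from `m` along smooth curves tangent to `D`. -/
def leaf (D : ∀ m : M, Submodule ℝ (TangentSpace I m)) (m : M) : Set M :=
  {m' | ∃ γ : ℝ → M, ContMDiff 𝓘(ℝ, ℝ) I ∞ γ ∧ γ 0 = m ∧ γ 1 = m' ∧
    ∀ t, mfderiv 𝓘(ℝ, ℝ) I γ t (1 : ℝ) ∈ D (γ t)}

/-! #### Geodesics -/

/-- `γ` is a geodesic on the open set `J` of times: it is `C²` there and in each preferred chart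
satisfies `x'' + Γ(x', x') = 0`. -/
def IsGeodesicOn (g : BilinField I M) (γ : ℝ → M) (J : Set ℝ) : Prop :=
  ContMDiffOn 𝓘(ℝ, ℝ) I 2 γ J ∧ ∀ t ∈ J, ∀ c : M, γ t ∈ (extChartAt I c).source →
    let x : ℝ → E := fun τ => extChartAt I c (γ τ)
    deriv (deriv x) t + christoffel g c (x t) (deriv x t) (deriv x t) = 0

/-- The velocity of a curve, as a point of the tangent bundle. -/
noncomputable def velocity (γ : ℝ → M) (t : ℝ) : TangentBundle I M :=
  ⟨γ t, mfderiv 𝓘(ℝ, ℝ) I γ t (1 : ℝ)⟩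

/-- Geodesic completeness. -/
def IsGeodesicallyComplete (g : BilinField I M) : Prop :=
  ∀ ξ : TangentBundle I M, ∃ γ : ℝ → M, IsGeodesicOn g γ univ ∧ velocity γ 0 = ξ

/-! #### Isometries -/

/-- `f` preserves `g`. -/
def PreservesMetric (g : BilinField I M) (f : M → M) : Prop :=
  ∀ m v w, g (f m) (mfderiv I I f m v) (mfderiv I I f m w) = g m v w

/-- Every point is an isolated fixed point of an isometry with differential `-1` there. -/
def IsSymmetricSpace (g : BilinField I M) : Prop :=
  ∀ m : M, ∃ s : Diffeomorph I I M M ∞, PreservesMetric g s ∧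
    ∀ v : TangentSpace I m,
      (⟨s m, mfderiv I I s m v⟩ : TangentBundle I M) = ⟨m, -v⟩

/-- A para-Kähler structure `(g, K)`: `K` is a smooth field of endomorphisms with `K² = 1` whose
`±1`-eigenspaces have equal dimension, `g(Ku, Kv) = -g(u, v)`, and `∇K = 0`. -/
structure IsParaKahler [IsManifold I ∞ M] (g : BilinField I M)
    (K : ∀ m : M, TangentSpace I m →L[ℝ] TangentSpace I m) : Prop where
  metric : IsPseudoRiemannian g
  smooth : ∀ (U : Set M) (X : ∀ m : M, TangentSpace I m), IsOpen U → SmoothFieldOn X U →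
    SmoothFieldOn (fun m => K m (X m)) U
  sq : ∀ m v, K m (K m v) = v
  eigenspaces : ∀ m, Module.finrank ℝ (Module.End.eigenspace (K m).toLinearMap 1) =
    Module.finrank ℝ (Module.End.eigenspace (K m).toLinearMap (-1))
  skew : ∀ m v w, g m (K m v) (K m w) = - g m v w
  parallel : ∀ (U : Set M) (X : ∀ m : M, TangentSpace I m), IsOpen U → SmoothFieldOn X U →
    ∀ m ∈ U, ∀ u, covDeriv g (fun x => K x (X x)) m u = K m (covDeriv g X m u)

/-! #### Submanifolds -/

/-- `S` is an embedded submanifold of codimension `k` with tangent spaces `T m`, `m ∈ S`: near each of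
its points, `S` is a level set of a smooth `ℝᵏ`-valued submersion with kernel `T m`. -/
def IsSubmanifold (S : Set M) (k : ℕ) (T : ∀ m : M, Submodule ℝ (TangentSpace I m)) : Prop :=
  ∀ m ∈ S, ∃ U : Set M, IsOpen U ∧ m ∈ U ∧ ∃ f : M → Fin k → ℝ,
    ContMDiffOn I 𝓘(ℝ, Fin k → ℝ) ∞ f U ∧
    ∀ x ∈ U, Function.Surjective (mfderiv I 𝓘(ℝ, Fin k → ℝ) f x) ∧
      (x ∈ S ↔ f x = f m) ∧
      (x ∈ S → T x = LinearMap.ker (mfderiv I 𝓘(ℝ, Fin k → ℝ) f x).toLinearMap)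

/-- Geodesics tangent to `S` at one point stay in `S` for some time. -/
def IsTotallyGeodesic (g : BilinField I M) (S : Set M)
    (T : ∀ m : M, Submodule ℝ (TangentSpace I m)) : Prop :=
  ∀ (γ : ℝ → M) (J : Set ℝ), IsOpen J → (0 : ℝ) ∈ J → IsGeodesicOn g γ J → γ 0 ∈ S →
    mfderiv 𝓘(ℝ, ℝ) I γ 0 (1 : ℝ) ∈ T (γ 0) → ∀ᶠ t in 𝓝 (0 : ℝ), γ t ∈ S

/-- `g` vanishes on the subspace `W` of the tangent space at `m`. -/
def IsNullSubspace (g : BilinField I M) (m : M) (W : Submodule ℝ (TangentSpace I m)) : Prop :=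
  ∀ v ∈ W, ∀ w ∈ W, g m v w = 0

end Geometry

/-! ### Linear algebra of 2-forms in dimension four -/

section TwoForms

variable {V : Type*} [NormedAddCommGroup V] [NormedSpace ℝ V]

/-- The bilinear form `β` is alternating, i.e. a 2-form. -/
def IsTwoForm (β : V →L[ℝ] V →L[ℝ] ℝ) : Prop := ∀ u, β u u = 0

/-- The wedge product of two 2-forms, evaluated on four vectors. -/
def wedge2 (α β : V → V → ℝ) (v : Fin 4 → V) : ℝ :=
  α (v 0) (v 1) * β (v 2) (v 3) - α (v 0) (v 2) * β (v 1) (v 3) + α (v 0) (v 3) * β (v 1) (v 2)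
    + α (v 1) (v 2) * β (v 0) (v 3) - α (v 1) (v 3) * β (v 0) (v 2) + α (v 2) (v 3) * β (v 0) (v 1)

/-- The wedge product of two 1-forms. -/
noncomputable def wedge1 (a b : V →L[ℝ] ℝ) : V →L[ℝ] V →L[ℝ] ℝ := a.smulRight b - b.smulRight a

/-- The inner product `½ αᵢⱼ βⁱʲ` of 2-forms induced by the scalar product `h`, computed as
`-½ tr (A B)` where `α = h(A ·, ·)` and `β = h(B ·, ·)`. -/
noncomputable def formInner [FiniteDimensional ℝ V] (h α β : V →L[ℝ] V →L[ℝ] ℝ) : ℝ :=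
  -(1 / 2) * trL ((h.inverse ∘L α) ∘L (h.inverse ∘L β))

/-- `*β = β`, where the Hodge star is defined by `α ∧ *β = ⟨α, β⟩ vol` for all 2-forms `α`. -/
def IsSelfDual [FiniteDimensional ℝ V] (h : V →L[ℝ] V →L[ℝ] ℝ) (vol : V [⋀^Fin 4]→ₗ[ℝ] ℝ)
    (β : V →L[ℝ] V →L[ℝ] ℝ) : Prop :=
  IsTwoForm β ∧ ∀ α : V →L[ℝ] V →L[ℝ] ℝ, IsTwoForm α → ∀ v,
    wedge2 (fun x y => α x y) (fun x y => β x y) v = formInner h α β * vol v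

/-- `*β = -β`. -/
def IsAntiSelfDual [FiniteDimensional ℝ V] (h : V →L[ℝ] V →L[ℝ] ℝ) (vol : V [⋀^Fin 4]→ₗ[ℝ] ℝ)
    (β : V →L[ℝ] V →L[ℝ] ℝ) : Prop :=
  IsTwoForm β ∧ ∀ α : V →L[ℝ] V →L[ℝ] ℝ, IsTwoForm α → ∀ v,
    wedge2 (fun x y => α x y) (fun x y => β x y) v = -(formInner h α β * vol v)

/-- The 2-plane `W` is self-dual: `θ₁ ∧ θ₂` is self-dual for a basis `θ₁, θ₂` of its annihilator. -/
def IsSelfDualPlane [FiniteDimensional ℝ V] (h : V →L[ℝ] V →L[ℝ] ℝ)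
    (vol : V [⋀^Fin 4]→ₗ[ℝ] ℝ) (W : Submodule ℝ V) : Prop :=
  ∃ a b : V →L[ℝ] ℝ, LinearIndependent ℝ ![a, b] ∧
    W = LinearMap.ker a.toLinearMap ⊓ LinearMap.ker b.toLinearMap ∧ IsSelfDual h vol (wedge1 a b)

/-- The 2-plane `W` is anti-self-dual. -/
def IsAntiSelfDualPlane [FiniteDimensional ℝ V] (h : V →L[ℝ] V →L[ℝ] ℝ)
    (vol : V [⋀^Fin 4]→ₗ[ℝ] ℝ) (W : Submodule ℝ V) : Prop :=
  ∃ a b : V →L[ℝ] ℝ, LinearIndependent ℝ ![a, b] ∧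
    W = LinearMap.ker a.toLinearMap ⊓ LinearMap.ker b.toLinearMap ∧
    IsAntiSelfDual h vol (wedge1 a b)

end TwoForms

section WeylOperator

variable {E : Type*} [NormedAddCommGroup E] [NormedSpace ℝ E] [FiniteDimensional ℝ E]
  {H : Type*} [TopologicalSpace H] {I : ModelWithCorners ℝ E H}
  {M : Type*} [TopologicalSpace M] [ChartedSpace H M]

/-- The Weyl tensor as an operator on 2-forms: `(𝒲β)ᵢⱼ = ½ Wᵢⱼᵏˡ βₖₗ`, where `𝒲` is normalised to be
the identity when `W` is replaced by the curvature tensor of the unit sphere. -/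
noncomputable def weylOp (g : BilinField I M) (m : M) (β : E →L[ℝ] E →L[ℝ] ℝ) (u v : E) : ℝ :=
  (1 / 2) * trL (weyl g m u v ∘L ((metricAt g m).inverse ∘L β))

/-- `𝒲⁻ = 0` at `m`: the Weyl operator vanishes on anti-self-dual 2-forms. -/
def WeylMinusVanishesAt (g : BilinField I M) (m : M) (vol : E [⋀^Fin 4]→ₗ[ℝ] ℝ) : Prop :=
  ∀ β, IsAntiSelfDual (metricAt g m) vol β → ∀ u v, weylOp g m β u v = 0

/-- `𝒲⁺ = 0` at `m`: the Weyl operator vanishes on self-dual 2-forms. -/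
def WeylPlusVanishesAt (g : BilinField I M) (m : M) (vol : E [⋀^Fin 4]→ₗ[ℝ] ℝ) : Prop :=
  ∀ β, IsSelfDual (metricAt g m) vol β → ∀ u v, weylOp g m β u v = 0

/-- `𝒲⁺` has Petrov type D at `m`: the conics `β ∧ β = 0` and `β ∧ 𝒲⁺β = 0` in the (complexified)
projective plane of self-dual 2-forms meet in exactly two points, each of multiplicity two. That is,
after a parametrization `(s : t) ↦ s² B + s t A + t² C` of the first conic, the left hand side of the
equation of the second one becomes a binary quartic with two distinct double roots. -/
def WeylPlusTypeDAt (g : BilinField I M) (m : M) (vol : E [⋀^Fin 4]→ₗ[ℝ] ℝ) : Prop :=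
  ∃ A B C : E →L[ℝ] E →L[ℝ] ℝ,
    IsSelfDual (metricAt g m) vol A ∧ IsSelfDual (metricAt g m) vol B ∧
    IsSelfDual (metricAt g m) vol C ∧ LinearIndependent ℝ ![A, B, C] ∧
    (∀ (s t : ℝ) (v : Fin 4 → E),
      let β := (s ^ 2) • B + (s * t) • A + (t ^ 2) • C
      wedge2 (fun x y => β x y) (fun x y => β x y) v = 0) ∧
    ∃ Q : ℝ → ℝ → ℝ,
      (∀ (s t : ℝ) (v : Fin 4 → E),
        let β := (s ^ 2) • B + (s * t) • A + (t ^ 2) • C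
        wedge2 (fun x y => β x y) (weylOp g m β) v = Q s t * vol v) ∧
      ∃ a₁ b₁ a₂ b₂ : ℂ, a₁ * b₂ - a₂ * b₁ ≠ 0 ∧
        ∀ s t : ℝ, (Q s t : ℂ) = (a₁ * s + b₁ * t) ^ 2 * (a₂ * s + b₂ * t) ^ 2

end WeylOperator

/-! ### The dancing metric -/

namespace M4

/-- The model space of `M⁴`. -/
abbrev E4 : Type := (Fin 2 → ℝ) × (Fin 2 → ℝ)

/-- The subspace `T_q RP² ⊕ 0` of the tangent space at `(q, p)`. -/
noncomputable def pointDir (m : M4) : Submodule ℝ (TangentSpace I4 m) :=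
  LinearMap.ker (mfderiv I4 𝓘(ℝ, Fin 2 → ℝ) line m).toLinearMap

/-- The subspace `0 ⊕ T_p RP²*` of the tangent space at `(q, p)`. -/
noncomputable def lineDir (m : M4) : Submodule ℝ (TangentSpace I4 m) :=
  LinearMap.ker (mfderiv I4 𝓘(ℝ, Fin 2 → ℝ) point m).toLinearMap

/-- The para-complex structure `K(q', p') = (q', -p')` on `T_q RP² ⊕ T_p RP²*`. -/
def paraK (m : M4) : TangentSpace I4 m →L[ℝ] TangentSpace I4 m :=
  (ContinuousLinearMap.prodMap (ContinuousLinearMap.id ℝ (Fin 2 → ℝ))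
    (-ContinuousLinearMap.id ℝ (Fin 2 → ℝ)) : E4 →L[ℝ] E4)

/-- The flat metric `-2 dp dq` of `ℝ^{3,3}`. -/
def flatMetric (a b : (Fin 3 → ℝ) × (Fin 3 → ℝ)) : ℝ := -(a.2 ⬝ᵥ b.1 + b.2 ⬝ᵥ a.1)

/-- `a` is tangent to the pseudo-sphere `p q = 1` at `z = (q, p)`. -/
def IsTangentQ (z a : (Fin 3 → ℝ) × (Fin 3 → ℝ)) : Prop := z.2 ⬝ᵥ a.1 + a.2 ⬝ᵥ z.1 = 0

/-- The differential at `z` of `(q, p) ↦ ([q], [p])`. -/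
noncomputable def dPi (z a : (Fin 3 → ℝ) × (Fin 3 → ℝ)) : TangentSpace I4 (ofHomogeneous z) :=
  mfderiv 𝓘(ℝ, (Fin 3 → ℝ) × (Fin 3 → ℝ)) I4 ofHomogeneous z a

/-- `a` is tangent to the pseudo-sphere and orthogonal to the fibre of the projection to `M⁴`. -/
def IsHorizontal (z a : (Fin 3 → ℝ) × (Fin 3 → ℝ)) : Prop :=
  IsTangentQ z a ∧ ∀ c, IsTangentQ z c → dPi z c = 0 → flatMetric a c = 0

/-- `g` is the dancing metric: the pseudo-Riemannian metric on `M⁴` for which the projection from the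
pseudo-sphere `p q = 1`, with the metric induced from `-2 dp dq`, is a pseudo-Riemannian submersion. -/
def IsDancingMetric (g : BilinField I4 M4) : Prop :=
  IsPseudoRiemannian g ∧ ∀ z : (Fin 3 → ℝ) × (Fin 3 → ℝ), z.2 ⬝ᵥ z.1 = 1 →
    ∀ a b, IsHorizontal z a → IsHorizontal z b →
      g (ofHomogeneous z) (dPi z a) (dPi z b) = flatMetric a b

/-- `vol` is the unit volume form at `m` which is positive on the bases `e₁, e₂, f₁, f₂` with
`e₁, e₂` in `T_q RP²`, `f₁, f₂` in `T_p RP²*` and `g(e_a, f_b) = δ_ab`. -/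
def IsOrientedVolume (g : BilinField I4 M4) (m : M4) (vol : E4 [⋀^Fin 4]→ₗ[ℝ] ℝ) : Prop :=
  ∃ b : Module.Basis (Fin 4) ℝ E4,
    b 0 ∈ pointDir m ∧ b 1 ∈ pointDir m ∧ b 2 ∈ lineDir m ∧ b 3 ∈ lineDir m ∧
    metricAt g m (b 0) (b 2) = 1 ∧ metricAt g m (b 1) (b 3) = 1 ∧
    metricAt g m (b 0) (b 3) = 0 ∧ metricAt g m (b 1) (b 2) = 0 ∧ vol = b.det

/-- The block matrix `diag(A, (det A)⁻¹)`. -/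
noncomputable def blockMatrix (A : Matrix (Fin 2) (Fin 2) ℝ) : Matrix (Fin 3) (Fin 3) ℝ :=
  !![A 0 0, A 0 1, 0; A 1 0, A 1 1, 0; 0, 0, A.det⁻¹]

theorem blockMatrix_mul (A B : Matrix (Fin 2) (Fin 2) ℝ) :
    blockMatrix (A * B) = blockMatrix A * blockMatrix B := by
  ext i j
  fin_cases i <;> fin_cases j <;>
    simp [blockMatrix, Matrix.mul_apply, Fin.sum_univ_succ] <;> ring

theorem det_blockMatrix (A : GL (Fin 2) ℝ) : (blockMatrix A.1).det = 1 := by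
  have h : A.1.det ≠ 0 := A.det.ne_zero
  unfold blockMatrix
  rw [Matrix.det_fin_two] at h ⊢
  rw [Matrix.det_fin_three]
  simp
  field_simp

/-- The embedding `A ↦ diag(A, (det A)⁻¹)` of `GL₂(ℝ)` into `SL₃(ℝ)`; its range is the subgroup `H`. -/
noncomputable def blockHom : GL (Fin 2) ℝ →* Matrix.SpecialLinearGroup (Fin 3) ℝ where
  toFun A := ⟨blockMatrix A.1, det_blockMatrix A⟩
  map_one' := by
    apply Subtype.ext
    show blockMatrix (1 : Matrix (Fin 2) (Fin 2) ℝ) = 1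
    ext i j
    fin_cases i <;> fin_cases j <;> simp [blockMatrix]
  map_mul' A B := Subtype.ext (blockMatrix_mul A.1 B.1)

/-- The set of non-incident pairs `(q, p)` with `q ∈ p̄` and `q̄ ∈ p`, for `x = (q̄, p̄)`. -/
def sigmaSurface (x : RP2 × RP2Dual) : Set M4 :=
  {m | Incident (m.point, x.2) ∧ Incident (x.1, m.line)}

/-- `D` is a null, self-dual, parallel, integrable distribution of rank two, its leaves are the fibres
of `f`, and these are totally geodesic surfaces. -/
structure IsDancingFoliation (g : BilinField I4 M4) (vol : M4 → E4 [⋀^Fin 4]→ₗ[ℝ] ℝ)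
    (D : ∀ m : M4, Submodule ℝ (TangentSpace I4 m)) (f : M4 → RP2) : Prop where
  distribution : IsDistributionOn D 2 univ
  null : ∀ m, IsNullSubspace g m (D m)
  selfDual : ∀ m, IsSelfDualPlane (V := E4) (metricAt g m) (vol m) (D m)
  parallel : IsParallelOn g D univ
  involutive : IsInvolutive D
  leaf_eq : ∀ m, leaf D m = f ⁻¹' {f m}
  fibres : ∀ y : RP2, (f ⁻¹' {y}).Nonempty ∧ IsSubmanifold (f ⁻¹' {y}) 2 D ∧
    IsTotallyGeodesic g (f ⁻¹' {y}) D
  fibration : ContMDiff I4 𝓘(ℝ, Fin 2 → ℝ) ∞ f ∧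
    (∀ m, Function.Surjective (mfderiv I4 𝓘(ℝ, Fin 2 → ℝ) f m)) ∧
    ∀ y : RP2, ∃ e : Bundle.Trivialization (Fin 2 → ℝ) f, y ∈ e.baseSet

end M4

/-! All computations take place in homogeneous coordinates. On pairs (q, p) with F = pq ≠ 0, the
polarisation of −2(dp dq / F − (dp q)(p dq) / F²) does not change when q and p are rescaled
separately or when radial multiples are added to tangent vectors (`homForm_smul`). It therefore
descends to M⁴, and on horizontal vectors over pq = 1 it is the flat metric −2 dp dq. This gives
existence of the dancing metric; uniqueness holds because every tangent vector has a horizontal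
lift. The form contains only pairings of a row with a column, so SL₃ acts by isometries. The
symmetry at (q, p) is itself an element of SL₃, the matrix 2qp − 1.

In a product of affine charts, F, A₁ = p dq, A₂ = dp q and the constant form B = dp ⊗ dq are closed
under differentiation: dF = A₁ + A₂, and A₁, A₂ have derivatives B and its transpose. The Koszul
formula then yields Γ(u, v) = −F⁻¹(A₁(u) v₁ + A₁(v) u₁ + A₂(u) v₂ + A₂(v) u₂), where the indices
denote components in the two factors (`koszulForm_formG`). The curvature is algebraic in the mixed
part H of the metric and the two projections (`chartCurvature_dancingMetric`), as for a para-complex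
space form. The rest of the local theory is linear algebra in a null basis (e₁, e₂, f₁, f₂) adapted
to the splitting (`IsAdapted`). One finds Ric = −3g, the Weyl operator kills anti-self-dual forms,
and on self-dual forms it has eigenvalues 1, 1, −2, which is type D (`weylOp_dancingMetric`).

The shape of Γ also controls the global geometry. It respects both factors, so K and the two
foliations are parallel. Along a geodesic the acceleration of the point is a multiple of its
velocity, and likewise for the line. An affine function of the point alone, or of the line alone,
thus satisfies f'' = a f' and is constant once stationary (`geodesic_affine_const`). The leaves and
the surfaces Σ are cut out by such functions, so they are totally geodesic. For Σ, the metric dual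
of the equation of p̄ is tangent to Σ because q̄ ∈ p̄, which makes Σ null and anti-self-dual.
Complete geodesics are the projections of solutions of z'' = −κz in ℝ³ × ℝ³* with horizontal
velocity.

For indecomposability, a parallel distribution is invariant under the curvature, and a
curvature-invariant subspace is contained in one of the two null planes or is the whole space
(`IsAdapted.invariant_trichotomy`). Conformal flatness fails because two curvature components
receive equal contributions from any conformal factor, but opposite ones from the dancing metric. -/

/-- Insertion of `1` in the `k`-th place. -/
noncomputable abbrev ins (k : Fin 3) (x : Fin 2 → ℝ) : Fin 3 → ℝ := k.insertNth (α := fun _ => ℝ) 1 x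

/-- Insertion of `0` in the `k`-th place. -/
noncomputable abbrev ins₀ (k : Fin 3) (x : Fin 2 → ℝ) : Fin 3 → ℝ := k.insertNth (α := fun _ => ℝ) 0 x

/-! ### Topology of the projective plane -/

namespace RP2

/-- A line in ℝ³ is determined by the orthogonal projection qqᵀ/|q|² onto it; this embeds the plane
injectively and continuously into matrices. -/
theorem T2Space_aux : T2Space RP2 := by
  let f₀ : {v : Fin 3 → ℝ // v ≠ 0} → Fin 3 → Fin 3 → ℝ := fun v i j =>
    v.1 i * v.1 j / (v.1 ⬝ᵥ v.1)
  have hpos : ∀ v : {v : Fin 3 → ℝ // v ≠ 0}, v.1 ⬝ᵥ v.1 ≠ 0 := fun v h =>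
    v.2 (dotProduct_self_eq_zero.1 h)
  have hf₀ : Continuous f₀ := by
    refine continuous_pi fun i => continuous_pi fun j => Continuous.div ?_ ?_ hpos
    · exact ((continuous_apply i).comp continuous_subtype_val).mul
        ((continuous_apply j).comp continuous_subtype_val)
    · exact Continuous.dotProduct continuous_subtype_val continuous_subtype_val
  let f : RP2 → Fin 3 → Fin 3 → ℝ := fun q => f₀ ⟨q.rep, q.rep_nonzero⟩
  have hcomp : f ∘ proj = f₀ := by
    funext ⟨v, hv⟩
    funext i j
    obtain ⟨a, ha, h⟩ := rep_mk v hv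
    show (Projectivization.mk ℝ v hv).rep i * (Projectivization.mk ℝ v hv).rep j /
      ((Projectivization.mk ℝ v hv).rep ⬝ᵥ (Projectivization.mk ℝ v hv).rep) = _
    rw [h]
    simp only [f₀, Pi.smul_apply, smul_eq_mul, dotProduct_smul, smul_dotProduct]
    have := hpos ⟨v, hv⟩
    field_simp
  have hf : Continuous f := by
    rw [isQuotientMap_proj.continuous_iff, hcomp]
    exact hf₀
  refine T2Space.of_injective_continuous (f := f) ?_ hf
  intro q q' h
  have h' : ∀ i j, q.rep i * q.rep j / (q.rep ⬝ᵥ q.rep) =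
      q'.rep i * q'.rep j / (q'.rep ⬝ᵥ q'.rep) := fun i j => congrFun (congrFun h i) j
  have n1 := hpos ⟨q.rep, q.rep_nonzero⟩
  have n2 := hpos ⟨q'.rep, q'.rep_nonzero⟩
  obtain ⟨k, hk⟩ : ∃ k, q.rep k ≠ 0 := ⟨_, chartIndex_spec q⟩
  rw [← q.mk_rep, ← q'.mk_rep, Projectivization.mk_eq_mk_iff']
  have hk' : q'.rep k * q'.rep k ≠ 0 := by
    intro h0
    have := h' k k
    rw [h0, zero_div] at this
    rcases div_eq_zero_iff.1 this with h | h
    · exact mul_ne_zero hk hk h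
    · exact n1 h
  have hk'' : q'.rep k ≠ 0 := left_ne_zero_of_mul hk'
  -- The k-th columns of the two equal matrices are nonzero multiples of the two representatives, so
  -- the k-th coordinate fixes the ratio.
  refine ⟨q.rep k / q'.rep k, ?_⟩
  funext i
  have e1 := h' i k
  have e2 := h' k k
  have n1' : q.rep ⬝ᵥ q.rep ≠ 0 := n1
  have n2' : q'.rep ⬝ᵥ q'.rep ≠ 0 := n2
  simp only [Pi.smul_apply, smul_eq_mul]
  rw [div_eq_div_iff n1' n2'] at e1 e2
  field_simp
  have e3 : q'.rep i * q.rep k * (q'.rep k * (q.rep ⬝ᵥ q.rep)) =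
      q.rep i * q'.rep k * (q'.rep k * (q.rep ⬝ᵥ q.rep)) := by
    refine mul_left_cancel₀ hk ?_
    linear_combination -q.rep k * q.rep k * e1 + q.rep k * q.rep i * e2
  have := mul_right_cancel₀ (mul_ne_zero hk'' n1') e3
  linear_combination this

instance : T2Space RP2 := T2Space_aux

/-- Three chart domains suffice. The k-th coordinate point has only its k-th coordinate nonzero, so
its preferred chart is the k-th one. -/
instance : SecondCountableTopology RP2 := by
  refine ChartedSpace.secondCountable_of_countable_cover (Fin 2 → ℝ) (s := range fun k : Fin 3 => affinePoint k 0) ?_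
    (countable_range _)
  rw [biUnion_range, iUnion_eq_univ_iff]
  intro q
  refine ⟨chartIndex q, ?_⟩
  have : chartIndex (affinePoint (chartIndex q) 0) = chartIndex q := by
    generalize chartIndex q = k
    have h : ∀ j, (affinePoint k 0).rep j ≠ 0 ↔ j = k := by
      intro j
      rw [affinePoint, rep_mk_ne_zero_iff]
      refine Fin.succAboveCases k ?_ (fun j => ?_) j
      · simp
      · simp [Fin.succAbove_ne]
    exact (h _).1 (chartIndex_spec _)
  show q.rep (chartIndex (affinePoint (chartIndex q) 0)) ≠ 0
  rw [this]
  exact chartIndex_spec q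

end RP2

/-! ### Charts of M⁴ and homogeneous coordinates -/

namespace M4

theorem extChartAt_apply (c m : M4) : extChartAt I4 c m =
    (RP2.affineCoord (RP2.chartIndex c.point) m.point,
      RP2.affineCoord (RP2.chartIndex c.line) m.line) := rfl

theorem extChartAt_source (c : M4) : (extChartAt I4 c).source =
    {m : M4 | m.point.rep (RP2.chartIndex c.point) ≠ 0 ∧
      m.line.rep (RP2.chartIndex c.line) ≠ 0} := by
  rw [_root_.extChartAt_source, TopologicalSpace.Opens.chartAt_eq,
    OpenPartialHomeomorph.subtypeRestr_source]
  rfl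

/-- The homogeneous coordinates of the point with affine coordinates `x` in the chart `(k, l)`. -/
noncomputable def lift (k l : Fin 3) (x : E4) : (Fin 3 → ℝ) × (Fin 3 → ℝ) := (ins k x.1, ins l x.2)

theorem ofHomogeneous_eq (z : (Fin 3 → ℝ) × (Fin 3 → ℝ)) (h : z.2 ⬝ᵥ z.1 ≠ 0) :
    ofHomogeneous z = ⟨(Projectivization.mk ℝ z.1 (fun h0 => h (by simp [h0])),
      Projectivization.mk ℝ z.2 (fun h0 => h (by simp [h0]))),
      fun hi => h ((incident_mk_iff _ _ _ _).1 hi)⟩ := dif_pos h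

theorem ofHomogeneous_rep (m : M4) : ofHomogeneous (m.point.rep, m.line.rep) = m := by
  rw [ofHomogeneous_eq (m.point.rep, m.line.rep) m.2]
  exact Subtype.ext (Prod.ext (Projectivization.mk_rep _) (Projectivization.mk_rep _))

theorem ofHomogeneous_smul (z : (Fin 3 → ℝ) × (Fin 3 → ℝ)) (h : z.2 ⬝ᵥ z.1 ≠ 0) {a b : ℝ}
    (ha : a ≠ 0) (hb : b ≠ 0) : ofHomogeneous (a • z.1, b • z.2) = ofHomogeneous z := by
  rw [ofHomogeneous_eq z h, ofHomogeneous_eq (a • z.1, b • z.2) (by simp [ha, hb, h])]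
  refine Subtype.ext (Prod.ext ?_ ?_)
  · exact (Projectivization.mk_eq_mk_iff' ..).2 ⟨a, rfl⟩
  · exact (Projectivization.mk_eq_mk_iff' ..).2 ⟨b, rfl⟩

theorem point_ofHomogeneous (z : (Fin 3 → ℝ) × (Fin 3 → ℝ)) (h : z.2 ⬝ᵥ z.1 ≠ 0) :
    (ofHomogeneous z).point = Projectivization.mk ℝ z.1 (fun h0 => h (by simp [h0])) := by
  rw [ofHomogeneous_eq z h]; rfl

theorem line_ofHomogeneous (z : (Fin 3 → ℝ) × (Fin 3 → ℝ)) (h : z.2 ⬝ᵥ z.1 ≠ 0) :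
    (ofHomogeneous z).line = Projectivization.mk ℝ z.2 (fun h0 => h (by simp [h0])) := by
  rw [ofHomogeneous_eq z h]; rfl

theorem lift_affineCoord (k l : Fin 3) (m : M4) (hk : m.point.rep k ≠ 0) (hl : m.line.rep l ≠ 0) :
    lift k l (RP2.affineCoord k m.point, RP2.affineCoord l m.line) =
      ((m.point.rep k)⁻¹ • m.point.rep, (m.line.rep l)⁻¹ • m.line.rep) := by
  simp only [lift, ins, RP2.insertNth_affineCoord k _ hk, RP2.insertNth_affineCoord l _ hl]

theorem extChartAt_target (c : M4) : (extChartAt I4 c).target =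
    {x | ins (RP2.chartIndex c.line) x.2 ⬝ᵥ ins (RP2.chartIndex c.point) x.1 ≠ 0} := by
  rw [← (extChartAt I4 c).image_source_eq_target, extChartAt_source]
  ext x
  constructor
  · rintro ⟨m, ⟨h1, h2⟩, rfl⟩
    have := lift_affineCoord _ _ m h1 h2
    rw [lift, Prod.mk.injEq] at this
    simp only [extChartAt_apply, mem_ofPred_eq, this, dotProduct_smul, smul_dotProduct]
    simp only [smul_eq_mul]
    exact mul_ne_zero (inv_ne_zero h1) (mul_ne_zero (inv_ne_zero h2) m.2)
  · intro hx
    have hx : (lift (RP2.chartIndex c.point) (RP2.chartIndex c.line) x).2 ⬝ᵥ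
      (lift (RP2.chartIndex c.point) (RP2.chartIndex c.line) x).1 ≠ 0 := hx
    refine ⟨ofHomogeneous (lift (RP2.chartIndex c.point) (RP2.chartIndex c.line) x), ⟨?_, ?_⟩, ?_⟩
    · rw [point_ofHomogeneous _ hx, RP2.rep_mk_ne_zero_iff]
      simp [lift]
    · rw [line_ofHomogeneous _ hx, RP2.rep_mk_ne_zero_iff]
      simp [lift]
    · rw [extChartAt_apply, point_ofHomogeneous _ hx, line_ofHomogeneous _ hx]
      refine Prod.ext (funext fun j => ?_) (funext fun j => ?_)
      · simp [RP2.affineCoord_mk, lift]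
      · simp [RP2.affineCoord_mk, lift]

/-- Every inverse chart factors through `ofHomogeneous` and an affine map, so derivatives of charts
reduce to those of quotients q_j / q_k. -/
theorem extChartAt_symm_apply (c : M4) (x : E4)
    (hx : ins (RP2.chartIndex c.line) x.2 ⬝ᵥ ins (RP2.chartIndex c.point) x.1 ≠ 0) :
    (extChartAt I4 c).symm x =
      ofHomogeneous (lift (RP2.chartIndex c.point) (RP2.chartIndex c.line) x) := by
  have hx' : x ∈ (extChartAt I4 c).target := by rw [extChartAt_target]; exact hx
  apply (extChartAt I4 c).injOn ((extChartAt I4 c).map_target hx')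
  · rw [extChartAt_source, mem_ofPred_eq, point_ofHomogeneous _ hx, RP2.rep_mk_ne_zero_iff,
      line_ofHomogeneous _ hx, RP2.rep_mk_ne_zero_iff]
    simp [lift]
  · rw [(extChartAt I4 c).right_inv hx', extChartAt_apply, point_ofHomogeneous _ hx,
      line_ofHomogeneous _ hx]
    refine Prod.ext (funext fun j => ?_) (funext fun j => ?_)
    · simp [RP2.affineCoord_mk, lift]
    · simp [RP2.affineCoord_mk, lift]

theorem ofHomogeneous_lift_extChartAt (c m : M4) (hm : m ∈ (extChartAt I4 c).source) :
    ofHomogeneous (lift (RP2.chartIndex c.point) (RP2.chartIndex c.line) (extChartAt I4 c m)) =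
      m := by
  have ht := (extChartAt I4 c).map_source hm
  rw [extChartAt_target] at ht
  rw [← extChartAt_symm_apply c _ ht, (extChartAt I4 c).left_inv hm]

/-- The derivative at `q` of `q ↦ (q_j / q_k)_{j ≠ k}`. -/
noncomputable def affineDeriv (k : Fin 3) (q : Fin 3 → ℝ) : (Fin 3 → ℝ) →L[ℝ] (Fin 2 → ℝ) :=
  ContinuousLinearMap.pi fun j =>
    (q k)⁻¹ • ContinuousLinearMap.proj (R := ℝ) (φ := fun _ : Fin 3 => ℝ) (k.succAbove j) -
      (q (k.succAbove j) / q k ^ 2) • ContinuousLinearMap.proj (R := ℝ) (φ := fun _ : Fin 3 => ℝ) k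

theorem affineDeriv_apply (k : Fin 3) (q a : Fin 3 → ℝ) (j : Fin 2) : affineDeriv k q a j =
    (q k)⁻¹ * a (k.succAbove j) - q (k.succAbove j) / q k ^ 2 * a k := rfl

theorem hasFDerivAt_affine (k : Fin 3) (q : Fin 3 → ℝ) (hq : q k ≠ 0) :
    HasFDerivAt (fun q : Fin 3 → ℝ => fun j : Fin 2 => q (k.succAbove j) / q k)
      (affineDeriv k q) q := by
  rw [hasFDerivAt_pi']
  intro j
  have h1 : HasFDerivAt (fun q : Fin 3 → ℝ => q (k.succAbove j))
    (ContinuousLinearMap.proj (R := ℝ) (φ := fun _ : Fin 3 => ℝ) (k.succAbove j)) q :=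
    (ContinuousLinearMap.proj (R := ℝ) (φ := fun _ : Fin 3 => ℝ) (k.succAbove j)).hasFDerivAt
  have h2 : HasFDerivAt (fun q : Fin 3 → ℝ => q k)
    (ContinuousLinearMap.proj (R := ℝ) (φ := fun _ : Fin 3 => ℝ) k) q :=
    (ContinuousLinearMap.proj (R := ℝ) (φ := fun _ : Fin 3 => ℝ) k).hasFDerivAt
  have h3 := h1.mul ((hasDerivAt_inv hq).comp_hasFDerivAt q h2)
  refine h3.congr_fderiv ?_
  ext a
  simp [affineDeriv_apply]
  field_simp
  ring

/-- After rescaling, the affine velocity differs from the homogeneous one only by a multiple of q.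
This is the ambiguity that the metric in homogeneous coordinates ignores. -/
theorem ins_affineDeriv (k : Fin 3) (q a : Fin 3 → ℝ) (hq : q k ≠ 0) :
    ins₀ k (affineDeriv k q a) = (q k)⁻¹ • a - (a k / q k ^ 2) • q := by
  funext i
  refine Fin.succAboveCases k ?_ (fun j => ?_) i
  · simp; field_simp; simp
  · simp [affineDeriv_apply]; ring

theorem affineDeriv_eq_zero_iff (k : Fin 3) (q a : Fin 3 → ℝ) (hq : q k ≠ 0) :
    affineDeriv k q a = 0 ↔ ∃ c : ℝ, a = c • q := by
  constructor
  · intro h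
    have := ins_affineDeriv k q a hq
    rw [h] at this
    refine ⟨a k / q k, ?_⟩
    have h0 : ins₀ k 0 = 0 := by
      funext i; refine Fin.succAboveCases k ?_ (fun j => ?_) i <;> simp
    rw [h0] at this
    have h2 := congrArg (fun v => q k • v) this
    simp only [smul_zero, smul_sub, smul_smul, mul_inv_cancel₀ hq, one_smul] at h2
    rw [eq_comm, sub_eq_zero] at h2
    have e : q k * (a k / q k ^ 2) = a k / q k := by field_simp
    rw [e] at h2
    exact h2
  · rintro ⟨c, rfl⟩
    funext j
    simp [affineDeriv_apply]
    field_simp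
    simp

theorem rep_ofHomogeneous_ne (z : (Fin 3 → ℝ) × (Fin 3 → ℝ)) (h : z.2 ⬝ᵥ z.1 ≠ 0) (k l : Fin 3) :
    ((ofHomogeneous z).point.rep k ≠ 0 ↔ z.1 k ≠ 0) ∧
      ((ofHomogeneous z).line.rep l ≠ 0 ↔ z.2 l ≠ 0) := by
  rw [point_ofHomogeneous z h, line_ofHomogeneous z h, RP2.rep_mk_ne_zero_iff,
    RP2.rep_mk_ne_zero_iff]
  exact ⟨Iff.rfl, Iff.rfl⟩

theorem isOpen_regular : IsOpen {z : (Fin 3 → ℝ) × (Fin 3 → ℝ) | z.2 ⬝ᵥ z.1 ≠ 0} :=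
  isOpen_ne_fun (continuous_snd.dotProduct continuous_fst) continuous_const

theorem extChartAt_ofHomogeneous (c : M4) (z : (Fin 3 → ℝ) × (Fin 3 → ℝ)) (h : z.2 ⬝ᵥ z.1 ≠ 0) :
    extChartAt I4 c (ofHomogeneous z) =
      (fun j => z.1 ((RP2.chartIndex c.point).succAbove j) / z.1 (RP2.chartIndex c.point),
       fun j => z.2 ((RP2.chartIndex c.line).succAbove j) / z.2 (RP2.chartIndex c.line)) := by
  rw [extChartAt_apply, point_ofHomogeneous z h, line_ofHomogeneous z h]
  exact Prod.ext (funext fun j => RP2.affineCoord_mk _ _ _ _)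
    (funext fun j => RP2.affineCoord_mk _ _ _ _)

theorem ofHomogeneous_mem_source_iff (c : M4) (z : (Fin 3 → ℝ) × (Fin 3 → ℝ))
    (h : z.2 ⬝ᵥ z.1 ≠ 0) : ofHomogeneous z ∈ (extChartAt I4 c).source ↔
      z.1 (RP2.chartIndex c.point) ≠ 0 ∧ z.2 (RP2.chartIndex c.line) ≠ 0 := by
  rw [extChartAt_source, mem_ofPred_eq, (rep_ofHomogeneous_ne z h _ (RP2.chartIndex c.line)).1,
    (rep_ofHomogeneous_ne z h (RP2.chartIndex c.point) _).2]

theorem chartIndex_ofHomogeneous_ne (z : (Fin 3 → ℝ) × (Fin 3 → ℝ)) (h : z.2 ⬝ᵥ z.1 ≠ 0) :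
    z.1 (RP2.chartIndex (ofHomogeneous z).point) ≠ 0 ∧
      z.2 (RP2.chartIndex (ofHomogeneous z).line) ≠ 0 :=
  (ofHomogeneous_mem_source_iff _ z h).1 (mem_extChartAt_source _)

theorem contDiffAt_affine (k : Fin 3) (q : Fin 3 → ℝ) (hq : q k ≠ 0) {n : WithTop ℕ∞} :
    ContDiffAt ℝ n (fun q : Fin 3 → ℝ => fun j : Fin 2 => q (k.succAbove j) / q k) q := by
  rw [contDiffAt_pi]
  intro j
  exact ((contDiff_apply ℝ ℝ (k.succAbove j)).contDiffAt).div ((contDiff_apply ℝ ℝ k).contDiffAt) hq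

theorem contMDiffAt_ofHomogeneous (z : (Fin 3 → ℝ) × (Fin 3 → ℝ)) (h : z.2 ⬝ᵥ z.1 ≠ 0) :
    ContMDiffAt 𝓘(ℝ, (Fin 3 → ℝ) × (Fin 3 → ℝ)) I4 ∞ ofHomogeneous z := by
  obtain ⟨h1, h2⟩ := chartIndex_ofHomogeneous_ne z h
  set c := ofHomogeneous z with hc
  let A : (Fin 3 → ℝ) × (Fin 3 → ℝ) → E4 := fun z =>
      (fun j => z.1 ((RP2.chartIndex c.point).succAbove j) / z.1 (RP2.chartIndex c.point),
       fun j => z.2 ((RP2.chartIndex c.line).succAbove j) / z.2 (RP2.chartIndex c.line))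
  have hA : ContDiffAt ℝ ∞ A z :=
    ((contDiffAt_affine _ _ h1).comp z contDiffAt_fst).prodMk
      ((contDiffAt_affine _ _ h2).comp z contDiffAt_snd)
  have hAz : A z = extChartAt I4 c c := (extChartAt_ofHomogeneous c z h).symm
  have hsymm : ContMDiffAt 𝓘(ℝ, E4) I4 ∞ (extChartAt I4 c).symm (A z) := by
    rw [hAz]
    exact (contMDiffOn_extChartAt_symm c).contMDiffAt (extChartAt_target_mem_nhds c)
  refine (hsymm.comp z hA.contMDiffAt).congr_of_eventuallyEq ?_
  have o1 : IsOpen {z : (Fin 3 → ℝ) × (Fin 3 → ℝ) | z.1 (RP2.chartIndex c.point) ≠ 0} :=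
    isOpen_ne_fun ((continuous_apply _).comp continuous_fst) continuous_const
  have o2 : IsOpen {z : (Fin 3 → ℝ) × (Fin 3 → ℝ) | z.2 (RP2.chartIndex c.line) ≠ 0} :=
    isOpen_ne_fun ((continuous_apply _).comp continuous_snd) continuous_const
  filter_upwards [isOpen_regular.mem_nhds h, o1.mem_nhds h1, o2.mem_nhds h2] with w hw hw1 hw2
  have hw' : w.2 ⬝ᵥ w.1 ≠ 0 := hw
  show _ = (extChartAt I4 c).symm (A w)
  have : A w = extChartAt I4 c (ofHomogeneous w) := (extChartAt_ofHomogeneous c w hw').symm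
  rw [this, (extChartAt I4 c).left_inv ((ofHomogeneous_mem_source_iff c w hw').2 ⟨hw1, hw2⟩)]

/-- The tangent space at the image is read in the preferred chart there, so the derivative is the
quotient rule with the chart indices of the image point. -/
theorem hasMFDerivAt_ofHomogeneous (z : (Fin 3 → ℝ) × (Fin 3 → ℝ)) (h : z.2 ⬝ᵥ z.1 ≠ 0) :
    HasMFDerivAt 𝓘(ℝ, (Fin 3 → ℝ) × (Fin 3 → ℝ)) I4 ofHomogeneous z
      ((affineDeriv (RP2.chartIndex (ofHomogeneous z).point) z.1).prodMap
        (affineDeriv (RP2.chartIndex (ofHomogeneous z).line) z.2)) := by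
  obtain ⟨h1, h2⟩ := chartIndex_ofHomogeneous_ne z h
  refine ⟨(contMDiffAt_ofHomogeneous z h).continuousAt, ?_⟩
  have := HasFDerivAt.prodMap (p := z) (hasFDerivAt_affine _ z.1 h1) (hasFDerivAt_affine _ z.2 h2)
  refine HasFDerivAt.hasFDerivWithinAt (HasFDerivAt.congr_of_eventuallyEq this ?_)
  filter_upwards [isOpen_regular.mem_nhds h] with w hw
  exact extChartAt_ofHomogeneous _ w hw

theorem dPi_apply (z a : (Fin 3 → ℝ) × (Fin 3 → ℝ)) (h : z.2 ⬝ᵥ z.1 ≠ 0) : dPi z a =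
    (affineDeriv (RP2.chartIndex (ofHomogeneous z).point) z.1 a.1,
      affineDeriv (RP2.chartIndex (ofHomogeneous z).line) z.2 a.2) := by
  rw [dPi, (hasMFDerivAt_ofHomogeneous z h).mfderiv]
  rfl

/-- The preferred charts are products, and the chart at m induces the preferred chart at its line;
in them the projection is linear. -/
theorem hasMFDerivAt_line (m : M4) :
    HasMFDerivAt I4 𝓘(ℝ, Fin 2 → ℝ) line m (ContinuousLinearMap.snd ℝ (Fin 2 → ℝ) (Fin 2 → ℝ)) := by
  refine ⟨(continuous_snd.comp continuous_subtype_val).continuousAt, ?_⟩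
  refine HasFDerivWithinAt.congr_of_eventuallyEq hasFDerivWithinAt_snd ?_
    (congrArg Prod.snd ((extChartAt I4 m).right_inv (mem_extChartAt_target m)))
  filter_upwards [extChartAt_target_mem_nhdsWithin m] with x hx
  exact congrArg Prod.snd ((extChartAt I4 m).right_inv hx)

theorem hasMFDerivAt_point (m : M4) :
    HasMFDerivAt I4 𝓘(ℝ, Fin 2 → ℝ) point m (ContinuousLinearMap.fst ℝ (Fin 2 → ℝ) (Fin 2 → ℝ)) := by
  refine ⟨(continuous_fst.comp continuous_subtype_val).continuousAt, ?_⟩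
  refine HasFDerivWithinAt.congr_of_eventuallyEq hasFDerivWithinAt_fst ?_
    (congrArg Prod.fst ((extChartAt I4 m).right_inv (mem_extChartAt_target m)))
  filter_upwards [extChartAt_target_mem_nhdsWithin m] with x hx
  exact congrArg Prod.fst ((extChartAt I4 m).right_inv hx)

theorem mem_pointDir_iff (m : M4) (v : E4) : v ∈ pointDir m ↔ v.2 = 0 := by
  rw [pointDir, (hasMFDerivAt_line m).mfderiv]
  exact Iff.rfl

theorem mem_lineDir_iff (m : M4) (v : E4) : v ∈ lineDir m ↔ v.1 = 0 := by
  rw [lineDir, (hasMFDerivAt_point m).mfderiv]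
  exact Iff.rfl

end M4

/-! ### Nondegenerate forms and insertion of coordinates -/

namespace ContinuousLinearMap

variable {E : Type*} [NormedAddCommGroup E] [NormedSpace ℝ E] [FiniteDimensional ℝ E]

/-- An injective map between spaces of equal finite dimension is bijective. Since
`ContinuousLinearMap.inverse` is 0 on non-invertible maps, this is what lets it raise indices. -/
theorem isInvertible_of_nondegenerate {h : E →L[ℝ] E →L[ℝ] ℝ}
    (hh : ∀ v, (∀ w, h v w = 0) → v = 0) : h.IsInvertible := by
  have hinj : Function.Injective h.toLinearMap := by
    rw [← LinearMap.ker_eq_bot, LinearMap.ker_eq_bot']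
    intro v hv
    exact hh v fun w => by
      have : h v = 0 := hv
      rw [this]; rfl
  have hdim : Module.finrank ℝ E = Module.finrank ℝ (E →L[ℝ] ℝ) := by
    rw [← (LinearMap.toContinuousLinearMap (𝕜 := ℝ) (E := E) (F' := ℝ)).finrank_eq]
    exact (Subspace.dual_finrank_eq (K := ℝ) (V := E)).symm
  let e := (LinearEquiv.ofInjectiveOfFinrankEq h.toLinearMap hinj hdim).toContinuousLinearEquiv
  exact ⟨e, by ext; rfl⟩

theorem inverse_apply_self {h : E →L[ℝ] E →L[ℝ] ℝ} (hh : ∀ v, (∀ w, h v w = 0) → v = 0) (v : E) :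
    h.inverse (h v) = v := by
  obtain ⟨e, rfl⟩ := isInvertible_of_nondegenerate hh
  rw [inverse_equiv]
  exact e.symm_apply_apply v

theorem apply_inverse_self {h : E →L[ℝ] E →L[ℝ] ℝ} (hh : ∀ v, (∀ w, h v w = 0) → v = 0)
    (φ : E →L[ℝ] ℝ) : h (h.inverse φ) = φ := by
  obtain ⟨e, rfl⟩ := isInvertible_of_nondegenerate hh
  rw [inverse_equiv]
  exact e.apply_symm_apply φ

end ContinuousLinearMap

theorem ins_apply_same (k : Fin 3) (x : Fin 2 → ℝ) : ins k x k = 1 := by simp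

theorem ins₀_injective {k : Fin 3} {x : Fin 2 → ℝ} (h : ins₀ k x = 0) : x = 0 := by
  funext j
  have := congrFun h (k.succAbove j)
  simpa using this

theorem exists_ins₀ (k : Fin 3) (v : Fin 3 → ℝ) (h : v k = 0) : ∃ x, v = ins₀ k x := by
  refine ⟨fun j => v (k.succAbove j), ?_⟩
  funext i
  refine Fin.succAboveCases k ?_ (fun j => ?_) i <;> simp [h]

/-- As q_k ≠ 0, the vector q and the hyperplane of vectors with vanishing k-th coordinate span ℝ³.
-/
theorem eq_zero_of_dotProduct_ins₀ (k : Fin 3) (q r : Fin 3 → ℝ) (hq : q k ≠ 0) (h : r ⬝ᵥ q = 0)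
    (h0 : ∀ u, r ⬝ᵥ ins₀ k u = 0) : r = 0 := by
  rw [← dotProduct_eq_zero_iff]
  intro w
  obtain ⟨x, hx⟩ := exists_ins₀ k (w - (w k / q k) • q) (by simp [hq])
  have e : w = ins₀ k x + (w k / q k) • q := by rw [← hx]; simp
  rw [e, dotProduct_add, dotProduct_smul, h, h0]
  simp

/-- The dot product of `ℝ³` as a continuous bilinear form. -/
noncomputable def dotL : (Fin 3 → ℝ) →L[ℝ] (Fin 3 → ℝ) →L[ℝ] ℝ :=
  ∑ i, (ContinuousLinearMap.proj (R := ℝ) (φ := fun _ : Fin 3 => ℝ) i).smulRight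
    (ContinuousLinearMap.proj (R := ℝ) (φ := fun _ : Fin 3 => ℝ) i)

theorem dotL_apply (u v : Fin 3 → ℝ) : dotL u v = u ⬝ᵥ v := by
  simp [dotL, dotProduct]

/-- `ins₀` as a continuous linear map. -/
noncomputable def insL (k : Fin 3) : (Fin 2 → ℝ) →L[ℝ] (Fin 3 → ℝ) :=
  LinearMap.toContinuousLinearMap
    { toFun := ins₀ k
      map_add' := fun x y => by
        funext i; refine Fin.succAboveCases k ?_ (fun j => ?_) i <;> simp
      map_smul' := fun c x => by
        funext i; refine Fin.succAboveCases k ?_ (fun j => ?_) i <;> simp }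

theorem insL_apply (k : Fin 3) (x : Fin 2 → ℝ) : insL k x = ins₀ k x := rfl

theorem hasFDerivAt_ins (k : Fin 3) (x : Fin 2 → ℝ) : HasFDerivAt (ins k) (insL k) x := by
  have : ins k = fun x => ins k 0 + insL k x := by
    funext x i
    refine Fin.succAboveCases k ?_ (fun j => ?_) i <;> simp [insL_apply]
  rw [this]
  exact (insL k).hasFDerivAt.const_add _

theorem contDiff_ins (k : Fin 3) {n : WithTop ℕ∞} : ContDiff ℝ n (ins k) := by
  have : ins k = fun x => ins k 0 + insL k x := by
    funext x i
    refine Fin.succAboveCases k ?_ (fun j => ?_) i <;> simp [insL_apply]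
  rw [this]
  exact contDiff_const.add (insL k).contDiff

/-! ### The metric and its connection in an affine chart -/

namespace M4

/-- The projection onto the first factor, as an endomorphism. -/
noncomputable def proj₁ : E4 →L[ℝ] E4 :=
  ContinuousLinearMap.inl ℝ (Fin 2 → ℝ) (Fin 2 → ℝ) ∘L ContinuousLinearMap.fst ℝ _ _

/-- The projection onto the second factor, as an endomorphism. -/
noncomputable def proj₂ : E4 →L[ℝ] E4 :=
  ContinuousLinearMap.inr ℝ (Fin 2 → ℝ) (Fin 2 → ℝ) ∘L ContinuousLinearMap.snd ℝ _ _

theorem proj₁_apply (u : E4) : proj₁ u = (u.1, 0) := rfl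
theorem proj₂_apply (u : E4) : proj₂ u = (0, u.2) := rfl

section chart

variable (k l : Fin 3)

/-- The bilinear form `(u, v) ↦ dp(u) dq(v)` in the chart `(k, l)`. -/
noncomputable def formB : E4 →L[ℝ] E4 →L[ℝ] ℝ :=
  dotL.bilinearComp (insL l ∘L ContinuousLinearMap.snd ℝ _ _)
    (insL k ∘L ContinuousLinearMap.fst ℝ _ _)

/-- The function `p q` in the chart `(k, l)`. -/
noncomputable def funF (x : E4) : ℝ := ins l x.2 ⬝ᵥ ins k x.1

/-- The 1-form `p dq` in the chart `(k, l)`. -/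
noncomputable def formA₁ (x : E4) : E4 →L[ℝ] ℝ :=
  (dotL (ins l x.2)) ∘L (insL k ∘L ContinuousLinearMap.fst ℝ _ _)

/-- The 1-form `dp q` in the chart `(k, l)`. -/
noncomputable def formA₂ (x : E4) : E4 →L[ℝ] ℝ :=
  (dotL (ins k x.1)) ∘L (insL l ∘L ContinuousLinearMap.snd ℝ _ _)

theorem formB_apply (u v : E4) : formB k l u v = ins₀ l u.2 ⬝ᵥ ins₀ k v.1 := by
  simp [formB, dotL_apply, insL_apply]

theorem formA₁_apply (x u : E4) : formA₁ k l x u = ins l x.2 ⬝ᵥ ins₀ k u.1 := by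
  simp [formA₁, dotL_apply, insL_apply]

theorem formA₂_apply (x u : E4) : formA₂ k l x u = ins₀ l u.2 ⬝ᵥ ins k x.1 := by
  simp [formA₂, dotL_apply, insL_apply, dotProduct_comm]

theorem ins₀_zero : ins₀ k 0 = 0 := (insL k).map_zero

@[simp] theorem formA₁_proj₁ (x u : E4) : formA₁ k l x (proj₁ u) = formA₁ k l x u := by
  simp only [formA₁_apply, proj₁_apply]
@[simp] theorem formA₁_proj₂ (x u : E4) : formA₁ k l x (proj₂ u) = 0 := by
  simp only [formA₁_apply, proj₂_apply, ins₀_zero, dotProduct_zero]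
@[simp] theorem formA₂_proj₂ (x u : E4) : formA₂ k l x (proj₂ u) = formA₂ k l x u := by
  simp only [formA₂_apply, proj₂_apply]
@[simp] theorem formA₂_proj₁ (x u : E4) : formA₂ k l x (proj₁ u) = 0 := by
  simp only [formA₂_apply, proj₁_apply, ins₀_zero, zero_dotProduct]
@[simp] theorem formB_proj₁_left (u v : E4) : formB k l (proj₁ u) v = 0 := by
  simp only [formB_apply, proj₁_apply, ins₀_zero, zero_dotProduct]
@[simp] theorem formB_proj₂_left (u v : E4) : formB k l (proj₂ u) v = formB k l u v := by
  simp only [formB_apply, proj₂_apply]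
@[simp] theorem formB_proj₁_right (u v : E4) : formB k l u (proj₁ v) = formB k l u v := by
  simp only [formB_apply, proj₁_apply]
@[simp] theorem formB_proj₂_right (u v : E4) : formB k l u (proj₂ v) = 0 := by
  simp only [formB_apply, proj₂_apply, ins₀_zero, dotProduct_zero]
@[simp] theorem proj₁_proj₁ (u : E4) : proj₁ (proj₁ u) = proj₁ u := rfl
@[simp] theorem proj₂_proj₂ (u : E4) : proj₂ (proj₂ u) = proj₂ u := rfl
@[simp] theorem proj₁_proj₂ (u : E4) : proj₁ (proj₂ u) = 0 := rfl
@[simp] theorem proj₂_proj₁ (u : E4) : proj₂ (proj₁ u) = 0 := rfl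

/-- With the next two lemmas this closes F, A₁, A₂, B under differentiation, B being constant. All
later derivatives are polynomial in F⁻¹ and these forms. -/
theorem hasFDerivAt_formA₁ (x : E4) : HasFDerivAt (formA₁ k l) (formB k l) x := by
  have h1 : HasFDerivAt (fun x : E4 => ins l x.2) (insL l ∘L ContinuousLinearMap.snd ℝ _ _) x :=
    (hasFDerivAt_ins l x.2).comp x hasFDerivAt_snd
  have h2 := (dotL.hasFDerivAt.comp x h1).clm_comp
    (hasFDerivAt_const (insL k ∘L ContinuousLinearMap.fst ℝ (Fin 2 → ℝ) (Fin 2 → ℝ)) x)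
  refine h2.congr_fderiv ?_
  ext u v <;> simp [formB]

theorem hasFDerivAt_formA₂ (x : E4) : HasFDerivAt (formA₂ k l) (formB k l).flip x := by
  have h1 : HasFDerivAt (fun x : E4 => ins k x.1) (insL k ∘L ContinuousLinearMap.fst ℝ _ _) x :=
    (hasFDerivAt_ins k x.1).comp x hasFDerivAt_fst
  have h2 := (dotL.hasFDerivAt.comp x h1).clm_comp
    (hasFDerivAt_const (insL l ∘L ContinuousLinearMap.snd ℝ (Fin 2 → ℝ) (Fin 2 → ℝ)) x)
  refine h2.congr_fderiv ?_
  apply ContinuousLinearMap.ext; intro u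
  apply ContinuousLinearMap.ext; intro v
  simp [formB, dotL_apply, dotProduct_comm]

theorem hasFDerivAt_funF (x : E4) :
    HasFDerivAt (funF k l) (formA₁ k l x + formA₂ k l x) x := by
  have h1 : HasFDerivAt (fun x : E4 => ins k x.1) (insL k ∘L ContinuousLinearMap.fst ℝ _ _) x :=
    (hasFDerivAt_ins k x.1).comp x hasFDerivAt_fst
  have h2 : HasFDerivAt (fun x : E4 => ins l x.2) (insL l ∘L ContinuousLinearMap.snd ℝ _ _) x :=
    (hasFDerivAt_ins l x.2).comp x hasFDerivAt_snd
  have h3 := (dotL.hasFDerivAt.comp x h2).clm_apply h1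
  have e : funF k l = fun y => (⇑dotL ∘ fun x : E4 => ins l x.2) y (ins k y.1) := by
    funext y
    simp [funF, dotL_apply]
  rw [e]
  refine h3.congr_fderiv ?_
  apply ContinuousLinearMap.ext; intro u
  simp [formA₁_apply, formA₂_apply, dotL_apply, insL_apply]

theorem contDiff_funF {n : WithTop ℕ∞} : ContDiff ℝ n (funF k l) := by
  have : funF k l = fun y => dotL (ins l y.2) (ins k y.1) := by
    funext y
    simp [funF, dotL_apply]
  rw [this]
  exact (dotL.contDiff.comp ((contDiff_ins l).comp contDiff_snd)).clm_apply
    ((contDiff_ins k).comp contDiff_fst)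

theorem contDiff_formA₁ {n : WithTop ℕ∞} : ContDiff ℝ n (formA₁ k l) :=
  (dotL.contDiff.comp ((contDiff_ins l).comp contDiff_snd)).clm_comp contDiff_const

theorem contDiff_formA₂ {n : WithTop ℕ∞} : ContDiff ℝ n (formA₂ k l) :=
  (dotL.contDiff.comp ((contDiff_ins k).comp contDiff_fst)).clm_comp contDiff_const

/-- The metric `-2 (dp dq / (p q) - (dp q) (p dq) / (p q)²)` in the chart `(k, l)`. -/
noncomputable def formG (x : E4) : E4 →L[ℝ] E4 →L[ℝ] ℝ :=
  ((funF k l x)⁻¹ ^ 2) • ((formA₁ k l x).smulRight (formA₂ k l x) +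
    (formA₂ k l x).smulRight (formA₁ k l x)) -
    (funF k l x)⁻¹ • (formB k l + (formB k l).flip)

theorem formG_apply (x u v : E4) : formG k l x u v =
    (funF k l x)⁻¹ ^ 2 * (formA₁ k l x u * formA₂ k l x v + formA₂ k l x u * formA₁ k l x v) -
      (funF k l x)⁻¹ * (formB k l u v + formB k l v u) := by
  simp [formG]
  ring

theorem formG_symm (x u v : E4) : formG k l x u v = formG k l x v u := by
  rw [formG_apply, formG_apply]
  ring

theorem isOpen_funF : IsOpen {x : E4 | funF k l x ≠ 0} :=
  isOpen_ne_fun (contDiff_funF k l (n := 0)).continuous continuous_const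

theorem contDiffAt_formG {n : WithTop ℕ∞} (x : E4) (hx : funF k l x ≠ 0) :
    ContDiffAt ℝ n (formG k l) x := by
  have hF := ((contDiff_funF k l (n := n)).contDiffAt (x := x)).inv hx
  have h1 := (contDiff_formA₁ k l (n := n)).contDiffAt (x := x)
  have h2 := (contDiff_formA₂ k l (n := n)).contDiffAt (x := x)
  exact ((hF.pow 2).smul ((h1.smulRight h2).add (h2.smulRight h1))).sub (hF.smul contDiffAt_const)

/-- Testing against point directions, and against q for free, shows that F dp − (dp q) p = 0. The
l-th coordinate of dp is 0 and that of p is 1, so dp q = 0 and then dp = 0. The point component is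
treated dually. -/
theorem formG_nondegenerate (x : E4) (hx : funF k l x ≠ 0) (u : E4)
    (h : ∀ v, formG k l x u v = 0) : u = 0 := by
  have hx' : ins l x.2 ⬝ᵥ ins k x.1 ≠ 0 := hx
  have key₁ : funF k l x • ins₀ l u.2 - formA₂ k l x u • ins l x.2 = 0 := by
    refine eq_zero_of_dotProduct_ins₀ k (ins k x.1) _ (by simp) ?_ ?_
    · rw [sub_dotProduct, smul_dotProduct, smul_dotProduct, formA₂_apply, funF]
      simp only [smul_eq_mul]; ring
    · intro w
      have := h (w, 0)
      rw [formG_apply] at this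
      simp only [formB_apply, formA₁_apply, formA₂_apply, ins₀_zero, zero_dotProduct] at this
      rw [sub_dotProduct, smul_dotProduct, smul_dotProduct, formA₂_apply]
      simp only [smul_eq_mul]
      field_simp at this
      linear_combination -this
  have key₂ : funF k l x • ins₀ k u.1 - formA₁ k l x u • ins k x.1 = 0 := by
    refine eq_zero_of_dotProduct_ins₀ l (ins l x.2) _ (by simp) ?_ ?_
    · rw [sub_dotProduct, smul_dotProduct, smul_dotProduct, formA₁_apply, funF,
        dotProduct_comm (ins k x.1), dotProduct_comm (ins₀ k u.1)]
      simp only [smul_eq_mul]; ring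
    · intro w
      have := h (0, w)
      rw [formG_apply] at this
      simp only [formB_apply, formA₁_apply, formA₂_apply, ins₀_zero, dotProduct_zero] at this
      rw [sub_dotProduct, smul_dotProduct, smul_dotProduct, formA₁_apply,
        dotProduct_comm (ins k x.1), dotProduct_comm (ins₀ k u.1)]
      simp only [smul_eq_mul]
      field_simp at this
      linear_combination -this
  have e₁ : formA₂ k l x u = 0 := by
    have := congrFun key₁ l
    simpa using this
  have e₂ : formA₁ k l x u = 0 := by
    have := congrFun key₂ k
    simpa using this
  rw [e₁, zero_smul, sub_zero, smul_eq_zero, or_iff_right hx] at key₁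
  rw [e₂, zero_smul, sub_zero, smul_eq_zero, or_iff_right hx] at key₂
  exact Prod.ext (ins₀_injective key₂) (ins₀_injective key₁)

theorem hasFDerivAt_inv_funF (x : E4) (hx : funF k l x ≠ 0) :
    HasFDerivAt (fun y => (funF k l y)⁻¹)
      (-((funF k l x)⁻¹ ^ 2) • (formA₁ k l x + formA₂ k l x)) x := by
  refine ((hasDerivAt_inv hx).comp_hasFDerivAt x (hasFDerivAt_funF k l x)).congr_fderiv ?_
  rw [inv_pow]

theorem hasFDerivAt_formG (x : E4) (hx : funF k l x ≠ 0) (v w : E4) :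
    HasFDerivAt (fun y => formG k l y v w)
      ((-2 * (funF k l x)⁻¹ ^ 3 * (formA₁ k l x v * formA₂ k l x w + formA₂ k l x v * formA₁ k l x w) +
        (funF k l x)⁻¹ ^ 2 * (formB k l v w + formB k l w v)) • (formA₁ k l x + formA₂ k l x) +
       (funF k l x)⁻¹ ^ 2 • (formA₂ k l x w • (formB k l).flip v + formA₁ k l x v • (formB k l w) +
         formA₁ k l x w • formB k l v + formA₂ k l x v • (formB k l).flip w)) x := by
  have hF := hasFDerivAt_inv_funF k l x hx
  have a (u : E4) : HasFDerivAt (fun y => formA₁ k l y u) ((formB k l).flip u) x := by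
    refine ((hasFDerivAt_formA₁ k l x).clm_apply (hasFDerivAt_const u x)).congr_fderiv ?_
    simp
  have b (u : E4) : HasFDerivAt (fun y => formA₂ k l y u) ((formB k l) u) x := by
    refine ((hasFDerivAt_formA₂ k l x).clm_apply (hasFDerivAt_const u x)).congr_fderiv ?_
    simp
  simp only [formG_apply]
  refine (((hF.pow 2).mul (((a v).mul (b w)).add ((b v).mul (a w)))).sub
    (hF.mul (hasFDerivAt_const (formB k l v w + formB k l w v) x))).congr_fderiv ?_
  apply ContinuousLinearMap.ext; intro u
  simp
  ring

/-- The Christoffel symbols in the chart `(k, l)`. -/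
noncomputable def chris (x : E4) : E4 →L[ℝ] E4 →L[ℝ] E4 :=
  -((funF k l x)⁻¹ • ((formA₁ k l x).smulRight proj₁ + ((formA₁ k l x).smulRight proj₁).flip +
    (formA₂ k l x).smulRight proj₂ + ((formA₂ k l x).smulRight proj₂).flip))

theorem chris_apply (x u v : E4) : chris k l x u v =
    -((funF k l x)⁻¹ • (formA₁ k l x u • proj₁ v + formA₁ k l x v • proj₁ u +
      formA₂ k l x u • proj₂ v + formA₂ k l x v • proj₂ u)) := by
  simp [chris]

/-- By nondegeneracy it is enough to verify a candidate for the connection. After inserting the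
derivative of the metric, both sides are polynomials in F⁻¹ and in values of A₁, A₂, B. -/
theorem koszulForm_formG (x : E4) (hx : funF k l x ≠ 0) (u v w : E4) :
    koszulForm (formG k l) x u v w = formG k l x (chris k l x u v) w := by
  have hd : DifferentiableAt ℝ (formG k l) x :=
    (contDiffAt_formG k l (n := 1) x hx).differentiableAt (by norm_num)
  have D (u v w : E4) : fderiv ℝ (formG k l) x u v w =
      (fderiv ℝ (fun y => formG k l y v w) x) u := by
    have h1 := (hd.hasFDerivAt.clm_apply (hasFDerivAt_const v x)).clm_apply (hasFDerivAt_const w x)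
    rw [h1.fderiv]
    simp
  have e : koszulForm (formG k l) x u v w = (1 / 2 : ℝ) * (fderiv ℝ (formG k l) x u v w +
      fderiv ℝ (formG k l) x v u w - fderiv ℝ (formG k l) x w u v) := by
    simp [koszulForm]
  rw [e, D, D, D, (hasFDerivAt_formG k l x hx v w).fderiv, (hasFDerivAt_formG k l x hx u w).fderiv,
    (hasFDerivAt_formG k l x hx u v).fderiv, chris_apply, formG_apply]
  simp
  ring

theorem hasFDerivAt_chris (x : E4) (hx : funF k l x ≠ 0) (v w : E4) :
    HasFDerivAt (fun y => chris k l y v w)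
      ((((funF k l x)⁻¹ ^ 2) • (formA₁ k l x + formA₂ k l x)).smulRight
        (formA₁ k l x v • proj₁ w + formA₁ k l x w • proj₁ v +
          formA₂ k l x v • proj₂ w + formA₂ k l x w • proj₂ v) -
       (funF k l x)⁻¹ • (((formB k l).flip v).smulRight (proj₁ w) +
        ((formB k l).flip w).smulRight (proj₁ v) + (formB k l v).smulRight (proj₂ w) +
        (formB k l w).smulRight (proj₂ v))) x := by
  have hF := hasFDerivAt_inv_funF k l x hx
  have a (u : E4) : HasFDerivAt (fun y => formA₁ k l y u) ((formB k l).flip u) x := by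
    refine ((hasFDerivAt_formA₁ k l x).clm_apply (hasFDerivAt_const u x)).congr_fderiv ?_
    simp
  have b (u : E4) : HasFDerivAt (fun y => formA₂ k l y u) ((formB k l) u) x := by
    refine ((hasFDerivAt_formA₂ k l x).clm_apply (hasFDerivAt_const u x)).congr_fderiv ?_
    simp
  simp only [chris_apply]
  refine ((hF.smul (((((a v).smul_const (proj₁ w)).add ((a w).smul_const (proj₁ v))).add
    ((b v).smul_const (proj₂ w))).add ((b w).smul_const (proj₂ v)))).neg).congr_fderiv ?_
  apply ContinuousLinearMap.ext; intro u
  simp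
  module

theorem contDiffAt_chris {n : WithTop ℕ∞} (x : E4) (hx : funF k l x ≠ 0) :
    ContDiffAt ℝ n (chris k l) x := by
  have hF := ((contDiff_funF k l (n := n)).contDiffAt (x := x)).inv hx
  have h1 := (contDiff_formA₁ k l (n := n)).contDiffAt (x := x)
  have h2 := (contDiff_formA₂ k l (n := n)).contDiffAt (x := x)
  have fl : ContDiff ℝ n (fun L : E4 →L[ℝ] E4 →L[ℝ] E4 => L.flip) :=
    (ContinuousLinearMap.flipₗᵢ ℝ E4 E4 E4).toContinuousLinearEquiv.contDiff
  have c1 := h1.smulRight (contDiffAt_const (c := proj₁))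
  have c2 := h2.smulRight (contDiffAt_const (c := proj₂))
  exact (hF.smul (((c1.add (fl.contDiffAt.comp x c1)).add c2).add (fl.contDiffAt.comp x c2))).neg

end chart

end M4

/-! ### Existence and uniqueness of the dancing metric -/

namespace M4

/-- The form `-2 (dp dq / (p q) - (dp q) (p dq) / (p q)²)` in homogeneous coordinates. -/
noncomputable def homForm (z a b : (Fin 3 → ℝ) × (Fin 3 → ℝ)) : ℝ :=
  ((z.2 ⬝ᵥ z.1)⁻¹) ^ 2 * ((z.2 ⬝ᵥ a.1) * (b.2 ⬝ᵥ z.1) + (a.2 ⬝ᵥ z.1) * (z.2 ⬝ᵥ b.1)) -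
    (z.2 ⬝ᵥ z.1)⁻¹ * (a.2 ⬝ᵥ b.1 + b.2 ⬝ᵥ a.1)

/-- The derivative of `lift k l`. -/
noncomputable def lift₀ (k l : Fin 3) (u : E4) : (Fin 3 → ℝ) × (Fin 3 → ℝ) := (ins₀ k u.1, ins₀ l u.2)

theorem homForm_lift (k l : Fin 3) (x u v : E4) :
    homForm (lift k l x) (lift₀ k l u) (lift₀ k l v) = formG k l x u v := by
  rw [formG_apply]
  simp only [homForm, lift, lift₀, formA₁_apply, formA₂_apply, formB_apply, funF]

/-- This is the invariance that makes the form descend to M⁴: q and p scale independently, and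
radial parts of tangent vectors drop out. -/
theorem homForm_smul (z a b : (Fin 3 → ℝ) × (Fin 3 → ℝ)) (hz : z.2 ⬝ᵥ z.1 ≠ 0) {c d : ℝ}
    (hc : c ≠ 0) (hd : d ≠ 0) (s t s' t' : ℝ) :
    homForm (c • z.1, d • z.2) (c • a.1 - s • z.1, d • a.2 - t • z.2)
      (c • b.1 - s' • z.1, d • b.2 - t' • z.2) = homForm z a b := by
  simp only [homForm, smul_dotProduct, dotProduct_smul, sub_dotProduct, dotProduct_sub, smul_eq_mul]
  field_simp
  ring

/-- The dancing metric. -/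
noncomputable def dancingMetric : BilinField I4 M4 := fun m =>
  (formG (RP2.chartIndex m.point) (RP2.chartIndex m.line) (extChartAt I4 m m) : E4 →L[ℝ] E4 →L[ℝ] ℝ)

theorem metricAt_dancingMetric (m : M4) : metricAt dancingMetric m =
    formG (RP2.chartIndex m.point) (RP2.chartIndex m.line) (extChartAt I4 m m) := rfl

theorem affine_eq_lift (k : Fin 3) (q : Fin 3 → ℝ) (hq : q k ≠ 0) :
    ins k (fun j => q (k.succAbove j) / q k) = (q k)⁻¹ • q := by
  funext i
  refine Fin.succAboveCases k ?_ (fun j => ?_) i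
  · simp [hq]
  · simp [div_eq_inv_mul]

/-- Ties the definition in preferred charts to homogeneous coordinates, so that transition functions
never need to be computed. -/
theorem dancingMetric_dPi (z a b : (Fin 3 → ℝ) × (Fin 3 → ℝ)) (h : z.2 ⬝ᵥ z.1 ≠ 0) :
    dancingMetric (ofHomogeneous z) (dPi z a) (dPi z b) = homForm z a b := by
  obtain ⟨h1, h2⟩ := chartIndex_ofHomogeneous_ne z h
  rw [dPi_apply z a h, dPi_apply z b h]
  show formG _ _ (extChartAt I4 (ofHomogeneous z) (ofHomogeneous z)) _ _ = _
  rw [← homForm_lift, extChartAt_ofHomogeneous _ z h]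
  simp only [lift, lift₀, ins_affineDeriv _ _ _ h1, ins_affineDeriv _ _ _ h2,
    affine_eq_lift _ _ h1, affine_eq_lift _ _ h2]
  exact homForm_smul z a b h (inv_ne_zero h1) (inv_ne_zero h2) _ _ _ _

theorem hasFDerivAt_lift (k l : Fin 3) (x : E4) :
    HasFDerivAt (lift k l) ((insL k).prodMap (insL l)) x :=
  HasFDerivAt.prodMap (p := x) (hasFDerivAt_ins k x.1) (hasFDerivAt_ins l x.2)

theorem mem_target_iff (c : M4) (x : E4) : x ∈ (extChartAt I4 c).target ↔
    funF (RP2.chartIndex c.point) (RP2.chartIndex c.line) x ≠ 0 := by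
  rw [extChartAt_target]; rfl

theorem extChartAt_symm_eventuallyEq (c : M4) (x : E4) (hx : x ∈ (extChartAt I4 c).target) :
    (extChartAt I4 c).symm =ᶠ[𝓝 x]
      ofHomogeneous ∘ lift (RP2.chartIndex c.point) (RP2.chartIndex c.line) := by
  rw [mem_target_iff] at hx
  filter_upwards [(isOpen_funF _ _).mem_nhds hx] with y hy
  exact extChartAt_symm_apply c y hy

/-- The derivative of the inverse of a chart. -/
theorem mfderiv_extChartAt_symm (c : M4) (x : E4) (hx : x ∈ (extChartAt I4 c).target) (u : E4) :
    (mfderiv 𝓘(ℝ, E4) I4 (extChartAt I4 c).symm x u : E4) =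
      dPi (lift (RP2.chartIndex c.point) (RP2.chartIndex c.line) x)
        (lift₀ (RP2.chartIndex c.point) (RP2.chartIndex c.line) u) := by
  have hx' := (mem_target_iff c x).1 hx
  have h1 := hasMFDerivAt_ofHomogeneous
    (lift (RP2.chartIndex c.point) (RP2.chartIndex c.line) x) hx'
  have h2 := h1.comp x (hasFDerivAt_lift _ _ x).hasMFDerivAt
  have h3 := h2.congr_of_eventuallyEq (extChartAt_symm_eventuallyEq c x hx)
  rw [h3.mfderiv]
  rw [dPi, h1.mfderiv]
  rfl

/-- The metric is defined at m through the preferred chart at m only. Here the same formula is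
obtained throughout the domain of a fixed chart, which is what smoothness and differentiation
require. -/
theorem chartMetric_dancingMetric (c : M4) (x : E4) (hx : x ∈ (extChartAt I4 c).target) :
    chartMetric dancingMetric c x =
      formG (RP2.chartIndex c.point) (RP2.chartIndex c.line) x := by
  have hx' := (mem_target_iff c x).1 hx
  apply ContinuousLinearMap.ext; intro u
  apply ContinuousLinearMap.ext; intro v
  show (dancingMetric ((extChartAt I4 c).symm x) : E4 →L[ℝ] E4 →L[ℝ] ℝ)
    (mfderiv 𝓘(ℝ, E4) I4 (extChartAt I4 c).symm x u : E4)
    (mfderiv 𝓘(ℝ, E4) I4 (extChartAt I4 c).symm x v : E4) = _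
  rw [mfderiv_extChartAt_symm c x hx, mfderiv_extChartAt_symm c x hx]
  have : (extChartAt I4 c).symm x =
    ofHomogeneous (lift (RP2.chartIndex c.point) (RP2.chartIndex c.line) x) :=
    extChartAt_symm_apply c x hx'
  rw [this, ← homForm_lift]
  exact dancingMetric_dPi _ _ _ hx'

theorem chartMetric_eventuallyEq (c : M4) (x : E4) (hx : x ∈ (extChartAt I4 c).target) :
    chartMetric dancingMetric c =ᶠ[𝓝 x]
      formG (RP2.chartIndex c.point) (RP2.chartIndex c.line) := by
  have ho : IsOpen (extChartAt I4 c).target := isOpen_extChartAt_target c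
  filter_upwards [ho.mem_nhds hx] with y hy
  exact chartMetric_dancingMetric c y hy

theorem isPseudoRiemannian_dancingMetric : IsPseudoRiemannian dancingMetric where
  symm m v w := formG_symm _ _ _ _ _
  nondegenerate m v hv := formG_nondegenerate _ _ _
    ((mem_target_iff m _).1 (mem_extChartAt_target m)) v hv
  smooth := by
    intro m₀
    rw [contMDiffAt_hom_bundle]
    refine ⟨contMDiffAt_id, ?_⟩
    have hs : ContMDiffAt I4 𝓘(ℝ, E4 →L[ℝ] E4 →L[ℝ] ℝ) ∞
        (fun m => formG (RP2.chartIndex m₀.point) (RP2.chartIndex m₀.line) (extChartAt I4 m₀ m)) m₀ :=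
      (contDiffAt_formG _ _ _ ((mem_target_iff m₀ _).1 (mem_extChartAt_target m₀))).contMDiffAt.comp m₀
        contMDiffAt_extChartAt
    refine hs.congr_of_eventuallyEq ?_
    filter_upwards [extChartAt_source_mem_nhds (I := I4) m₀] with m hm
    have hm' : m ∈ (chartAt (ModelProd (Fin 2 → ℝ) (Fin 2 → ℝ)) m₀).source := by
      rwa [_root_.extChartAt_source] at hm
    apply ContinuousLinearMap.ext; intro u
    apply ContinuousLinearMap.ext; intro v
    have hb : m ∈ (trivializationAt E4 (TangentSpace I4 : M4 → Type _) m₀).baseSet := by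
      rwa [TangentBundle.trivializationAt_baseSet]
    rw [inCoordinates_apply_eq₂ hb hb (mem_univ _)]
    -- The inverse of the tangent trivialisation is the differential of the inverse chart, so the
    -- metric in the trivialisation is the chart metric.
    have hsy (u : E4) : (trivializationAt E4 (TangentSpace I4 : M4 → Type _) m₀).symm m u =
        mfderiv 𝓘(ℝ, E4) I4 (extChartAt I4 m₀).symm (extChartAt I4 m₀ m) u := by
      have := TangentBundle.symmL_trivializationAt (I := I4) hm'
      rw [ModelWithCorners.range_eq_univ, mfderivWithin_univ] at this
      exact (Bundle.Trivialization.symmL_apply _ hb _).symm.trans (congrArg (fun L => L u) this)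
    rw [hsy, hsy, ← chartMetric_dancingMetric m₀ _ ((extChartAt I4 m₀).map_source hm)]
    simp only [Bundle.Trivial.fiberBundle_trivializationAt', Bundle.Trivial.linearMapAt_trivialization,
        LinearMap.id_coe, id_eq]
    show dancingMetric m _ _ = dancingMetric ((extChartAt I4 m₀).symm (extChartAt I4 m₀ m)) _ _
    have e : (extChartAt I4 m₀).symm (extChartAt I4 m₀ m) = m := (extChartAt I4 m₀).left_inv hm
    rw [e]
    rfl

theorem dPi_sub (z a b : (Fin 3 → ℝ) × (Fin 3 → ℝ)) : dPi z (a - b) = dPi z a - dPi z b :=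
  ContinuousLinearMap.map_sub (mfderiv 𝓘(ℝ, (Fin 3 → ℝ) × (Fin 3 → ℝ)) I4 ofHomogeneous z) a b

theorem isTangentQ_vertical (z : (Fin 3 → ℝ) × (Fin 3 → ℝ)) : IsTangentQ z (z.1, -z.2) := by
  simp [IsTangentQ]

theorem dPi_eq_zero_iff (z a : (Fin 3 → ℝ) × (Fin 3 → ℝ)) (h : z.2 ⬝ᵥ z.1 ≠ 0) :
    dPi z a = 0 ↔ ∃ s t : ℝ, a = (s • z.1, t • z.2) := by
  obtain ⟨h1, h2⟩ := chartIndex_ofHomogeneous_ne z h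
  have : dPi z a = 0 ↔ affineDeriv (RP2.chartIndex (ofHomogeneous z).point) z.1 a.1 = 0 ∧
      affineDeriv (RP2.chartIndex (ofHomogeneous z).line) z.2 a.2 = 0 := by
    rw [dPi_apply z a h]
    exact Prod.mk_eq_zero
  rw [this, affineDeriv_eq_zero_iff _ _ _ h1, affineDeriv_eq_zero_iff _ _ _ h2]
  constructor
  · rintro ⟨⟨s, hs⟩, t, ht⟩
    exact ⟨s, t, Prod.ext hs ht⟩
  · rintro ⟨s, t, rfl⟩
    exact ⟨⟨s, rfl⟩, t, rfl⟩

/-- The fibre direction tangent to the pseudo-sphere is (q, −p). Tangency fixes the sum of p dq and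
dp q, orthogonality to the fibre fixes their difference. -/
theorem isHorizontal_iff (z a : (Fin 3 → ℝ) × (Fin 3 → ℝ)) (h : z.2 ⬝ᵥ z.1 = 1) :
    IsHorizontal z a ↔ z.2 ⬝ᵥ a.1 = 0 ∧ a.2 ⬝ᵥ z.1 = 0 := by
  have h' : z.2 ⬝ᵥ z.1 ≠ 0 := by rw [h]; exact one_ne_zero
  constructor
  · rintro ⟨h1, h2⟩
    have h3 := h2 _ (isTangentQ_vertical z)
      ((dPi_eq_zero_iff z _ h').2 ⟨1, -1, by simp⟩)
    simp only [IsTangentQ] at h1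
    simp only [flatMetric, neg_dotProduct] at h3
    constructor <;> linarith
  · rintro ⟨h1, h2⟩
    refine ⟨by rw [IsTangentQ, h1, h2, add_zero], ?_⟩
    intro c _ hc
    obtain ⟨s, t, rfl⟩ := (dPi_eq_zero_iff z _ h').1 hc
    simp [flatMetric, h1, h2]

/-- Every tangent vector has a horizontal lift. -/
theorem exists_horizontal_lift (z : (Fin 3 → ℝ) × (Fin 3 → ℝ)) (h : z.2 ⬝ᵥ z.1 ≠ 0)
    (v : TangentSpace I4 (ofHomogeneous z)) :
    ∃ a, z.2 ⬝ᵥ a.1 = 0 ∧ a.2 ⬝ᵥ z.1 = 0 ∧ dPi z a = v := by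
  obtain ⟨h1, h2⟩ := chartIndex_ofHomogeneous_ne z h
  set k := RP2.chartIndex (ofHomogeneous z).point with hk
  set l := RP2.chartIndex (ofHomogeneous z).line with hl
  let v' : E4 := v
  let a : (Fin 3 → ℝ) × (Fin 3 → ℝ) := (z.1 k • ins₀ k v'.1, z.2 l • ins₀ l v'.2)
  have ha : dPi z a = v := by
    rw [dPi_apply z a h, ← hk, ← hl]
    refine Prod.ext (funext fun j => ?_) (funext fun j => ?_)
    · simp [affineDeriv_apply, a, h1, v']
    · simp [affineDeriv_apply, a, h2, v']
  refine ⟨(a.1 - ((z.2 ⬝ᵥ a.1) / (z.2 ⬝ᵥ z.1)) • z.1, a.2 - ((a.2 ⬝ᵥ z.1) / (z.2 ⬝ᵥ z.1)) • z.2),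
    ?_, ?_, ?_⟩
  · simp [dotProduct_sub, h]
  · simp [sub_dotProduct, h]
  · rw [← ha]
    have e : (a.1 - ((z.2 ⬝ᵥ a.1) / (z.2 ⬝ᵥ z.1)) • z.1,
      a.2 - ((a.2 ⬝ᵥ z.1) / (z.2 ⬝ᵥ z.1)) • z.2) =
        a - (((z.2 ⬝ᵥ a.1) / (z.2 ⬝ᵥ z.1)) • z.1, ((a.2 ⬝ᵥ z.1) / (z.2 ⬝ᵥ z.1)) • z.2) := rfl
    rw [e, dPi_sub, (dPi_eq_zero_iff z
      (((z.2 ⬝ᵥ a.1) / (z.2 ⬝ᵥ z.1)) • z.1, ((a.2 ⬝ᵥ z.1) / (z.2 ⬝ᵥ z.1)) • z.2) h).2 ⟨_, _, rfl⟩,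
      sub_zero]

theorem homForm_horizontal (z a b : (Fin 3 → ℝ) × (Fin 3 → ℝ)) (h : z.2 ⬝ᵥ z.1 = 1)
    (ha : z.2 ⬝ᵥ a.1 = 0 ∧ a.2 ⬝ᵥ z.1 = 0) : homForm z a b = flatMetric a b := by
  simp [homForm, flatMetric, h, ha.1, ha.2]

theorem isDancingMetric_dancingMetric : IsDancingMetric dancingMetric := by
  refine ⟨isPseudoRiemannian_dancingMetric, fun z hz a b ha _ => ?_⟩
  rw [dancingMetric_dPi z a b (by rw [hz]; exact one_ne_zero)]
  exact homForm_horizontal z a b hz ((isHorizontal_iff z a hz).1 ha)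

/-- Every point has homogeneous coordinates with `p q = 1`. -/
theorem exists_normalized (m : M4) : ∃ z : (Fin 3 → ℝ) × (Fin 3 → ℝ),
    z.2 ⬝ᵥ z.1 = 1 ∧ ofHomogeneous z = m := by
  have h : m.line.rep ⬝ᵥ m.point.rep ≠ 0 := m.2
  refine ⟨(m.point.rep, (m.line.rep ⬝ᵥ m.point.rep)⁻¹ • m.line.rep), ?_, ?_⟩
  · simp [h]
  · have := ofHomogeneous_smul (m.point.rep, m.line.rep) h one_ne_zero (inv_ne_zero h)
    rw [one_smul] at this
    rw [this, ofHomogeneous_rep]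

/-- Over a normalised pair, every tangent vector is the image of a horizontal one, where the
submersion condition prescribes the metric. -/
theorem IsDancingMetric.eq_dancingMetric {g : BilinField I4 M4} (hg : IsDancingMetric g) :
    g = dancingMetric := by
  funext m
  obtain ⟨z, hz, rfl⟩ := exists_normalized m
  have hz' : z.2 ⬝ᵥ z.1 ≠ 0 := by rw [hz]; exact one_ne_zero
  apply ContinuousLinearMap.ext; intro u
  apply ContinuousLinearMap.ext; intro v
  obtain ⟨a, ha1, ha2, rfl⟩ := exists_horizontal_lift z hz' u
  obtain ⟨b, hb1, hb2, rfl⟩ := exists_horizontal_lift z hz' v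
  have ha := (isHorizontal_iff z a hz).2 ⟨ha1, ha2⟩
  have hb := (isHorizontal_iff z b hz).2 ⟨hb1, hb2⟩
  rw [hg.2 z hz a b ha hb, isDancingMetric_dancingMetric.2 z hz a b ha hb]

theorem christoffel_dancingMetric (c : M4) (x : E4) (hx : x ∈ (extChartAt I4 c).target) :
    christoffel dancingMetric c x =
      chris (RP2.chartIndex c.point) (RP2.chartIndex c.line) x := by
  have hx' := (mem_target_iff c x).1 hx
  apply ContinuousLinearMap.ext; intro u
  apply ContinuousLinearMap.ext; intro v
  have e := chartMetric_eventuallyEq c x hx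
  have hk : koszulForm (chartMetric dancingMetric c) x =
      koszulForm (formG (RP2.chartIndex c.point) (RP2.chartIndex c.line)) x := by
    simp only [koszulForm, e.fderiv_eq]
  show (chartMetric dancingMetric c x).inverse (koszulForm (chartMetric dancingMetric c) x u v) = _
  rw [hk, chartMetric_dancingMetric c x hx]
  have : koszulForm (formG (RP2.chartIndex c.point) (RP2.chartIndex c.line)) x u v =
      formG (RP2.chartIndex c.point) (RP2.chartIndex c.line) x
        (chris (RP2.chartIndex c.point) (RP2.chartIndex c.line) x u v) := by
    apply ContinuousLinearMap.ext; intro w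
    exact koszulForm_formG _ _ x hx' u v w
  rw [this]
  exact ContinuousLinearMap.inverse_apply_self (formG_nondegenerate _ _ x hx') _

theorem christoffel_eventuallyEq (c : M4) (x : E4) (hx : x ∈ (extChartAt I4 c).target) :
    christoffel dancingMetric c =ᶠ[𝓝 x]
      chris (RP2.chartIndex c.point) (RP2.chartIndex c.line) := by
  have ho : IsOpen (extChartAt I4 c).target := isOpen_extChartAt_target c
  filter_upwards [ho.mem_nhds hx] with y hy
  exact christoffel_dancingMetric c y hy

/-- The mixed part of the metric: `g(u, v) = -(H(u, v) + H(v, u))` with `H(u, v)` depending only on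
the second component of `u` and the first component of `v`. -/
noncomputable def mixed (h : E4 →L[ℝ] E4 →L[ℝ] ℝ) (u v : E4) : ℝ := -h (proj₂ u) (proj₁ v)

theorem mixed_formG (k l : Fin 3) (x u v : E4) : mixed (formG k l x) u v =
    (funF k l x)⁻¹ * formB k l u v - (funF k l x)⁻¹ ^ 2 * (formA₂ k l x u * formA₁ k l x v) := by
  simp [mixed, formG_apply]

theorem chartCurvature_eq_chris (c : M4) (x : E4) (hx : x ∈ (extChartAt I4 c).target)
    (u v w : E4) : chartCurvature dancingMetric c x u v w =
    let Γ := chris (RP2.chartIndex c.point) (RP2.chartIndex c.line)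
    fderiv ℝ Γ x u v w - fderiv ℝ Γ x v u w + Γ x u (Γ x v w) - Γ x v (Γ x u w) := by
  simp only [chartCurvature, (christoffel_eventuallyEq c x hx).fderiv_eq,
    christoffel_dancingMetric c x hx]
  simp

/-- Differentiating A₁ and A₂ produces terms F⁻¹B; differentiating F⁻¹ and composing Γ with itself
produce terms F⁻²A₂A₁. They combine into the mixed part H of the metric, so no derivative survives
and the curvature is pointwise linear algebra. -/
theorem chartCurvature_dancingMetric (c : M4) (x : E4) (hx : x ∈ (extChartAt I4 c).target)
    (u v w : E4) : chartCurvature dancingMetric c x u v w =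
    let H := mixed (formG (RP2.chartIndex c.point) (RP2.chartIndex c.line) x)
    (H v u - H u v) • proj₁ w + H v w • proj₁ u - H u w • proj₁ v +
      (H u v - H v u) • proj₂ w + H w v • proj₂ u - H w u • proj₂ v := by
  have hx' := (mem_target_iff c x).1 hx
  set k := RP2.chartIndex c.point
  set l := RP2.chartIndex c.line
  have hd : DifferentiableAt ℝ (chris k l) x :=
    (contDiffAt_chris k l (n := 1) x hx').differentiableAt (by norm_num)
  have D (u v w : E4) : fderiv ℝ (chris k l) x u v w =
      (fderiv ℝ (fun y => chris k l y v w) x) u := by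
    have h1 := (hd.hasFDerivAt.clm_apply (hasFDerivAt_const v x)).clm_apply (hasFDerivAt_const w x)
    rw [h1.fderiv]
    simp
  rw [chartCurvature_eq_chris c x hx]
  simp only
  rw [D, D, (hasFDerivAt_chris k l x hx' v w).fderiv, (hasFDerivAt_chris k l x hx' u w).fderiv]
  simp only [mixed_formG, chris_apply]
  simp
  module

theorem curvature_dancingMetric (m : M4) (u v w : E4) : curvature dancingMetric m u v w =
    let H := mixed (metricAt dancingMetric m)
    (H v u - H u v) • proj₁ w + H v w • proj₁ u - H u w • proj₁ v +
      (H u v - H v u) • proj₂ w + H w v • proj₂ u - H w u • proj₂ v :=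
  chartCurvature_dancingMetric m _ (mem_extChartAt_target m) u v w

end M4

/-! ### Adapted null bases, 2-forms and duality -/

theorem trL_smulRight {E : Type*} [NormedAddCommGroup E] [NormedSpace ℝ E] [FiniteDimensional ℝ E]
    (φ : E →L[ℝ] ℝ) (u : E) : trL (φ.smulRight u) = φ u :=
  LinearMap.trace_smulRight (φ : E →ₗ[ℝ] ℝ) u

namespace M4

/-- The basis `b = (e₁, e₂, f₁, f₂)` is adapted to `h`. -/
structure IsAdapted (h : E4 →L[ℝ] E4 →L[ℝ] ℝ) (b : Module.Basis (Fin 4) ℝ E4) : Prop where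
  symm : ∀ u v, h u v = h v u
  null₁ : ∀ u v, h (proj₁ u) (proj₁ v) = 0
  null₂ : ∀ u v, h (proj₂ u) (proj₂ v) = 0
  mem0 : proj₁ (b 0) = b 0
  mem1 : proj₁ (b 1) = b 1
  mem2 : proj₂ (b 2) = b 2
  mem3 : proj₂ (b 3) = b 3
  h02 : h (b 0) (b 2) = 1
  h13 : h (b 1) (b 3) = 1
  h03 : h (b 0) (b 3) = 0
  h12 : h (b 1) (b 2) = 0

theorem proj₁_add_proj₂ (u : E4) : proj₁ u + proj₂ u = u := by
  simp [proj₁_apply, proj₂_apply]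

theorem proj₁_of_proj₂ {u : E4} (h : proj₂ u = u) : proj₁ u = 0 := by
  rw [← h]; simp

theorem proj₂_of_proj₁ {u : E4} (h : proj₁ u = u) : proj₂ u = 0 := by
  rw [← h]; simp

section adapted

variable {h : E4 →L[ℝ] E4 →L[ℝ] ℝ} {b : Module.Basis (Fin 4) ℝ E4}

namespace IsAdapted

theorem h01 (H : IsAdapted h b) : h (b 0) (b 1) = 0 := by rw [← H.mem0, ← H.mem1, H.null₁]
theorem h00 (H : IsAdapted h b) : h (b 0) (b 0) = 0 := by rw [← H.mem0, H.null₁]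
theorem h11 (H : IsAdapted h b) : h (b 1) (b 1) = 0 := by rw [← H.mem1, H.null₁]
theorem h22 (H : IsAdapted h b) : h (b 2) (b 2) = 0 := by rw [← H.mem2, H.null₂]
theorem h33 (H : IsAdapted h b) : h (b 3) (b 3) = 0 := by rw [← H.mem3, H.null₂]
theorem h23 (H : IsAdapted h b) : h (b 2) (b 3) = 0 := by rw [← H.mem2, ← H.mem3, H.null₂]

theorem expand (b : Module.Basis (Fin 4) ℝ E4) (v : E4) :
    v = b.repr v 0 • b 0 + b.repr v 1 • b 1 + b.repr v 2 • b 2 + b.repr v 3 • b 3 := by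
  conv_lhs => rw [← b.sum_repr v]
  rw [Fin.sum_univ_four]

/-- The metric dual basis of (e₁, e₂, f₁, f₂) is (f₁, f₂, e₁, e₂), so coordinates, traces and raised
indices are all read off as metric products. -/
theorem repr0 (H : IsAdapted h b) (v : E4) : b.repr v 0 = h v (b 2) := by
  conv_rhs => rw [expand b v]
  simp [H.h02, H.h12, H.h22, H.symm (b 3) (b 2), H.h23]

theorem repr1 (H : IsAdapted h b) (v : E4) : b.repr v 1 = h v (b 3) := by
  conv_rhs => rw [expand b v]
  simp [H.h03, H.h13, H.h23, H.h33]

theorem repr2 (H : IsAdapted h b) (v : E4) : b.repr v 2 = h v (b 0) := by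
  conv_rhs => rw [expand b v]
  simp [H.h00, H.symm (b 1) (b 0), H.symm (b 2) (b 0), H.symm (b 3) (b 0), H.h01, H.h02, H.h03]

theorem repr3 (H : IsAdapted h b) (v : E4) : b.repr v 3 = h v (b 1) := by
  conv_rhs => rw [expand b v]
  simp [H.h01, H.h11, H.symm (b 2) (b 1), H.symm (b 3) (b 1), H.h12, H.h13]

theorem expand' (H : IsAdapted h b) (v : E4) :
    v = h v (b 2) • b 0 + h v (b 3) • b 1 + h v (b 0) • b 2 + h v (b 1) • b 3 := by
  conv_lhs => rw [expand b v, H.repr0, H.repr1, H.repr2, H.repr3]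

theorem nondegenerate (H : IsAdapted h b) (v : E4) (hv : ∀ w, h v w = 0) : v = 0 := by
  rw [H.expand' v]
  simp [hv]

theorem trL_eq (H : IsAdapted h b) (f : E4 →L[ℝ] E4) :
    trL f = h (f (b 0)) (b 2) + h (f (b 1)) (b 3) + h (f (b 2)) (b 0) + h (f (b 3)) (b 1) := by
  have : trL f = LinearMap.trace ℝ E4 (f : E4 →ₗ[ℝ] E4) := rfl
  rw [this, LinearMap.trace_eq_matrix_trace ℝ b, Matrix.trace, Fin.sum_univ_four]
  simp only [Matrix.diag_apply, LinearMap.toMatrix_apply, H.repr0, H.repr1, H.repr2, H.repr3]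
  rfl

theorem inverse_apply (H : IsAdapted h b) (φ : E4 →L[ℝ] ℝ) (w : E4) : h (h.inverse φ) w = φ w := by
  rw [ContinuousLinearMap.apply_inverse_self H.nondegenerate]

theorem inverse_expand (H : IsAdapted h b) (φ : E4 →L[ℝ] ℝ) :
    h.inverse φ = φ (b 2) • b 0 + φ (b 3) • b 1 + φ (b 0) • b 2 + φ (b 1) • b 3 := by
  conv_lhs => rw [H.expand' (h.inverse φ)]
  simp only [H.inverse_apply]

theorem formInner_eq (H : IsAdapted h b) {α β : E4 →L[ℝ] E4 →L[ℝ] ℝ}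
    (hα : ∀ u v, α u v = -α v u) (hβ : ∀ u v, β u v = -β v u) :
    formInner h α β = -(β (b 0) (b 2) * α (b 0) (b 2)) - β (b 0) (b 3) * α (b 1) (b 2) +
      β (b 0) (b 1) * α (b 2) (b 3) - β (b 1) (b 2) * α (b 0) (b 3) -
      β (b 1) (b 3) * α (b 1) (b 3) + β (b 2) (b 3) * α (b 0) (b 1) := by
  have z (γ : E4 →L[ℝ] E4 →L[ℝ] ℝ) (hγ : ∀ u v, γ u v = -γ v u) (u : E4) : γ u u = 0 := by
    have := hγ u u; linarith
  rw [formInner, H.trL_eq]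
  simp only [ContinuousLinearMap.comp_apply, H.inverse_apply]
  simp only [H.inverse_expand, map_add, map_smul, add_apply,
    smul_apply, smul_eq_mul, z α hα, z β hβ]
  rw [hα (b 3) (b 2), hα (b 1) (b 0), hα (b 2) (b 0), hα (b 3) (b 0), hα (b 2) (b 1), hα (b 3) (b 1),
    hβ (b 3) (b 2), hβ (b 1) (b 0), hβ (b 2) (b 0), hβ (b 3) (b 0), hβ (b 2) (b 1), hβ (b 3) (b 1)]
  ring

end IsAdapted

theorem twoForm_antisymm {β : E4 →L[ℝ] E4 →L[ℝ] ℝ} (hβ : IsTwoForm β) (u v : E4) :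
    β u v = -β v u := by
  have := hβ (u + v)
  simp only [map_add, add_apply, hβ u, hβ v] at this
  linarith

theorem twoForm_expand (b : Module.Basis (Fin 4) ℝ E4) {β : E4 →L[ℝ] E4 →L[ℝ] ℝ} (hβ : IsTwoForm β)
    (u v : E4) : β u v =
    β (b 0) (b 1) * (b.repr u 0 * b.repr v 1 - b.repr u 1 * b.repr v 0) +
    β (b 0) (b 2) * (b.repr u 0 * b.repr v 2 - b.repr u 2 * b.repr v 0) +
    β (b 0) (b 3) * (b.repr u 0 * b.repr v 3 - b.repr u 3 * b.repr v 0) +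
    β (b 1) (b 2) * (b.repr u 1 * b.repr v 2 - b.repr u 2 * b.repr v 1) +
    β (b 1) (b 3) * (b.repr u 1 * b.repr v 3 - b.repr u 3 * b.repr v 1) +
    β (b 2) (b 3) * (b.repr u 2 * b.repr v 3 - b.repr u 3 * b.repr v 2) := by
  conv_lhs => rw [IsAdapted.expand b u, IsAdapted.expand b v]
  have z := hβ
  have s := twoForm_antisymm hβ
  simp only [map_add, map_smul, add_apply,
    smul_apply, smul_eq_mul, z (b 0), z (b 1), z (b 2), z (b 3)]
  rw [s (b 3) (b 2), s (b 1) (b 0), s (b 2) (b 0), s (b 3) (b 0), s (b 2) (b 1), s (b 3) (b 1)]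
  ring

theorem det_fin_four (A : Matrix (Fin 4) (Fin 4) ℝ) : A.det =
    A 0 0 * (A 1 1 * (A 2 2 * A 3 3 - A 2 3 * A 3 2) - A 1 2 * (A 2 1 * A 3 3 - A 2 3 * A 3 1) +
      A 1 3 * (A 2 1 * A 3 2 - A 2 2 * A 3 1)) -
    A 0 1 * (A 1 0 * (A 2 2 * A 3 3 - A 2 3 * A 3 2) - A 1 2 * (A 2 0 * A 3 3 - A 2 3 * A 3 0) +
      A 1 3 * (A 2 0 * A 3 2 - A 2 2 * A 3 0)) +
    A 0 2 * (A 1 0 * (A 2 1 * A 3 3 - A 2 3 * A 3 1) - A 1 1 * (A 2 0 * A 3 3 - A 2 3 * A 3 0) +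
      A 1 3 * (A 2 0 * A 3 1 - A 2 1 * A 3 0)) -
    A 0 3 * (A 1 0 * (A 2 1 * A 3 2 - A 2 2 * A 3 1) - A 1 1 * (A 2 0 * A 3 2 - A 2 2 * A 3 0) +
      A 1 2 * (A 2 0 * A 3 1 - A 2 1 * A 3 0)) := by
  rw [Matrix.det_succ_row_zero, Fin.sum_univ_four]
  simp only [Matrix.det_fin_three, Matrix.submatrix_apply, Fin.succAbove, Fin.succ, Fin.castSucc]
  simp [Fin.lt_def]
  ring

/-- A 4-form in dimension four is fixed by its value on one basis; here this is checked by expanding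
both forms in components. -/
theorem wedge2_eq (b : Module.Basis (Fin 4) ℝ E4) {α β : E4 →L[ℝ] E4 →L[ℝ] ℝ}
    (hα : IsTwoForm α) (hβ : IsTwoForm β) (v : Fin 4 → E4) :
    wedge2 (fun x y => α x y) (fun x y => β x y) v =
      wedge2 (fun x y => α x y) (fun x y => β x y) b * b.det v := by
  have hd : b.det v = Matrix.det (Matrix.of fun i j => b.repr (v j) i) := rfl
  rw [hd, det_fin_four]
  simp only [wedge2, Matrix.of_apply]
  rw [twoForm_expand b hα (v 0) (v 1), twoForm_expand b hα (v 0) (v 2),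
    twoForm_expand b hα (v 0) (v 3), twoForm_expand b hα (v 1) (v 2),
    twoForm_expand b hα (v 1) (v 3), twoForm_expand b hα (v 2) (v 3),
    twoForm_expand b hβ (v 0) (v 1), twoForm_expand b hβ (v 0) (v 2),
    twoForm_expand b hβ (v 0) (v 3), twoForm_expand b hβ (v 1) (v 2),
    twoForm_expand b hβ (v 1) (v 3), twoForm_expand b hβ (v 2) (v 3)]
  ring

end adapted

end M4

theorem isTwoForm_wedge1 {V : Type*} [NormedAddCommGroup V] [NormedSpace ℝ V] (a b : V →L[ℝ] ℝ) :
    IsTwoForm (wedge1 a b) := fun u => by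
  simp [wedge1, mul_comm]

theorem wedge1_apply {V : Type*} [NormedAddCommGroup V] [NormedSpace ℝ V] (a b : V →L[ℝ] ℝ)
    (u v : V) : wedge1 a b u v = a u * b v - b u * a v := by
  simp [wedge1]

namespace M4

section adapted

variable {h : E4 →L[ℝ] E4 →L[ℝ] ℝ} {b : Module.Basis (Fin 4) ℝ E4}

/-- In the adapted basis the defining identity is a comparison of coefficients, so testing it on
three decomposable forms already gives all the conditions. -/
theorem IsAdapted.isSelfDual_iff (H : IsAdapted h b) (β : E4 →L[ℝ] E4 →L[ℝ] ℝ) :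
    IsSelfDual h b.det β ↔ IsTwoForm β ∧ β (b 1) (b 2) = 0 ∧ β (b 0) (b 3) = 0 ∧
      β (b 0) (b 2) = β (b 1) (b 3) := by
  constructor
  · rintro ⟨hβ, hs⟩
    have key (i j : Fin 4) := hs _ (isTwoForm_wedge1 (h (b i)) (h (b j))) b
    simp only [b.det_self, mul_one, H.formInner_eq
      (twoForm_antisymm (isTwoForm_wedge1 _ _)) (twoForm_antisymm hβ), wedge2, wedge1_apply] at key
    have s := H.symm
    -- Pairing with b 2, b 3, b 0, b 1 gives the coordinates 0, 1, 2, 3. The test forms are thus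
    -- wedges of coordinate forms, each isolating one component condition on β.
    have k1 := key 2 1
    have k2 := key 2 0
    have k3 := key 3 0
    simp only [H.h00, H.h01, H.h02, H.h03, H.h11, H.h12, H.h13, H.h22, H.h23, H.h33,
      s (b 1) (b 0), s (b 2) (b 0), s (b 3) (b 0), s (b 2) (b 1), s (b 3) (b 1), s (b 3) (b 2)]
      at k1 k2 k3
    refine ⟨hβ, ?_, ?_, ?_⟩ <;> linarith
  · rintro ⟨hβ, h1, h2, h3⟩
    refine ⟨hβ, fun α hα v => ?_⟩
    rw [wedge2_eq b hα hβ, H.formInner_eq (twoForm_antisymm hα) (twoForm_antisymm hβ)]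
    congr 1
    simp only [wedge2, h1, h2, h3]
    ring

theorem IsAdapted.isAntiSelfDual_iff (H : IsAdapted h b) (β : E4 →L[ℝ] E4 →L[ℝ] ℝ) :
    IsAntiSelfDual h b.det β ↔ IsTwoForm β ∧ β (b 0) (b 1) = 0 ∧ β (b 2) (b 3) = 0 ∧
      β (b 0) (b 2) = -β (b 1) (b 3) := by
  constructor
  · rintro ⟨hβ, hs⟩
    have key (i j : Fin 4) := hs _ (isTwoForm_wedge1 (h (b i)) (h (b j))) b
    simp only [b.det_self, mul_one, H.formInner_eq
      (twoForm_antisymm (isTwoForm_wedge1 _ _)) (twoForm_antisymm hβ), wedge2, wedge1_apply] at key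
    have s := H.symm
    have k1 := key 2 3
    have k2 := key 2 0
    have k3 := key 0 1
    simp only [H.h00, H.h01, H.h02, H.h03, H.h11, H.h12, H.h13, H.h22, H.h23, H.h33,
      s (b 1) (b 0), s (b 2) (b 0), s (b 3) (b 0), s (b 2) (b 1), s (b 3) (b 1), s (b 3) (b 2)]
      at k1 k2 k3
    refine ⟨hβ, ?_, ?_, ?_⟩ <;> linarith
  · rintro ⟨hβ, h1, h2, h3⟩
    refine ⟨hβ, fun α hα v => ?_⟩
    rw [wedge2_eq b hα hβ, H.formInner_eq (twoForm_antisymm hα) (twoForm_antisymm hβ), ← neg_mul]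
    congr 1
    simp only [wedge2, h1, h2, h3]
    ring

theorem IsAdapted.linearIndependent_pair (H : IsAdapted h b) {i j : Fin 4} (hij : i ≠ j) :
    LinearIndependent ℝ ![h (b i), h (b j)] := by
  rw [LinearIndependent.pair_iff]
  intro s t hst
  have h0 : s • b i + t • b j = 0 := H.nondegenerate _ fun w => by
    rw [map_add, map_smul, map_smul, hst]; rfl
  have hb : LinearIndependent ℝ ![b i, b j] := by
    have := b.linearIndependent.comp ![i, j] (by
      intro x y; fin_cases x <;> fin_cases y <;> simp [hij, hij.symm])
    have e : b ∘ ![i, j] = ![b i, b j] := by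
      funext x; fin_cases x <;> rfl
    rwa [e] at this
  exact LinearIndependent.pair_iff.1 hb s t h0

theorem IsAdapted.proj₁_eq_zero_iff (H : IsAdapted h b) (v : E4) :
    proj₁ v = 0 ↔ h (b 2) v = 0 ∧ h (b 3) v = 0 := by
  constructor
  · intro hv
    have : v = proj₂ v := by conv_lhs => rw [← proj₁_add_proj₂ v, hv, zero_add]
    rw [this, ← H.mem2, ← H.mem3, H.null₂, H.null₂]
    exact ⟨rfl, rfl⟩
  · rintro ⟨h2, h3⟩
    rw [H.expand' v, H.symm v, H.symm v, h2, h3]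
    simp [proj₁_of_proj₂ H.mem2, proj₁_of_proj₂ H.mem3]

theorem IsAdapted.proj₂_eq_zero_iff (H : IsAdapted h b) (v : E4) :
    proj₂ v = 0 ↔ h (b 0) v = 0 ∧ h (b 1) v = 0 := by
  constructor
  · intro hv
    have : v = proj₁ v := by conv_lhs => rw [← proj₁_add_proj₂ v, hv, add_zero]
    rw [this, ← H.mem0, ← H.mem1, H.null₁, H.null₁]
    exact ⟨rfl, rfl⟩
  · rintro ⟨h2, h3⟩
    rw [H.expand' v, H.symm v (b 0), H.symm v (b 1), h2, h3]
    simp [proj₂_of_proj₁ H.mem0, proj₂_of_proj₁ H.mem1]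

theorem IsAdapted.isSelfDualPlane_of_proj₂ (H : IsAdapted h b) (W : Submodule ℝ E4)
    (hW : ∀ v, v ∈ W ↔ proj₂ v = 0) : IsSelfDualPlane h b.det W := by
  refine ⟨h (b 0), h (b 1), H.linearIndependent_pair (by decide), ?_, ?_⟩
  · ext v
    rw [hW, H.proj₂_eq_zero_iff]
    exact Iff.rfl
  · rw [H.isSelfDual_iff]
    refine ⟨isTwoForm_wedge1 _ _, ?_⟩
    simp [wedge1_apply, H.h00, H.h01, H.h11, H.symm (b 1) (b 0)]

theorem IsAdapted.isSelfDualPlane_of_proj₁ (H : IsAdapted h b) (W : Submodule ℝ E4)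
    (hW : ∀ v, v ∈ W ↔ proj₁ v = 0) : IsSelfDualPlane h b.det W := by
  refine ⟨h (b 2), h (b 3), H.linearIndependent_pair (by decide), ?_, ?_⟩
  · ext v
    rw [hW, H.proj₁_eq_zero_iff]
    exact Iff.rfl
  · rw [H.isSelfDual_iff]
    refine ⟨isTwoForm_wedge1 _ _, ?_⟩
    simp [wedge1_apply, H.h22, H.h23, H.h33, H.symm (b 3) (b 2)]

/-- As a sees only point directions and c only line directions, a ∧ c has mixed components only. The
remaining condition is that its mixed trace vanish, which says that c kills the metric dual w of a.
-/
theorem IsAdapted.isAntiSelfDualPlane (H : IsAdapted h b) (a c : E4 →L[ℝ] ℝ)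
    (hac : LinearIndependent ℝ ![a, c]) (ha : ∀ v, a (proj₂ v) = 0) (hc : ∀ v, c (proj₁ v) = 0)
    (w : E4) (hw : h w = a) (hcw : c w = 0) :
    IsAntiSelfDualPlane h b.det (LinearMap.ker a.toLinearMap ⊓ LinearMap.ker c.toLinearMap) := by
  refine ⟨a, c, hac, rfl, ?_⟩
  rw [H.isAntiSelfDual_iff]
  have a2 : a (b 2) = 0 := by rw [← H.mem2, ha]
  have a3 : a (b 3) = 0 := by rw [← H.mem3, ha]
  have c0 : c (b 0) = 0 := by rw [← H.mem0, hc]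
  have c1 : c (b 1) = 0 := by rw [← H.mem1, hc]
  refine ⟨isTwoForm_wedge1 _ _, ?_, ?_, ?_⟩
  · simp [wedge1_apply, c0, c1]
  · simp [wedge1_apply, a2, a3]
  · have e := H.expand' w
    rw [hw, a2, a3] at e
    rw [e] at hcw
    simp at hcw
    simp only [wedge1_apply, a2, a3, c0, c1]
    linarith

/-- The change of basis is block diagonal with blocks M and N, and duality of the bases forces MᵀN =
1, so its determinant is 1. This makes the orientation well defined. -/
theorem IsAdapted.det_eq (H : IsAdapted h b) {b' : Module.Basis (Fin 4) ℝ E4}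
    (H' : IsAdapted h b') : b'.det = b.det := by
  have h1 : b.det b' = 1 := by
    have hd : b.det b' = Matrix.det (Matrix.of fun i j => b.repr (b' j) i) := rfl
    have z1 (u v : E4) (hu : proj₁ u = u) (hv : proj₁ v = v) : h u v = 0 := by
      rw [← hu, ← hv, H.null₁]
    have z2 (u v : E4) (hu : proj₂ u = u) (hv : proj₂ v = v) : h u v = 0 := by
      rw [← hu, ← hv, H.null₂]
    have e (u v : E4) : h u v = h u (b 2) * h (b 0) v + h u (b 3) * h (b 1) v +
        h u (b 0) * h (b 2) v + h u (b 1) * h (b 3) v := by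
      conv_lhs => rw [H.expand' u]
      simp
    have e02 := e (b' 0) (b' 2)
    have e13 := e (b' 1) (b' 3)
    have e03 := e (b' 0) (b' 3)
    have e12 := e (b' 1) (b' 2)
    rw [H'.h02] at e02
    rw [H'.h13] at e13
    rw [H'.h03] at e03
    rw [H'.h12] at e12
    rw [hd, det_fin_four]
    simp only [Matrix.of_apply, H.repr0, H.repr1, H.repr2, H.repr3, H.symm (b' 2), H.symm (b' 3),
      z1 _ _ H'.mem0 H.mem0, z1 _ _ H'.mem0 H.mem1, z1 _ _ H'.mem1 H.mem0, z1 _ _ H'.mem1 H.mem1,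
      z2 _ _ H.mem2 H'.mem2, z2 _ _ H.mem2 H'.mem3, z2 _ _ H.mem3 H'.mem2,
      z2 _ _ H.mem3 H'.mem3] at e02 e13 e03 e12 ⊢
    linear_combination (-1 : ℝ) * e13 - (h (b' 1) (b 2) * h (b 0) (b' 3) + h (b' 1) (b 3) * h (b 1) (b' 3)) * e02 +
      (h (b' 0) (b 2) * h (b 0) (b' 3) + h (b' 0) (b 3) * h (b 1) (b' 3)) * e12
  have := b'.det.eq_smul_basis_det b
  have h2 := b.det.eq_smul_basis_det b'
  rw [h1, one_smul] at h2
  exact h2.symm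

/-- Take the standard vectors e_i and let f_i be the metric dual of the i-th coordinate form. That
form kills the second factor, so f_i has no component in the first. -/
theorem exists_isAdapted (hsymm : ∀ u v, h u v = h v u) (hnd : ∀ v, (∀ w, h v w = 0) → v = 0)
    (null₁ : ∀ u v, h (proj₁ u) (proj₁ v) = 0) (null₂ : ∀ u v, h (proj₂ u) (proj₂ v) = 0) :
    ∃ b : Module.Basis (Fin 4) ℝ E4, IsAdapted h b := by
  let e : Fin 2 → E4 := fun i => (Pi.single i 1, 0)
  let φ : Fin 2 → E4 →L[ℝ] ℝ := fun i =>
    (ContinuousLinearMap.proj (R := ℝ) (φ := fun _ : Fin 2 => ℝ) i) ∘L ContinuousLinearMap.fst ℝ _ _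
  let f : Fin 2 → E4 := fun i => h.inverse (φ i)
  have hf (i : Fin 2) (w : E4) : h (f i) w = w.1 i := by
    simp only [f]
    rw [ContinuousLinearMap.apply_inverse_self hnd]; rfl
  have pe (i : Fin 2) : proj₁ (e i) = e i := rfl
  have pf (i : Fin 2) : proj₂ (f i) = f i := by
    have : proj₁ (f i) = 0 := by
      refine hnd _ fun w => ?_
      rw [← proj₁_add_proj₂ w, map_add, null₁, zero_add]
      have h1 : h (f i) (proj₂ w) = 0 := by rw [hf]; rfl
      rw [← proj₁_add_proj₂ (f i), map_add, add_apply, null₂, add_zero] at h1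
      exact h1
    conv_rhs => rw [← proj₁_add_proj₂ (f i), this, zero_add]
  have hef (i j : Fin 2) : h (e i) (f j) = if i = j then 1 else 0 := by
    rw [hsymm, hf]
    simp only [e, Pi.single_apply]
    simp [eq_comm]
  let v : Fin 4 → E4 := ![e 0, e 1, f 0, f 1]
  have hee (i j : Fin 2) : h (e i) (e j) = 0 := by rw [← pe, ← pe j, null₁]
  have hff (i j : Fin 2) : h (f i) (f j) = 0 := by rw [← pf, ← pf j, null₂]
  have hfe (i j : Fin 2) : h (f i) (e j) = if i = j then 1 else 0 := by
    rw [hsymm, hef]; simp [eq_comm]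
  have hv : LinearIndependent ℝ v := by
    rw [Fintype.linearIndependent_iff]
    intro c hc
    rw [Fin.sum_univ_four] at hc
    have h0 (w : E4) : h (c 0 • v 0 + c 1 • v 1 + c 2 • v 2 + c 3 • v 3) w = 0 := by rw [hc]; simp
    have k0 := h0 (f 0)
    have k1 := h0 (f 1)
    have k2 := h0 (e 0)
    have k3 := h0 (e 1)
    simp [v, hee, hff, hef, hfe] at k0 k1 k2 k3
    intro i
    fin_cases i <;> assumption
  refine ⟨basisOfLinearIndependentOfCardEqFinrank hv (by simp), ?_⟩
  constructor <;> try simp only [coe_basisOfLinearIndependentOfCardEqFinrank]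
  · exact hsymm
  · exact null₁
  · exact null₂
  · exact pe 0
  · exact pe 1
  · exact pf 0
  · exact pf 1
  · exact hef 0 0
  · exact hef 1 1
  · exact hef 0 1
  · exact hef 1 0

end adapted

theorem formG_proj₁ (k l : Fin 3) (x u v : E4) : formG k l x (proj₁ u) (proj₁ v) = 0 := by
  simp [formG_apply]

theorem formG_proj₂ (k l : Fin 3) (x u v : E4) : formG k l x (proj₂ u) (proj₂ v) = 0 := by
  simp [formG_apply]

theorem funF_ne_zero (m : M4) :
    funF (RP2.chartIndex m.point) (RP2.chartIndex m.line) (extChartAt I4 m m) ≠ 0 :=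
  (mem_target_iff m _).1 (mem_extChartAt_target m)

theorem exists_isAdapted_metricAt (m : M4) :
    ∃ b : Module.Basis (Fin 4) ℝ E4, IsAdapted (metricAt dancingMetric m) b :=
  exists_isAdapted (formG_symm _ _ _) (formG_nondegenerate _ _ _ (funF_ne_zero m))
    (formG_proj₁ _ _ _) (formG_proj₂ _ _ _)

theorem isOrientedVolume_iff (m : M4) (vol : E4 [⋀^Fin 4]→ₗ[ℝ] ℝ) :
    IsOrientedVolume dancingMetric m vol ↔
      ∃ b : Module.Basis (Fin 4) ℝ E4, IsAdapted (metricAt dancingMetric m) b ∧ vol = b.det := by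
  constructor
  · rintro ⟨b, h0, h1, h2, h3, h02, h13, h03, h12, rfl⟩
    rw [mem_pointDir_iff] at h0 h1
    rw [mem_lineDir_iff] at h2 h3
    exact ⟨b, ⟨formG_symm _ _ _, formG_proj₁ _ _ _, formG_proj₂ _ _ _, Prod.ext rfl h0.symm,
      Prod.ext rfl h1.symm, Prod.ext h2.symm rfl, Prod.ext h3.symm rfl, h02, h13, h03, h12⟩, rfl⟩
  · rintro ⟨b, H, rfl⟩
    refine ⟨b, ?_, ?_, ?_, ?_, H.h02, H.h13, H.h03, H.h12, rfl⟩
    · exact (mem_pointDir_iff m _).2 (congrArg Prod.snd H.mem0).symm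
    · exact (mem_pointDir_iff m _).2 (congrArg Prod.snd H.mem1).symm
    · exact (mem_lineDir_iff m _).2 (congrArg Prod.fst H.mem2).symm
    · exact (mem_lineDir_iff m _).2 (congrArg Prod.fst H.mem3).symm

theorem existsUnique_orientedVolume : ∃! vol : M4 → E4 [⋀^Fin 4]→ₗ[ℝ] ℝ,
    ∀ m, IsOrientedVolume dancingMetric m (vol m) := by
  choose b hb using exists_isAdapted_metricAt
  refine ⟨fun m => (b m).det, fun m => (isOrientedVolume_iff m _).2 ⟨b m, hb m, rfl⟩, ?_⟩
  intro vol hvol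
  funext m
  obtain ⟨b', H', h'⟩ := (isOrientedVolume_iff m _).1 (hvol m)
  rw [h', (hb m).det_eq H']

/-! ### Ricci and Weyl curvature -/

/-- `mixed` as a continuous bilinear form. -/
noncomputable def mixedL (h : E4 →L[ℝ] E4 →L[ℝ] ℝ) : E4 →L[ℝ] E4 →L[ℝ] ℝ :=
  -h.bilinearComp proj₂ proj₁

theorem mixedL_apply (h : E4 →L[ℝ] E4 →L[ℝ] ℝ) (u v : E4) : mixedL h u v = mixed h u v := by
  simp [mixedL, mixed]

theorem trL_proj₁ : trL proj₁ = 2 := by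
  obtain ⟨b, H⟩ := exists_isAdapted_metricAt base
  rw [H.trL_eq, H.mem0, H.mem1, proj₁_of_proj₂ H.mem2, proj₁_of_proj₂ H.mem3, H.h02, H.h13]
  simp; norm_num

theorem trL_proj₂ : trL proj₂ = 2 := by
  obtain ⟨b, H⟩ := exists_isAdapted_metricAt base
  rw [H.trL_eq, H.mem2, H.mem3, proj₂_of_proj₁ H.mem0, proj₂_of_proj₁ H.mem1,
    H.symm (b 2), H.symm (b 3), H.h02, H.h13]
  simp; norm_num

/-- The endomorphism u ↦ R(u, v)w is a sum of rank-one maps and multiples of the two projections,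
each of trace 2. -/
theorem ricci_dancingMetric (m : M4) :
    ricci dancingMetric m = (-3 : ℝ) • metricAt dancingMetric m := by
  apply ContinuousLinearMap.ext; intro v
  apply ContinuousLinearMap.ext; intro w
  set h := metricAt dancingMetric m with hh
  have e : ricci dancingMetric m v w = trL (((curvature dancingMetric m).flip v).flip w) := rfl
  have e2 : ((curvature dancingMetric m).flip v).flip w =
      (mixedL h v - (mixedL h).flip v).smulRight (proj₁ w) + mixed h v w • proj₁ -
        ((mixedL h).flip w).smulRight (proj₁ v) + ((mixedL h).flip v - mixedL h v).smulRight (proj₂ w) +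
        mixed h w v • proj₂ - (mixedL h w).smulRight (proj₂ v) := by
    apply ContinuousLinearMap.ext; intro u
    have := curvature_dancingMetric m u v w
    simp only [ContinuousLinearMap.flip_apply]
    rw [this]
    simp [mixedL_apply, ← hh]
  obtain ⟨b, H⟩ := exists_isAdapted_metricAt m
  rw [e, e2]
  simp only [map_add, map_sub, map_smul, trL_smulRight, trL_proj₁, trL_proj₂]
  simp only [sub_apply, ContinuousLinearMap.flip_apply, mixedL_apply]
  -- Both factors are null, so the metric is recovered from its mixed part.
  have hs : h v w = -mixed h v w - mixed h w v := by
    simp only [mixed]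
    conv_lhs => rw [← proj₁_add_proj₂ v, ← proj₁_add_proj₂ w]
    simp only [map_add, add_apply]
    rw [H.null₁, H.null₂, H.symm (proj₁ v)]
    ring
  have e3 : ((-3 : ℝ) • h) v w = -3 * h v w := rfl
  rw [e3, hs]
  simp [mixed]
  ring

theorem isEinstein_dancingMetric : IsEinstein dancingMetric := ⟨-3, ricci_dancingMetric⟩

theorem scalarCurvature_dancingMetric (m : M4) : scalarCurvature dancingMetric m = -12 := by
  obtain ⟨b, H⟩ := exists_isAdapted_metricAt m
  rw [scalarCurvature, ricci_dancingMetric, H.trL_eq]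
  simp only [ContinuousLinearMap.comp_apply, H.inverse_apply]
  simp [H.h02, H.h13, H.symm (b 2) (b 0), H.symm (b 3) (b 1)]
  norm_num

theorem schouten_dancingMetric (m : M4) :
    schouten dancingMetric m = (-(1 / 2) : ℝ) • metricAt dancingMetric m := by
  rw [schouten, ricci_dancingMetric, scalarCurvature_dancingMetric]
  module

theorem weyl_dancingMetric (m : M4) (u v z : E4) : weyl dancingMetric m u v z =
    curvature dancingMetric m u v z + metricAt dancingMetric m v z • u -
      metricAt dancingMetric m u z • v := by
  obtain ⟨b, H⟩ := exists_isAdapted_metricAt m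
  simp only [weyl, schouten_dancingMetric]
  simp only [sub_apply, add_apply, ContinuousLinearMap.smulRight_apply, smul_apply, map_smul,
    ContinuousLinearMap.inverse_apply_self H.nondegenerate]
  module

/-- Traces of rank-one maps again. The mixed components of β in the curvature terms cancel those of
the scalar part. What survives is the restriction of β to each factor and the para-Kähler form times
the mixed trace of β. -/
theorem weylOp_dancingMetric (m : M4) {b : Module.Basis (Fin 4) ℝ E4}
    (H : IsAdapted (metricAt dancingMetric m) b) {β : E4 →L[ℝ] E4 →L[ℝ] ℝ} (hβ : IsTwoForm β)
    (u v : E4) : weylOp dancingMetric m β u v =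
      (mixed (metricAt dancingMetric m) v u - mixed (metricAt dancingMetric m) u v) *
        (β (b 0) (b 2) + β (b 1) (b 3)) +
      β (proj₁ u) (proj₁ v) + β (proj₂ u) (proj₂ v) := by
  set h := metricAt dancingMetric m with hh
  set B := h.inverse ∘L β with hB
  have hBa (x y : E4) : h (B x) y = β x y := H.inverse_apply _ _
  have hs := twoForm_antisymm hβ
  have e : weyl dancingMetric m u v ∘L B =
      (mixed h v u - mixed h u v) • (proj₁ ∘L B) + (mixedL h v ∘L B).smulRight (proj₁ u) -
        (mixedL h u ∘L B).smulRight (proj₁ v) + (mixed h u v - mixed h v u) • (proj₂ ∘L B) +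
        ((mixedL h).flip v ∘L B).smulRight (proj₂ u) - ((mixedL h).flip u ∘L B).smulRight (proj₂ v)
        + (h v ∘L B).smulRight u - (h u ∘L B).smulRight v := by
    apply ContinuousLinearMap.ext; intro z
    rw [ContinuousLinearMap.comp_apply, weyl_dancingMetric, curvature_dancingMetric, ← hh]
    simp [mixedL_apply]
  have p1 (x y : E4) : h (proj₁ x) y = h x (proj₂ y) := by
    conv_lhs => rw [← proj₁_add_proj₂ y, map_add, H.null₁, zero_add]
    conv_rhs => rw [← proj₁_add_proj₂ x, map_add, add_apply, H.null₂, add_zero]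
  have p2 (x y : E4) : h (proj₂ x) y = h x (proj₁ y) := by
    conv_lhs => rw [← proj₁_add_proj₂ y, map_add, H.null₂, add_zero]
    conv_rhs => rw [← proj₁_add_proj₂ x, map_add, add_apply, H.null₁, zero_add]
  have t1 : trL (proj₁ ∘L B) = β (b 0) (b 2) + β (b 1) (b 3) := by
    rw [H.trL_eq]
    simp only [ContinuousLinearMap.comp_apply, p1, hBa]
    simp [proj₂_of_proj₁ H.mem0, proj₂_of_proj₁ H.mem1, H.mem2, H.mem3]
  have t2 : trL (proj₂ ∘L B) = -(β (b 0) (b 2) + β (b 1) (b 3)) := by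
    rw [H.trL_eq]
    simp only [ContinuousLinearMap.comp_apply, p2, hBa]
    simp only [proj₁_of_proj₂ H.mem2, proj₁_of_proj₂ H.mem3, H.mem0, H.mem1, map_zero]
    rw [hs (b 2), hs (b 3)]
    ring
  rw [weylOp, e]
  simp only [map_add, map_sub, map_smul, trL_smulRight, t1, t2]
  have c1 (v x : E4) : mixed h v (B x) = -β x (proj₂ v) := by
    rw [mixed, H.symm, p1, proj₂_proj₂, hBa]
  have c2 (x v : E4) : mixed h (B x) v = -β x (proj₁ v) := by
    rw [mixed, p2, proj₁_proj₁, hBa]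
  have c3 (x y : E4) : h x (B y) = β y x := by rw [H.symm, hBa]
  simp only [ContinuousLinearMap.comp_apply, ContinuousLinearMap.flip_apply, mixedL_apply,
    smul_eq_mul, c1, c2, c3]
  have ex : β u v = β (proj₁ u) (proj₁ v) + β (proj₁ u) (proj₂ v) + β (proj₂ u) (proj₁ v) +
      β (proj₂ u) (proj₂ v) := by
    conv_lhs => rw [← proj₁_add_proj₂ u, ← proj₁_add_proj₂ v]
    simp only [map_add, add_apply]
    ring
  rw [hs v u, ex, hs (proj₁ v), hs (proj₂ v)]
  ring

/-- Anti-self-dual forms vanish on each factor and have zero mixed trace, which kills all terms of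
the formula. -/
theorem weylMinusVanishesAt_dancingMetric (m : M4) {b : Module.Basis (Fin 4) ℝ E4}
    (H : IsAdapted (metricAt dancingMetric m) b) :
    WeylMinusVanishesAt dancingMetric m b.det := by
  intro β hβ u v
  obtain ⟨h2, h01, h23, h02⟩ := (H.isAntiSelfDual_iff β).1 hβ
  rw [weylOp_dancingMetric m H h2, h02]
  have e1 : β (proj₁ u) (proj₁ v) = 0 := by
    rw [twoForm_expand b h2, H.repr2, H.repr3, H.repr2, H.repr3, h01]
    rw [← H.mem0, ← H.mem1, H.null₁, H.null₁, H.null₁, H.null₁]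
    ring
  have e2 : β (proj₂ u) (proj₂ v) = 0 := by
    rw [twoForm_expand b h2, H.repr0, H.repr1, H.repr0, H.repr1, h23]
    rw [← H.mem2, ← H.mem3, H.null₂, H.null₂, H.null₂, H.null₂]
    ring
  rw [e1, e2]
  ring

/-- The area form of the point directions is a self-dual eigenvector with eigenvalue 1. -/
theorem weylPlus_ne_zero (m : M4) {b : Module.Basis (Fin 4) ℝ E4}
    (H : IsAdapted (metricAt dancingMetric m) b) :
    ¬ WeylPlusVanishesAt dancingMetric m b.det := by
  intro hW
  set h := metricAt dancingMetric m with hh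
  have hβ : IsSelfDual h b.det (wedge1 (h (b 2)) (h (b 3))) := by
    rw [H.isSelfDual_iff]
    refine ⟨isTwoForm_wedge1 _ _, ?_⟩
    simp [wedge1_apply, H.h22, H.h23, H.h33, H.symm (b 3) (b 2)]
  have := hW _ hβ (b 0) (b 1)
  rw [weylOp_dancingMetric m H hβ.1, H.mem0, H.mem1, proj₂_of_proj₁ H.mem0,
    proj₂_of_proj₁ H.mem1] at this
  simp [wedge1_apply, mixed, proj₂_of_proj₁ H.mem0, proj₂_of_proj₁ H.mem1, H.symm (b 2) (b 0),
    H.symm (b 2) (b 1), H.symm (b 3) (b 0), H.symm (b 3) (b 1), H.h02, H.h13, H.h03, H.h12, H.h22, H.h23, H.h33] at this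

/-- B and C, the area forms of the two factors, have eigenvalue 1; the form A of para-Kähler type
has eigenvalue −2. On the conic s²B + stA + t²C, which parametrises β ∧ β = 0, the quartic is s²t² +
s²t² + 4s²t² = 6s²t², with double roots at the two null foliations. -/
theorem weylPlusTypeDAt_dancingMetric (m : M4) {b : Module.Basis (Fin 4) ℝ E4}
    (H : IsAdapted (metricAt dancingMetric m) b) :
    WeylPlusTypeDAt dancingMetric m b.det := by
  set h := metricAt dancingMetric m with hh
  obtain ⟨B, hB⟩ : ∃ B, B = wedge1 (h (b 0)) (h (b 1)) := ⟨_, rfl⟩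
  obtain ⟨C, hC⟩ : ∃ C, C = wedge1 (h (b 2)) (h (b 3)) := ⟨_, rfl⟩
  obtain ⟨A, hA⟩ : ∃ A, A = wedge1 (h (b 2)) (h (b 0)) + wedge1 (h (b 3)) (h (b 1)) := ⟨_, rfl⟩
  have tB : IsTwoForm B := hB ▸ isTwoForm_wedge1 _ _
  have tC : IsTwoForm C := hC ▸ isTwoForm_wedge1 _ _
  have tA : IsTwoForm A := fun u => by
    have h1 := isTwoForm_wedge1 (h (b 2)) (h (b 0)) u
    have h2 := isTwoForm_wedge1 (h (b 3)) (h (b 1)) u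
    simp only [hA, add_apply, h1, h2, add_zero]
  have s := H.symm
  have vals : A (b 0) (b 1) = 0 ∧ A (b 0) (b 2) = 1 ∧ A (b 0) (b 3) = 0 ∧ A (b 1) (b 2) = 0 ∧
      A (b 1) (b 3) = 1 ∧ A (b 2) (b 3) = 0 ∧ B (b 0) (b 1) = 0 ∧ B (b 0) (b 2) = 0 ∧
      B (b 0) (b 3) = 0 ∧ B (b 1) (b 2) = 0 ∧ B (b 1) (b 3) = 0 ∧ B (b 2) (b 3) = 1 ∧
      C (b 0) (b 1) = 1 ∧ C (b 0) (b 2) = 0 ∧ C (b 0) (b 3) = 0 ∧ C (b 1) (b 2) = 0 ∧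
      C (b 1) (b 3) = 0 ∧ C (b 2) (b 3) = 0 := by
    have w (p q u v : E4) : wedge1 (h p) (h q) u v = h p u * h q v - h p v * h q u := by
      rw [wedge1_apply]; ring
    simp only [hA, hB, hC, add_apply, w]
    norm_num [H.h00, H.h01, H.h02, H.h03, H.h11, H.h12, H.h13, H.h22, H.h23,
      H.h33, s (b 1) (b 0), s (b 2) (b 0), s (b 3) (b 0), s (b 2) (b 1), s (b 3) (b 1),
      s (b 3) (b 2)]
  obtain ⟨A01, A02, A03, A12, A13, A23, B01, B02, B03, B12, B13, B23, C01, C02, C03, C12, C13,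
    C23⟩ := vals
  have tβ (p q r : ℝ) : IsTwoForm (p • B + q • A + r • C) := fun u => by
    simp [tA u, tB u, tC u]
  refine ⟨A, B, C, (H.isSelfDual_iff A).2 ⟨tA, A12, A03, A02.trans A13.symm⟩,
    (H.isSelfDual_iff B).2 ⟨tB, B12, B03, B02.trans B13.symm⟩,
    (H.isSelfDual_iff C).2 ⟨tC, C12, C03, C02.trans C13.symm⟩, ?_, ?_,
    fun s t => 6 * s ^ 2 * t ^ 2, ?_, ?_⟩
  · rw [Fintype.linearIndependent_iff]
    intro c hc
    rw [Fin.sum_univ_three] at hc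
    have h0 (u v : E4) : (c 0 • A + c 1 • B + c 2 • C) u v = 0 := by
      have : c 0 • A + c 1 • B + c 2 • C = 0 := hc
      rw [this]; rfl
    have k1 := h0 (b 0) (b 2)
    have k2 := h0 (b 2) (b 3)
    have k3 := h0 (b 0) (b 1)
    simp [A02, B02, C02, A23, B23, C23, A01, B01, C01] at k1 k2 k3
    intro i
    fin_cases i <;> assumption
  · intro s t v
    dsimp only
    rw [wedge2_eq b (tβ _ _ _) (tβ _ _ _)]
    simp [wedge2, A01, A02, A03, A12, A13, A23, B01, B02, B03, B12, B13, B23, C01, C02, C03, C12,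
      C13, C23]
    left
    ring
  · intro s t v
    dsimp only
    have hW : weylOp dancingMetric m ((s ^ 2) • B + (s * t) • A + (t ^ 2) • C) =
        fun u v => ((s ^ 2) • B + (-2 * (s * t)) • A + (t ^ 2) • C) u v := by
      funext u v
      rw [weylOp_dancingMetric m H (tβ _ _ _), ← hh]
      rw [twoForm_expand b (tβ _ _ _) (proj₁ u), twoForm_expand b (tβ _ _ _) (proj₂ u),
        twoForm_expand b (tβ (s ^ 2) (-2 * (s * t)) (t ^ 2)) u]
      simp only [add_apply, smul_apply, A01, A02, A03, A12, A13, A23, B01, B02, B03, B12, B13, B23,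
        C01, C02, C03, C12, C13, C23, smul_eq_mul, mixed]
      have p1 (x y : E4) : h (proj₁ x) y = h x (proj₂ y) := by
        conv_lhs => rw [← proj₁_add_proj₂ y, map_add, H.null₁, zero_add]
        conv_rhs => rw [← proj₁_add_proj₂ x, map_add, add_apply, H.null₂, add_zero]
      have p2 (x y : E4) : h (proj₂ x) y = h x (proj₁ y) := by
        conv_lhs => rw [← proj₁_add_proj₂ y, map_add, H.null₂, add_zero]
        conv_rhs => rw [← proj₁_add_proj₂ x, map_add, add_apply, H.null₁, zero_add]
      have e1 : h (proj₂ u) (proj₁ v) = h u (b 0) * h v (b 2) + h u (b 1) * h v (b 3) := by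
        rw [p2, proj₁_proj₁]
        conv_lhs => rw [H.expand' v]
        simp [H.mem0, H.mem1, proj₁_of_proj₂ H.mem2, proj₁_of_proj₂ H.mem3]
        ring
      have e2 : h (proj₂ v) (proj₁ u) = h v (b 0) * h u (b 2) + h v (b 1) * h u (b 3) := by
        rw [p2, proj₁_proj₁]
        conv_lhs => rw [H.expand' u]
        simp [H.mem0, H.mem1, proj₁_of_proj₂ H.mem2, proj₁_of_proj₂ H.mem3]
        ring
      simp only [H.repr0, H.repr1, H.repr2, H.repr3, e1, e2, p1, p2, H.mem0, H.mem1, H.mem2, H.mem3,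
        proj₁_of_proj₂ H.mem2, proj₁_of_proj₂ H.mem3, proj₂_of_proj₁ H.mem0,
        proj₂_of_proj₁ H.mem1, map_zero]
      ring
    rw [hW, wedge2_eq b (tβ _ _ _) (tβ _ _ _)]
    congr 1
    simp [wedge2, A01, A02, A03, A12, A13, A23, B01, B02, B03, B12, B13, B23, C01, C02, C03, C12,
      C13, C23]
    ring
  -- The factor 6 is absorbed into one linear factor: 6s²t² = (√6 s)² t².
  · refine ⟨((6 : ℝ).sqrt : ℂ), 0, 0, 1, ?_, ?_⟩
    · simp
    · intro s t
      have : ((6 : ℝ).sqrt : ℂ) ^ 2 = 6 := by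
        rw [← Complex.ofReal_pow, Real.sq_sqrt (by norm_num)]; norm_num
      push_cast
      linear_combination (-(s : ℂ) ^ 2 * (t : ℂ) ^ 2) * this

theorem two_le_sigPos (Q : QuadraticForm ℝ E4) (φ : (Fin 2 → ℝ) →ₗ[ℝ] E4)
    (h : ∀ c, c ≠ 0 → 0 < Q (φ c)) : 2 ≤ sigPos Q := by
  have hφ : Function.Injective φ := by
    rw [← LinearMap.ker_eq_bot, LinearMap.ker_eq_bot']
    intro c hc
    by_contra h0
    have := h c h0
    rw [hc, QuadraticMap.map_zero] at this
    exact lt_irrefl _ this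
  have hd : Module.finrank ℝ (LinearMap.range φ) = 2 := by
    rw [LinearMap.finrank_range_of_inj hφ]; simp
  refine hd.symm.le.trans (le_sigPos_of_posDef Q (V := LinearMap.range φ) ?_)
  rintro ⟨x, c, rfl⟩ hx
  have : c ≠ 0 := by
    rintro rfl
    exact hx (Subtype.ext (map_zero φ))
  exact h c this

/-- The plane spanned by e_a + f_a is positive definite and that spanned by e_a − f_a is negative
definite; dimension four leaves no room for more. -/
theorem IsAdapted.signature {h : E4 →L[ℝ] E4 →L[ℝ] ℝ} {b : Module.Basis (Fin 4) ℝ E4}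
    (H : IsAdapted h b) (Q : QuadraticForm ℝ E4) (hQ : ∀ v, Q v = h v v) :
    sigPos Q = 2 ∧ sigNeg Q = 2 := by
  have pos (c : Fin 2 → ℝ) (hc : c ≠ 0) : 0 < c 0 ^ 2 + c 1 ^ 2 := by
    by_contra hn
    apply hc
    have h0 : c 0 = 0 := by nlinarith [sq_nonneg (c 0), sq_nonneg (c 1)]
    have h1 : c 1 = 0 := by nlinarith [sq_nonneg (c 0), sq_nonneg (c 1)]
    funext i
    fin_cases i
    · exact h0
    · exact h1
  let φ (s : ℝ) : (Fin 2 → ℝ) →ₗ[ℝ] E4 :=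
    (LinearMap.proj 0).smulRight (b 0 + s • b 2) + (LinearMap.proj 1).smulRight (b 1 + s • b 3)
  have hφ (s : ℝ) (c : Fin 2 → ℝ) : Q (φ s c) = 2 * s * (c 0 ^ 2 + c 1 ^ 2) := by
    rw [hQ]
    have e : φ s c = c 0 • (b 0 + s • b 2) + c 1 • (b 1 + s • b 3) := rfl
    rw [e]
    simp only [map_add, map_smul, add_apply, smul_apply, H.h00, H.h01, H.h02, H.h03, H.h11, H.h12,
      H.h13, H.h22, H.h23, H.h33, H.symm (b 1) (b 0), H.symm (b 2) (b 0), H.symm (b 3) (b 0),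
      H.symm (b 2) (b 1), H.symm (b 3) (b 1), H.symm (b 3) (b 2), smul_eq_mul]
    ring
  have h1 : 2 ≤ sigPos Q := two_le_sigPos Q (φ 1) fun c hc => by
    rw [hφ]; linarith [pos c hc]
  have h2 : 2 ≤ sigNeg Q := two_le_sigPos (-Q) (φ (-1)) fun c hc => by
    rw [neg_apply, hφ]; linarith [pos c hc]
  have h3 := QuadraticForm.sigPos_add_sigNeg_add_radical (Q := Q)
  have h4 : Module.finrank ℝ E4 = 4 := by simp
  omega

theorem hasSignature_dancingMetric : HasSignature dancingMetric 2 2 := by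
  intro m
  obtain ⟨b, H⟩ := exists_isAdapted_metricAt m
  exact H.signature (metricQuadraticForm dancingMetric m) fun v => rfl

end M4

/-! ### The action of SL₃ and the symmetries -/

/-- Homogeneous coordinates of point-line pairs. -/
abbrev HomCoord : Type := (Fin 3 → ℝ) × (Fin 3 → ℝ)

namespace M4

theorem ofHomogeneous_eq_iff {z w : HomCoord} (hz : z.2 ⬝ᵥ z.1 ≠ 0) (hw : w.2 ⬝ᵥ w.1 ≠ 0) :
    ofHomogeneous z = ofHomogeneous w ↔ (∃ s : ℝ, s • w.1 = z.1) ∧ ∃ t : ℝ, t • w.2 = z.2 := by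
  have e : ofHomogeneous z = ofHomogeneous w ↔ (ofHomogeneous z).point = (ofHomogeneous w).point ∧
      (ofHomogeneous z).line = (ofHomogeneous w).line :=
    ⟨fun h => by rw [h]; exact ⟨rfl, rfl⟩, fun h => Subtype.ext (Prod.ext h.1 h.2)⟩
  rw [e, point_ofHomogeneous z hz, point_ofHomogeneous w hw, line_ofHomogeneous z hz,
    line_ofHomogeneous w hw, Projectivization.mk_eq_mk_iff', Projectivization.mk_eq_mk_iff']

/-- The lift of `x` near `ofHomogeneous z` through `z`. -/
noncomputable def localLift (z : HomCoord) (x : M4) : HomCoord :=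
  let c := ofHomogeneous z
  (z.1 (RP2.chartIndex c.point) • ins (RP2.chartIndex c.point) (extChartAt I4 c x).1,
    z.2 (RP2.chartIndex c.line) • ins (RP2.chartIndex c.line) (extChartAt I4 c x).2)

theorem localLift_self (z : HomCoord) (h : z.2 ⬝ᵥ z.1 ≠ 0) : localLift z (ofHomogeneous z) = z := by
  obtain ⟨h1, h2⟩ := chartIndex_ofHomogeneous_ne z h
  simp only [localLift, extChartAt_ofHomogeneous _ z h, affine_eq_lift _ _ h1,
    affine_eq_lift _ _ h2, smul_smul, mul_inv_cancel₀ h1, mul_inv_cancel₀ h2, one_smul]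

theorem localLift_regular (z : HomCoord) (h : z.2 ⬝ᵥ z.1 ≠ 0) (x : M4)
    (hx : x ∈ (extChartAt I4 (ofHomogeneous z)).source) :
    (localLift z x).2 ⬝ᵥ (localLift z x).1 ≠ 0 := by
  obtain ⟨h1, h2⟩ := chartIndex_ofHomogeneous_ne z h
  have ht := (extChartAt I4 (ofHomogeneous z)).map_source hx
  rw [extChartAt_target] at ht
  simp only [localLift, smul_dotProduct, dotProduct_smul, smul_eq_mul]
  exact mul_ne_zero h1 (mul_ne_zero h2 ht)

theorem ofHomogeneous_localLift (z : HomCoord) (h : z.2 ⬝ᵥ z.1 ≠ 0) (x : M4)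
    (hx : x ∈ (extChartAt I4 (ofHomogeneous z)).source) : ofHomogeneous (localLift z x) = x := by
  obtain ⟨h1, h2⟩ := chartIndex_ofHomogeneous_ne z h
  have ht := (extChartAt I4 (ofHomogeneous z)).map_source hx
  rw [extChartAt_target] at ht
  have := ofHomogeneous_smul (lift (RP2.chartIndex (ofHomogeneous z).point)
    (RP2.chartIndex (ofHomogeneous z).line) (extChartAt I4 (ofHomogeneous z) x)) ht h1 h2
  rw [ofHomogeneous_lift_extChartAt _ _ hx] at this
  exact this

theorem contMDiffAt_localLift (z : HomCoord) (x : M4)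
    (hx : x ∈ (extChartAt I4 (ofHomogeneous z)).source) :
    ContMDiffAt I4 𝓘(ℝ, HomCoord) ∞ (localLift z) x := by
  have h : ContMDiffAt I4 𝓘(ℝ, E4) ∞ (extChartAt I4 (ofHomogeneous z)) x :=
    contMDiffAt_extChartAt' (by rwa [_root_.extChartAt_source] at hx)
  have h2 : ContDiff ℝ ∞ (fun y : E4 =>
      ((z.1 (RP2.chartIndex (ofHomogeneous z).point) • ins (RP2.chartIndex (ofHomogeneous z).point) y.1,
    z.2 (RP2.chartIndex (ofHomogeneous z).line) • ins (RP2.chartIndex (ofHomogeneous z).line) y.2) :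
      HomCoord)) :=
    (((contDiff_ins _).comp contDiff_fst).const_smul _).prodMk
      (((contDiff_ins _).comp contDiff_snd).const_smul _)
  exact h2.contDiffAt.contMDiffAt.comp x h

/-- Smoothness can be checked in homogeneous coordinates. -/
theorem contMDiffAt_of_comp_ofHomogeneous {E' H' N : Type*} [NormedAddCommGroup E'] [NormedSpace ℝ E']
    [TopologicalSpace H'] {J : ModelWithCorners ℝ E' H'} [TopologicalSpace N] [ChartedSpace H' N]
    {f : M4 → N} {z : HomCoord} (h : z.2 ⬝ᵥ z.1 ≠ 0)
    (hf : ContMDiffAt 𝓘(ℝ, HomCoord) J ∞ (f ∘ ofHomogeneous) z) :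
    ContMDiffAt I4 J ∞ f (ofHomogeneous z) := by
  have hs := mem_extChartAt_source (I := I4) (ofHomogeneous z)
  have h1 := contMDiffAt_localLift z (ofHomogeneous z) hs
  have hf' : ContMDiffAt 𝓘(ℝ, HomCoord) J ∞ (f ∘ ofHomogeneous) (localLift z (ofHomogeneous z)) := by
    rwa [localLift_self z h]
  refine (hf'.comp _ h1).congr_of_eventuallyEq ?_
  filter_upwards [extChartAt_source_mem_nhds (I := I4) (ofHomogeneous z)] with x hx
  simp only [Function.comp_apply, ofHomogeneous_localLift z h x hx]

/-- The map `(q, p) ↦ (A q, p B)`. -/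
noncomputable def actL (A B : Matrix (Fin 3) (Fin 3) ℝ) : HomCoord →L[ℝ] HomCoord :=
  LinearMap.toContinuousLinearMap (A.mulVecLin.prodMap B.vecMulLinear)

/-- The action of `SL₃(ℝ)` in homogeneous coordinates. -/
noncomputable def act (A : Matrix.SpecialLinearGroup (Fin 3) ℝ) : HomCoord →L[ℝ] HomCoord :=
  actL A.1 (A⁻¹ : Matrix.SpecialLinearGroup (Fin 3) ℝ).1

theorem act_apply (A : Matrix.SpecialLinearGroup (Fin 3) ℝ) (z : HomCoord) :
    act A z = (A.1 *ᵥ z.1, z.2 ᵥ* (A⁻¹ : Matrix.SpecialLinearGroup (Fin 3) ℝ).1) := rfl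

theorem inv_mul_val (A : Matrix.SpecialLinearGroup (Fin 3) ℝ) :
    (A⁻¹ : Matrix.SpecialLinearGroup (Fin 3) ℝ).1 * A.1 = 1 :=
  congrArg Subtype.val (inv_mul_cancel A)

theorem mul_inv_val (A : Matrix.SpecialLinearGroup (Fin 3) ℝ) :
    A.1 * (A⁻¹ : Matrix.SpecialLinearGroup (Fin 3) ℝ).1 = 1 :=
  congrArg Subtype.val (mul_inv_cancel A)

theorem act_dotProduct (A : Matrix.SpecialLinearGroup (Fin 3) ℝ) (z w : HomCoord) :
    (act A z).2 ⬝ᵥ (act A w).1 = z.2 ⬝ᵥ w.1 := by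
  rw [act_apply, act_apply, ← Matrix.dotProduct_mulVec, Matrix.mulVec_mulVec, inv_mul_val,
    Matrix.one_mulVec]

theorem smul_ofHomogeneous (A : Matrix.SpecialLinearGroup (Fin 3) ℝ) (z : HomCoord)
    (hz : z.2 ⬝ᵥ z.1 ≠ 0) : A • ofHomogeneous z = ofHomogeneous (act A z) := by
  have h' : (act A z).2 ⬝ᵥ (act A z).1 ≠ 0 := by rwa [act_dotProduct]
  rw [ofHomogeneous_eq z hz, ofHomogeneous_eq _ h']
  refine Subtype.ext (Prod.ext ?_ ?_)
  · show A • Projectivization.mk ℝ z.1 _ = _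
    rw [Projectivization.smul_mk]
    rfl
  · show (A⁻¹.transpose) • Projectivization.mk ℝ z.2 _ = _
    rw [Projectivization.smul_mk, Projectivization.mk_eq_mk_iff']
    refine ⟨1, ?_⟩
    rw [one_smul, act_apply]
    exact (Matrix.mulVec_transpose (A⁻¹ : Matrix.SpecialLinearGroup (Fin 3) ℝ).1 z.2).symm

theorem smul_comp_ofHomogeneous (A : Matrix.SpecialLinearGroup (Fin 3) ℝ) (z : HomCoord)
    (hz : z.2 ⬝ᵥ z.1 ≠ 0) :
    (fun m : M4 => A • m) ∘ ofHomogeneous =ᶠ[𝓝 z] ofHomogeneous ∘ act A := by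
  filter_upwards [isOpen_regular.mem_nhds hz] with w hw
  exact smul_ofHomogeneous A w hw

theorem contMDiff_smul (A : Matrix.SpecialLinearGroup (Fin 3) ℝ) :
    ContMDiff I4 I4 ∞ (fun m : M4 => A • m) := by
  intro m
  obtain ⟨z, hz, rfl⟩ := exists_normalized m
  have hz' : z.2 ⬝ᵥ z.1 ≠ 0 := by rw [hz]; exact one_ne_zero
  apply contMDiffAt_of_comp_ofHomogeneous hz'
  refine ContMDiffAt.congr_of_eventuallyEq ?_ (smul_comp_ofHomogeneous A z hz')
  have h := contMDiffAt_ofHomogeneous (act A z) (by rwa [act_dotProduct])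
  exact h.comp z (act A).contDiff.contDiffAt.contMDiffAt

/-- The action lifts to a linear map of homogeneous coordinates; this is the derivative of the
intertwining relation with `ofHomogeneous`. -/
theorem mfderiv_smul_dPi (A : Matrix.SpecialLinearGroup (Fin 3) ℝ) (z a : HomCoord)
    (hz : z.2 ⬝ᵥ z.1 ≠ 0) :
    (mfderiv I4 I4 (fun m : M4 => A • m) (ofHomogeneous z) (dPi z a) : E4) =
      dPi (act A z) (act A a) := by
  have h' : (act A z).2 ⬝ᵥ (act A z).1 ≠ 0 := by rwa [act_dotProduct]
  have h1 := hasMFDerivAt_ofHomogeneous z hz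
  have h2 := ((contMDiff_smul A).mdifferentiableAt (by simp)).hasMFDerivAt.comp z h1
  have h3 := ((hasMFDerivAt_ofHomogeneous _ h').comp z (act A).hasFDerivAt.hasMFDerivAt)
    |>.congr_of_eventuallyEq (smul_comp_ofHomogeneous A z hz)
  have h4 := hasMFDerivAt_unique h2 h3
  have h5 := congrArg (fun L : HomCoord →L[ℝ] E4 => L a) h4
  rw [dPi, h1.mfderiv, dPi, (hasMFDerivAt_ofHomogeneous _ h').mfderiv]
  exact h5

theorem homForm_act (A : Matrix.SpecialLinearGroup (Fin 3) ℝ) (z a b : HomCoord) :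
    homForm (act A z) (act A a) (act A b) = homForm z a b := by
  simp only [homForm, act_dotProduct]

theorem preservesMetric_smul (A : Matrix.SpecialLinearGroup (Fin 3) ℝ) :
    PreservesMetric dancingMetric (fun m : M4 => A • m) := by
  intro m v w
  obtain ⟨z, hz, rfl⟩ := exists_normalized m
  have hz' : z.2 ⬝ᵥ z.1 ≠ 0 := by rw [hz]; exact one_ne_zero
  obtain ⟨a, -, -, rfl⟩ := exists_horizontal_lift z hz' v
  obtain ⟨b, -, -, rfl⟩ := exists_horizontal_lift z hz' w
  rw [dancingMetric_dPi z a b hz', ← homForm_act A z a b,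
    ← dancingMetric_dPi _ _ _ (by rwa [act_dotProduct])]
  show (dancingMetric (A • ofHomogeneous z) : E4 →L[ℝ] E4 →L[ℝ] ℝ)
    (mfderiv I4 I4 (fun m : M4 => A • m) (ofHomogeneous z) (dPi z a) : E4)
    (mfderiv I4 I4 (fun m : M4 => A • m) (ofHomogeneous z) (dPi z b) : E4) = _
  rw [mfderiv_smul_dPi A z a hz', mfderiv_smul_dPi A z b hz', smul_ofHomogeneous A z hz']

/-- `paraK` on the model space. -/
noncomputable def paraKL : E4 →L[ℝ] E4 :=
  ContinuousLinearMap.prodMap (ContinuousLinearMap.id ℝ (Fin 2 → ℝ))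
    (-ContinuousLinearMap.id ℝ (Fin 2 → ℝ))

theorem paraKL_apply (v : E4) : paraKL v = (v.1, -v.2) := rfl

theorem paraKL_dPi (z a : HomCoord) (hz : z.2 ⬝ᵥ z.1 ≠ 0) :
    paraKL (dPi z a) = dPi z (a.1, -a.2) := by
  rw [dPi_apply z _ hz, dPi_apply z _ hz, paraKL_apply]
  simp only [map_neg]

theorem mfderiv_smul_paraK (A : Matrix.SpecialLinearGroup (Fin 3) ℝ) (m : M4)
    (v : TangentSpace I4 m) : mfderiv I4 I4 (fun x : M4 => A • x) m (paraK m v) =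
      paraK (A • m) (mfderiv I4 I4 (fun x : M4 => A • x) m v) := by
  obtain ⟨z, hz, rfl⟩ := exists_normalized m
  have hz' : z.2 ⬝ᵥ z.1 ≠ 0 := by rw [hz]; exact one_ne_zero
  obtain ⟨a, -, -, rfl⟩ := exists_horizontal_lift z hz' v
  have e : paraK (ofHomogeneous z) (dPi z a) = dPi z (a.1, -a.2) := paraKL_dPi z a hz'
  rw [e]
  show (mfderiv I4 I4 (fun m : M4 => A • m) (ofHomogeneous z) (dPi z (a.1, -a.2)) : E4) =
    paraKL (mfderiv I4 I4 (fun m : M4 => A • m) (ofHomogeneous z) (dPi z a) : E4)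
  rw [mfderiv_smul_dPi A z _ hz', mfderiv_smul_dPi A z _ hz', paraKL_dPi _ _ (by rwa [act_dotProduct])]
  simp only [act_apply, Matrix.neg_vecMul]
  rfl

theorem tangentBundle_mk_eq {m m' : M4} (h : m = m') {v w : E4} (hv : v = w) :
    (⟨m, v⟩ : TangentBundle I4 M4) = ⟨m', w⟩ := by
  subst h; subst hv; rfl

/-- The diffeomorphism of `M⁴` induced by an element of `SL₃(ℝ)`. -/
noncomputable def smulDiffeomorph (A : Matrix.SpecialLinearGroup (Fin 3) ℝ) :
    Diffeomorph I4 I4 M4 M4 ∞ where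
  toEquiv := MulAction.toPerm A
  contMDiff_toFun := contMDiff_smul A
  contMDiff_invFun := contMDiff_smul A⁻¹

/-- For pq = 1 the matrix 2qp − 1 is 1 on q and −1 on ker p. It has determinant 1 in dimension
three, so it lies in SL₃. It fixes the lift (q, p), and horizontal vectors, having p dq = 0 and dp q
= 0, change sign. -/
theorem isSymmetricSpace_dancingMetric : IsSymmetricSpace dancingMetric := by
  intro m
  obtain ⟨z, hz, rfl⟩ := exists_normalized m
  have hz' : z.2 ⬝ᵥ z.1 ≠ 0 := by rw [hz]; exact one_ne_zero
  let S₀ : Matrix (Fin 3) (Fin 3) ℝ := (2 : ℝ) • Matrix.vecMulVec z.1 z.2 - 1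
  have hdet : S₀.det = 1 := by
    have : S₀.det = 2 * (z.2 ⬝ᵥ z.1) - 1 := by
      simp [S₀, Matrix.det_fin_three, Matrix.vecMulVec_apply, dotProduct, Fin.sum_univ_three]
      ring
    rw [this, hz]; norm_num
  let S : Matrix.SpecialLinearGroup (Fin 3) ℝ := ⟨S₀, hdet⟩
  have hS1 (v : Fin 3 → ℝ) : S₀ *ᵥ v = (2 * (z.2 ⬝ᵥ v)) • z.1 - v := by
    simp only [S₀, Matrix.sub_mulVec, Matrix.smul_mulVec, Matrix.vecMulVec_mulVec, Matrix.one_mulVec]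
    simp [smul_smul]
  have hS2 (v : Fin 3 → ℝ) : v ᵥ* S₀ = (2 * (v ⬝ᵥ z.1)) • z.2 - v := by
    simp only [S₀, Matrix.vecMul_sub, Matrix.vecMul_smul, Matrix.vecMul_vecMulVec, Matrix.vecMul_one]
    simp [smul_smul]
  have hSS : S₀ * S₀ = 1 := by
    apply Matrix.mulVec_injective
    funext v
    rw [← Matrix.mulVec_mulVec, hS1, hS1, Matrix.one_mulVec, dotProduct_sub, dotProduct_smul, hz]
    simp only [smul_eq_mul]
    module
  have hinv : S⁻¹ = S := by
    rw [inv_eq_iff_mul_eq_one]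
    exact Subtype.ext hSS
  have hact (a : HomCoord) : act S a = (S₀ *ᵥ a.1, a.2 ᵥ* S₀) := by
    rw [act_apply, hinv]
  have hSz : act S z = z := by
    rw [hact, hS1, hS2, hz]
    ext <;> simp <;> ring
  refine ⟨smulDiffeomorph S, preservesMetric_smul S, fun v => ?_⟩
  obtain ⟨a, ha1, ha2, rfl⟩ := exists_horizontal_lift z hz' v
  have hSa : act S a = -a := by
    rw [hact, hS1, hS2, ha1, ha2]
    ext <;> simp
  refine tangentBundle_mk_eq ?_ ?_
  · show S • ofHomogeneous z = _
    rw [smul_ofHomogeneous S z hz', hSz]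
  · refine (mfderiv_smul_dPi S z a hz').trans ?_
    rw [hSz, hSa]
    exact ContinuousLinearMap.map_neg (mfderiv 𝓘(ℝ, HomCoord) I4 ofHomogeneous z) a

end M4

/-! ### M⁴ as the homogeneous space SL₃/H -/

namespace M4

/-- The third standard basis vector. -/
noncomputable abbrev e₃ : Fin 3 → ℝ := ![0, 0, 1]

theorem base_eq : base = ofHomogeneous (e₃, e₃) := by
  rw [ofHomogeneous_eq (e₃, e₃) (by simp)]
  rfl

theorem exists_smooth_action : ∃ F : (Fin 3 → Fin 3 → ℝ) × M4 → M4,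
    ContMDiffOn (𝓘(ℝ, Fin 3 → Fin 3 → ℝ).prod I4) I4 ∞ F {x | (Matrix.of x.1).det ≠ 0} ∧
    ∀ (A : Matrix.SpecialLinearGroup (Fin 3) ℝ) (m : M4),
      F (fun i j => A.1 i j, m) = A • m := by
  -- The adjugate replaces the inverse, which makes the lifted map polynomial in A. The extra factor
  -- det A is invisible projectively, and it only multiplies pq by det A.
  let G : (Fin 3 → Fin 3 → ℝ) × HomCoord → HomCoord := fun x =>
    (Matrix.of x.1 *ᵥ x.2.1, x.2.2 ᵥ* (Matrix.of x.1).adjugate)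
  have hG : ContDiff ℝ ∞ G := by
    refine ContDiff.prodMk ?_ ?_
    · rw [contDiff_pi]
      intro i
      simp only [Matrix.mulVec, dotProduct, Matrix.of_apply]
      fun_prop
    · rw [contDiff_pi]
      intro j
      simp only [Matrix.vecMul, dotProduct, Matrix.adjugate_fin_three, Fin.sum_univ_three]
      fin_cases j <;> simp <;> fun_prop
  have hreg (A : Fin 3 → Fin 3 → ℝ) (z : HomCoord) :
      (G (A, z)).2 ⬝ᵥ (G (A, z)).1 = (Matrix.of A).det * (z.2 ⬝ᵥ z.1) := by
    simp only [G]
    rw [← Matrix.dotProduct_mulVec, Matrix.mulVec_mulVec, Matrix.adjugate_mul, Matrix.smul_mulVec,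
      Matrix.one_mulVec, dotProduct_smul, smul_eq_mul]
  have hsmul (A : Fin 3 → Fin 3 → ℝ) (hA : (Matrix.of A).det ≠ 0) (z w : HomCoord)
      (hz : z.2 ⬝ᵥ z.1 ≠ 0) (hw : w.2 ⬝ᵥ w.1 ≠ 0) (h : ofHomogeneous z = ofHomogeneous w) :
      ofHomogeneous (G (A, z)) = ofHomogeneous (G (A, w)) := by
    obtain ⟨⟨s, hs⟩, t, ht⟩ := (ofHomogeneous_eq_iff hz hw).1 h
    rw [ofHomogeneous_eq_iff (by rw [hreg]; exact mul_ne_zero hA hz)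
      (by rw [hreg]; exact mul_ne_zero hA hw)]
    refine ⟨⟨s, ?_⟩, t, ?_⟩
    · simp only [G, ← hs, Matrix.mulVec_smul]
    · simp only [G, ← ht, Matrix.smul_vecMul]
  let F : (Fin 3 → Fin 3 → ℝ) × M4 → M4 := fun x =>
    ofHomogeneous (G (x.1, (x.2.point.rep, x.2.line.rep)))
  refine ⟨F, ?_, ?_⟩
  · rintro ⟨A, m⟩ hA
    refine ContMDiffAt.contMDiffWithinAt ?_
    obtain ⟨z, hz, rfl⟩ := exists_normalized m
    have hz' : z.2 ⬝ᵥ z.1 ≠ 0 := by rw [hz]; exact one_ne_zero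
    have hs := mem_extChartAt_source (I := I4) (ofHomogeneous z)
    have h1 : ContMDiffAt (𝓘(ℝ, Fin 3 → Fin 3 → ℝ).prod I4) 𝓘(ℝ, HomCoord) ∞
        (fun x : (Fin 3 → Fin 3 → ℝ) × M4 => localLift z x.2) (A, ofHomogeneous z) :=
      (contMDiffAt_localLift z (ofHomogeneous z) hs).comp (A, ofHomogeneous z) contMDiffAt_snd
    have h2 : ContMDiffAt (𝓘(ℝ, Fin 3 → Fin 3 → ℝ).prod I4) 𝓘(ℝ, (Fin 3 → Fin 3 → ℝ) × HomCoord) ∞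
        (fun x : (Fin 3 → Fin 3 → ℝ) × M4 => (x.1, localLift z x.2)) (A, ofHomogeneous z) :=
      contMDiffAt_fst.prodMk_space h1
    have h3 := hG.contDiffAt.contMDiffAt.comp (A, ofHomogeneous z) h2
    have h4 : ContMDiffAt 𝓘(ℝ, HomCoord) I4 ∞ ofHomogeneous (G (A, localLift z (ofHomogeneous z))) :=
      contMDiffAt_ofHomogeneous _ (by
        rw [hreg, localLift_self z hz']; exact mul_ne_zero hA hz')
    refine (h4.comp (A, ofHomogeneous z) h3).congr_of_eventuallyEq ?_
    have o : IsOpen {x : (Fin 3 → Fin 3 → ℝ) × M4 | (Matrix.of x.1).det ≠ 0} :=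
      isOpen_ne_fun (Continuous.matrix_det continuous_fst) continuous_const
    have o2 := continuousAt_snd.preimage_mem_nhds (x := (A, ofHomogeneous z))
      (extChartAt_source_mem_nhds (I := I4) (ofHomogeneous z))
    filter_upwards [o.mem_nhds hA, o2] with x hx1 hx2
    refine hsmul _ hx1 _ _ x.2.2 (localLift_regular z hz' _ hx2) ?_
    rw [ofHomogeneous_rep, ofHomogeneous_localLift z hz' _ hx2]
  · intro A m
    conv_rhs => rw [← ofHomogeneous_rep m, smul_ofHomogeneous A (m.point.rep, m.line.rep) m.2]
    show ofHomogeneous (A.1 *ᵥ _, _ ᵥ* A.1.adjugate) = _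
    rw [act_apply, Matrix.SpecialLinearGroup.coe_inv]

/-- The condition on lines is put as pA ∥ e³ so that A⁻¹ need not be computed for the local
sections. -/
theorem smul_base_eq (A : Matrix.SpecialLinearGroup (Fin 3) ℝ) (z : HomCoord)
    (hz : z.2 ⬝ᵥ z.1 ≠ 0) {s t : ℝ} (h1 : A.1 *ᵥ e₃ = s • z.1) (h2 : z.2 ᵥ* A.1 = t • e₃)
    (ht : t ≠ 0) : A • base = ofHomogeneous z := by
  have hb : (((e₃, e₃) : HomCoord).2 ⬝ᵥ ((e₃, e₃) : HomCoord).1) ≠ 0 := by simp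
  rw [base_eq, smul_ofHomogeneous A _ hb, ofHomogeneous_eq_iff (by rwa [act_dotProduct]) hz]
  refine ⟨⟨s, h1.symm⟩, t⁻¹, ?_⟩
  have h3 : z.2 = t • (e₃ ᵥ* (A⁻¹ : Matrix.SpecialLinearGroup (Fin 3) ℝ).1) := by
    rw [← Matrix.smul_vecMul, ← h2, Matrix.vecMul_vecMul, mul_inv_val, Matrix.vecMul_one]
  rw [h3, smul_smul, inv_mul_cancel₀ ht, one_smul]
  rfl

theorem mem_range_blockHom_iff (A : Matrix.SpecialLinearGroup (Fin 3) ℝ) :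
    A ∈ blockHom.range ↔ A.1 0 2 = 0 ∧ A.1 1 2 = 0 ∧ A.1 2 0 = 0 ∧ A.1 2 1 = 0 := by
  constructor
  · rintro ⟨B, rfl⟩
    have : (blockHom B).1 = blockMatrix B.1 := rfl
    rw [this]
    simp [blockMatrix]
  · rintro ⟨h02, h12, h20, h21⟩
    have hdet := A.2
    rw [Matrix.det_fin_three, h02, h12, h20, h21] at hdet
    let B₀ : Matrix (Fin 2) (Fin 2) ℝ := !![A.1 0 0, A.1 0 1; A.1 1 0, A.1 1 1]
    have hB : B₀.det * A.1 2 2 = 1 := by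
      rw [Matrix.det_fin_two_of]
      linear_combination hdet
    have hB0 : B₀.det ≠ 0 := left_ne_zero_of_mul_eq_one hB
    refine ⟨Matrix.GeneralLinearGroup.mkOfDetNeZero B₀ hB0, ?_⟩
    apply Subtype.ext
    show blockMatrix B₀ = A.1
    have hinv : B₀.det⁻¹ = A.1 2 2 := by field_simp; linear_combination -hB
    ext i j
    fin_cases i <;> fin_cases j <;> simp [blockMatrix, hinv, h02, h12, h20, h21] <;> simp [B₀]

theorem mulVec_e₃ (A : Matrix (Fin 3) (Fin 3) ℝ) : A *ᵥ e₃ = fun i => A i 2 := by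
  funext i
  simp [Matrix.mulVec, dotProduct, Fin.sum_univ_three]

theorem e₃_vecMul (A : Matrix (Fin 3) (Fin 3) ℝ) : e₃ ᵥ* A = fun i => A 2 i := by
  funext i
  simp [Matrix.vecMul, dotProduct, Fin.sum_univ_three]

/-- Fixing [e₃] makes the last column a multiple of e₃, and fixing [e³] makes the last row a
multiple of e³. -/
theorem stabilizer_base :
    MulAction.stabilizer (Matrix.SpecialLinearGroup (Fin 3) ℝ) base = blockHom.range := by
  have hb : (((e₃, e₃) : HomCoord).2 ⬝ᵥ ((e₃, e₃) : HomCoord).1) ≠ 0 := by simp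
  ext A
  rw [MulAction.mem_stabilizer_iff, mem_range_blockHom_iff]
  constructor
  · intro h
    rw [base_eq, smul_ofHomogeneous A _ hb, ofHomogeneous_eq_iff (by rwa [act_dotProduct]) hb] at h
    obtain ⟨⟨s, hs⟩, t, ht⟩ := h
    simp only [act_apply] at hs ht
    rw [mulVec_e₃] at hs
    have ht' : t • (e₃ ᵥ* A.1) = e₃ := by
      rw [← Matrix.smul_vecMul, ht, Matrix.vecMul_vecMul, inv_mul_val, Matrix.vecMul_one]
    rw [e₃_vecMul] at ht'
    have t0 := congrFun ht' 0
    have t1 := congrFun ht' 1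
    have t2 := congrFun ht' 2
    have s0 := congrFun hs 0
    have s1 := congrFun hs 1
    simp at t0 t1 t2 s0 s1
    have ht0 : t ≠ 0 := left_ne_zero_of_mul_eq_one t2
    exact ⟨s0.symm, s1.symm, t0.resolve_left ht0, t1.resolve_left ht0⟩
  · rintro ⟨h02, h12, h20, h21⟩
    have hdet := A.2
    rw [Matrix.det_fin_three, h02, h12, h20, h21] at hdet
    have h22 : A.1 2 2 ≠ 0 := fun h => by rw [h] at hdet; simp at hdet
    conv_rhs => rw [base_eq]
    refine smul_base_eq A _ hb (s := A.1 2 2) (t := A.1 2 2) ?_ ?_ h22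
    · rw [mulVec_e₃]
      funext i
      fin_cases i <;> simp [h02, h12]
    · rw [e₃_vecMul]
      funext i
      fin_cases i <;> simp [h20, h21]

theorem continuous_blockHom : Continuous blockHom := by
  refine Continuous.subtype_mk ?_ _
  have h : Continuous fun A : GL (Fin 2) ℝ => (A.1 : Matrix (Fin 2) (Fin 2) ℝ) :=
    Units.continuous_val
  have hd : Continuous fun A : GL (Fin 2) ℝ => (A.1.det)⁻¹ :=
    (Continuous.matrix_det h).inv₀ fun A => A.det.ne_zero
  refine continuous_matrix fun i j => ?_
  have he (i j : Fin 2) : Continuous fun A : GL (Fin 2) ℝ => A.1 i j := h.matrix_elem i j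
  fin_cases i <;> fin_cases j <;> simp [blockMatrix] <;>
    first | exact he _ _ | exact continuous_const | exact hd

/-- The topology of GL₂ is induced by A ↦ (A, A⁻¹), and this map is recovered continuously from the
upper left blocks of the image and of its inverse. -/
theorem isEmbedding_blockHom : Topology.IsEmbedding blockHom := by
  let r : Matrix.SpecialLinearGroup (Fin 3) ℝ → Matrix (Fin 2) (Fin 2) ℝ :=
    fun A => !![A.1 0 0, A.1 0 1; A.1 1 0, A.1 1 1]
  have hr : Continuous r := by
    have h : Continuous fun A : Matrix.SpecialLinearGroup (Fin 3) ℝ => A.1 := continuous_subtype_val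
    refine continuous_matrix fun i j => ?_
    fin_cases i <;> fin_cases j <;> simp [r] <;> exact h.matrix_elem _ _
  have hrb (A : GL (Fin 2) ℝ) : r (blockHom A) = A.1 := by
    show !![blockMatrix A.1 0 0, blockMatrix A.1 0 1; blockMatrix A.1 1 0, blockMatrix A.1 1 1] = A.1
    ext i j
    fin_cases i <;> fin_cases j <;> simp [blockMatrix]
  let G : Matrix.SpecialLinearGroup (Fin 3) ℝ →
      Matrix (Fin 2) (Fin 2) ℝ × (Matrix (Fin 2) (Fin 2) ℝ)ᵐᵒᵖ :=
    fun A => (r A, MulOpposite.op (r A⁻¹))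
  have hG : Continuous G := hr.prodMk (MulOpposite.continuous_op.comp (hr.comp continuous_inv))
  refine Topology.IsEmbedding.of_comp continuous_blockHom hG ?_
  have : G ∘ blockHom = Units.embedProduct (Matrix (Fin 2) (Fin 2) ℝ) := by
    funext A
    simp only [G, Function.comp_apply, hrb, ← map_inv]
    rfl
  rw [this]
  exact Units.isEmbedding_embedProduct

/-- The matrix, in the chart `(k, l)`, whose last column is a multiple of `q` and whose other columns
span the kernel of `p`. -/
noncomputable def frameMatrix (k l : Fin 3) (x : E4) (s : ℝ) : Matrix (Fin 3) (Fin 3) ℝ :=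
  (Matrix.of ![ins₀ l (Pi.single 0 1) - x.2 0 • Pi.single l 1,
    ins₀ l (Pi.single 1 1) - x.2 1 • Pi.single l 1, s • ins k x.1])ᵀ

theorem vecMul_frameMatrix (k l : Fin 3) (x : E4) (s : ℝ) :
    ins l x.2 ᵥ* frameMatrix k l x s = (s * funF k l x) • e₃ := by
  funext i
  have e (a : Fin 2) : ins l x.2 ⬝ᵥ ins₀ l (Pi.single a 1) = x.2 a := by
    simp only [dotProduct]
    rw [Fin.sum_univ_succAbove _ l]
    simp [Pi.single_apply]
  have e' : ins l x.2 ⬝ᵥ Pi.single l 1 = 1 := by simp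
  fin_cases i
  · show ins l x.2 ⬝ᵥ (ins₀ l (Pi.single 0 1) - x.2 0 • Pi.single l 1) = _
    rw [dotProduct_sub, dotProduct_smul, e, e']
    simp
  · show ins l x.2 ⬝ᵥ (ins₀ l (Pi.single 1 1) - x.2 1 • Pi.single l 1) = _
    rw [dotProduct_sub, dotProduct_smul, e, e']
    simp
  · show ins l x.2 ⬝ᵥ (s • ins k x.1) = _
    rw [dotProduct_smul]
    simp [funF]

theorem det_frameMatrix_smul (k l : Fin 3) (x : E4) (s : ℝ) :
    (frameMatrix k l x s).det = s * (frameMatrix k l x 1).det := by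
  simp only [frameMatrix, Matrix.det_transpose, Matrix.det_fin_three, Matrix.of_apply]
  simp
  ring

/-- Pair the image of a kernel vector with p: since pq ≠ 0 the coefficient of q vanishes. The rows
other than the l-th then show that the other two coefficients vanish. -/
theorem det_frameMatrix_ne_zero (k l : Fin 3) (x : E4) (hx : funF k l x ≠ 0) :
    (frameMatrix k l x 1).det ≠ 0 := by
  intro h
  obtain ⟨w, hw, h0⟩ := Matrix.exists_mulVec_eq_zero_iff.2 h
  have h1 : (ins l x.2 ᵥ* frameMatrix k l x 1) ⬝ᵥ w = 0 := by
    rw [← Matrix.dotProduct_mulVec, h0, dotProduct_zero]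
  rw [vecMul_frameMatrix] at h1
  have w2 : w 2 = 0 := by
    simpa [hx, dotProduct, Fin.sum_univ_three] using h1
  have h2 (a : Fin 2) : (frameMatrix k l x 1 *ᵥ w) (l.succAbove a) = 0 := by rw [h0]; rfl
  have h3 (a : Fin 2) : w 0 * (Pi.single 0 1 : Fin 2 → ℝ) a + w 1 * (Pi.single 1 1 : Fin 2 → ℝ) a = 0 := by
    have := h2 a
    simp only [Matrix.mulVec, dotProduct, Fin.sum_univ_three, w2, frameMatrix, Matrix.transpose_apply,
      Matrix.of_apply] at this
    simp [Fin.succAbove_ne] at this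
    linear_combination this
  have w0 := h3 0
  have w1 := h3 1
  simp at w0 w1
  apply hw
  funext i
  fin_cases i
  · exact w0
  · exact w1
  · exact w2

theorem contDiff_frameMatrix (k l : Fin 3) :
    ContDiff ℝ ∞ (fun y : E4 × ℝ => fun i j : Fin 3 => frameMatrix k l y.1 y.2 i j) := by
  rw [contDiff_pi]; intro i
  rw [contDiff_pi]; intro j
  have hi (i : Fin 3) : ContDiff ℝ ∞ (fun y : E4 × ℝ => ins k y.1.1 i) :=
    (contDiff_apply ℝ ℝ i).comp ((contDiff_ins k).comp (contDiff_fst.comp contDiff_fst))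
  have hy (a : Fin 2) : ContDiff ℝ ∞ (fun y : E4 × ℝ => y.1.2 a) :=
    (contDiff_apply ℝ ℝ a).comp (contDiff_snd.comp contDiff_fst)
  have h0 : ContDiff ℝ ∞ (fun y : E4 × ℝ =>
      (ins₀ l (Pi.single 0 1) - y.1.2 0 • Pi.single l 1 : Fin 3 → ℝ) i) :=
    contDiff_const.sub ((hy 0).mul contDiff_const)
  have h1 : ContDiff ℝ ∞ (fun y : E4 × ℝ =>
      (ins₀ l (Pi.single 1 1) - y.1.2 1 • Pi.single l 1 : Fin 3 → ℝ) i) :=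
    contDiff_const.sub ((hy 1).mul contDiff_const)
  have h2 : ContDiff ℝ ∞ (fun y : E4 × ℝ => (y.2 • ins k y.1.1 : Fin 3 → ℝ) i) :=
    contDiff_snd.mul (hi i)
  fin_cases j
  · exact h0
  · exact h1
  · exact h2

theorem exists_local_section (m : M4) : ∃ U : Set M4, IsOpen U ∧ m ∈ U ∧
    ∃ σ : M4 → Fin 3 → Fin 3 → ℝ, ContMDiffOn I4 𝓘(ℝ, Fin 3 → Fin 3 → ℝ) ∞ σ U ∧
      ∀ x ∈ U, ∃ A : Matrix.SpecialLinearGroup (Fin 3) ℝ,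
        (∀ i j, A.1 i j = σ x i j) ∧ A • base = x := by
  set k := RP2.chartIndex m.point with hk
  set l := RP2.chartIndex m.line with hl
  -- Scaling the column proportional to q normalises the determinant without moving the point [q].
  let s : E4 → ℝ := fun y => ((frameMatrix k l y 1).det)⁻¹
  have hdet : ContDiff ℝ ∞ (fun y : E4 => (frameMatrix k l y 1).det) := by
    have h (i j : Fin 3) : ContDiff ℝ ∞ (fun y : E4 => frameMatrix k l y 1 i j) := by
      have := (contDiff_frameMatrix k l).comp (contDiff_id.prodMk (contDiff_const (c := (1 : ℝ))))
      exact (contDiff_apply ℝ ℝ j).comp ((contDiff_apply ℝ (Fin 3 → ℝ) i).comp this)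
    simp only [Matrix.det_fin_three]
    fun_prop
  refine ⟨(extChartAt I4 m).source, isOpen_extChartAt_source m, mem_extChartAt_source m,
    fun x => fun i j => frameMatrix k l (extChartAt I4 m x) (s (extChartAt I4 m x)) i j, ?_, ?_⟩
  · intro x hx
    refine ContMDiffAt.contMDiffWithinAt ?_
    have ht := (mem_target_iff m _).1 ((extChartAt I4 m).map_source hx)
    have h1 : ContMDiffAt I4 𝓘(ℝ, E4) ∞ (extChartAt I4 m) x :=
      contMDiffAt_extChartAt' (by rwa [_root_.extChartAt_source] at hx)
    have h2 : ContDiffAt ℝ ∞ s (extChartAt I4 m x) :=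
      hdet.contDiffAt.inv (det_frameMatrix_ne_zero k l _ ht)
    have h3 := (contDiff_frameMatrix k l).contDiffAt.comp (extChartAt I4 m x)
      (contDiffAt_id.prodMk h2)
    exact h3.contMDiffAt.comp x h1
  · intro x hx
    have ht := (mem_target_iff m _).1 ((extChartAt I4 m).map_source hx)
    have hd := det_frameMatrix_ne_zero k l _ ht
    refine ⟨⟨frameMatrix k l (extChartAt I4 m x) (s (extChartAt I4 m x)), ?_⟩, fun _ _ => rfl, ?_⟩
    · rw [det_frameMatrix_smul, inv_mul_cancel₀ hd]
    · conv_rhs => rw [← ofHomogeneous_lift_extChartAt m x hx]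
      refine smul_base_eq _ _ ht (s := s (extChartAt I4 m x)) ?_ (vecMul_frameMatrix k l _ _)
        (mul_ne_zero (inv_ne_zero hd) ht)
      rw [mulVec_e₃]
      rfl

/-- The orbit map is injective modulo the stabilizer, and surjective since sections exist near every
point. Continuity of those sections makes the inverse continuous. -/
theorem exists_homeomorph : ∃ Φ : (Matrix.SpecialLinearGroup (Fin 3) ℝ ⧸ blockHom.range) ≃ₜ M4,
    ∀ A : Matrix.SpecialLinearGroup (Fin 3) ℝ, Φ (QuotientGroup.mk A) = A • base := by
  let f : Matrix.SpecialLinearGroup (Fin 3) ℝ ⧸ blockHom.range → M4 :=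
    Quotient.lift (fun A => A • base) (by
      intro A B hAB
      have h : A⁻¹ * B ∈ blockHom.range := QuotientGroup.leftRel_apply.1 hAB
      rw [← stabilizer_base, MulAction.mem_stabilizer_iff, mul_smul, inv_smul_eq_iff] at h
      exact h.symm)
  have hf (A : Matrix.SpecialLinearGroup (Fin 3) ℝ) : f (QuotientGroup.mk A) = A • base := rfl
  have hcont : Continuous f := by
    refine Continuous.quotient_lift ?_ _
    obtain ⟨F, hF, hFA⟩ := exists_smooth_action
    have h1 : ContinuousOn F _ := hF.continuousOn
    have h2 : Continuous fun A : Matrix.SpecialLinearGroup (Fin 3) ℝ =>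
        ((fun i j => A.1 i j, base) : (Fin 3 → Fin 3 → ℝ) × M4) :=
      Continuous.prodMk (continuous_pi fun i => continuous_pi fun j =>
        continuous_subtype_val.matrix_elem i j) continuous_const
    have h3 := h1.comp_continuous h2 (fun A => by
      show (Matrix.of fun i j => A.1 i j).det ≠ 0
      have : (Matrix.of fun i j => A.1 i j) = A.1 := rfl
      rw [this, A.2]; exact one_ne_zero)
    exact h3.congr fun A => hFA A base
  have hinj : Function.Injective f := by
    intro a b
    induction a using QuotientGroup.induction_on with | H A
    induction b using QuotientGroup.induction_on with | H B
    rw [hf, hf]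
    intro h
    rw [QuotientGroup.eq, ← stabilizer_base, MulAction.mem_stabilizer_iff, mul_smul, inv_smul_eq_iff]
    exact h.symm
  have hsurj : Function.Surjective f := by
    intro m
    obtain ⟨U, -, hm, σ, -, hσ⟩ := exists_local_section m
    obtain ⟨A, -, hA⟩ := hσ m hm
    exact ⟨QuotientGroup.mk A, hA⟩
  let e := Equiv.ofBijective f ⟨hinj, hsurj⟩
  refine ⟨⟨e, hcont, ?_⟩, hf⟩
  rw [continuous_iff_continuousAt]
  intro m
  obtain ⟨U, hU, hm, σ, hσ, hA⟩ := exists_local_section m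
  choose! S hS using hA
  have hSc : ContinuousOn S U := by
    rw [continuousOn_iff_continuous_domRestrict]
    refine continuous_induced_rng.2 ?_
    have : (Subtype.val ∘ U.domRestrict S) = fun x : U => Matrix.of (σ x) := by
      funext x
      ext i j
      exact (hS x x.2).1 i j
    have h2 : Continuous fun x : U => Matrix.of (σ x) :=
      continuousOn_iff_continuous_domRestrict.1 hσ.continuousOn
    exact this ▸ h2
  have hc : ContinuousAt (fun x => (QuotientGroup.mk (S x) :
      Matrix.SpecialLinearGroup (Fin 3) ℝ ⧸ blockHom.range)) m :=
    QuotientGroup.continuous_mk.continuousAt.comp (hSc.continuousAt (hU.mem_nhds hm))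
  refine hc.congr ?_
  filter_upwards [hU.mem_nhds hm] with x hx
  apply e.injective
  exact (hS x hx).2.trans (e.apply_symm_apply x).symm

theorem exists_involution : ∃ τ : Matrix.SpecialLinearGroup (Fin 3) ℝ ≃*
      Matrix.SpecialLinearGroup (Fin 3) ℝ,
    Continuous τ ∧ τ ≠ MulEquiv.refl _ ∧ (∀ A, τ (τ A) = A) ∧
      ∀ A, τ A = A ↔ A ∈ blockHom.range := by
  -- The involution is conjugation by the symmetry at the base point; commuting with diag(−1, −1, 1)
  -- means being block diagonal.
  let D : Matrix.SpecialLinearGroup (Fin 3) ℝ := ⟨Matrix.diagonal ![-1, -1, 1], by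
    rw [Matrix.det_diagonal, Fin.prod_univ_three]; simp⟩
  have hD : D * D = 1 := by
    apply Subtype.ext
    show Matrix.diagonal ![-1, -1, 1] * Matrix.diagonal ![-1, -1, 1] = (1 : Matrix (Fin 3) (Fin 3) ℝ)
    rw [Matrix.diagonal_mul_diagonal, ← Matrix.diagonal_one]
    congr 1
    funext i
    fin_cases i <;> simp
  have hD' : D⁻¹ = D := inv_eq_iff_mul_eq_one.2 hD
  have hfix (A : Matrix.SpecialLinearGroup (Fin 3) ℝ) :
      MulAut.conj D A = A ↔ A ∈ blockHom.range := by
    have e0 : D * A = A * D ↔ (D * A).1 = (A * D).1 := Subtype.ext_iff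
    rw [MulAut.conj_apply, mul_inv_eq_iff_eq_mul, mem_range_blockHom_iff, e0]
    have e1 : (D * A).1 = Matrix.diagonal ![-1, -1, 1] * A.1 := rfl
    have e2 : (A * D).1 = A.1 * Matrix.diagonal ![-1, -1, 1] := rfl
    rw [e1, e2]
    constructor
    · intro h
      have h' (i j : Fin 3) := congrFun (congrFun h i) j
      simp only [Matrix.diagonal_mul, Matrix.mul_diagonal] at h'
      have a := h' 0 2
      have b := h' 1 2
      have c := h' 2 0
      have d := h' 2 1
      simp at a b c d
      refine ⟨?_, ?_, ?_, ?_⟩ <;> linarith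
    · rintro ⟨h02, h12, h20, h21⟩
      ext i j
      rw [Matrix.diagonal_mul, Matrix.mul_diagonal]
      fin_cases i <;> fin_cases j <;> simp [h02, h12, h20, h21]
  refine ⟨MulAut.conj D, ?_, ?_, ?_, hfix⟩
  · show Continuous fun A => D * A * D⁻¹
    fun_prop
  · intro h
    -- A shear which is not block diagonal, so the involution moves it.
    let N : Matrix.SpecialLinearGroup (Fin 3) ℝ := ⟨!![1, 0, 1; 0, 1, 0; 0, 0, 1], by
      simp [Matrix.det_fin_three]⟩
    have hN := (hfix N).1 (by rw [h]; rfl)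
    rw [mem_range_blockHom_iff] at hN
    simp [N] at hN
  · intro A
    simp only [MulAut.conj_apply, hD']
    rw [show D * (D * A * D) * D = (D * D) * A * (D * D) by group, hD, one_mul, mul_one]

end M4

/-! ### The para-Kähler structure -/

namespace M4

theorem mfderiv_extChartAt_dPi (c : M4) (z a : HomCoord) (hz : z.2 ⬝ᵥ z.1 ≠ 0)
    (hs : ofHomogeneous z ∈ (extChartAt I4 c).source) :
    (mfderiv I4 𝓘(ℝ, E4) (extChartAt I4 c) (ofHomogeneous z) (dPi z a) : E4) =
      (affineDeriv (RP2.chartIndex c.point) z.1 a.1, affineDeriv (RP2.chartIndex c.line) z.2 a.2) := by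
  obtain ⟨h1, h2⟩ := (ofHomogeneous_mem_source_iff c z hz).1 hs
  have hd : MDifferentiableAt I4 𝓘(ℝ, E4) (extChartAt I4 c) (ofHomogeneous z) :=
    mdifferentiableAt_extChartAt (by rwa [_root_.extChartAt_source] at hs)
  have h3 := hd.hasMFDerivAt.comp z (hasMFDerivAt_ofHomogeneous z hz)
  have h4 := ((hasFDerivAt_affine (RP2.chartIndex c.point) z.1 h1).prodMap z
    (hasFDerivAt_affine (RP2.chartIndex c.line) z.2 h2)).hasMFDerivAt
  have h5 : (extChartAt I4 c) ∘ ofHomogeneous =ᶠ[𝓝 z] Prod.map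
      (fun q : Fin 3 → ℝ => fun j : Fin 2 =>
        q ((RP2.chartIndex c.point).succAbove j) / q (RP2.chartIndex c.point))
      (fun q : Fin 3 → ℝ => fun j : Fin 2 =>
        q ((RP2.chartIndex c.line).succAbove j) / q (RP2.chartIndex c.line)) := by
    filter_upwards [isOpen_regular.mem_nhds hz] with w hw
    exact extChartAt_ofHomogeneous c w hw
  have h6 := hasMFDerivAt_unique h3 (h4.congr_of_eventuallyEq h5)
  have h7 := congrArg (fun L : HomCoord →L[ℝ] E4 => L a) h6
  rw [dPi, (hasMFDerivAt_ofHomogeneous z hz).mfderiv]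
  exact h7

/-- All charts are products of a chart for the point and one for the line, so K is the same constant
matrix in each of them. -/
theorem mfderiv_extChartAt_paraK (c m : M4) (hm : m ∈ (extChartAt I4 c).source) (v : E4) :
    (mfderiv I4 𝓘(ℝ, E4) (extChartAt I4 c) m (paraKL v) : E4) =
      paraKL (mfderiv I4 𝓘(ℝ, E4) (extChartAt I4 c) m v) := by
  obtain ⟨z, hz, rfl⟩ := exists_normalized m
  have hz' : z.2 ⬝ᵥ z.1 ≠ 0 := by rw [hz]; exact one_ne_zero
  obtain ⟨a, -, -, rfl⟩ := exists_horizontal_lift z hz' v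
  rw [paraKL_dPi z a hz']
  refine (mfderiv_extChartAt_dPi c z _ hz' hm).trans ?_
  refine Eq.trans ?_ (congrArg paraKL (mfderiv_extChartAt_dPi c z a hz' hm)).symm
  simp only [map_neg, paraKL_apply]
  rfl

/-- The vector field `X` in the preferred chart at `c`. -/
noncomputable def chartField (c : M4) (X : ∀ m : M4, TangentSpace I4 m) : E4 → E4 :=
  VectorField.mpullback 𝓘(ℝ, E4) I4 (extChartAt I4 c).symm X

theorem chartField_apply (c : M4) (X : ∀ m : M4, TangentSpace I4 m) (x : E4)
    (hx : x ∈ (extChartAt I4 c).target) : chartField c X x =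
      mfderiv I4 𝓘(ℝ, E4) (extChartAt I4 c) ((extChartAt I4 c).symm x)
        (X ((extChartAt I4 c).symm x)) := by
  have h1 := mfderivWithin_extChartAt_symm_comp_mfderiv_extChartAt hx
  have h2 := isInvertible_mfderivWithin_extChartAt_symm hx
  rw [I4.range_eq_univ, mfderivWithin_univ] at h1 h2
  show (mfderiv 𝓘(ℝ, E4) I4 (extChartAt I4 c).symm x).inverse (X ((extChartAt I4 c).symm x)) = _
  exact h2.inverse_apply_eq.2
    (congrArg (fun L : E4 →L[ℝ] E4 => L (X ((extChartAt I4 c).symm x))) h1).symm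

theorem covDeriv_dancingMetric (X : ∀ m : M4, TangentSpace I4 m) (m : M4) (u : E4) :
    (covDeriv dancingMetric X m u : E4) = fderiv ℝ (chartField m X) (extChartAt I4 m m) u +
      chris (RP2.chartIndex m.point) (RP2.chartIndex m.line) (extChartAt I4 m m) u
        (chartField m X (extChartAt I4 m m)) := by
  rw [← christoffel_dancingMetric m _ (mem_extChartAt_target m)]
  rfl

theorem smoothFieldOn_iff (X : ∀ m : M4, TangentSpace I4 m) (U : Set M4) :
    SmoothFieldOn X U ↔ ∀ m ∈ U, ContMDiffWithinAt I4 𝓘(ℝ, E4) ∞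
      (fun x => (mfderiv I4 𝓘(ℝ, E4) (extChartAt I4 m) x (X x) : E4)) U m := by
  refine forall₂_congr fun m hm => ?_
  rw [Bundle.contMDiffWithinAt_totalSpace]
  have e : (fun x : M4 => (trivializationAt E4 (TangentSpace I4) m ⟨x, X x⟩).2) =ᶠ[𝓝[U] m]
      (fun x => (mfderiv I4 𝓘(ℝ, E4) (extChartAt I4 m) x (X x) : E4)) := by
    filter_upwards [mem_nhdsWithin_of_mem_nhds (chart_source_mem_nhds (ModelProd (Fin 2 → ℝ) (Fin 2 → ℝ)) m)] with x hx
    have h2 := congrArg (fun L : E4 →L[ℝ] E4 => L (X x))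
      (TangentBundle.continuousLinearMapAt_trivializationAt (I := I4) hx)
    refine Eq.trans ?_ h2
    exact (congrFun (Bundle.Trivialization.coe_linearMapAt_of_mem (R := ℝ)
      (trivializationAt E4 (TangentSpace I4) m) (by simpa using hx)) (X x)).symm
  constructor
  · rintro ⟨-, h⟩
    exact h.congr_of_eventuallyEq_of_mem e.symm hm
  · intro h
    exact ⟨contMDiffWithinAt_id, h.congr_of_eventuallyEq_of_mem e hm⟩

theorem paraKL_paraKL (v : E4) : paraKL (paraKL v) = v := by simp [paraKL_apply]

/-- `paraKL` as an isomorphism. -/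
noncomputable def paraKE : E4 ≃L[ℝ] E4 :=
  ContinuousLinearEquiv.equivOfInverse paraKL paraKL paraKL_paraKL paraKL_paraKL

theorem formA₁_paraKL (k l : Fin 3) (x v : E4) : formA₁ k l x (paraKL v) = formA₁ k l x v := by
  simp only [formA₁_apply, paraKL_apply]

theorem formA₂_paraKL (k l : Fin 3) (x v : E4) : formA₂ k l x (paraKL v) = -formA₂ k l x v := by
  have h : paraKL v = proj₁ v - proj₂ v := by ext <;> simp [paraKL_apply, proj₁_apply, proj₂_apply]
  have h' : v = proj₁ v + proj₂ v := by ext <;> simp [proj₁_apply, proj₂_apply]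
  rw [h]
  conv_rhs => rw [h']
  simp only [map_sub, map_add, formA₂_proj₁, zero_sub, zero_add]

theorem chris_paraKL (k l : Fin 3) (x u v : E4) :
    chris k l x u (paraKL v) = paraKL (chris k l x u v) := by
  rw [chris_apply, chris_apply, formA₁_paraKL, formA₂_paraKL]
  ext i <;> simp [paraKL_apply, proj₁_apply, proj₂_apply]
  ring

theorem formG_paraKL (k l : Fin 3) (x v w : E4) :
    formG k l x (paraKL v) (paraKL w) = -formG k l x v w := by
  have h (v : E4) : paraKL v = proj₁ v - proj₂ v := by
    ext <;> simp [paraKL_apply, proj₁_apply, proj₂_apply]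
  have h' (v w : E4) : formB k l (paraKL v) (paraKL w) = -formB k l v w := by
    rw [h, h]
    simp
  rw [formG_apply, formG_apply, h', h', formA₁_paraKL, formA₁_paraKL, formA₂_paraKL, formA₂_paraKL]
  ring

theorem chartField_paraK (c : M4) (X : ∀ m : M4, TangentSpace I4 m) (x : E4)
    (hx : x ∈ (extChartAt I4 c).target) :
    chartField c (fun m => paraK m (X m)) x = paraKL (chartField c X x) := by
  rw [chartField_apply c _ x hx, chartField_apply c X x hx]
  exact mfderiv_extChartAt_paraK c _ ((extChartAt I4 c).map_target hx) _

/-- With K constant in charts, smoothness is immediate and ∇K = 0 says that K commutes with Γ(u, ·),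
as Γ has no cross terms in its second argument. -/
theorem isParaKahler_dancingMetric : IsParaKahler dancingMetric paraK where
  metric := isPseudoRiemannian_dancingMetric
  smooth U X _ hX := by
    rw [smoothFieldOn_iff] at hX ⊢
    intro m hm
    have h := paraKL.contDiff.contMDiff.contMDiffAt.comp_contMDiffWithinAt m (hX m hm)
    refine h.congr_of_eventuallyEq_of_mem ?_ hm
    filter_upwards [mem_nhdsWithin_of_mem_nhds (extChartAt_source_mem_nhds (I := I4) m)] with x hx
    exact mfderiv_extChartAt_paraK m x hx _
  sq m v := paraKL_paraKL v
  eigenspaces m := by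
    -- Exchanging the two factors exchanges the eigenspaces of K.
    let S : E4 ≃ₗ[ℝ] E4 := LinearEquiv.prodComm ℝ (Fin 2 → ℝ) (Fin 2 → ℝ)
    have h : Module.End.eigenspace paraKL.toLinearMap (-1) =
        (Module.End.eigenspace paraKL.toLinearMap 1).map S.toLinearMap := by
      ext v
      rw [Submodule.mem_map_equiv, Module.End.mem_eigenspace_iff, Module.End.mem_eigenspace_iff]
      show ((v.1, -v.2) : E4) = (-1 : ℝ) • v ↔ ((v.2, -v.1) : E4) = (1 : ℝ) • (v.2, v.1)
      rw [Prod.ext_iff, Prod.ext_iff]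
      simp [eq_comm]
    show Module.finrank ℝ (Module.End.eigenspace paraKL.toLinearMap 1) =
      Module.finrank ℝ (Module.End.eigenspace paraKL.toLinearMap (-1))
    rw [h]
    exact (S.finrank_map_eq _).symm
  skew m v w := by
    exact formG_paraKL _ _ _ v w
  parallel U X _ _ m _ u := by
    refine (covDeriv_dancingMetric _ m u).trans
      (Eq.trans ?_ (congrArg paraKL (covDeriv_dancingMetric X m u)).symm)
    rw [map_add]
    have ht := mem_extChartAt_target (I := I4) m
    have he : chartField m (fun x => paraK x (X x)) =ᶠ[𝓝 (extChartAt I4 m m)]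
        paraKE ∘ chartField m X := by
      filter_upwards [(isOpen_extChartAt_target m).mem_nhds ht] with x hx
      exact chartField_paraK m X x hx
    -- Since K is an isomorphism, `fderiv` commutes with it without a differentiability condition.
    rw [he.fderiv_eq, he.eq_of_nhds, ContinuousLinearEquiv.comp_fderiv]
    exact congrArg _ (chris_paraKL _ _ _ _ _)

/-! ### The isotropy representation at the base point -/

theorem chartIndex_mk_of_ne (v : Fin 3 → ℝ) (hv : v ≠ 0) (h : v 2 ≠ 0) :
    RP2.chartIndex (Projectivization.mk ℝ v hv) = 2 := by
  rw [RP2.chartIndex, if_pos ((RP2.rep_mk_ne_zero_iff 2 v hv).2 h)]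

theorem chartIndex_base : RP2.chartIndex base.point = 2 ∧ RP2.chartIndex base.line = 2 :=
  ⟨chartIndex_mk_of_ne _ _ (by simp), chartIndex_mk_of_ne _ _ (by simp)⟩

theorem dPi_of_eq_base (z a : HomCoord) (hz : z.2 ⬝ᵥ z.1 ≠ 0) (h : ofHomogeneous z = base) :
    (dPi z a : E4) = (affineDeriv 2 z.1 a.1, affineDeriv 2 z.2 a.2) := by
  rw [dPi_apply z a hz, h, chartIndex_base.1, chartIndex_base.2]

theorem affineDeriv_smul_e₃ (d : ℝ) (u : Fin 2 → ℝ) :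
    affineDeriv 2 (d • e₃) (ins₀ 2 u) = d⁻¹ • u := by
  funext j
  simp [affineDeriv_apply]

theorem extChartAt_base : extChartAt I4 base base = 0 := by
  have hz : ((e₃, e₃) : HomCoord).2 ⬝ᵥ ((e₃, e₃) : HomCoord).1 ≠ 0 := by simp
  have h := extChartAt_ofHomogeneous base (e₃, e₃) hz
  rw [← base_eq, chartIndex_base.1, chartIndex_base.2] at h
  rw [h]
  ext j <;> fin_cases j <;> exact zero_div _

theorem ins_two_zero : ins 2 0 = e₃ := by
  funext i
  fin_cases i <;> rfl

theorem e₃_dotProduct_ins₀ (u : Fin 2 → ℝ) : e₃ ⬝ᵥ ins₀ 2 u = 0 := by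
  rw [← ins_two_zero]
  simp only [dotProduct]
  rw [Fin.sum_univ_succAbove _ 2]
  simp

theorem ins₀_dotProduct_ins₀ (k : Fin 3) (u v : Fin 2 → ℝ) : ins₀ k u ⬝ᵥ ins₀ k v = u ⬝ᵥ v := by
  simp only [dotProduct]
  rw [Fin.sum_univ_succAbove _ k]
  simp

theorem funF_two_zero : funF 2 2 0 = 1 := by
  show ins 2 0 ⬝ᵥ ins 2 0 = 1
  rw [ins_two_zero]
  simp

theorem formA₁_two_zero (u : E4) : formA₁ 2 2 0 u = 0 := by
  rw [formA₁_apply]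
  show ins 2 0 ⬝ᵥ _ = 0
  rw [ins_two_zero, e₃_dotProduct_ins₀]

theorem formA₂_two_zero (u : E4) : formA₂ 2 2 0 u = 0 := by
  rw [formA₂_apply]
  show _ ⬝ᵥ ins 2 0 = 0
  rw [ins_two_zero, dotProduct_comm, e₃_dotProduct_ins₀]

theorem formG_two_zero (v w : E4) : formG 2 2 0 v w = -(v.2 ⬝ᵥ w.1 + w.2 ⬝ᵥ v.1) := by
  rw [formG_apply, funF_two_zero]
  simp only [formA₁_two_zero, formA₂_two_zero, formB_apply, ins₀_dotProduct_ins₀]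
  ring

theorem dancingMetric_base (v w : E4) :
    (dancingMetric base : E4 →L[ℝ] E4 →L[ℝ] ℝ) v w = -(v.2 ⬝ᵥ w.1 + w.2 ⬝ᵥ v.1) := by
  have h : metricAt dancingMetric base v w = -(v.2 ⬝ᵥ w.1 + w.2 ⬝ᵥ v.1) := by
    rw [metricAt_dancingMetric, chartIndex_base.1, chartIndex_base.2, extChartAt_base,
      formG_two_zero]
  exact h

theorem ins₀_two (u : Fin 2 → ℝ) : ins₀ 2 u = ![u 0, u 1, 0] := by
  funext i
  fin_cases i <;> rfl

theorem blockMatrix_mulVec (B : Matrix (Fin 2) (Fin 2) ℝ) (u : Fin 2 → ℝ) :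
    blockMatrix B *ᵥ ins₀ 2 u = ins₀ 2 (B *ᵥ u) := by
  rw [ins₀_two, ins₀_two]
  funext i
  fin_cases i <;> simp [blockMatrix, Matrix.mulVec, dotProduct, Fin.sum_univ_succ]

theorem vecMul_blockMatrix (B : Matrix (Fin 2) (Fin 2) ℝ) (u : Fin 2 → ℝ) :
    ins₀ 2 u ᵥ* blockMatrix B = ins₀ 2 (u ᵥ* B) := by
  rw [ins₀_two, ins₀_two]
  funext i
  fin_cases i <;> simp [blockMatrix, Matrix.vecMul, dotProduct, Fin.sum_univ_succ]

theorem blockHom_smul_base (B : GL (Fin 2) ℝ) : blockHom B • base = base := by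
  have : blockHom B ∈ MulAction.stabilizer (Matrix.SpecialLinearGroup (Fin 3) ℝ) base := by
    rw [stabilizer_base]
    exact ⟨B, rfl⟩
  exact this

/-- The block matrix sends e₃ to (det B)⁻¹e₃. Renormalising the last coordinate to 1 multiplies the
point part by det B, and the line part by its inverse. -/
theorem mfderiv_blockHom_smul (B : GL (Fin 2) ℝ) (v : E4) :
    (mfderiv I4 I4 (fun x : M4 => blockHom B • x) base v : E4) =
      (B.1.det • (B.1 *ᵥ v.1), B.1.det⁻¹ • (v.2 ᵥ* B.1⁻¹)) := by
  have hz : ((e₃, e₃) : HomCoord).2 ⬝ᵥ ((e₃, e₃) : HomCoord).1 ≠ 0 := by simp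
  have hB : B.1.det ≠ 0 := B.det.ne_zero
  have h1 := mfderiv_smul_dPi (blockHom B) (e₃, e₃) (ins₀ 2 v.1, ins₀ 2 v.2) hz
  have hv : (dPi (e₃, e₃) (ins₀ 2 v.1, ins₀ 2 v.2) : E4) = v := by
    refine (dPi_of_eq_base _ _ hz base_eq.symm).trans ?_
    have := affineDeriv_smul_e₃ 1
    simp only [one_smul, inv_one] at this
    simp only [this, Prod.mk.eta]
    rfl
  have hi : ((blockHom B)⁻¹).1 = blockMatrix (B⁻¹ : GL (Fin 2) ℝ).1 := by
    rw [← map_inv]; rfl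
  have hdi : (B⁻¹ : GL (Fin 2) ℝ).1.det⁻¹ = B.1.det := by
    rw [Matrix.coe_units_inv, Matrix.det_nonsing_inv, Ring.inverse_eq_inv', inv_inv]
  have ha : act (blockHom B) (ins₀ 2 v.1, ins₀ 2 v.2) =
      (ins₀ 2 (B.1 *ᵥ v.1), ins₀ 2 (v.2 ᵥ* B.1⁻¹)) := by
    rw [act_apply, hi, ← Matrix.coe_units_inv B]
    exact Prod.ext (blockMatrix_mulVec B.1 v.1) (vecMul_blockMatrix _ v.2)
  have he : act (blockHom B) (e₃, e₃) = (B.1.det⁻¹ • e₃, B.1.det • e₃) := by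
    rw [act_apply, hi, mulVec_e₃, e₃_vecMul]
    refine Prod.ext ?_ ?_
    · show (fun i => blockMatrix B.1 i 2) = _
      funext i
      fin_cases i <;> simp [blockMatrix]
    · funext i
      fin_cases i <;> simp [blockMatrix]
  have hr : (act (blockHom B) (e₃, e₃)).2 ⬝ᵥ (act (blockHom B) (e₃, e₃)).1 ≠ 0 := by
    rwa [act_dotProduct]
  have hb : ofHomogeneous (act (blockHom B) (e₃, e₃)) = base := by
    rw [← smul_ofHomogeneous _ _ hz, ← base_eq, blockHom_smul_base]
  have h2 := h1.trans (dPi_of_eq_base _ _ hr hb)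
  rw [ha, he, affineDeriv_smul_e₃, affineDeriv_smul_e₃, inv_inv, hv] at h2
  have h3 (m : M4) (hm : m = base) :
      (mfderiv I4 I4 (fun x : M4 => blockHom B • x) m v : E4) =
        (mfderiv I4 I4 (fun x : M4 => blockHom B • x) base v : E4) := by
    subst hm; rfl
  exact (h3 _ base_eq.symm).symm.trans h2

theorem tangentBundle_mk_eq_iff {m m' : M4} (h : m = m') (v w : E4) :
    (⟨m, v⟩ : TangentBundle I4 M4) = ⟨m', w⟩ ↔ v = w := by
  subst h
  refine ⟨fun h => ?_, fun h => by rw [h]⟩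
  exact eq_of_heq (Bundle.TotalSpace.mk.inj h).2

theorem exists_cube_root (x : ℝ) : ∃ r : ℝ, r ^ 3 = x := by
  have hc : Continuous fun r : ℝ => r ^ 3 := by fun_prop
  refine mem_range_of_exists_le_of_exists_ge hc ⟨-(|x| + 1), ?_⟩ ⟨|x| + 1, ?_⟩
  · have := neg_abs_le x
    nlinarith [abs_nonneg x, sq_nonneg (|x|), pow_nonneg (abs_nonneg x) 3]
  · have := le_abs_self x
    nlinarith [abs_nonneg x, sq_nonneg (|x|), pow_nonneg (abs_nonneg x) 3]

/-- Commuting with K splits L into blocks P and Q, and preserving g gives QᵀP = 1. It remains to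
solve det(B) B = P. Taking determinants, det(B)³ = det P, so det B is the unique real cube root and
B is determined. -/
theorem existsUnique_isotropy (L : TangentSpace I4 base ≃L[ℝ] TangentSpace I4 base)
    (hg : ∀ v w, dancingMetric base (L v) (L w) = dancingMetric base v w)
    (hK : ∀ v, L (paraK base v) = paraK base (L v)) :
    ∃! B : GL (Fin 2) ℝ, ∀ v : TangentSpace I4 base,
      (⟨blockHom B • base, mfderiv I4 I4 (fun x : M4 => blockHom B • x) base v⟩ :
        TangentBundle I4 M4) = ⟨base, L v⟩ := by
  let L' : E4 →L[ℝ] E4 := (L : TangentSpace I4 base →L[ℝ] TangentSpace I4 base)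
  have hg' (v w : E4) : (L' v).2 ⬝ᵥ (L' w).1 + (L' w).2 ⬝ᵥ (L' v).1 = v.2 ⬝ᵥ w.1 + w.2 ⬝ᵥ v.1 :=
    neg_injective ((dancingMetric_base _ _).symm.trans ((hg v w).trans (dancingMetric_base v w)))
  have hK' (v : E4) : L' (paraKL v) = paraKL (L' v) := hK v
  have h1 (u : Fin 2 → ℝ) : (L' (u, 0)).2 = 0 := by
    have := congrArg Prod.snd (hK' (u, 0))
    simp only [paraKL_apply, neg_zero] at this
    exact self_eq_neg.1 this
  have h2 (u : Fin 2 → ℝ) : (L' (0, u)).1 = 0 := by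
    have := congrArg Prod.fst (hK' (0, u))
    have e : paraKL (0, u) = -(0, u) := by simp [paraKL_apply]
    rw [e, map_neg] at this
    simp only [paraKL_apply] at this
    exact neg_eq_self.1 this
  let P := LinearMap.toMatrix' ((ContinuousLinearMap.fst ℝ _ _ ∘L L' ∘L
    ContinuousLinearMap.inl ℝ (Fin 2 → ℝ) (Fin 2 → ℝ)).toLinearMap)
  let Q := LinearMap.toMatrix' ((ContinuousLinearMap.snd ℝ _ _ ∘L L' ∘L
    ContinuousLinearMap.inr ℝ (Fin 2 → ℝ) (Fin 2 → ℝ)).toLinearMap)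
  have hP (u : Fin 2 → ℝ) : P *ᵥ u = (L' (u, 0)).1 := by
    rw [← Matrix.toLin'_apply, Matrix.toLin'_toMatrix']
    rfl
  have hQ (u : Fin 2 → ℝ) : Q *ᵥ u = (L' (0, u)).2 := by
    rw [← Matrix.toLin'_apply, Matrix.toLin'_toMatrix']
    rfl
  have hL (v : E4) : L' v = (P *ᵥ v.1, Q *ᵥ v.2) := by
    have e : v = (v.1, 0) + (0, v.2) := by simp
    conv_lhs => rw [e, map_add]
    refine Prod.ext ?_ ?_
    · rw [Prod.fst_add, h2, hP, add_zero]
    · rw [Prod.snd_add, h1, hQ, zero_add]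
  have hQP : Qᵀ * P = 1 := by
    apply Matrix.mulVec_injective
    funext w
    rw [Matrix.one_mulVec]
    have (v : Fin 2 → ℝ) : v ⬝ᵥ ((Qᵀ * P) *ᵥ w) = v ⬝ᵥ w := by
      have := hg' (0, v) (w, 0)
      simp only [hL, Matrix.mulVec_zero, dotProduct_zero, add_zero] at this
      rw [← this, ← Matrix.mulVec_mulVec, Matrix.dotProduct_mulVec, Matrix.vecMul_transpose]
    exact dotProduct_eq _ _ fun v => by rw [dotProduct_comm, this, dotProduct_comm]
  have hPd : P.det ≠ 0 := by
    have := congrArg Matrix.det hQP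
    rw [Matrix.det_mul, Matrix.det_one] at this
    exact right_ne_zero_of_mul_eq_one this
  have hPi : P⁻¹ = Qᵀ := Matrix.inv_eq_left_inv hQP
  have key (B : GL (Fin 2) ℝ) : (∀ v : TangentSpace I4 base,
      (⟨blockHom B • base, mfderiv I4 I4 (fun x : M4 => blockHom B • x) base v⟩ :
        TangentBundle I4 M4) = ⟨base, L v⟩) ↔ B.1.det • B.1 = P := by
    have hB : B.1.det ≠ 0 := B.det.ne_zero
    have e (v : E4) : ((⟨blockHom B • base, mfderiv I4 I4 (fun x : M4 => blockHom B • x) base v⟩ :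
        TangentBundle I4 M4) = ⟨base, L v⟩) ↔
        (B.1.det • (B.1 *ᵥ v.1), B.1.det⁻¹ • (v.2 ᵥ* B.1⁻¹)) = (P *ᵥ v.1, Q *ᵥ v.2) := by
      rw [← hL, ← mfderiv_blockHom_smul]
      exact tangentBundle_mk_eq_iff (blockHom_smul_base B) _ _
    constructor
    · intro h
      apply Matrix.mulVec_injective
      funext u
      have := (congrArg Prod.fst ((e (u, 0)).1 (h (u, 0))))
      rw [Matrix.smul_mulVec]
      exact this
    · intro h v
      refine (e v).2 (Prod.ext ?_ ?_)
      · show B.1.det • (B.1 *ᵥ v.1) = P *ᵥ v.1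
        rw [← h, Matrix.smul_mulVec]
      · show B.1.det⁻¹ • (v.2 ᵥ* B.1⁻¹) = Q *ᵥ v.2
        rw [← Matrix.vecMul_transpose, ← hPi, ← h, ← Matrix.vecMul_smul]
        congr 1
        symm
        apply Matrix.inv_eq_left_inv
        rw [Matrix.smul_mul, Matrix.mul_smul, smul_smul, inv_mul_cancel₀ hB, one_smul]
        exact Matrix.nonsing_inv_mul _ (isUnit_iff_ne_zero.2 hB)
  obtain ⟨r, hr⟩ := exists_cube_root P.det
  have hr0 : r ≠ 0 := by
    rintro rfl
    exact hPd (by rw [← hr]; simp)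
  have hd : (r⁻¹ • P).det = r := by
    rw [Matrix.det_smul, ← hr, Fintype.card_fin]
    field_simp
  refine ⟨Matrix.GeneralLinearGroup.mkOfDetNeZero (r⁻¹ • P) (by rwa [hd]), ?_, ?_⟩
  · refine (key _).2 ?_
    show (r⁻¹ • P).det • (r⁻¹ • P) = P
    rw [hd, smul_smul, mul_inv_cancel₀ hr0, one_smul]
  · intro B hB
    have hB' := (key B).1 hB
    have h3 : B.1.det ^ 3 = r ^ 3 := by
      rw [hr, ← hB', Matrix.det_smul, Fintype.card_fin]
      ring
    have h3' : B.1.det = r := (Odd.strictMono_pow (by decide : Odd 3)).injective h3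
    apply Units.ext
    show B.1 = r⁻¹ • P
    rw [← hB', h3', smul_smul, inv_mul_cancel₀ hr0, one_smul]

end M4

/-! ### Geodesics and completeness -/

namespace M4

theorem hasDerivAt_affine (k : Fin 3) {q : ℝ → Fin 3 → ℝ} {q' : Fin 3 → ℝ} {t : ℝ}
    (h : HasDerivAt q q' t) (hk : q t k ≠ 0) :
    HasDerivAt (fun τ => fun j : Fin 2 => q τ (k.succAbove j) / q τ k) (affineDeriv k (q t) q') t :=
  (hasFDerivAt_affine k (q t) hk).comp_hasDerivAt t h

/-- A radial acceleration disappears in affine coordinates, apart from a multiple of the velocity: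
the affine curve runs along a straight line. -/
theorem hasDerivAt_affineDeriv (k : Fin 3) {q q' : ℝ → Fin 3 → ℝ} {t μ : ℝ}
    (h : HasDerivAt q (q' t) t) (h' : HasDerivAt q' (μ • q t) t) (hk : q t k ≠ 0) :
    HasDerivAt (fun τ => affineDeriv k (q τ) (q' τ))
      (-(2 * (q' t k / q t k)) • affineDeriv k (q t) (q' t)) t := by
  rw [hasDerivAt_pi] at h h' ⊢
  intro j
  have e := (((h k).inv hk).mul (h' (k.succAbove j))).sub
    (((h (k.succAbove j)).div ((h k).pow 2) (pow_ne_zero 2 hk)).mul (h' k))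
  refine e.congr_deriv ?_
  simp only [Pi.smul_apply, smul_eq_mul, affineDeriv_apply, Pi.inv_apply, Pi.div_apply, Pi.pow_apply]
  push_cast
  field_simp
  ring

theorem mfderiv_curve {γ : ℝ → M4} {t : ℝ} (h : MDifferentiableAt 𝓘(ℝ, ℝ) I4 γ t) :
    (mfderiv 𝓘(ℝ, ℝ) I4 γ t (1 : ℝ) : E4) = deriv (fun τ => extChartAt I4 (γ t) (γ τ)) t := by
  refine (congrArg (fun L : ℝ →L[ℝ] E4 => L 1) h.mfderiv).trans ?_
  show (fderivWithin ℝ (fun τ => extChartAt I4 (γ t) (γ τ)) (range 𝓘(ℝ, ℝ)) t : ℝ →L[ℝ] E4) 1 = _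
  rw [ModelWithCorners.range_eq_univ, fderivWithin_univ]
  exact fderiv_apply_one_eq_deriv

/-- A curve in homogeneous coordinates with `z'' = μ z`, `p q = 1` and horizontal velocity. -/
structure IsHomogeneousGeodesic (z z' : ℝ → HomCoord) (μ : ℝ) : Prop where
  smooth : ContDiff ℝ ∞ z
  deriv₁ : ∀ t, HasDerivAt z (z' t) t
  deriv₂ : ∀ t, HasDerivAt z' (μ • z t) t
  normalized : ∀ t, (z t).2 ⬝ᵥ (z t).1 = 1
  horizontal₁ : ∀ t, (z t).2 ⬝ᵥ (z' t).1 = 0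
  horizontal₂ : ∀ t, (z' t).2 ⬝ᵥ (z t).1 = 0

namespace IsHomogeneousGeodesic

variable {z z' : ℝ → HomCoord} {μ : ℝ} (h : IsHomogeneousGeodesic z z' μ)
include h

theorem regular (t : ℝ) : (z t).2 ⬝ᵥ (z t).1 ≠ 0 := by rw [h.normalized]; exact one_ne_zero

theorem contMDiff : ContMDiff 𝓘(ℝ, ℝ) I4 ∞ (ofHomogeneous ∘ z) := fun t =>
  (contMDiffAt_ofHomogeneous (z t) (h.regular t)).comp t h.smooth.contDiffAt.contMDiffAt

theorem velocity_eq (t : ℝ) : velocity (I := I4) (ofHomogeneous ∘ z) t =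
    ⟨ofHomogeneous (z t), dPi (z t) (z' t)⟩ := by
  have h1 := (hasMFDerivAt_ofHomogeneous (z t) (h.regular t)).comp t
    (h.deriv₁ t).hasFDerivAt.hasMFDerivAt
  refine tangentBundle_mk_eq rfl ?_
  rw [h1.mfderiv, dPi, (hasMFDerivAt_ofHomogeneous (z t) (h.regular t)).mfderiv]
  exact congrArg (((affineDeriv _ (z t).1).prodMap (affineDeriv _ (z t).2) : HomCoord →L[ℝ] E4))
    (one_smul ℝ (z' t))

theorem isGeodesicOn : IsGeodesicOn dancingMetric (ofHomogeneous ∘ z) univ := by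
  refine ⟨(h.contMDiff.of_le ENat.LEInfty.out).contMDiffOn, fun t _ c hc => ?_⟩
  set k := RP2.chartIndex c.point with hk
  set l := RP2.chartIndex c.line with hl
  have hcont : Continuous z := h.smooth.continuous
  obtain ⟨h1, h2⟩ : (z t).1 k ≠ 0 ∧ (z t).2 l ≠ 0 :=
    (ofHomogeneous_mem_source_iff c (z t) (h.regular t)).1 hc
  have ex (τ : ℝ) : extChartAt I4 c ((ofHomogeneous ∘ z) τ) =
      (fun j => (z τ).1 (k.succAbove j) / (z τ).1 k, fun j => (z τ).2 (l.succAbove j) / (z τ).2 l) :=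
    extChartAt_ofHomogeneous c (z τ) (h.regular τ)
  have d1 (τ : ℝ) : HasDerivAt (fun τ => (z τ).1) (z' τ).1 τ := (h.deriv₁ τ).fst
  have d2 (τ : ℝ) : HasDerivAt (fun τ => (z τ).2) (z' τ).2 τ := (h.deriv₁ τ).snd
  have d1' (τ : ℝ) : HasDerivAt (fun τ => (z' τ).1) (μ • (z τ).1) τ := (h.deriv₂ τ).fst
  have d2' (τ : ℝ) : HasDerivAt (fun τ => (z' τ).2) (μ • (z τ).2) τ := (h.deriv₂ τ).snd
  have dx : deriv (fun τ => extChartAt I4 c ((ofHomogeneous ∘ z) τ)) =ᶠ[𝓝 t]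
      fun τ => (affineDeriv k (z τ).1 (z' τ).1, affineDeriv l (z τ).2 (z' τ).2) := by
    have o1 : IsOpen {τ | (z τ).1 k ≠ 0} :=
      isOpen_ne_fun ((continuous_apply k).comp (continuous_fst.comp hcont)) continuous_const
    have o2 : IsOpen {τ | (z τ).2 l ≠ 0} :=
      isOpen_ne_fun ((continuous_apply l).comp (continuous_snd.comp hcont)) continuous_const
    filter_upwards [o1.mem_nhds h1, o2.mem_nhds h2] with τ t1 t2
    simp only [ex]
    exact ((hasDerivAt_affine k (d1 τ) t1).prodMk (hasDerivAt_affine l (d2 τ) t2)).deriv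
  have ddx := ((hasDerivAt_affineDeriv k (d1 t) (d1' t) h1).prodMk
    (hasDerivAt_affineDeriv l (d2 t) (d2' t) h2)).congr_of_eventuallyEq dx
  have ht := (extChartAt I4 c).map_source hc
  show deriv (deriv fun τ => extChartAt I4 c ((ofHomogeneous ∘ z) τ)) t +
    christoffel dancingMetric c (extChartAt I4 c ((ofHomogeneous ∘ z) t)) _ _ = 0
  rw [christoffel_dancingMetric c _ ht, ddx.deriv, dx.eq_of_nhds, chris_apply]
  -- The pair is normalised and its velocity horizontal, so A₁/F = −q'_k/q_k and A₂/F = −p'_l/p_l.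
  -- These are the factors that cancel the affine acceleration.
  have hF : funF k l (extChartAt I4 c ((ofHomogeneous ∘ z) t)) = ((z t).2 l)⁻¹ * ((z t).1 k)⁻¹ := by
    rw [ex, funF, affine_eq_lift k _ h1, affine_eq_lift l _ h2]
    simp [h.normalized, mul_comm]
  have hA : formA₁ k l (extChartAt I4 c ((ofHomogeneous ∘ z) t))
      (affineDeriv k (z t).1 (z' t).1, affineDeriv l (z t).2 (z' t).2) =
      -(((z t).2 l)⁻¹ * ((z' t).1 k / (z t).1 k ^ 2)) := by
    rw [formA₁_apply, ex, affine_eq_lift l _ h2, ins_affineDeriv k _ _ h1]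
    simp [h.normalized, h.horizontal₁, mul_comm]
  have hB : formA₂ k l (extChartAt I4 c ((ofHomogeneous ∘ z) t))
      (affineDeriv k (z t).1 (z' t).1, affineDeriv l (z t).2 (z' t).2) =
      -(((z t).1 k)⁻¹ * ((z' t).2 l / (z t).2 l ^ 2)) := by
    rw [formA₂_apply, ex, affine_eq_lift k _ h1, ins_affineDeriv l _ _ h2]
    simp [h.normalized, h.horizontal₂]
  rw [hF, hA, hB]
  ext j
  · simp [proj₁_apply, proj₂_apply]
    field_simp
    ring
  · simp [proj₁_apply, proj₂_apply]
    field_simp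
    ring

end IsHomogeneousGeodesic

/-- Solutions of `S' = C`, `C' = -κ S` with `S 0 = 0`, `C 0 = 1`. -/
theorem exists_generalized_trig (κ : ℝ) : ∃ C S : ℝ → ℝ, ContDiff ℝ ∞ C ∧ ContDiff ℝ ∞ S ∧
    (∀ t, HasDerivAt S (C t) t) ∧ (∀ t, HasDerivAt C (-κ * S t) t) ∧ C 0 = 1 ∧ S 0 = 0 ∧
    ∀ t, C t ^ 2 + κ * S t ^ 2 = 1 := by
  rcases lt_trichotomy κ 0 with hκ | rfl | hκ
  · obtain ⟨r, hr, rfl⟩ : ∃ r : ℝ, 0 < r ∧ κ = -r ^ 2 :=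
      ⟨√(-κ), Real.sqrt_pos.2 (neg_pos.2 hκ), by rw [Real.sq_sqrt (by linarith)]; ring⟩
    have hd (t : ℝ) : HasDerivAt (fun t => r * t) r t := by
      simpa using (hasDerivAt_id t).const_mul r
    refine ⟨fun t => Real.cosh (r * t), fun t => Real.sinh (r * t) / r,
      Real.contDiff_cosh.comp (contDiff_const.mul contDiff_id),
      (Real.contDiff_sinh.comp (contDiff_const.mul contDiff_id)).div_const r, fun t => ?_, fun t => ?_,
      by simp, by simp, fun t => ?_⟩
    · refine ((hd t).sinh.div_const r).congr_deriv (by field_simp)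
    · refine (hd t).cosh.congr_deriv (by field_simp)
    · have := Real.cosh_sq (r * t)
      field_simp
      linarith
  · exact ⟨fun _ => 1, fun t => t, contDiff_const, contDiff_id, fun t => hasDerivAt_id t,
      fun t => by simpa using hasDerivAt_const t (1 : ℝ), rfl, rfl, fun t => by simp⟩
  · obtain ⟨r, hr, rfl⟩ : ∃ r : ℝ, 0 < r ∧ κ = r ^ 2 :=
      ⟨√κ, Real.sqrt_pos.2 hκ, by rw [Real.sq_sqrt hκ.le]⟩
    have hd (t : ℝ) : HasDerivAt (fun t => r * t) r t := by
      simpa using (hasDerivAt_id t).const_mul r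
    refine ⟨fun t => Real.cos (r * t), fun t => Real.sin (r * t) / r,
      Real.contDiff_cos.comp (contDiff_const.mul contDiff_id),
      (Real.contDiff_sin.comp (contDiff_const.mul contDiff_id)).div_const r, fun t => ?_, fun t => ?_,
      by simp, by simp, fun t => ?_⟩
    · refine ((hd t).sin.div_const r).congr_deriv (by field_simp)
    · refine (hd t).cos.congr_deriv (by field_simp)
    · have := Real.cos_sq_add_sin_sq (r * t)
      field_simp
      linarith

theorem isGeodesicallyComplete_dancingMetric : IsGeodesicallyComplete dancingMetric := by
  rintro ⟨m, v⟩
  obtain ⟨z, hz, rfl⟩ := exists_normalized m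
  have hz' : z.2 ⬝ᵥ z.1 ≠ 0 := by rw [hz]; exact one_ne_zero
  obtain ⟨a, ha1, ha2, rfl⟩ := exists_horizontal_lift z hz' v
  obtain ⟨C, S, hC, hS, dS, dC, C0, S0, hCS⟩ := exists_generalized_trig (a.2 ⬝ᵥ a.1)
  set κ := a.2 ⬝ᵥ a.1 with hκ
  -- In the plane spanned by z and a horizontal a one has pq = C² + κS² with κ = a₂a₁. Requiring pq
  -- = 1 and horizontality gives circular, hyperbolic or linear motion according to the sign of κ,
  -- in each case for all times.
  have H : IsHomogeneousGeodesic (fun t => C t • z + S t • a)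
      (fun t => (-κ * S t) • z + C t • a) (-κ) := by
    refine ⟨(hC.smul contDiff_const).add (hS.smul contDiff_const), fun t =>
      ((dC t).smul_const z).add ((dS t).smul_const a), fun t => ?_, fun t => ?_, fun t => ?_,
      fun t => ?_⟩
    · refine ((((dS t).const_mul (-κ)).smul_const z).add ((dC t).smul_const a)).congr_deriv ?_
      module
    all_goals
      simp only [Prod.fst_add, Prod.snd_add, Prod.smul_fst, Prod.smul_snd, add_dotProduct,
        dotProduct_add, smul_dotProduct, dotProduct_smul, smul_eq_mul, hz, ha1, ha2, ← hκ]
      linarith [hCS t]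
  refine ⟨_, H.isGeodesicOn, (H.velocity_eq 0).trans ?_⟩
  have e : C 0 • z + S 0 • a = z := by simp [C0, S0]
  have e' : (-κ * S 0) • z + C 0 • a = a := by simp [C0, S0]
  simp only [e']
  have h (w : HomCoord) (hw : w = z) :
      (⟨ofHomogeneous w, dPi w a⟩ : TangentBundle I4 M4) = ⟨ofHomogeneous z, dPi z a⟩ := by
    subst hw; rfl
  exact h _ e

/-- A solution of the linear equation `f' = a f` which vanishes at `t₀` vanishes near `t₀`. -/
theorem eventually_eq_zero_of_hasDerivAt {f a : ℝ → ℝ} {t₀ : ℝ} (ha : ContinuousAt a t₀)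
    (hf : ∀ᶠ t in 𝓝 t₀, HasDerivAt f (a t * f t) t) (h0 : f t₀ = 0) : ∀ᶠ t in 𝓝 t₀, f t = 0 := by
  -- A bound for the coefficient near t₀ serves as Lipschitz constant in the uniqueness theorem.
  have hb : ∀ᶠ t in 𝓝 t₀, |a t| < |a t₀| + 1 :=
    ha.abs.eventually_lt continuousAt_const (lt_add_one _)
  refine ODE_solution_unique_of_eventually (v := fun t y => a t * y) (s := fun _ => univ)
    (K := ⟨|a t₀| + 1, by positivity⟩) (g := fun _ => 0) ?_ (hf.mono fun t ht => ⟨ht, mem_univ _⟩)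
    (Eventually.of_forall fun t => ⟨by simpa using hasDerivAt_const t (0 : ℝ), mem_univ _⟩) h0
  filter_upwards [hb] with t ht
  refine LipschitzWith.lipschitzOnWith (LipschitzWith.of_dist_le_mul fun x y => ?_)
  rw [Real.dist_eq, Real.dist_eq, ← mul_sub, abs_mul]
  exact mul_le_mul_of_nonneg_right ht.le (abs_nonneg _)

/-- If `f'' = a f'` near `t₀` and `f'(t₀) = 0` then `f` is constant near `t₀`. -/
theorem eventually_const_of_hasDerivAt {f f' a : ℝ → ℝ} {t₀ : ℝ} (ha : ContinuousAt a t₀)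
    (hf : ∀ᶠ t in 𝓝 t₀, HasDerivAt f (f' t) t) (hf' : ∀ᶠ t in 𝓝 t₀, HasDerivAt f' (a t * f' t) t)
    (h0 : f' t₀ = 0) : ∀ᶠ t in 𝓝 t₀, f t = f t₀ := by
  have h1 := eventually_eq_zero_of_hasDerivAt ha hf' h0
  have h2 : ∀ᶠ t in 𝓝 t₀, HasDerivAt (fun t => f t - f t₀) (0 * (f t - f t₀)) t := by
    filter_upwards [hf, h1] with t ht ht'
    rw [zero_mul, ← ht']
    exact ht.sub_const _
  filter_upwards [eventually_eq_zero_of_hasDerivAt continuousAt_const h2 (sub_self _)] with t ht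
  exact sub_eq_zero.1 ht

/-- Along a geodesic the affine functions `n q / q_k` of the point and `p n / p_l` of the line are
constant as soon as they are stationary. -/
theorem geodesic_affine_const {γ : ℝ → M4} {J : Set ℝ} (hJ : IsOpen J) (h0 : (0 : ℝ) ∈ J)
    (hγ : IsGeodesicOn dancingMetric γ J) (n : Fin 3 → ℝ) :
    let v : E4 := mfderiv 𝓘(ℝ, ℝ) I4 γ 0 (1 : ℝ)
    let k := RP2.chartIndex (γ 0).point
    let l := RP2.chartIndex (γ 0).line
    let x : ℝ → E4 := fun t => extChartAt I4 (γ 0) (γ t)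
    (n ⬝ᵥ ins₀ k v.1 = 0 → ∀ᶠ t in 𝓝 0, n ⬝ᵥ ins k (x t).1 = n ⬝ᵥ ins k (x 0).1) ∧
    (n ⬝ᵥ ins₀ l v.2 = 0 → ∀ᶠ t in 𝓝 0, n ⬝ᵥ ins l (x t).2 = n ⬝ᵥ ins l (x 0).2) := by
  intro v k l x
  obtain ⟨hs, hode⟩ := hγ
  set W : Set ℝ := J ∩ γ ⁻¹' (extChartAt I4 (γ 0)).source with hW
  have hWo : IsOpen W := hs.continuousOn.isOpen_inter_preimage hJ (isOpen_extChartAt_source _)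
  have h0W : (0 : ℝ) ∈ W := ⟨h0, mem_extChartAt_source _⟩
  have hx : ContDiffOn ℝ 2 x W := by
    intro t ht
    have h1 : ContMDiffAt 𝓘(ℝ, ℝ) I4 2 γ t := (hs t ht.1).contMDiffAt (hJ.mem_nhds ht.1)
    have h2 : ContMDiffAt I4 𝓘(ℝ, E4) 2 (extChartAt I4 (γ 0)) (γ t) :=
      contMDiffAt_extChartAt' (by rw [← _root_.extChartAt_source I4]; exact ht.2)
    exact (h2.comp t h1).contDiffAt.contDiffWithinAt
  have hx' : ContDiffOn ℝ 1 (deriv x) W := hx.deriv_of_isOpen hWo (by norm_num)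
  have d1 (t : ℝ) (ht : t ∈ W) : HasDerivAt x (deriv x t) t :=
    ((hx t ht).contDiffAt (hWo.mem_nhds ht)).differentiableAt (by norm_num) |>.hasDerivAt
  have d2 (t : ℝ) (ht : t ∈ W) : HasDerivAt (deriv x) (-chris k l (x t) (deriv x t) (deriv x t)) t := by
    have e := hode t ht.1 (γ 0) ht.2
    simp only at e
    rw [christoffel_dancingMetric (γ 0) _ ((extChartAt I4 (γ 0)).map_source ht.2)] at e
    have h := ((hx' t ht).contDiffAt (hWo.mem_nhds ht)).differentiableAt (by norm_num) |>.hasDerivAt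
    rwa [eq_neg_of_add_eq_zero_left e] at h
  have hv : v = deriv x 0 := mfderiv_curve
    (((hs 0 h0).contMDiffAt (hJ.mem_nhds h0)).mdifferentiableAt (by norm_num))
  have hnear : ∀ᶠ t in 𝓝 (0 : ℝ), t ∈ W := hWo.mem_nhds h0W
  have hF (t : ℝ) (ht : t ∈ W) : funF k l (x t) ≠ 0 :=
    (mem_target_iff _ _).1 ((extChartAt I4 (γ 0)).map_source ht.2)
  have cx : ContinuousAt x 0 := (d1 0 h0W).continuousAt
  have cx' : ContinuousAt (deriv x) 0 := (d2 0 h0W).continuousAt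
  have cF : ContinuousAt (fun t => (funF k l (x t))⁻¹) 0 :=
    ((contDiff_funF k l (n := 1)).continuous.continuousAt.comp cx).inv₀ (hF 0 h0W)
  have cA : ContinuousAt (fun t => formA₁ k l (x t) (deriv x t)) 0 :=
    ((contDiff_formA₁ k l (n := 1)).continuous.continuousAt.comp cx).clm_apply cx'
  have cB : ContinuousAt (fun t => formA₂ k l (x t) (deriv x t)) 0 :=
    ((contDiff_formA₂ k l (n := 1)).continuous.continuousAt.comp cx).clm_apply cx'
  have dins (k : Fin 3) {y : ℝ → Fin 2 → ℝ} {y' : Fin 2 → ℝ} {t : ℝ} (h : HasDerivAt y y' t) :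
      HasDerivAt (fun t => n ⬝ᵥ ins k (y t)) (n ⬝ᵥ ins₀ k y') t := by
    have := ((dotL n).hasFDerivAt.comp_hasDerivAt t ((hasFDerivAt_ins k (y t)).comp_hasDerivAt t h))
    simpa [Function.comp_def, dotL_apply, insL_apply] using this
  have dins₀ (k : Fin 3) {y : ℝ → Fin 2 → ℝ} {y' : Fin 2 → ℝ} {t : ℝ} (h : HasDerivAt y y' t) :
      HasDerivAt (fun t => n ⬝ᵥ ins₀ k (y t)) (n ⬝ᵥ ins₀ k y') t := by
    have := ((dotL n).hasFDerivAt.comp_hasDerivAt t ((insL k).hasFDerivAt.comp_hasDerivAt t h))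
    simpa [Function.comp_def, dotL_apply, insL_apply] using this
  have smul_ins₀ (k : Fin 3) (c : ℝ) (y : Fin 2 → ℝ) :
      n ⬝ᵥ ins₀ k (c • y) = c * (n ⬝ᵥ ins₀ k y) := by
    rw [← insL_apply, map_smul, dotProduct_smul, smul_eq_mul, insL_apply]
  -- The point component of the acceleration is a scalar multiple of its velocity, and so is the
  -- line component. The scalar is continuous in t at 0, so an affine function f of one component
  -- satisfies f'' = a f'.
  have e1 (t : ℝ) : (-chris k l (x t) (deriv x t) (deriv x t)).1 =
      (2 * ((funF k l (x t))⁻¹ * formA₁ k l (x t) (deriv x t))) • (deriv x t).1 := by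
    rw [chris_apply]
    ext j
    simp [proj₁_apply, proj₂_apply]
    ring
  have e2 (t : ℝ) : (-chris k l (x t) (deriv x t) (deriv x t)).2 =
      (2 * ((funF k l (x t))⁻¹ * formA₂ k l (x t) (deriv x t))) • (deriv x t).2 := by
    rw [chris_apply]
    ext j
    simp [proj₁_apply, proj₂_apply]
    ring
  constructor
  · intro h
    refine eventually_const_of_hasDerivAt (f' := fun t => n ⬝ᵥ ins₀ k (deriv x t).1)
      (a := fun t => 2 * ((funF k l (x t))⁻¹ * formA₁ k l (x t) (deriv x t)))
      (continuousAt_const.mul (cF.mul cA)) ?_ ?_ (by rwa [hv] at h)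
    · filter_upwards [hnear] with t ht
      exact dins k (d1 t ht).fst
    · filter_upwards [hnear] with t ht
      have := dins₀ k (d2 t ht).fst
      rwa [e1, smul_ins₀] at this
  · intro h
    refine eventually_const_of_hasDerivAt (f' := fun t => n ⬝ᵥ ins₀ l (deriv x t).2)
      (a := fun t => 2 * ((funF k l (x t))⁻¹ * formA₂ k l (x t) (deriv x t)))
      (continuousAt_const.mul (cF.mul cB)) ?_ ?_ (by rwa [hv] at h)
    · filter_upwards [hnear] with t ht
      exact dins l (d1 t ht).snd
    · filter_upwards [hnear] with t ht
      have := dins₀ l (d2 t ht).snd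
      rwa [e2, smul_ins₀] at this

end M4

namespace M4

/-! ### Vector fields in charts -/

/-- The vector field given by `f` in the preferred chart at `c`. -/
noncomputable def fieldOf (c : M4) (f : E4 → E4) (m : M4) : TangentSpace I4 m :=
  (trivializationAt E4 (TangentSpace I4) c).symmL ℝ m (f (extChartAt I4 c m))

theorem mem_chartAt_source {c m : M4} (hm : m ∈ (extChartAt I4 c).source) :
    m ∈ (chartAt (ModelProd (Fin 2 → ℝ) (Fin 2 → ℝ)) c).source := by
  rwa [_root_.extChartAt_source] at hm

theorem mfderiv_extChartAt_fieldOf (c m : M4) (hm : m ∈ (extChartAt I4 c).source) (f : E4 → E4) :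
    (mfderiv I4 𝓘(ℝ, E4) (extChartAt I4 c) m (fieldOf c f m) : E4) = f (extChartAt I4 c m) := by
  have h := TangentBundle.continuousLinearMapAt_trivializationAt (I := I4) (mem_chartAt_source hm)
  refine (congrArg (fun L : E4 →L[ℝ] E4 => L (fieldOf c f m)) h).symm.trans ?_
  exact (trivializationAt E4 (TangentSpace I4) c).continuousLinearMapAt_symmL (R := ℝ)
    (by simpa using mem_chartAt_source hm) _

theorem smoothFieldOn_fieldOf (c : M4) {f : E4 → E4} {V : Set M4} (hV : V ⊆ (extChartAt I4 c).source)
    (hf : ∀ m ∈ V, ContDiffAt ℝ ∞ f (extChartAt I4 c m)) : SmoothFieldOn (fieldOf c f) V := by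
  intro m hm
  refine ContMDiffAt.contMDiffWithinAt ?_
  have hs := mem_chartAt_source (hV hm)
  refine ((trivializationAt E4 (TangentSpace I4) c).contMDiffAt_section_iff
    (by simpa using hs)).2 ?_
  have h1 : ContMDiffAt I4 𝓘(ℝ, E4) ∞ (extChartAt I4 c) m := contMDiffAt_extChartAt' hs
  refine ((hf m hm).contMDiffAt.comp m h1).congr_of_eventuallyEq ?_
  filter_upwards [(isOpen_extChartAt_source (I := I4) c).mem_nhds (hV hm)] with x hx
  refine Eq.trans ?_ (mfderiv_extChartAt_fieldOf c x hx f)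
  refine Eq.trans ?_ (congrArg (fun L : E4 →L[ℝ] E4 => L (fieldOf c f x))
      (TangentBundle.continuousLinearMapAt_trivializationAt (I := I4) (mem_chartAt_source hx)))
  exact (congrFun (Bundle.Trivialization.coe_linearMapAt_of_mem (R := ℝ)
      (trivializationAt E4 (TangentSpace I4) c) (by simpa using mem_chartAt_source hx)) _).symm

/-- The differential at `m` of the preferred chart at `c`. -/
noncomputable def chartD (c m : M4) : E4 →L[ℝ] E4 := mfderiv I4 𝓘(ℝ, E4) (extChartAt I4 c) m

theorem chartD_injective {c m : M4} (hm : m ∈ (extChartAt I4 c).source) :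
    Function.Injective (chartD c m) := (isInvertible_mfderiv_extChartAt hm).injective

theorem chartD_surjective {c m : M4} (hm : m ∈ (extChartAt I4 c).source) :
    Function.Surjective (chartD c m) := (isInvertible_mfderiv_extChartAt hm).surjective

theorem chartD_paraKL {c m : M4} (hm : m ∈ (extChartAt I4 c).source) (v : E4) :
    chartD c m (paraKL v) = paraKL (chartD c m v) := mfderiv_extChartAt_paraK c m hm v

theorem chartD_fieldOf {c m : M4} (hm : m ∈ (extChartAt I4 c).source) (f : E4 → E4) :
    chartD c m (fieldOf c f m) = f (extChartAt I4 c m) := mfderiv_extChartAt_fieldOf c m hm f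

/-- A vanishing component is an eigenvalue equation for K, and chart differentials commute with K.
-/
theorem chartD_fst {c m : M4} (hm : m ∈ (extChartAt I4 c).source) (v : E4) :
    (chartD c m v).1 = 0 ↔ v.1 = 0 := by
  have e (w : E4) : w.1 = 0 ↔ paraKL w = -w := by
    rw [paraKL_apply, Prod.ext_iff]
    simp [self_eq_neg]
  rw [e, e, ← chartD_paraKL hm, ← map_neg, (chartD_injective hm).eq_iff]

theorem chartD_snd {c m : M4} (hm : m ∈ (extChartAt I4 c).source) (v : E4) :
    (chartD c m v).2 = 0 ↔ v.2 = 0 := by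
  have e (w : E4) : w.2 = 0 ↔ paraKL w = w := by
    rw [paraKL_apply, Prod.ext_iff]
    simp [neg_eq_self]
  rw [e, e, ← chartD_paraKL hm, (chartD_injective hm).eq_iff]

/-! ### Distributions which are constant in all charts -/

/-- The distribution `D` is given by `π v = 0` in all charts, `f` is a submersion whose fibres are
given by constancy of `π` in all charts, and covariant derivatives preserve `π v = 0`. -/
structure IsModelFoliation (π : E4 →L[ℝ] (Fin 2 → ℝ))
    (D : ∀ m : M4, Submodule ℝ (TangentSpace I4 m)) (f : M4 → RP2) : Prop where
  mem_iff : ∀ (m : M4) (v : E4), v ∈ D m ↔ π v = 0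
  surjective : Function.Surjective π
  chart_iff : ∀ c m : M4, m ∈ (extChartAt I4 c).source → ∀ v : E4,
    π (chartD c m v) = 0 ↔ π v = 0
  chris_mem : ∀ (k l : Fin 3) (x u v : E4), π v = 0 → π (chris k l x u v) = 0
  fibre_iff : ∀ c m m' : M4, m ∈ (extChartAt I4 c).source → m' ∈ (extChartAt I4 c).source →
    (f m = f m' ↔ π (extChartAt I4 c m) = π (extChartAt I4 c m'))

/-- If v has no point component then A₁(v) = 0, and both terms of Γ(u, v) with values in the first
factor vanish. -/
theorem isModelFoliation_point : IsModelFoliation (ContinuousLinearMap.fst ℝ _ _) lineDir point where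
  mem_iff := mem_lineDir_iff
  surjective := Prod.fst_surjective
  chart_iff := fun _ _ hm => chartD_fst hm
  chris_mem k l x u v hv := by
    replace hv : v.1 = 0 := hv
    show (chris k l x u v).1 = 0
    rw [chris_apply, formA₁_apply k l x v, hv]
    simp [proj₁_apply, proj₂_apply, hv]
  fibre_iff c m m' hm hm' := by
    show _ ↔ (extChartAt I4 c m).1 = (extChartAt I4 c m').1
    rw [extChartAt_source] at hm hm'
    refine ⟨fun h => by rw [extChartAt_apply, extChartAt_apply, h], fun h => ?_⟩
    exact (RP2.affineChart (RP2.chartIndex c.point)).injOn hm.1 hm'.1 h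

theorem isModelFoliation_line : IsModelFoliation (ContinuousLinearMap.snd ℝ _ _) pointDir line where
  mem_iff := mem_pointDir_iff
  surjective := Prod.snd_surjective
  chart_iff := fun _ _ hm => chartD_snd hm
  chris_mem k l x u v hv := by
    replace hv : v.2 = 0 := hv
    show (chris k l x u v).2 = 0
    rw [chris_apply, formA₂_apply k l x v, hv]
    simp [proj₁_apply, proj₂_apply, hv]
  fibre_iff c m m' hm hm' := by
    show _ ↔ (extChartAt I4 c m).2 = (extChartAt I4 c m').2
    rw [extChartAt_source] at hm hm'
    refine ⟨fun h => by rw [extChartAt_apply, extChartAt_apply, h], fun h => ?_⟩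
    exact (RP2.affineChart (RP2.chartIndex c.line)).injOn hm.2 hm'.2 h

theorem apply_fderiv_eq_zero {F : Type*} [NormedAddCommGroup F] [NormedSpace ℝ F] (π : E4 →L[ℝ] F)
    {f : E4 → E4} {x : E4} (h : ∀ᶠ y in 𝓝 x, π (f y) = 0) (u : E4) : π (fderiv ℝ f x u) = 0 := by
  by_cases hf : DifferentiableAt ℝ f x
  · have h1 : HasFDerivAt (π ∘ f) (π ∘L fderiv ℝ f x) x := π.hasFDerivAt.comp x hf.hasFDerivAt
    have h2 : HasFDerivAt (π ∘ f) (0 : E4 →L[ℝ] F) x :=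
      (hasFDerivAt_const (0 : F) x).congr_of_eventuallyEq h
    exact congrArg (fun L : E4 →L[ℝ] F => L u) (h1.unique h2)
  -- Where f is not differentiable, `fderiv` is 0 by convention and the claim still holds.
  · rw [fderiv_zero_of_not_differentiableAt hf]
    simp

/-- The chart at m has identity differential at m in the identification used for the tangent space,
so the bracket is the flat one. -/
theorem mlieBracket_eq (X Y : ∀ m : M4, TangentSpace I4 m) (m : M4) :
    (VectorField.mlieBracket I4 X Y m : E4) =
      fderiv ℝ (chartField m Y) (extChartAt I4 m m) (chartField m X (extChartAt I4 m m)) -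
      fderiv ℝ (chartField m X) (extChartAt I4 m m) (chartField m Y (extChartAt I4 m m)) := by
  rw [← VectorField.mlieBracketWithin_univ, VectorField.mlieBracketWithin_apply,
    mfderiv_extChartAt_self, I4.range_eq_univ]
  simp only [VectorField.mpullbackWithin_univ, preimage_univ, inter_univ]
  refine (congrArg (fun L : E4 →L[ℝ] E4 => L _)
    (ContinuousLinearMap.inverse_id : (ContinuousLinearMap.id ℝ E4).inverse = _)).trans ?_
  show VectorField.lieBracketWithin ℝ (chartField m X) (chartField m Y) univ (extChartAt I4 m m) = _
  rw [VectorField.lieBracketWithin_univ]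
  rfl

namespace IsModelFoliation

variable {π : E4 →L[ℝ] (Fin 2 → ℝ)} {D : ∀ m : M4, Submodule ℝ (TangentSpace I4 m)} {f : M4 → RP2}
  (H : IsModelFoliation π D f)
include H

theorem chartField_mem {V : Set M4} (hV : IsOpen V) {X : ∀ m : M4, TangentSpace I4 m}
    (hX : ∀ x ∈ V, X x ∈ D x) {m : M4} (hm : m ∈ V) :
    ∀ᶠ y in 𝓝 (extChartAt I4 m m), π (chartField m X y) = 0 := by
  have h1 : ∀ᶠ y in 𝓝 (extChartAt I4 m m), (extChartAt I4 m).symm y ∈ V :=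
    (continuousAt_extChartAt_symm m).preimage_mem_nhds
      (by rw [extChartAt_to_inv]; exact hV.mem_nhds hm)
  filter_upwards [h1, (isOpen_extChartAt_target m).mem_nhds (mem_extChartAt_target (I := I4) m)]
    with y hy hyt
  rw [chartField_apply m X y hyt]
  exact (H.chart_iff m _ ((extChartAt I4 m).map_target hyt) _).2 ((H.mem_iff _ _).1 (hX _ hy))

/-- In a chart, a section satisfies πX = 0 on an open set, so its derivative does too; the term with
Γ preserves the condition. -/
theorem isParallelOn : IsParallelOn dancingMetric D univ := by
  intro V _ hV X _ hX m hm u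
  have h := H.chartField_mem hV hX hm
  refine (H.mem_iff m _).2 ?_
  refine (congrArg π (covDeriv_dancingMetric X m u)).trans ((map_add π _ _).trans ?_)
  exact (congrArg₂ (· + ·) (apply_fderiv_eq_zero π h u)
    (H.chris_mem _ _ _ _ _ h.self_of_nhds)).trans (add_zero 0)

theorem isInvolutive : IsInvolutive D := by
  intro V hV X Y _ _ hX hY m hm
  refine (H.mem_iff m _).2 ?_
  refine (congrArg π (mlieBracket_eq X Y m)).trans ?_
  rw [map_sub, apply_fderiv_eq_zero π (H.chartField_mem hV hX hm),
    apply_fderiv_eq_zero π (H.chartField_mem hV hY hm), sub_zero]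

theorem finrank_ker : Module.finrank ℝ (LinearMap.ker π.toLinearMap) = 2 := by
  have h := LinearMap.finrank_range_add_finrank_ker π.toLinearMap
  rw [LinearMap.range_eq_top.2 H.surjective, finrank_top] at h
  simp at h
  omega

theorem coe_eq (m : M4) : D m = LinearMap.ker π.toLinearMap :=
  Submodule.ext fun v => (H.mem_iff m v).trans Iff.rfl

/-- A basis of ker π, extended by constants in a chart, is a smooth local frame. -/
theorem isDistributionOn : IsDistributionOn D 2 univ := by
  intro m _
  refine ⟨by rw [H.coe_eq]; exact H.finrank_ker, (extChartAt I4 m).source, subset_univ _,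
    isOpen_extChartAt_source m, mem_extChartAt_source m, ?_⟩
  let b := Module.finBasisOfFinrankEq ℝ _ H.finrank_ker
  refine ⟨fun i => fieldOf m (fun _ => (b i : E4)), fun i =>
    smoothFieldOn_fieldOf m Subset.rfl fun _ _ => contDiffAt_const, fun x hx => ?_⟩
  have hmem (i : Fin 2) : fieldOf m (fun _ => (b i : E4)) x ∈ D x := by
    refine (H.mem_iff x _).2 ((H.chart_iff m x hx _).1 ?_)
    rw [chartD_fieldOf hx]
    exact (b i).2
  refine le_antisymm (Submodule.span_le.2 (range_subset_iff.2 hmem)) fun v hv => ?_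
  have hv' := (H.chart_iff m x hx v).2 ((H.mem_iff _ _).1 hv)
  let w : LinearMap.ker π.toLinearMap := ⟨_, hv'⟩
  let g : Fin 2 → E4 := fun i => fieldOf m (fun _ => (b i : E4)) x
  have e : v = ∑ i, b.repr w i • g i := by
    apply chartD_injective hx
    have h1 : chartD m x (∑ i, b.repr w i • g i) = ∑ i, b.repr w i • (b i : E4) := by
      rw [map_sum]
      exact Finset.sum_congr rfl fun i _ => by rw [map_smul, chartD_fieldOf hx]
    refine Eq.trans ?_ h1.symm
    have h2 := congrArg Subtype.val (b.sum_repr w)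
    exact h2.symm.trans (by simp only [Submodule.coe_sum, Submodule.coe_smul])
  rw [e]
  exact Submodule.sum_mem _ fun i _ => Submodule.smul_mem _ _ (Submodule.subset_span ⟨i, rfl⟩)

end IsModelFoliation

end M4

/-! ### Leaves and fibres of the two projections -/

namespace M4

/-- A straight segment in homogeneous coordinates. -/
theorem contMDiff_segment (z a : HomCoord)
    (hr : ∀ t : ℝ, (z + t • a).2 ⬝ᵥ (z + t • a).1 ≠ 0) :
    ContMDiff 𝓘(ℝ, ℝ) I4 ∞ (fun t : ℝ => ofHomogeneous (z + t • a)) ∧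
      ∀ t : ℝ, (mfderiv 𝓘(ℝ, ℝ) I4 (fun t : ℝ => ofHomogeneous (z + t • a)) t (1 : ℝ) : E4) =
        dPi (z + t • a) a := by
  constructor
  · intro t
    exact (contMDiffAt_ofHomogeneous _ (hr t)).comp t
      (contDiff_const.add (contDiff_id.smul contDiff_const)).contDiffAt.contMDiffAt
  · intro t
    have hd : HasDerivAt (fun t : ℝ => z + t • a) a t := by
      simpa using ((hasDerivAt_id t).smul_const a).const_add z
    have h1 := (hasMFDerivAt_ofHomogeneous _ (hr t)).comp t hd.hasFDerivAt.hasMFDerivAt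
    have h2 := h1.mfderiv
    rw [dPi, (hasMFDerivAt_ofHomogeneous _ (hr t)).mfderiv]
    refine (congrArg (fun L : ℝ →L[ℝ] E4 => L 1) h2).trans ?_
    exact congrArg (((affineDeriv _ _).prodMap (affineDeriv _ _) : HomCoord →L[ℝ] E4))
      (one_smul ℝ a)

/-- Scale both lines to have pairing 1 with the common q. Then every p + t(p' − p) has pairing 1
with q, so the whole straight line stays in M⁴. -/
theorem exists_segment_point (m m' : M4) (h : m.point = m'.point) : ∃ z a : HomCoord,
    (∀ t : ℝ, (z + t • a).2 ⬝ᵥ (z + t • a).1 ≠ 0) ∧ ofHomogeneous z = m ∧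
      ofHomogeneous (z + a) = m' ∧ a.1 = 0 := by
  have h1 : m.line.rep ⬝ᵥ m.point.rep ≠ 0 := m.2
  have h2 : m'.line.rep ⬝ᵥ m.point.rep ≠ 0 := by rw [h]; exact m'.2
  set q := m.point.rep with hq
  set p := (m.line.rep ⬝ᵥ q)⁻¹ • m.line.rep with hp
  set p' := (m'.line.rep ⬝ᵥ q)⁻¹ • m'.line.rep with hp'
  have e1 : p ⬝ᵥ q = 1 := by simp [hp, h1]
  have e2 : p' ⬝ᵥ q = 1 := by simp [hp', h2]
  refine ⟨(q, p), (0, p' - p), fun t => ?_, ?_, ?_, rfl⟩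
  · simp [e1, e2]
  · have := ofHomogeneous_smul (m.point.rep, m.line.rep) m.2 one_ne_zero (inv_ne_zero h1)
    rw [one_smul, ofHomogeneous_rep] at this
    exact this
  · have := ofHomogeneous_smul (m'.point.rep, m'.line.rep) m'.2 one_ne_zero (inv_ne_zero h2)
    rw [one_smul, ofHomogeneous_rep] at this
    have e : ((q, p) + (0, p' - p) : HomCoord) = (m'.point.rep, p') := by
      rw [← h]; simp [← hq]
    rw [e]
    exact this

theorem exists_segment_line (m m' : M4) (h : m.line = m'.line) : ∃ z a : HomCoord,
    (∀ t : ℝ, (z + t • a).2 ⬝ᵥ (z + t • a).1 ≠ 0) ∧ ofHomogeneous z = m ∧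
      ofHomogeneous (z + a) = m' ∧ a.2 = 0 := by
  have h1 : m.line.rep ⬝ᵥ m.point.rep ≠ 0 := m.2
  have h2 : m.line.rep ⬝ᵥ m'.point.rep ≠ 0 := by rw [h]; exact m'.2
  set p := m.line.rep with hp
  set q := (p ⬝ᵥ m.point.rep)⁻¹ • m.point.rep with hq
  set q' := (p ⬝ᵥ m'.point.rep)⁻¹ • m'.point.rep with hq'
  have e1 : p ⬝ᵥ q = 1 := by simp [hq, h1]
  have e2 : p ⬝ᵥ q' = 1 := by simp [hq', h2]
  refine ⟨(q, p), (q' - q, 0), fun t => ?_, ?_, ?_, rfl⟩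
  · simp [e1, e2]
  · have := ofHomogeneous_smul (m.point.rep, m.line.rep) m.2 (inv_ne_zero h1) one_ne_zero
    rw [one_smul, ofHomogeneous_rep] at this
    exact this
  · have := ofHomogeneous_smul (m'.point.rep, m'.line.rep) m'.2 (inv_ne_zero h2) one_ne_zero
    rw [one_smul, ofHomogeneous_rep] at this
    have e : ((q, p) + (q' - q, 0) : HomCoord) = (q', m'.line.rep) := by
      rw [← h]; simp [← hp]
    rw [e]
    exact this

namespace IsModelFoliation

variable {π : E4 →L[ℝ] (Fin 2 → ℝ)} {D : ∀ m : M4, Submodule ℝ (TangentSpace I4 m)} {f : M4 → RP2}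
  (H : IsModelFoliation π D f)
include H

/-- Along a tangent curve the transverse coordinates have zero derivative, so f is locally constant
along it, and ℝ is connected. -/
theorem eq_of_tangent {γ : ℝ → M4} (hγ : ContMDiff 𝓘(ℝ, ℝ) I4 ∞ γ)
    (ht : ∀ t, mfderiv 𝓘(ℝ, ℝ) I4 γ t (1 : ℝ) ∈ D (γ t)) (s t : ℝ) : f (γ s) = f (γ t) := by
  have hloc : IsLocallyConstant (f ∘ γ) := by
    rw [IsLocallyConstant.iff_eventually_eq]
    intro t₀
    set c := γ t₀ with hc
    have hW : IsOpen (γ ⁻¹' (extChartAt I4 c).source) :=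
      (isOpen_extChartAt_source c).preimage hγ.continuous
    obtain ⟨ε, hε, hb⟩ := Metric.isOpen_iff.1 hW t₀ (mem_extChartAt_source c)
    have hd (τ : ℝ) (hτ : τ ∈ Metric.ball t₀ ε) :
        HasDerivAt (fun τ => π (extChartAt I4 c (γ τ))) 0 τ := by
      have h1 : MDifferentiableAt I4 𝓘(ℝ, E4) (extChartAt I4 c) (γ τ) :=
        mdifferentiableAt_extChartAt (mem_chartAt_source (hb hτ))
      have h2 : MDifferentiableAt 𝓘(ℝ, ℝ) I4 γ τ := (hγ τ).mdifferentiableAt (by simp)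
      have h3 : HasFDerivAt (extChartAt I4 c ∘ γ)
          (chartD c (γ τ) ∘L (mfderiv 𝓘(ℝ, ℝ) I4 γ τ : ℝ →L[ℝ] E4)) τ :=
        (h1.hasMFDerivAt.comp τ h2.hasMFDerivAt).hasFDerivAt
      have h4 := (π.hasFDerivAt.comp τ h3).hasDerivAt
      have h5 : π (chartD c (γ τ) (mfderiv 𝓘(ℝ, ℝ) I4 γ τ (1 : ℝ))) = 0 :=
        (H.chart_iff c _ (hb hτ) _).2 ((H.mem_iff _ _).1 (ht τ))
      exact h4.congr_deriv h5
    filter_upwards [Metric.ball_mem_nhds t₀ hε] with τ hτ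
    refine (H.fibre_iff c _ _ (hb hτ) (mem_extChartAt_source c)).2 ?_
    exact Metric.isOpen_ball.is_const_of_deriv_eq_zero (convex_ball t₀ ε).isPreconnected
      (fun x hx => (hd x hx).differentiableAt.differentiableWithinAt)
      (fun x hx => (hd x hx).deriv) hτ (Metric.mem_ball_self hε)
  exact hloc.apply_eq_of_preconnectedSpace s t

theorem leaf_eq (hseg : ∀ m m' : M4, f m = f m' → ∃ z a : HomCoord,
      (∀ t : ℝ, (z + t • a).2 ⬝ᵥ (z + t • a).1 ≠ 0) ∧ ofHomogeneous z = m ∧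
      ofHomogeneous (z + a) = m' ∧ ∀ t : ℝ, π (dPi (z + t • a) a : E4) = 0) (m : M4) :
    leaf D m = f ⁻¹' {f m} := by
  ext m'
  constructor
  · rintro ⟨γ, hγ, h0, h1, ht⟩
    have := H.eq_of_tangent hγ ht 1 0
    rwa [h0, h1] at this
  · intro hm'
    obtain ⟨z, a, hr, h0, h1, hπ⟩ := hseg m m' (Eq.symm hm')
    obtain ⟨hs, hd⟩ := contMDiff_segment z a hr
    -- The segment through homogeneous coordinates is a smooth curve defined for all times, as
    -- `leaf` requires.
    refine ⟨_, hs, by simp [h0], by simp [h1], fun t => (H.mem_iff _ _).2 ?_⟩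
    rw [hd]
    exact hπ t

theorem isSubmanifold_fibre (y : RP2) : IsSubmanifold (f ⁻¹' {y}) 2 D := by
  intro m hm
  have hm' : f m = y := hm
  have hs (x : M4) (hx : x ∈ (extChartAt I4 m).source) :
      HasMFDerivAt I4 𝓘(ℝ, Fin 2 → ℝ) (fun x => π (extChartAt I4 m x)) x (π ∘L chartD m x) :=
    π.hasFDerivAt.hasMFDerivAt.comp x
      (mdifferentiableAt_extChartAt (mem_chartAt_source hx)).hasMFDerivAt
  refine ⟨(extChartAt I4 m).source, isOpen_extChartAt_source m, mem_extChartAt_source m,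
    fun x => π (extChartAt I4 m x), ?_, fun x hx => ⟨?_, ?_, fun _ => ?_⟩⟩
  · exact fun x hx => (π.contDiff.contMDiff.contMDiffAt.comp x
      (contMDiffAt_extChartAt' (mem_chartAt_source hx))).contMDiffWithinAt
  · rw [(hs x hx).mfderiv]
    exact H.surjective.comp (chartD_surjective hx)
  · rw [← H.fibre_iff m x m hx (mem_extChartAt_source m), hm']
    rfl
  · rw [(hs x hx).mfderiv]
    exact Submodule.ext fun v => (H.mem_iff x v).trans (H.chart_iff m x hx v).symm

theorem isTotallyGeodesic_fibre (hgeo : ∀ (γ : ℝ → M4) (J : Set ℝ), IsOpen J → (0 : ℝ) ∈ J →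
      IsGeodesicOn dancingMetric γ J → π (mfderiv 𝓘(ℝ, ℝ) I4 γ 0 (1 : ℝ) : E4) = 0 →
      ∀ᶠ t in 𝓝 (0 : ℝ), π (extChartAt I4 (γ 0) (γ t)) = π (extChartAt I4 (γ 0) (γ 0)))
    (y : RP2) : IsTotallyGeodesic dancingMetric (f ⁻¹' {y}) D := by
  intro γ J hJ h0 hγ hy hv
  have hc : ContinuousAt γ 0 := (hγ.1.continuousOn 0 h0).continuousAt (hJ.mem_nhds h0)
  filter_upwards [hgeo γ J hJ h0 hγ ((H.mem_iff _ _).1 hv),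
    hc.preimage_mem_nhds (extChartAt_source_mem_nhds (I := I4) (γ 0))] with t ht hs
  exact ((H.fibre_iff (γ 0) _ _ hs (mem_extChartAt_source _)).2 ht).trans hy

end IsModelFoliation

theorem eq_of_forall_ins (k : Fin 3) {x y : Fin 2 → ℝ} (h : ∀ i, ins k x i = ins k y i) : x = y := by
  funext j
  simpa using h (k.succAbove j)

/-- Apply the constancy of stationary affine functions to the three coordinate forms. -/
theorem geodesic_point_const {γ : ℝ → M4} {J : Set ℝ} (hJ : IsOpen J) (h0 : (0 : ℝ) ∈ J)
    (hγ : IsGeodesicOn dancingMetric γ J) (hv : (mfderiv 𝓘(ℝ, ℝ) I4 γ 0 (1 : ℝ) : E4).1 = 0) :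
    ∀ᶠ t in 𝓝 (0 : ℝ), (extChartAt I4 (γ 0) (γ t)).1 = (extChartAt I4 (γ 0) (γ 0)).1 := by
  have h (i : Fin 3) := (geodesic_affine_const hJ h0 hγ (Pi.single i 1)).1 (by rw [hv]; simp)
  filter_upwards [eventually_all.2 h] with t ht
  refine eq_of_forall_ins (RP2.chartIndex (γ 0).point) fun i => ?_
  simpa using ht i

theorem geodesic_line_const {γ : ℝ → M4} {J : Set ℝ} (hJ : IsOpen J) (h0 : (0 : ℝ) ∈ J)
    (hγ : IsGeodesicOn dancingMetric γ J) (hv : (mfderiv 𝓘(ℝ, ℝ) I4 γ 0 (1 : ℝ) : E4).2 = 0) :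
    ∀ᶠ t in 𝓝 (0 : ℝ), (extChartAt I4 (γ 0) (γ t)).2 = (extChartAt I4 (γ 0) (γ 0)).2 := by
  have h (i : Fin 3) := (geodesic_affine_const hJ h0 hγ (Pi.single i 1)).2 (by rw [hv]; simp)
  filter_upwards [eventually_all.2 h] with t ht
  refine eq_of_forall_ins (RP2.chartIndex (γ 0).line) fun i => ?_
  simpa using ht i

/-! ### Local triviality -/

/-- A fibre coordinate of `M⁴ → RP²` over the affine chart `k`. -/
noncomputable def fibreCoord (k : Fin 3) (m : M4) : Fin 2 → ℝ := fun j =>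
  m.line.rep (k.succAbove j) * m.point.rep k / (m.line.rep ⬝ᵥ m.point.rep)

theorem fibreCoord_ofHomogeneous (k : Fin 3) (z : HomCoord) (hz : z.2 ⬝ᵥ z.1 ≠ 0) :
    fibreCoord k (ofHomogeneous z) = fun j => z.2 (k.succAbove j) * z.1 k / (z.2 ⬝ᵥ z.1) := by
  funext j
  simp only [fibreCoord, point_ofHomogeneous z hz, line_ofHomogeneous z hz]
  obtain ⟨a, ha, h⟩ := RP2.rep_mk z.1 (fun h0 => hz (by simp [h0]))
  obtain ⟨b, hb, h'⟩ := RP2.rep_mk z.2 (fun h0 => hz (by simp [h0]))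
  rw [h, h']
  simp only [Pi.smul_apply, smul_eq_mul, smul_dotProduct, dotProduct_smul]
  field_simp

theorem continuous_fibreCoord (k : Fin 3) : Continuous (fibreCoord k) := by
  rw [continuous_iff_continuousAt]
  intro m
  obtain ⟨z, hz, rfl⟩ := exists_normalized m
  have hz' : z.2 ⬝ᵥ z.1 ≠ 0 := by rw [hz]; exact one_ne_zero
  refine (contMDiffAt_of_comp_ofHomogeneous (J := 𝓘(ℝ, Fin 2 → ℝ)) hz' ?_).continuousAt
  have h : ContDiffAt ℝ ∞
      (fun z : HomCoord => fun j => z.2 (k.succAbove j) * z.1 k / (z.2 ⬝ᵥ z.1)) z := by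
    have h1 (i : Fin 3) : ContDiffAt ℝ ∞ (fun z : HomCoord => z.1 i) z :=
      ((contDiff_apply ℝ ℝ i).comp contDiff_fst).contDiffAt
    have h2 (i : Fin 3) : ContDiffAt ℝ ∞ (fun z : HomCoord => z.2 i) z :=
      ((contDiff_apply ℝ ℝ i).comp contDiff_snd).contDiffAt
    refine contDiffAt_pi.2 fun j => ((h2 _).mul (h1 _)).div ?_ hz'
    simp only [dotProduct]
    exact ContDiffAt.sum fun i _ => (h2 i).mul (h1 i)
  refine h.contMDiffAt.congr_of_eventuallyEq ?_
  filter_upwards [isOpen_regular.mem_nhds hz'] with w hw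
  exact fibreCoord_ofHomogeneous k w hw

/-- Homogeneous coordinates of a pair with given point and fibre coordinate. -/
noncomputable def fibrePair (k : Fin 3) (x w : Fin 2 → ℝ) : HomCoord :=
  (ins k x, k.insertNth (α := fun _ => ℝ) (1 - w ⬝ᵥ x) w)

theorem fibrePair_dotProduct (k : Fin 3) (x w : Fin 2 → ℝ) :
    (fibrePair k x w).2 ⬝ᵥ (fibrePair k x w).1 = 1 := by
  simp only [fibrePair, dotProduct]
  rw [Fin.sum_univ_succAbove _ k]
  simp

theorem fibrePair_regular (k : Fin 3) (x w : Fin 2 → ℝ) :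
    (fibrePair k x w).2 ⬝ᵥ (fibrePair k x w).1 ≠ 0 := by
  rw [fibrePair_dotProduct]; exact one_ne_zero

theorem continuous_fibrePair (k : Fin 3) : Continuous fun y : (Fin 2 → ℝ) × (Fin 2 → ℝ) =>
    ofHomogeneous (fibrePair k y.1 y.2) := by
  rw [continuous_iff_continuousAt]
  intro y
  refine (contMDiffAt_ofHomogeneous _ (fibrePair_regular k y.1 y.2)).continuousAt.comp
    (f := fun y : (Fin 2 → ℝ) × (Fin 2 → ℝ) => fibrePair k y.1 y.2) ?_
  refine Continuous.continuousAt (Continuous.prodMk ?_ ?_)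
  · exact (contDiff_ins k (n := 0)).continuous.comp continuous_fst
  · exact Continuous.finInsertNth (A := fun _ => ℝ) k
      (continuous_const.sub (continuous_snd.dotProduct continuous_fst)) continuous_snd

theorem continuousOn_fibrePair (k : Fin 3) : ContinuousOn
    (fun y : RP2 × (Fin 2 → ℝ) => ofHomogeneous (fibrePair k (RP2.affineCoord k y.1) y.2))
    ({q : RP2 | q.rep k ≠ 0} ×ˢ univ) := by
  have h1 : ContinuousOn (fun y : RP2 × (Fin 2 → ℝ) => RP2.affineCoord k y.1)
      ({q : RP2 | q.rep k ≠ 0} ×ˢ univ) :=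
    (RP2.continuousOn_affineCoord k).comp continuousOn_fst mapsTo_fst_prod
  have h2 : ContinuousOn (fun y : RP2 × (Fin 2 → ℝ) => y.2)
      ({q : RP2 | q.rep k ≠ 0} ×ˢ univ) := continuousOn_snd
  have h3 := (continuous_fibrePair k).comp_continuousOn (h1.prodMk h2)
  rwa [Function.comp_def] at h3

/-- The local trivialization of `M⁴ → RP²` over the affine chart `k`. -/
noncomputable def pointTrivialization (k : Fin 3) : Bundle.Trivialization (Fin 2 → ℝ) point where
  toFun m := (m.point, fibreCoord k m)
  invFun y := ofHomogeneous (fibrePair k (RP2.affineCoord k y.1) y.2)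
  source := point ⁻¹' {q : RP2 | q.rep k ≠ 0}
  target := {q : RP2 | q.rep k ≠ 0} ×ˢ univ
  baseSet := {q : RP2 | q.rep k ≠ 0}
  map_source' m hm := ⟨show m.point.rep k ≠ 0 from hm, mem_univ _⟩
  map_target' y _ := ((rep_ofHomogeneous_ne _ (fibrePair_regular k _ _) k k).1).2 (by
    simp [fibrePair])
  left_inv' m hm := by
    have hm' : m.point.rep k ≠ 0 := hm
    have hd : m.line.rep ⬝ᵥ m.point.rep ≠ 0 := m.2
    -- Normalise q_k = 1 and pq = 1. The coordinates p_j with j ≠ k form the free vector w, and p_k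
    -- = 1 − w · x is forced, so the fibre is an affine plane.
    have e : fibrePair k (RP2.affineCoord k m.point) (fibreCoord k m) =
        ((m.point.rep k)⁻¹ • m.point.rep,
          (m.point.rep k / (m.line.rep ⬝ᵥ m.point.rep)) • m.line.rep) := by
      refine Prod.ext (RP2.insertNth_affineCoord k m.point hm') ?_
      funext i
      refine Fin.succAboveCases k ?_ (fun j => ?_) i
      · simp only [fibrePair, Fin.insertNth_apply_same, Pi.smul_apply, smul_eq_mul]
        have h := Fin.sum_univ_succAbove (fun i => m.line.rep i * m.point.rep i) k
        have h' : fibreCoord k m ⬝ᵥ RP2.affineCoord k m.point =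
            (m.line.rep ⬝ᵥ m.point.rep - m.line.rep k * m.point.rep k) /
              (m.line.rep ⬝ᵥ m.point.rep) := by
          simp only [dotProduct] at h ⊢
          rw [h, add_sub_cancel_left, Finset.sum_div, ← h]
          refine Finset.sum_congr rfl fun j _ => ?_
          simp only [fibreCoord, RP2.affineCoord, dotProduct]
          field_simp
        rw [h']
        field_simp
        ring
      · simp [fibrePair, fibreCoord]
        ring
    show ofHomogeneous (fibrePair k (RP2.affineCoord k m.point) (fibreCoord k m)) = m
    rw [e]
    have := ofHomogeneous_smul (m.point.rep, m.line.rep) m.2 (inv_ne_zero hm') (div_ne_zero hm' hd)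
    rwa [ofHomogeneous_rep] at this
  right_inv' y hy := by
    refine Prod.ext ?_ ?_
    · show point _ = y.1
      rw [point_ofHomogeneous _ (fibrePair_regular k _ _)]
      exact RP2.affinePoint_affineCoord k y.1 hy.1
    · show fibreCoord k _ = y.2
      rw [fibreCoord_ofHomogeneous k _ (fibrePair_regular k _ _), fibrePair_dotProduct]
      funext j
      simp [fibrePair]
  open_source := (RP2.isOpen_source k).preimage (continuous_fst.comp continuous_subtype_val)
  open_target := (RP2.isOpen_source k).prod isOpen_univ
  open_baseSet := RP2.isOpen_source k
  continuousOn_toFun := ((continuous_fst.comp continuous_subtype_val).prodMk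
    (continuous_fibreCoord k)).continuousOn
  continuousOn_invFun := continuousOn_fibrePair k
  source_eq := rfl
  target_eq := rfl
  proj_toFun _ _ := rfl

/-- The exchange of points and lines. -/
def dual : M4 ≃ₜ M4 where
  toFun m := ⟨(m.1.2, m.1.1), fun h => m.2 ((dotProduct_comm _ _).trans h)⟩
  invFun m := ⟨(m.1.2, m.1.1), fun h => m.2 ((dotProduct_comm _ _).trans h)⟩
  left_inv _ := rfl
  right_inv _ := rfl
  continuous_toFun := (continuous_swap.comp continuous_subtype_val).subtype_mk _
  continuous_invFun := (continuous_swap.comp continuous_subtype_val).subtype_mk _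

/-- The local trivialization of `M⁴ → RP²*` over the affine chart `k`. -/
noncomputable def lineTrivialization (k : Fin 3) : Bundle.Trivialization (Fin 2 → ℝ) line :=
  (pointTrivialization k).compHomeomorph dual

theorem point_surjective : Function.Surjective point := fun q =>
  ⟨_, (pointTrivialization (RP2.chartIndex q)).proj_symm_apply' (x := 0)
    (show q.rep _ ≠ 0 from RP2.chartIndex_spec q)⟩

theorem contMDiff_point : ContMDiff I4 𝓘(ℝ, Fin 2 → ℝ) ∞ point :=
  contMDiff_fst.comp contMDiff_subtype_val

theorem contMDiff_line : ContMDiff I4 𝓘(ℝ, Fin 2 → ℝ) ∞ line :=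
  contMDiff_snd.comp contMDiff_subtype_val

theorem isDancingFoliation_point (vol : M4 → E4 [⋀^Fin 4]→ₗ[ℝ] ℝ)
    (hvol : ∀ m, IsOrientedVolume dancingMetric m (vol m)) :
    IsDancingFoliation dancingMetric vol lineDir point where
  distribution := isModelFoliation_point.isDistributionOn
  null m v hv w hw := by
    have hv' := (mem_lineDir_iff m v).1 hv
    have hw' := (mem_lineDir_iff m w).1 hw
    have := formG_proj₂ (RP2.chartIndex m.point) (RP2.chartIndex m.line) (extChartAt I4 m m) v w
    have e (v : E4) (hv : v.1 = 0) : proj₂ v = v := Prod.ext hv.symm rfl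
    rwa [e v hv', e w hw'] at this
  selfDual m := by
    obtain ⟨b, Hb, h⟩ := (isOrientedVolume_iff m _).1 (hvol m)
    rw [h]
    exact Hb.isSelfDualPlane_of_proj₁ _ fun v => (mem_lineDir_iff m v).trans
      ⟨fun h => Prod.ext h rfl, fun h => congrArg Prod.fst h⟩
  parallel := isModelFoliation_point.isParallelOn
  involutive := isModelFoliation_point.isInvolutive
  leaf_eq := isModelFoliation_point.leaf_eq fun m m' h => by
    obtain ⟨z, a, hr, h0, h1, ha⟩ := exists_segment_point m m' h
    refine ⟨z, a, hr, h0, h1, fun t => ?_⟩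
    rw [dPi_apply _ _ (hr t), ha]
    exact (affineDeriv _ _).map_zero
  fibres y := ⟨point_surjective y, isModelFoliation_point.isSubmanifold_fibre y,
    isModelFoliation_point.isTotallyGeodesic_fibre
      (fun _ _ hJ h0 hγ hv => geodesic_point_const hJ h0 hγ hv) y⟩
  fibration := ⟨contMDiff_point, fun m => by
    rw [(hasMFDerivAt_point m).mfderiv]; exact Prod.fst_surjective,
    fun y => ⟨pointTrivialization (RP2.chartIndex y), show y.rep _ ≠ 0 from RP2.chartIndex_spec y⟩⟩

theorem line_surjective : Function.Surjective line := fun p =>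
  (point_surjective p).imp' dual fun _ h => h

theorem isDancingFoliation_line (vol : M4 → E4 [⋀^Fin 4]→ₗ[ℝ] ℝ)
    (hvol : ∀ m, IsOrientedVolume dancingMetric m (vol m)) :
    IsDancingFoliation dancingMetric vol pointDir line where
  distribution := isModelFoliation_line.isDistributionOn
  null m v hv w hw := by
    have hv' := (mem_pointDir_iff m v).1 hv
    have hw' := (mem_pointDir_iff m w).1 hw
    have := formG_proj₁ (RP2.chartIndex m.point) (RP2.chartIndex m.line) (extChartAt I4 m m) v w
    have e (v : E4) (hv : v.2 = 0) : proj₁ v = v := Prod.ext rfl hv.symm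
    rwa [e v hv', e w hw'] at this
  selfDual m := by
    obtain ⟨b, Hb, h⟩ := (isOrientedVolume_iff m _).1 (hvol m)
    rw [h]
    exact Hb.isSelfDualPlane_of_proj₂ _ fun v => (mem_pointDir_iff m v).trans
      ⟨fun h => Prod.ext rfl h, fun h => congrArg Prod.snd h⟩
  parallel := isModelFoliation_line.isParallelOn
  involutive := isModelFoliation_line.isInvolutive
  leaf_eq := isModelFoliation_line.leaf_eq fun m m' h => by
    obtain ⟨z, a, hr, h0, h1, ha⟩ := exists_segment_line m m' h
    refine ⟨z, a, hr, h0, h1, fun t => ?_⟩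
    rw [dPi_apply _ _ (hr t), ha]
    exact (affineDeriv _ _).map_zero
  fibres y := ⟨line_surjective y, isModelFoliation_line.isSubmanifold_fibre y,
    isModelFoliation_line.isTotallyGeodesic_fibre
      (fun _ _ hJ h0 hγ hv => geodesic_line_const hJ h0 hγ hv) y⟩
  fibration := ⟨contMDiff_line, fun m => by
    rw [(hasMFDerivAt_line m).mfderiv]; exact Prod.snd_surjective,
    fun y => ⟨lineTrivialization (RP2.chartIndex y), show y.rep _ ≠ 0 from RP2.chartIndex_spec y⟩⟩

theorem isCompl_pointDir_lineDir (m : M4) : IsCompl (pointDir m) (lineDir m) := by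
  rw [isModelFoliation_point.coe_eq, isModelFoliation_line.coe_eq]
  have h : IsCompl (LinearMap.ker (ContinuousLinearMap.snd ℝ (Fin 2 → ℝ) (Fin 2 → ℝ)).toLinearMap)
      (LinearMap.ker (ContinuousLinearMap.fst ℝ (Fin 2 → ℝ) (Fin 2 → ℝ)).toLinearMap) := by
    refine isCompl_iff.2 ⟨Submodule.disjoint_def.2 fun v hs hp => Prod.ext hp hs,
      codisjoint_iff.2 (eq_top_iff.2 fun v _ => Submodule.mem_sup.2 ?_)⟩
    exact ⟨(v.1, 0), rfl, (0, v.2), rfl, Prod.ext (add_zero _) (zero_add _)⟩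
  exact h

end M4

/-! ### Submanifolds from rescaled equations; the incidence variety -/

/-- A set with local defining functions, one for each of its points, which differ by invertible
factors, is a submanifold. -/
theorem isSubmanifold_of_scaling {E : Type*} [NormedAddCommGroup E] [NormedSpace ℝ E]
    {H : Type*} [TopologicalSpace H] {I : ModelWithCorners ℝ E H}
    {M : Type*} [TopologicalSpace M] [ChartedSpace H M] {S : Set M} {k : ℕ}
    (F : M → M → Fin k → ℝ) (U : M → Set M)
    (hU : ∀ c ∈ S, IsOpen (U c) ∧ c ∈ U c)
    (hs : ∀ c ∈ S, ContMDiffOn I 𝓘(ℝ, Fin k → ℝ) ∞ (F c) (U c))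
    (hd : ∀ c ∈ S, ∀ x ∈ U c, Function.Surjective (mfderiv I 𝓘(ℝ, Fin k → ℝ) (F c) x))
    (hz : ∀ c ∈ S, ∀ x ∈ U c, x ∈ S ↔ F c x = 0)
    (hr : ∀ c ∈ S, ∀ x ∈ U c, ∃ r : M → Fin k → ℝ, MDifferentiableAt I 𝓘(ℝ, Fin k → ℝ) r x ∧
      (∀ i, r x i ≠ 0) ∧ F c =ᶠ[𝓝 x] r * F x) :
    IsSubmanifold S k fun x => LinearMap.ker (mfderiv I 𝓘(ℝ, Fin k → ℝ) (F x) x).toLinearMap := by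
  intro c hc
  refine ⟨U c, (hU c hc).1, (hU c hc).2, F c, hs c hc, fun x hx => ⟨hd c hc x hx, ?_, fun hxS => ?_⟩⟩
  · rw [hz c hc x hx, (hz c hc c (hU c hc).2).1 hc]
  · obtain ⟨r, hrd, hr0, he⟩ := hr c hc x hx
    have hx' := (hU x hxS).2
    have h1 : MDifferentiableAt I 𝓘(ℝ, Fin k → ℝ) (F x) x :=
      ((hs x hxS).contMDiffAt ((hU x hxS).1.mem_nhds hx')).mdifferentiableAt (by simp)
    have h3 : F x x = 0 := (hz x hxS x hx').1 hxS
    obtain ⟨A, hA⟩ : ∃ A : E →L[ℝ] (Fin k → ℝ), HasMFDerivAt I 𝓘(ℝ, Fin k → ℝ) (F x) x A :=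
      ⟨_, h1.hasMFDerivAt⟩
    obtain ⟨B, hB⟩ : ∃ B : E →L[ℝ] (Fin k → ℝ), HasMFDerivAt I 𝓘(ℝ, Fin k → ℝ) r x B :=
      ⟨_, hrd.hasMFDerivAt⟩
    -- On S the function F x vanishes at x, so the product rule leaves only r · dF. As r has no zero
    -- component the kernel is unchanged, and the tangent spaces fit together.
    have h2 := (hB.mul hA).congr_of_eventuallyEq he
    have h4 : LinearMap.ker A.toLinearMap =
        LinearMap.ker (r x • A + F x x • B : E →L[ℝ] (Fin k → ℝ)).toLinearMap := by
      ext v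
      rw [h3, zero_smul, add_zero, LinearMap.mem_ker, LinearMap.mem_ker]
      refine funext_iff.trans (Iff.trans ?_ funext_iff.symm)
      exact forall_congr' fun i => (mul_eq_zero_iff_left (hr0 i)).symm
    exact (congrArg (fun L : E →L[ℝ] (Fin k → ℝ) => LinearMap.ker L.toLinearMap) hA.mfderiv).trans
      (h4.trans (congrArg (fun L : E →L[ℝ] (Fin k → ℝ) => LinearMap.ker L.toLinearMap)
        h2.mfderiv).symm)

namespace M4

theorem prod_extChartAt_apply (c x : RP2 × RP2Dual) : extChartAt I4 c x =
    (RP2.affineCoord (RP2.chartIndex c.1) x.1, RP2.affineCoord (RP2.chartIndex c.2) x.2) := rfl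

theorem prod_extChartAt_source (c : RP2 × RP2Dual) : (extChartAt I4 c).source =
    {x | x.1.rep (RP2.chartIndex c.1) ≠ 0 ∧ x.2.rep (RP2.chartIndex c.2) ≠ 0} := by
  rw [_root_.extChartAt_source]
  rfl

theorem ins_affineCoord (k : Fin 3) (q : RP2) (hq : q.rep k ≠ 0) :
    ins k (RP2.affineCoord k q) = (q.rep k)⁻¹ • q.rep := RP2.insertNth_affineCoord k q hq

theorem isClosed_incident : IsClosed {x : RP2 × RP2Dual | Incident x} :=
  isOpen_compl_iff.1 isOpen_nonIncident

theorem eq_zero_of_dotProduct_ins₀_of_ins (k : Fin 3) (n : Fin 3 → ℝ) (x : Fin 2 → ℝ)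
    (h : ∀ u, n ⬝ᵥ ins₀ k u = 0) (h0 : n ⬝ᵥ ins k x = 0) : n = 0 :=
  eq_zero_of_dotProduct_ins₀ k (ins k x) n (by simp) h0 h

/-- The differential of `p q` in the chart `(k, l)` only vanishes where `p q = 1`. -/
theorem exists_formA_ne_zero (k l : Fin 3) (x : E4) (hx : funF k l x ≠ 1) :
    ∃ u, (formA₁ k l x + formA₂ k l x) u ≠ 0 := by
  by_contra! h
  have h1 (u : Fin 2 → ℝ) : ins l x.2 ⬝ᵥ ins₀ k u = 0 := by
    have := h (u, 0)
    rw [add_apply, formA₁_apply, formA₂_apply] at this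
    simpa using this
  have e : ins l x.2 = Pi.single k (ins l x.2 k) := by
    funext i
    refine Fin.succAboveCases k (by simp) (fun j => ?_) i
    have := h1 (Pi.single j 1)
    rw [dotProduct, Fin.sum_univ_succAbove _ k] at this
    simpa [Pi.single_apply] using this
  have hkl : ins l x.2 k = 1 := by
    have h2 := congrFun e l
    rw [ins_apply_same, Pi.single_apply] at h2
    split_ifs at h2 with h3
    · rw [← h2]
    · exact absurd h2 one_ne_zero
  apply hx
  rw [funF, e, single_dotProduct, hkl, ins_apply_same, one_mul]

theorem surjective_pi_of_ne_zero {φ : E4 →L[ℝ] ℝ} {u : E4} (hu : φ u ≠ 0) :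
    Function.Surjective (ContinuousLinearMap.pi fun _ : Fin 1 => φ) := fun t =>
  ⟨(t 0 / φ u) • u, funext fun i => by
    rw [Subsingleton.elim i 0]
    exact (map_smul φ _ u).trans (div_mul_cancel₀ _ hu)⟩

theorem funF_extChartAt (c x : RP2 × RP2Dual) (hx : x ∈ (extChartAt I4 c).source) :
    funF (RP2.chartIndex c.1) (RP2.chartIndex c.2) (extChartAt I4 c x) =
      (x.2.rep (RP2.chartIndex c.2))⁻¹ * ((x.1.rep (RP2.chartIndex c.1))⁻¹ *
        (x.2.rep ⬝ᵥ x.1.rep)) := by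
  rw [prod_extChartAt_source] at hx
  rw [prod_extChartAt_apply, funF, ins_affineCoord _ _ hx.1, ins_affineCoord _ _ hx.2,
    smul_dotProduct, dotProduct_smul, smul_eq_mul, smul_eq_mul]

theorem isSubmanifold_incident : ∃ T : ∀ x : RP2 × RP2Dual, Submodule ℝ (TangentSpace I4 x),
    IsSubmanifold {x : RP2 × RP2Dual | Incident x} 1 T := by
  let f : RP2 × RP2Dual → RP2 × RP2Dual → ℝ := fun c x =>
    funF (RP2.chartIndex c.1) (RP2.chartIndex c.2) (extChartAt I4 c x)
  have hz (c x : RP2 × RP2Dual) (hx : x ∈ (extChartAt I4 c).source) : Incident x ↔ f c x = 0 := by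
    rw [show f c x = _ from funF_extChartAt c x hx]
    rw [prod_extChartAt_source] at hx
    simp [Incident, hx.1, hx.2]
  have hs' (c x : RP2 × RP2Dual) (hx : x ∈ (extChartAt I4 c).source) :
      x ∈ (chartAt (ModelProd (Fin 2 → ℝ) (Fin 2 → ℝ)) c).source := by
    rwa [_root_.extChartAt_source] at hx
  have hsm (c x : RP2 × RP2Dual) (hx : x ∈ (extChartAt I4 c).source) {G : Type}
      [NormedAddCommGroup G] [NormedSpace ℝ G] (φ : E4 → G) (hφ : ContDiff ℝ ∞ φ) :
      ContMDiffAt I4 𝓘(ℝ, G) ∞ (fun x => φ (extChartAt I4 c x)) x :=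
    hφ.contMDiff.contMDiffAt.comp x (contMDiffAt_extChartAt' (hs' c x hx))
  refine ⟨_, isSubmanifold_of_scaling (I := I4) (fun c x _ => f c x)
      -- The differential of pq in a chart can vanish only where pq = 1. Removing that level set
      -- makes pq a submersion and keeps the incident pairs, where pq = 0.
      (fun c : RP2 × RP2Dual => (extChartAt I4 c).source ∩ f c ⁻¹' {1}ᶜ) (fun c hc => ⟨?_, ?_⟩) (fun c hc => ?_)
    (fun c hc x hx => ?_) (fun c hc x hx => ?_) (fun c hc x hx => ?_)⟩
  · refine ContinuousOn.isOpen_inter_preimage ?_ (isOpen_extChartAt_source c)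
      isOpen_compl_singleton
    exact fun x hx => (hsm c x hx _ (contDiff_funF _ _)).continuousAt.continuousWithinAt
  · refine ⟨mem_extChartAt_source c, ?_⟩
    have h1 : f c c = 0 := (hz c c (mem_extChartAt_source c)).1 hc
    show f c c ≠ 1
    rw [h1]
    exact zero_ne_one
  · exact fun x hx => (hsm c x hx.1 (fun x _ => funF _ _ x)
      (contDiff_pi.2 fun _ => contDiff_funF _ _)).contMDiffWithinAt
  · obtain ⟨u, hu⟩ := exists_formA_ne_zero _ _ _ hx.2
    have h1 : HasFDerivAt (fun y (_ : Fin 1) => funF (RP2.chartIndex c.1) (RP2.chartIndex c.2) y)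
      (ContinuousLinearMap.pi fun _ : Fin 1 => formA₁ _ _ _ + formA₂ _ _ _) (extChartAt I4 c x) :=
      hasFDerivAt_pi.2 fun _ => hasFDerivAt_funF _ _ _
    have h2 := (mdifferentiableAt_extChartAt (I := I4) (hs' c x hx.1)).hasMFDerivAt
    have h3 := h1.hasMFDerivAt.comp x h2
    rw [show mfderiv I4 𝓘(ℝ, Fin 1 → ℝ) (fun (x : RP2 × RP2Dual) (_ : Fin 1) => f c x) x = _ from
      h3.mfderiv]
    exact (surjective_pi_of_ne_zero hu).comp (isInvertible_mfderiv_extChartAt hx.1).surjective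
  · exact (hz c x hx.1).trans (by simp [funext_iff])
  · have hx1 := hx.1
    rw [prod_extChartAt_source] at hx1
    -- The equations pq = 0 in two charts differ by the factor that renormalises q and p from one
    -- chart to the other.
    refine ⟨fun y _ => ins (RP2.chartIndex c.1) (extChartAt I4 c y).1 (RP2.chartIndex x.1) *
      ins (RP2.chartIndex c.2) (extChartAt I4 c y).2 (RP2.chartIndex x.2), ?_, fun _ => ?_, ?_⟩
    · refine (hsm c x hx.1 (fun z (_ : Fin 1) => ins _ z.1 (RP2.chartIndex x.1) *
        ins _ z.2 (RP2.chartIndex x.2)) ?_).mdifferentiableAt (by simp)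
      refine contDiff_pi.2 fun _ => ContDiff.mul ?_ ?_
      · exact (contDiff_apply ℝ ℝ _).comp ((contDiff_ins _).comp contDiff_fst)
      · exact (contDiff_apply ℝ ℝ _).comp ((contDiff_ins _).comp contDiff_snd)
    · beta_reduce
      rw [prod_extChartAt_apply, ins_affineCoord _ _ hx1.1, ins_affineCoord _ _ hx1.2]
      simp only [Pi.smul_apply, smul_eq_mul]
      exact mul_ne_zero (mul_ne_zero (inv_ne_zero hx1.1) (RP2.chartIndex_spec _))
        (mul_ne_zero (inv_ne_zero hx1.2) (RP2.chartIndex_spec _))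
    · filter_upwards [(isOpen_extChartAt_source (I := I4) c).mem_nhds hx.1,
        extChartAt_source_mem_nhds (I := I4) x] with y hy hy'
      funext i
      have e1 : f c y = _ := funF_extChartAt c y hy
      have e2 : f x y = _ := funF_extChartAt x y hy'
      rw [Pi.mul_apply, Pi.mul_apply, e1, e2]
      rw [prod_extChartAt_source] at hy hy'
      have := hy'.1
      have := hy'.2
      rw [prod_extChartAt_apply, ins_affineCoord _ _ hy.1, ins_affineCoord _ _ hy.2]
      simp only [Pi.smul_apply, smul_eq_mul]
      field_simp

end M4

/-! ### The anti-self-dual surfaces Σ -/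

/-- In `ℝ³`, the common kernel of two independent linear forms is a line. -/
theorem exists_eq_smul_of_dotProduct {n₁ n₂ q u r : Fin 3 → ℝ} (h1 : n₁ ≠ 0) (hq1 : n₁ ⬝ᵥ q = 0)
    (hq2 : n₂ ⬝ᵥ q ≠ 0) (hu : u ≠ 0) (hu1 : n₁ ⬝ᵥ u = 0) (hu2 : n₂ ⬝ᵥ u = 0) (hr1 : n₁ ⬝ᵥ r = 0)
    (hr2 : n₂ ⬝ᵥ r = 0) : ∃ c : ℝ, r = c • u := by
  -- All three vectors lie in the plane n₁ = 0, so they are dependent. Applying n₂ removes q from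
  -- the relation.
  have hdet : (Matrix.of ![q, u, r]).det = 0 := by
    refine Matrix.exists_mulVec_eq_zero_iff.1 ⟨n₁, h1, funext fun i => ?_⟩
    fin_cases i
    · exact (dotProduct_comm _ _).trans hq1
    · exact (dotProduct_comm _ _).trans hu1
    · exact (dotProduct_comm _ _).trans hr1
  obtain ⟨v, hv, hv0⟩ := Matrix.exists_vecMul_eq_zero_iff.2 hdet
  have e : v 0 • q + v 1 • u + v 2 • r = 0 := by
    rw [← hv0]
    funext i
    simp [Matrix.vecMul, dotProduct, Fin.sum_univ_three]
  have v0 : v 0 = 0 := by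
    have := congrArg (n₂ ⬝ᵥ ·) e
    simp only [dotProduct_add, dotProduct_smul, hu2, hr2, dotProduct_zero] at this
    simpa [hq2] using this
  have v2 : v 2 ≠ 0 := by
    intro v2
    rw [v0, v2] at e
    have v1 : v 1 = 0 := by simpa [hu] using e
    exact hv (funext fun i => by fin_cases i <;> assumption)
  refine ⟨-(v 1 / v 2), ?_⟩
  rw [v0, zero_smul, zero_add, add_comm] at e
  rw [neg_smul, div_eq_inv_mul, mul_smul, ← smul_neg, eq_inv_smul_iff₀ v2]
  exact eq_neg_of_add_eq_zero_left e

/-- In `ℝ²`, the kernel of a non-zero linear form is a line. -/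
theorem exists_eq_smul_of_apply_eq_zero {φ : (Fin 2 → ℝ) →L[ℝ] ℝ} (hφ : φ ≠ 0) {u r : Fin 2 → ℝ}
    (hu : u ≠ 0) (hu1 : φ u = 0) (hr1 : φ r = 0) : ∃ c : ℝ, r = c • u := by
  have hker : Module.finrank ℝ (LinearMap.ker φ.toLinearMap) = 1 := by
    have h := Module.Dual.finrank_ker_add_one_of_ne_zero (f := φ.toLinearMap)
      (fun h => hφ (ContinuousLinearMap.coe_injective h))
    simpa using h
  obtain ⟨c, hc⟩ := (finrank_eq_one_iff_of_nonzero' (⟨u, hu1⟩ : LinearMap.ker φ.toLinearMap)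
    (fun h => hu (congrArg Subtype.val h))).1 hker ⟨r, hr1⟩
  exact ⟨c, (congrArg Subtype.val hc).symm⟩

theorem RP2.eq_of_rep_eq_smul {x y : RP2} {c : ℝ} (h : x.rep = c • y.rep) : x = y := by
  rw [← x.mk_rep, ← y.mk_rep]
  exact (Projectivization.mk_eq_mk_iff' ..).2 ⟨c, h.symm⟩

theorem incident_mk_left (q : Fin 3 → ℝ) (hq : q ≠ 0) (y : RP2Dual) :
    Incident (Projectivization.mk ℝ q hq, y) ↔ y.rep ⬝ᵥ q = 0 := by
  obtain ⟨a, ha, h⟩ := RP2.rep_mk q hq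
  simp [Incident, h, ha]

theorem incident_mk_right (p : Fin 3 → ℝ) (hp : p ≠ 0) (y : RP2) :
    Incident (y, Projectivization.mk ℝ p hp) ↔ p ⬝ᵥ y.rep = 0 := by
  obtain ⟨a, ha, h⟩ := RP2.rep_mk p hp
  simp [Incident, h, ha]

namespace M4

/-- Defining functions of `Σ`, in the affine charts `k`, `l`. -/
noncomputable def sigmaFun (k l : Fin 3) (x : RP2 × RP2Dual) (y : E4) : Fin 2 → ℝ :=
  ![x.2.rep ⬝ᵥ ins k y.1, x.1.rep ⬝ᵥ ins l y.2]

/-- The linear form `n · q` in the affine chart `k`. -/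
noncomputable def affineForm (k : Fin 3) (n : Fin 3 → ℝ) : (Fin 2 → ℝ) →L[ℝ] ℝ := dotL n ∘L insL k

theorem affineForm_apply (k : Fin 3) (n : Fin 3 → ℝ) (u : Fin 2 → ℝ) :
    affineForm k n u = n ⬝ᵥ ins₀ k u := dotL_apply _ _

/-- A form vanishing on the directions of an affine chart and also at one of its points vanishes on
all of ℝ³. -/
theorem affineForm_ne_zero {k : Fin 3} {n : Fin 3 → ℝ} {x : Fin 2 → ℝ} (hn : n ≠ 0)
    (h : n ⬝ᵥ ins k x = 0) : affineForm k n ≠ 0 := fun h0 =>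
  hn (eq_zero_of_dotProduct_ins₀_of_ins k n x (fun u => by
    rw [← affineForm_apply, h0]; rfl) h)

/-- The derivative of `sigmaFun`. -/
noncomputable def sigmaForm (k l : Fin 3) (x : RP2 × RP2Dual) : E4 →L[ℝ] (Fin 2 → ℝ) :=
  ContinuousLinearMap.pi ![affineForm k x.2.rep ∘L ContinuousLinearMap.fst ℝ _ _,
    affineForm l x.1.rep ∘L ContinuousLinearMap.snd ℝ _ _]

theorem sigmaForm_apply (k l : Fin 3) (x : RP2 × RP2Dual) (v : E4) :
    sigmaForm k l x v = ![affineForm k x.2.rep v.1, affineForm l x.1.rep v.2] := by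
  funext i
  fin_cases i <;> rfl

theorem sigmaFun_eq (k l : Fin 3) (x : RP2 × RP2Dual) :
    sigmaFun k l x = fun y => sigmaFun k l x 0 + sigmaForm k l x y := by
  have e (k : Fin 3) (n : Fin 3 → ℝ) (u : Fin 2 → ℝ) :
      n ⬝ᵥ ins k u = n ⬝ᵥ ins k 0 + affineForm k n u := by
    rw [affineForm_apply, ← dotProduct_add]
    congr 1
    funext i
    refine Fin.succAboveCases k ?_ (fun j => ?_) i <;> simp
  funext y i
  rw [sigmaForm_apply]
  fin_cases i
  · exact e k _ y.1
  · exact e l _ y.2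

theorem hasFDerivAt_sigmaFun (k l : Fin 3) (x : RP2 × RP2Dual) (y : E4) :
    HasFDerivAt (sigmaFun k l x) (sigmaForm k l x) y := by
  rw [sigmaFun_eq]
  exact (sigmaForm k l x).hasFDerivAt.const_add _

theorem contDiff_sigmaFun (k l : Fin 3) (x : RP2 × RP2Dual) : ContDiff ℝ ∞ (sigmaFun k l x) := by
  rw [sigmaFun_eq]
  exact contDiff_const.add (sigmaForm k l x).contDiff

theorem sigmaForm_surjective {k l : Fin 3} {x : RP2 × RP2Dual} {y : E4}
    (h : sigmaFun k l x y = 0) : Function.Surjective (sigmaForm k l x) := by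
  have h1 := affineForm_ne_zero x.2.rep_nonzero (congrFun h 0)
  have h2 := affineForm_ne_zero x.1.rep_nonzero (congrFun h 1)
  intro t
  obtain ⟨u, hu⟩ := LinearMap.surjective (f := (affineForm k x.2.rep).toLinearMap)
    (fun h => h1 (ContinuousLinearMap.coe_injective h)) (t 0)
  obtain ⟨v, hv⟩ := LinearMap.surjective (f := (affineForm l x.1.rep).toLinearMap)
    (fun h => h2 (ContinuousLinearMap.coe_injective h)) (t 1)
  refine ⟨(u, v), ?_⟩
  rw [sigmaForm_apply]
  funext i
  fin_cases i
  · exact hu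
  · exact hv

/-- The defining function of `Σ` near `c`. -/
noncomputable def sigmaDef (x : RP2 × RP2Dual) (c m : M4) : Fin 2 → ℝ :=
  sigmaFun (RP2.chartIndex c.point) (RP2.chartIndex c.line) x (extChartAt I4 c m)

theorem sigmaDef_eq (x : RP2 × RP2Dual) {c m : M4} (hm : m ∈ (extChartAt I4 c).source) :
    sigmaDef x c m = ![(m.point.rep (RP2.chartIndex c.point))⁻¹ * (x.2.rep ⬝ᵥ m.point.rep),
      (m.line.rep (RP2.chartIndex c.line))⁻¹ * (x.1.rep ⬝ᵥ m.line.rep)] := by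
  rw [extChartAt_source] at hm
  rw [sigmaDef, extChartAt_apply, sigmaFun, ins_affineCoord _ _ hm.1, ins_affineCoord _ _ hm.2,
    dotProduct_smul, dotProduct_smul, smul_eq_mul, smul_eq_mul]

theorem mem_sigmaSurface_iff (x : RP2 × RP2Dual) (m : M4) : m ∈ sigmaSurface x ↔
    x.2.rep ⬝ᵥ m.point.rep = 0 ∧ x.1.rep ⬝ᵥ m.line.rep = 0 := by
  rw [dotProduct_comm x.1.rep]
  rfl

theorem mem_sigmaSurface_iff_sigmaDef (x : RP2 × RP2Dual) {c m : M4}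
    (hm : m ∈ (extChartAt I4 c).source) : m ∈ sigmaSurface x ↔ sigmaDef x c m = 0 := by
  rw [sigmaDef_eq x hm, mem_sigmaSurface_iff]
  rw [extChartAt_source] at hm
  simp [hm.1, hm.2]

theorem contMDiffAt_comp_extChartAt {c m : M4} (hm : m ∈ (extChartAt I4 c).source) {G : Type}
    [NormedAddCommGroup G] [NormedSpace ℝ G] {φ : E4 → G} (hφ : ContDiff ℝ ∞ φ) :
    ContMDiffAt I4 𝓘(ℝ, G) ∞ (fun x => φ (extChartAt I4 c x)) m :=
  hφ.contMDiff.contMDiffAt.comp m (contMDiffAt_extChartAt' (mem_chartAt_source hm))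

theorem hasMFDerivAt_sigmaDef (x : RP2 × RP2Dual) {c m : M4}
    (hm : m ∈ (extChartAt I4 c).source) : HasMFDerivAt I4 𝓘(ℝ, Fin 2 → ℝ) (sigmaDef x c) m
      (sigmaForm (RP2.chartIndex c.point) (RP2.chartIndex c.line) x ∘L chartD c m) :=
  (hasFDerivAt_sigmaFun _ _ x (extChartAt I4 c m)).hasMFDerivAt.comp m
    (mdifferentiableAt_extChartAt (mem_chartAt_source hm)).hasMFDerivAt

/-- The tangent spaces of `Σ`. -/
noncomputable def sigmaTangent (x : RP2 × RP2Dual) (m : M4) : Submodule ℝ (TangentSpace I4 m) :=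
  LinearMap.ker (mfderiv I4 𝓘(ℝ, Fin 2 → ℝ) (sigmaDef x m) m).toLinearMap

theorem mem_sigmaTangent_iff (x : RP2 × RP2Dual) (m : M4) (v : E4) : v ∈ sigmaTangent x m ↔
    affineForm (RP2.chartIndex m.point) x.2.rep v.1 = 0 ∧
      affineForm (RP2.chartIndex m.line) x.1.rep v.2 = 0 := by
  have h := (hasMFDerivAt_sigmaDef x (mem_extChartAt_source (I := I4) m)).mfderiv
  have h1 : v ∈ sigmaTangent x m ↔ sigmaForm (RP2.chartIndex m.point) (RP2.chartIndex m.line) x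
      (chartD m m v) = 0 := by
    rw [sigmaTangent, h]
    rfl
  have h2 : chartD m m v = v :=
    congrArg (fun L : E4 →L[ℝ] E4 => L v) (mfderiv_extChartAt_self (I := I4) (x := m))
  rw [h1, h2, sigmaForm_apply]
  simp

theorem isSubmanifold_sigmaSurface (x : RP2 × RP2Dual) :
    IsSubmanifold (sigmaSurface x) 2 (sigmaTangent x) := by
  refine isSubmanifold_of_scaling (I := I4) (sigmaDef x) (fun c => (extChartAt I4 c).source)
    (fun c _ => ⟨isOpen_extChartAt_source c, mem_extChartAt_source c⟩) (fun c _ m hm => ?_)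
    (fun c hc m hm => ?_) (fun c _ m hm => mem_sigmaSurface_iff_sigmaDef x hm)
    (fun c _ m hm => ?_)
  · exact (contMDiffAt_comp_extChartAt hm (contDiff_sigmaFun _ _ x)).contMDiffWithinAt
  · rw [(hasMFDerivAt_sigmaDef x hm).mfderiv]
    exact (sigmaForm_surjective ((mem_sigmaSurface_iff_sigmaDef x
      (mem_extChartAt_source c)).1 hc)).comp (chartD_surjective hm)
  · have hm1 := hm
    rw [extChartAt_source] at hm1
    -- The factors by which the two defining functions change between charts: the new normalising
    -- coordinates of the point and of the line.
    let φ : E4 → Fin 2 → ℝ := fun y =>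
      ![ins (RP2.chartIndex c.point) y.1 (RP2.chartIndex m.point),
        ins (RP2.chartIndex c.line) y.2 (RP2.chartIndex m.line)]
    have hφ : ContDiff ℝ ∞ φ := by
      have h1 (k j : Fin 3) : ContDiff ℝ ∞ fun y : E4 => ins k y.1 j :=
        (contDiff_apply ℝ ℝ j).comp ((contDiff_ins k).comp contDiff_fst)
      have h2 (k j : Fin 3) : ContDiff ℝ ∞ fun y : E4 => ins k y.2 j :=
        (contDiff_apply ℝ ℝ j).comp ((contDiff_ins k).comp contDiff_snd)
      exact contDiff_pi.2 (Fin.forall_fin_two.2 ⟨h1 _ _, h2 _ _⟩)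
    have e (y : M4) (hy : y ∈ (extChartAt I4 c).source) : φ (extChartAt I4 c y) =
        ![(y.point.rep (RP2.chartIndex c.point))⁻¹ * y.point.rep (RP2.chartIndex m.point),
          (y.line.rep (RP2.chartIndex c.line))⁻¹ * y.line.rep (RP2.chartIndex m.line)] := by
      rw [extChartAt_source] at hy
      simp only [φ]
      rw [extChartAt_apply, ins_affineCoord _ _ hy.1, ins_affineCoord _ _ hy.2]
      rfl
    refine ⟨fun y => φ (extChartAt I4 c y),
      (contMDiffAt_comp_extChartAt hm hφ).mdifferentiableAt (by simp), fun i => ?_, ?_⟩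
    · beta_reduce
      rw [e m hm]
      fin_cases i
      · exact mul_ne_zero (inv_ne_zero hm1.1) (RP2.chartIndex_spec _)
      · exact mul_ne_zero (inv_ne_zero hm1.2) (RP2.chartIndex_spec _)
    · filter_upwards [(isOpen_extChartAt_source (I := I4) c).mem_nhds hm,
        extChartAt_source_mem_nhds (I := I4) m] with y hy hy'
      rw [Pi.mul_apply, sigmaDef_eq x hy, sigmaDef_eq x hy', e y hy]
      rw [extChartAt_source] at hy hy'
      have h1 := hy'.1
      have h2 := hy'.2
      refine funext (Fin.forall_fin_two.2 ⟨?_, ?_⟩) <;>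
        simp only [Pi.mul_apply, Matrix.cons_val_zero, Matrix.cons_val_one] <;> field_simp

/-- Σ is cut out by one affine function of the point and one of the line. Tangency says that both
are stationary, so both stay constant along the geodesic. -/
theorem isTotallyGeodesic_sigmaSurface (x : RP2 × RP2Dual) :
    IsTotallyGeodesic dancingMetric (sigmaSurface x) (sigmaTangent x) := by
  intro γ J hJ h0 hγ hy hv
  have hc : ContinuousAt γ 0 := (hγ.1.continuousOn 0 h0).continuousAt (hJ.mem_nhds h0)
  obtain ⟨hv1, hv2⟩ := (mem_sigmaTangent_iff x (γ 0) _).1 hv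
  rw [affineForm_apply] at hv1 hv2
  have hy0 := (mem_sigmaSurface_iff_sigmaDef x (mem_extChartAt_source (I := I4) (γ 0))).1 hy
  filter_upwards [(geodesic_affine_const hJ h0 hγ x.2.rep).1 hv1,
    (geodesic_affine_const hJ h0 hγ x.1.rep).2 hv2,
    hc.preimage_mem_nhds (extChartAt_source_mem_nhds (I := I4) (γ 0))] with t h1 h2 hs
  refine (mem_sigmaSurface_iff_sigmaDef x hs).2 (Eq.trans ?_ hy0)
  funext i
  fin_cases i
  · exact h1
  · exact h2

theorem affineForm_chart_ne_zero {x : RP2 × RP2Dual} {m : M4} (hm : m ∈ sigmaSurface x) :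
    affineForm (RP2.chartIndex m.point) x.2.rep ≠ 0 ∧
      affineForm (RP2.chartIndex m.line) x.1.rep ≠ 0 := by
  have h := (mem_sigmaSurface_iff_sigmaDef x (mem_extChartAt_source (I := I4) m)).1 hm
  exact ⟨affineForm_ne_zero x.2.rep_nonzero (congrFun h 0),
    affineForm_ne_zero x.1.rep_nonzero (congrFun h 1)⟩

/-- A vector tangent to `Σ`, vertical for the projection to `RP²`, which is dual to the equation of
the line `x.2`. -/
theorem exists_metric_eq_affineForm {x : RP2 × RP2Dual} (hx : Incident x) {m : M4}
    (hm : m ∈ sigmaSurface x) : ∃ w : E4, w.1 = 0 ∧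
      affineForm (RP2.chartIndex m.line) x.1.rep w.2 = 0 ∧
      ∀ v : E4, metricAt dancingMetric m w v = affineForm (RP2.chartIndex m.point) x.2.rep v.1 := by
  have h := (mem_sigmaSurface_iff_sigmaDef x (mem_extChartAt_source (I := I4) m)).1 hm
  have hf := funF_ne_zero m
  have hx' : x.2.rep ⬝ᵥ x.1.rep = 0 := hx
  rw [metricAt_dancingMetric]
  set k := RP2.chartIndex m.point
  set l := RP2.chartIndex m.line
  set y := extChartAt I4 m m
  have h1 : x.2.rep ⬝ᵥ ins k y.1 = 0 := congrFun h 0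
  have h2 : x.1.rep ⬝ᵥ ins l y.2 = 0 := congrFun h 1
  set f := funF k l y with hfdef
  -- The metric dual of p̄ dq is −F p̄ up to a multiple of p, chosen so that the l-th coordinate
  -- vanishes. It annihilates q̄ because p q̄ = 0 and, by incidence, p̄ q̄ = 0.
  obtain ⟨w, hw⟩ := exists_ins₀ l ((f * x.2.rep l) • ins l y.2 - f • x.2.rep) (by simp)
  refine ⟨(0, w), rfl, ?_, fun v => ?_⟩
  · rw [affineForm_apply, ← hw, dotProduct_sub, dotProduct_smul, dotProduct_smul, h2,
      dotProduct_comm, hx']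
    simp
  · rw [formG_apply, formA₁_apply, formA₁_apply, formA₂_apply, formA₂_apply, formB_apply, formB_apply,
      ← hw, affineForm_apply]
    have e0 : ins₀ k (0 : Fin 2 → ℝ) = 0 := ins₀_zero k
    have e1 : ins l y.2 ⬝ᵥ ins k y.1 = f := rfl
    simp only [e0, dotProduct_zero, sub_dotProduct, smul_dotProduct,
      e1, h1, ← hfdef, smul_eq_mul]
    field_simp
    ring

/-- The line part of a tangent vector lies in a one-dimensional kernel containing w, so the vector
is a point direction plus a multiple of w. Point directions are null to each other, and g(w, ·) = p̄
dq vanishes on tangent vectors. -/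
theorem isNullSubspace_sigmaTangent {x : RP2 × RP2Dual} (hx : Incident x) {m : M4}
    (hm : m ∈ sigmaSurface x) : IsNullSubspace dancingMetric m (sigmaTangent x m) := by
  obtain ⟨w, hw1, hw2, hw⟩ := exists_metric_eq_affineForm hx hm
  obtain ⟨h1, h2⟩ := affineForm_chart_ne_zero hm
  have hw0 : w.2 ≠ 0 := by
    intro h0
    apply h1
    ext u
    have := hw (u, 0)
    rw [show w = 0 from Prod.ext hw1 h0, map_zero] at this
    exact this.symm
  have key (u v : E4) (hu : affineForm (RP2.chartIndex m.point) x.2.rep u.1 = 0 ∧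
      affineForm (RP2.chartIndex m.line) x.1.rep u.2 = 0)
      (hv : affineForm (RP2.chartIndex m.point) x.2.rep v.1 = 0 ∧
      affineForm (RP2.chartIndex m.line) x.1.rep v.2 = 0) : metricAt dancingMetric m u v = 0 := by
    have hdec (u : E4) (hu : affineForm (RP2.chartIndex m.line) x.1.rep u.2 = 0) :
        ∃ c : ℝ, u = proj₁ u + c • w := by
      obtain ⟨c, hc⟩ := exists_eq_smul_of_apply_eq_zero h2 hw0 hw2 hu
      refine ⟨c, Prod.ext ?_ ?_⟩
      · show u.1 = u.1 + c • w.1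
        rw [hw1, smul_zero, add_zero]
      · show u.2 = 0 + c • w.2
        rw [hc, zero_add]
    obtain ⟨c, hc⟩ := hdec u hu.2
    obtain ⟨d, hd⟩ := hdec v hv.2
    have s (u v : E4) : metricAt dancingMetric m u v = metricAt dancingMetric m v u :=
      formG_symm _ _ _ _ _
    have n (u v : E4) : metricAt dancingMetric m (proj₁ u) (proj₁ v) = 0 := formG_proj₁ _ _ _ _ _
    rw [hc, hd]
    simp only [map_add, map_smul, add_apply, smul_apply, s _ w, hw, n]
    simp [proj₁_apply, hu.1, hv.1, hw1]
  intro u hu v hv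
  exact key u v ((mem_sigmaTangent_iff x m u).1 hu) ((mem_sigmaTangent_iff x m v).1 hv)

theorem isAntiSelfDualPlane_sigmaTangent {x : RP2 × RP2Dual} (hx : Incident x) {m : M4}
    (hm : m ∈ sigmaSurface x) {vol : E4 [⋀^Fin 4]→ₗ[ℝ] ℝ}
    (hvol : IsOrientedVolume dancingMetric m vol) :
    IsAntiSelfDualPlane (V := E4) (metricAt dancingMetric m) vol (sigmaTangent x m) := by
  obtain ⟨b, Hb, rfl⟩ := (isOrientedVolume_iff m _).1 hvol
  obtain ⟨w, hw1, hw2, hw⟩ := exists_metric_eq_affineForm hx hm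
  obtain ⟨h1, h2⟩ := affineForm_chart_ne_zero hm
  let a : E4 →L[ℝ] ℝ := affineForm (RP2.chartIndex m.point) x.2.rep ∘L ContinuousLinearMap.fst ℝ _ _
  let c : E4 →L[ℝ] ℝ := affineForm (RP2.chartIndex m.line) x.1.rep ∘L ContinuousLinearMap.snd ℝ _ _
  have hac : LinearIndependent ℝ ![a, c] := by
    refine LinearIndependent.pair_iff.2 fun s t hst => ?_
    obtain ⟨u, hu⟩ := ContinuousLinearMap.exists_ne_zero h1
    obtain ⟨v, hv⟩ := ContinuousLinearMap.exists_ne_zero h2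
    have e1 := congrArg (fun L : E4 →L[ℝ] ℝ => L (u, 0)) hst
    have e2 := congrArg (fun L : E4 →L[ℝ] ℝ => L (0, v)) hst
    exact ⟨by simpa [a, c, hu] using e1, by simpa [a, c, hv] using e2⟩
  have h := Hb.isAntiSelfDualPlane a c hac (fun _ => (affineForm _ _).map_zero)
    (fun _ => (affineForm _ _).map_zero) w
    (ContinuousLinearMap.ext hw) hw2
  have e : (sigmaTangent x m : Submodule ℝ E4) =
      LinearMap.ker a.toLinearMap ⊓ LinearMap.ker c.toLinearMap :=
    Submodule.ext fun v => mem_sigmaTangent_iff x m v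
  exact e ▸ h

/-- `Σ` is parametrized by `ℝ²`. -/
theorem exists_sigmaSurface_param {x : RP2 × RP2Dual} (hx : Incident x) : ∃ q p : Fin 3 → ℝ,
    p ⬝ᵥ q = 1 ∧ x.2.rep ⬝ᵥ q = 0 ∧ p ⬝ᵥ x.1.rep = 0 := by
  have hx' : x.2.rep ⬝ᵥ x.1.rep = 0 := hx
  -- The cross product is orthogonal to both p̄ and q̄, so it serves as point and, after scaling, as
  -- line. Incidence gives n · n = |p̄|²|q̄|² ≠ 0.
  set n := crossProduct x.2.rep x.1.rep with hn
  have hnn : n ⬝ᵥ n ≠ 0 := by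
    rw [hn, cross_dot_cross, hx', zero_mul, sub_zero]
    exact mul_ne_zero (fun h => x.2.rep_nonzero (dotProduct_self_eq_zero.1 h))
      (fun h => x.1.rep_nonzero (dotProduct_self_eq_zero.1 h))
  refine ⟨n, (n ⬝ᵥ n)⁻¹ • n, by simp [hnn], dot_self_cross _ _, ?_⟩
  rw [smul_dotProduct, dotProduct_comm n x.1.rep, hn, dot_cross_self, smul_zero]

theorem sigma_pair_regular {x : RP2 × RP2Dual} (hx : Incident x) {q p : Fin 3 → ℝ} (h : p ⬝ᵥ q = 1)
    (hq : x.2.rep ⬝ᵥ q = 0) (hp : p ⬝ᵥ x.1.rep = 0) (s t : ℝ) :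
    (p + t • x.2.rep) ⬝ᵥ (q + s • x.1.rep) = 1 := by
  have hx' : x.2.rep ⬝ᵥ x.1.rep = 0 := hx
  simp [h, hq, hp, hx']

/-- The vectors q and q̄ span ker p̄, and dually p and p̄ span the forms vanishing on q̄.
Non-incidence makes the coefficients of q and p nonzero, so they can be scaled to 1. -/
theorem sigmaSurface_eq_range {x : RP2 × RP2Dual} (hx : Incident x) {q p : Fin 3 → ℝ}
    (h : p ⬝ᵥ q = 1) (hq : x.2.rep ⬝ᵥ q = 0) (hp : p ⬝ᵥ x.1.rep = 0) :
    sigmaSurface x = range fun y : ℝ × ℝ =>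
      ofHomogeneous (q + y.1 • x.1.rep, p + y.2 • x.2.rep) := by
  have hx' : x.2.rep ⬝ᵥ x.1.rep = 0 := hx
  have hr (s t : ℝ) := sigma_pair_regular hx h hq hp s t
  have hr0 (s t : ℝ) : (p + t • x.2.rep) ⬝ᵥ (q + s • x.1.rep) ≠ 0 := by
    rw [hr]; exact one_ne_zero
  ext m
  constructor
  · intro hm
    obtain ⟨h1, h2⟩ := (mem_sigmaSurface_iff x m).1 hm
    obtain ⟨s, hs⟩ := exists_eq_smul_of_dotProduct (r := m.point.rep - (p ⬝ᵥ m.point.rep) • q)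
      x.2.rep_nonzero hq (by rw [h]; exact one_ne_zero) x.1.rep_nonzero hx' hp (by simp [h1, hq])
      (by simp [h])
    obtain ⟨t, ht⟩ := exists_eq_smul_of_dotProduct (r := m.line.rep - (m.line.rep ⬝ᵥ q) • p)
      x.1.rep_nonzero ((dotProduct_comm _ _).trans hp)
      (by rw [dotProduct_comm, h]; exact one_ne_zero) x.2.rep_nonzero
      ((dotProduct_comm _ _).trans hx') ((dotProduct_comm _ _).trans hq)
      (by rw [dotProduct_sub, dotProduct_smul, dotProduct_comm _ p, h2, hp]; simp)
      (by rw [dotProduct_sub, dotProduct_smul, dotProduct_comm _ p, h, dotProduct_comm]; simp)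
    set a := p ⬝ᵥ m.point.rep with ha
    set b := m.line.rep ⬝ᵥ q with hb
    have e1 : m.point.rep = a • q + s • x.1.rep := by rw [← hs]; abel
    have e2 : m.line.rep = b • p + t • x.2.rep := by rw [← ht]; abel
    have hab : m.line.rep ⬝ᵥ m.point.rep = b * a := by
      rw [e1, e2]
      simp [h, hq, hp, hx', mul_comm]
    have hab0 : b * a ≠ 0 := by rw [← hab]; exact m.2
    have ha0 := right_ne_zero_of_mul hab0
    have hb0 := left_ne_zero_of_mul hab0
    refine ⟨(a⁻¹ * s, b⁻¹ * t), ?_⟩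
    have h3 := ofHomogeneous_smul (m.point.rep, m.line.rep) m.2 (inv_ne_zero ha0) (inv_ne_zero hb0)
    rw [ofHomogeneous_rep] at h3
    rw [← h3]
    show ofHomogeneous (q + (a⁻¹ * s) • x.1.rep, p + (b⁻¹ * t) • x.2.rep) =
      ofHomogeneous (a⁻¹ • m.point.rep, b⁻¹ • m.line.rep)
    rw [e1, e2, smul_add, smul_add, inv_smul_smul₀ ha0, inv_smul_smul₀ hb0, smul_smul, smul_smul]
  · rintro ⟨⟨s, t⟩, rfl⟩
    constructor
    · beta_reduce
      rw [point_ofHomogeneous _ (hr0 s t), incident_mk_left]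
      simp [hq, hx']
    · beta_reduce
      rw [line_ofHomogeneous _ (hr0 s t), incident_mk_right]
      simp [hp, hx']

theorem isConnected_sigmaSurface {x : RP2 × RP2Dual} (hx : Incident x) :
    IsConnected (sigmaSurface x) := by
  obtain ⟨q, p, h, hq, hp⟩ := exists_sigmaSurface_param hx
  rw [sigmaSurface_eq_range hx h hq hp]
  refine isConnected_range (continuous_iff_continuousAt.2 fun y => ?_)
  refine (contMDiffAt_ofHomogeneous _ ?_).continuousAt.comp
    (f := fun y : ℝ × ℝ => ((q + y.1 • x.1.rep, p + y.2 • x.2.rep) : HomCoord)) ?_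
  · rw [sigma_pair_regular hx h hq hp]
    exact one_ne_zero
  · fun_prop

/-- Comparing two parameter values shows that the second line vanishes on q and q̄ and that the
second point is killed by p and p̄. This determines both up to scale. -/
theorem sigmaSurface_injective {x y : RP2 × RP2Dual} (hx : Incident x)
    (h : sigmaSurface x = sigmaSurface y) : x = y := by
  obtain ⟨q, p, hpq, hq, hp⟩ := exists_sigmaSurface_param hx
  have hx' : x.2.rep ⬝ᵥ x.1.rep = 0 := hx
  have hmem (s t : ℝ) : y.2.rep ⬝ᵥ (q + s • x.1.rep) = 0 ∧ (p + t • x.2.rep) ⬝ᵥ y.1.rep = 0 := by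
    have hr0 : (p + t • x.2.rep) ⬝ᵥ (q + s • x.1.rep) ≠ 0 := by
      rw [sigma_pair_regular hx hpq hq hp]; exact one_ne_zero
    have h1 : ofHomogeneous (q + s • x.1.rep, p + t • x.2.rep) ∈ sigmaSurface y := by
      rw [← h, sigmaSurface_eq_range hx hpq hq hp]
      exact ⟨(s, t), rfl⟩
    obtain ⟨h2, h3⟩ := h1
    rw [point_ofHomogeneous _ hr0, incident_mk_left] at h2
    rw [line_ofHomogeneous _ hr0, incident_mk_right] at h3
    exact ⟨h2, h3⟩
  obtain ⟨a1, a2⟩ := hmem 0 0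
  obtain ⟨b1, b2⟩ := hmem 1 1
  rw [zero_smul, add_zero] at a1 a2
  rw [one_smul, dotProduct_add, a1, zero_add] at b1
  rw [one_smul, add_dotProduct, a2, zero_add] at b2
  have hpq0 : p ⬝ᵥ q ≠ 0 := by rw [hpq]; exact one_ne_zero
  obtain ⟨c, hc⟩ := exists_eq_smul_of_dotProduct x.2.rep_nonzero hq hpq0 x.1.rep_nonzero hx' hp b2 a2
  obtain ⟨d, hd⟩ := exists_eq_smul_of_dotProduct (n₂ := q) (q := p) x.1.rep_nonzero
    ((dotProduct_comm _ _).trans hp) ((dotProduct_comm _ _).trans_ne hpq0) x.2.rep_nonzero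
    ((dotProduct_comm _ _).trans hx') ((dotProduct_comm _ _).trans hq)
    ((dotProduct_comm _ _).trans b1) ((dotProduct_comm _ _).trans a1)
  exact Prod.ext (RP2.eq_of_rep_eq_smul hc).symm (RP2.eq_of_rep_eq_smul hd).symm

end M4

/-! ### Failure of conformal flatness -/

namespace M4

/-- The difference of the Levi-Civita connections of two conformal metrics. -/
noncomputable def conformalTensor (G : E4 →L[ℝ] E4 →L[ℝ] ℝ) (ψ : E4 →L[ℝ] ℝ) :
    E4 →L[ℝ] E4 →L[ℝ] E4 :=
  ψ.smulRight (ContinuousLinearMap.id ℝ E4) + (ψ.smulRight (ContinuousLinearMap.id ℝ E4)).flip -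
    ((ContinuousLinearMap.smulRightL ℝ E4 E4).flip (G.inverse ψ)) ∘L G

theorem conformalTensor_apply (G : E4 →L[ℝ] E4 →L[ℝ] ℝ) (ψ : E4 →L[ℝ] ℝ) (u v : E4) :
    conformalTensor G ψ u v = ψ u • v + ψ v • u - G u v • G.inverse ψ := by
  simp [conformalTensor]

theorem contDiffAt_inverse_formG {n : WithTop ℕ∞} (k l : Fin 3) (x : E4) (hx : funF k l x ≠ 0) :
    ContDiffAt ℝ n (fun y => (formG k l y).inverse) x := by
  obtain ⟨e, he⟩ := ContinuousLinearMap.isInvertible_of_nondegenerate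
    (formG_nondegenerate k l x hx)
  have h : ContDiffAt ℝ n ContinuousLinearMap.inverse (formG k l x) := by
    rw [← he]
    exact contDiffAt_map_inverse e
  exact h.comp x (contDiffAt_formG k l x hx)

/-- The classical change of connection under a conformal factor φ, with ψ = d(½ log φ) = dφ / 2φ. -/
theorem koszulForm_smul_formG (k l : Fin 3) (x : E4) (hx : funF k l x ≠ 0) {φ : E4 → ℝ}
    (hφ : DifferentiableAt ℝ φ x) (h0 : φ x ≠ 0) (u v : E4) :
    koszulForm (fun y => φ y • formG k l y) x u v = (φ x • formG k l x) ((chris k l x +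
      conformalTensor (formG k l x) ((2 * φ x)⁻¹ • fderiv ℝ φ x)) u v) := by
  have hd : DifferentiableAt ℝ (formG k l) x :=
    (contDiffAt_formG k l (n := 1) x hx).differentiableAt (by norm_num)
  have hd' := hφ.hasFDerivAt.smul hd.hasFDerivAt
  have e (L : E4 → E4 →L[ℝ] E4 →L[ℝ] ℝ) (u v w : E4) : koszulForm L x u v w =
      (1 / 2 : ℝ) * (fderiv ℝ L x u v w + fderiv ℝ L x v u w - fderiv ℝ L x w u v) := by
    simp [koszulForm]
  apply ContinuousLinearMap.ext; intro w
  have hi := congrArg (fun L : E4 →L[ℝ] ℝ => L w) (ContinuousLinearMap.apply_inverse_self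
    (formG_nondegenerate k l x hx) (fderiv ℝ φ x))
  have hk := koszulForm_formG k l x hx u v w
  rw [e] at hk
  have hf : fderiv ℝ (fun y => φ y • formG k l y) x = _ := hd'.fderiv
  rw [e, hf]
  simp only [add_apply, smul_apply, map_add, conformalTensor_apply, map_sub, map_smul,
    sub_apply]
  rw [show formG k l x ((formG k l x).inverse (fderiv ℝ φ x)) w = _ from hi, ← hk]
  simp only [ContinuousLinearMap.smulRight_apply, smul_apply, smul_eq_mul]
  field_simp
  ring

theorem chartMetric_smul (f : M4 → ℝ) (c : M4) (x : E4) (hx : x ∈ (extChartAt I4 c).target) :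
    chartMetric (fun y => f y • dancingMetric y) c x = f ((extChartAt I4 c).symm x) •
      formG (RP2.chartIndex c.point) (RP2.chartIndex c.line) x := by
  rw [← chartMetric_dancingMetric c x hx]
  rfl

theorem christoffel_smul (f : M4 → ℝ) (c : M4) (x : E4) (hx : x ∈ (extChartAt I4 c).target)
    (hf : DifferentiableAt ℝ (fun y => f ((extChartAt I4 c).symm y)) x)
    (h0 : f ((extChartAt I4 c).symm x) ≠ 0) :
    christoffel (fun y => f y • dancingMetric y) c x =
      chris (RP2.chartIndex c.point) (RP2.chartIndex c.line) x +
        conformalTensor (formG (RP2.chartIndex c.point) (RP2.chartIndex c.line) x)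
          ((2 * f ((extChartAt I4 c).symm x))⁻¹ •
            fderiv ℝ (fun y => f ((extChartAt I4 c).symm y)) x) := by
  have hx' := (mem_target_iff c x).1 hx
  have e : chartMetric (fun y => f y • dancingMetric y) c =ᶠ[𝓝 x] fun x =>
      f ((extChartAt I4 c).symm x) •
        formG (RP2.chartIndex c.point) (RP2.chartIndex c.line) x := by
    filter_upwards [(isOpen_extChartAt_target (I := I4) c).mem_nhds hx] with y hy
    exact chartMetric_smul f c y hy
  have hk : koszulForm (chartMetric (fun y => f y • dancingMetric y) c) x = koszulForm (fun x =>
      f ((extChartAt I4 c).symm x) •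
        formG (RP2.chartIndex c.point) (RP2.chartIndex c.line) x) x := by
    simp only [koszulForm, e.fderiv_eq]
  apply ContinuousLinearMap.ext; intro u
  apply ContinuousLinearMap.ext; intro v
  show (chartMetric (fun y => f y • dancingMetric y) c x).inverse
    (koszulForm (chartMetric (fun y => f y • dancingMetric y) c) x u v) = _
  rw [hk, e.self_of_nhds, koszulForm_smul_formG _ _ x hx' hf h0]
  refine ContinuousLinearMap.inverse_apply_self (fun v hv => ?_) _
  refine formG_nondegenerate _ _ x hx' v fun w => ?_
  exact (mul_eq_zero_iff_left h0).1 (hv w)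

/-- A₁ and A₂ vanish at the base point, so the affine chart is normal to first order there. -/
theorem hasFDerivAt_formG_zero (u v : E4) :
    HasFDerivAt (fun y => formG 2 2 y u v) (0 : E4 →L[ℝ] ℝ) 0 := by
  have e₁ : formA₁ 2 2 0 = 0 := ContinuousLinearMap.ext formA₁_two_zero
  have e₂ : formA₂ 2 2 0 = 0 := ContinuousLinearMap.ext formA₂_two_zero
  refine (hasFDerivAt_formG 2 2 0 (by rw [funF_two_zero]; exact one_ne_zero) u v).congr_fderiv ?_
  rw [e₁, e₂]
  simp

/-- Suppose f g is flat near the base point, and compute its curvature at the origin of the chart,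
where the Christoffel symbols of g vanish. Two components are chosen in which the conformal factor
enters identically and the dancing metric with opposite signs. -/
theorem not_isConformallyFlat_dancingMetric : ¬ IsConformallyFlat dancingMetric := by
  intro h
  obtain ⟨U, hU, hm, f, hf, hpos, hcurv⟩ := h base
  have hR := hcurv base hm
  have hF : funF 2 2 0 ≠ 0 := by rw [funF_two_zero]; exact one_ne_zero
  have ht0 : (0 : E4) ∈ (extChartAt I4 base).target := by
    rw [← extChartAt_base]; exact mem_extChartAt_target base
  set φ : E4 → ℝ := fun y => f ((extChartAt I4 base).symm y) with hφ
  have hs0 : (extChartAt I4 base).symm 0 = base := by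
    rw [← extChartAt_base]; exact extChartAt_to_inv base
  have hφ0 : ContDiffAt ℝ ∞ φ 0 := by
    have h1 : ContMDiffAt I4 𝓘(ℝ, ℝ) ∞ f ((extChartAt I4 base).symm 0) := by
      rw [hs0]; exact hf.contMDiffAt (hU.mem_nhds hm)
    have h2 : ContMDiffAt 𝓘(ℝ, E4) I4 ∞ (extChartAt I4 base).symm 0 :=
      (contMDiffOn_extChartAt_symm base).contMDiffAt
        ((isOpen_extChartAt_target base).mem_nhds ht0)
    exact (h1.comp (0 : E4) h2).contDiffAt
  have hφne : φ 0 ≠ 0 := by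
    show f _ ≠ 0
    rw [hs0]; exact (hpos base hm).ne'
  set ψ : E4 → E4 →L[ℝ] ℝ := fun x => (2 * φ x)⁻¹ • fderiv ℝ φ x with hψ
  have hψ0 : ContDiffAt ℝ 1 ψ 0 := by
    have h1 : ContDiffAt ℝ 1 (fun x => (2 * φ x)⁻¹) 0 :=
      ((contDiffAt_const.mul hφ0).inv (mul_ne_zero two_ne_zero hφne)).of_le (by simp)
    have h2 : ContDiffAt ℝ 1 (fderiv ℝ φ) 0 := hφ0.fderiv_right (m := 1) (n := ∞) (by
      rw [one_add_one_eq_two]; exact ENat.LEInfty.out)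
    exact h1.smul h2
  let Γ : E4 → E4 →L[ℝ] E4 →L[ℝ] E4 := fun x => chris 2 2 x + conformalTensor (formG 2 2 x) (ψ x)
  have hΓ : christoffel (fun y => f y • dancingMetric y) base =ᶠ[𝓝 0] Γ := by
    have h1 : ∀ᶠ y in 𝓝 (0 : E4), DifferentiableAt ℝ φ y :=
      ((hφ0.of_le (m := 1) (by simp)).eventually (by simp)).mono fun y hy =>
        hy.differentiableAt (by simp)
    filter_upwards [h1, hφ0.continuousAt.eventually_ne hφne,
      (isOpen_extChartAt_target (I := I4) base).mem_nhds ht0] with y h1 h2 h3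
    have h4 := christoffel_smul f base y h3 h1 h2
    rwa [chartIndex_base.1, chartIndex_base.2] at h4
  set X : E4 → E4 := fun x => (formG 2 2 x).inverse (ψ x) with hX
  have hψd : DifferentiableAt ℝ ψ 0 := hψ0.differentiableAt (by simp)
  have hXd : DifferentiableAt ℝ X 0 :=
    ((contDiffAt_inverse_formG (n := 1) 2 2 0 hF).differentiableAt (by simp)).clm_apply hψd
  have hΓd : DifferentiableAt ℝ Γ 0 := by
    have h1 : DifferentiableAt ℝ (chris 2 2) 0 :=
      (contDiffAt_chris 2 2 (n := 1) 0 hF).differentiableAt (by simp)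
    have h2 : DifferentiableAt ℝ (formG 2 2) 0 :=
      (contDiffAt_formG 2 2 (n := 1) 0 hF).differentiableAt (by simp)
    have h3 : DifferentiableAt ℝ
        (fun x => (ψ x).smulRight (ContinuousLinearMap.id ℝ E4)) 0 :=
      ((ContinuousLinearMap.smulRightL ℝ E4 (E4 →L[ℝ] E4)).flip
        (ContinuousLinearMap.id ℝ E4)).differentiableAt.comp (0 : E4) hψd
    have h4 : DifferentiableAt ℝ
        (fun x => ((ψ x).smulRight (ContinuousLinearMap.id ℝ E4)).flip) 0 :=
      (ContinuousLinearMap.flipₗᵢ ℝ E4 E4 E4).toContinuousLinearEquiv.differentiableAt.comp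
        (0 : E4) h3
    have h5 : DifferentiableAt ℝ (fun x => (ContinuousLinearMap.smulRightL ℝ E4 E4).flip (X x)) 0 :=
      ((ContinuousLinearMap.smulRightL ℝ E4 E4).flip).differentiableAt.comp (0 : E4) hXd
    exact h1.add ((h3.add h4).sub (h5.clm_comp h2))
  have hD (a u v : E4) : fderiv ℝ Γ 0 a u v =
      -(formB 2 2 a u • proj₁ v + formB 2 2 a v • proj₁ u + formB 2 2 u a • proj₂ v +
        formB 2 2 v a • proj₂ u) + (fderiv ℝ ψ 0 a u • v + fderiv ℝ ψ 0 a v • u -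
          formG 2 2 0 u v • fderiv ℝ X 0 a) := by
    have h1 := (hΓd.hasFDerivAt.clm_apply (hasFDerivAt_const u (0 : E4))).clm_apply
      (hasFDerivAt_const v (0 : E4))
    have hψu (u : E4) : HasFDerivAt (fun x => ψ x u) ((fderiv ℝ ψ 0).flip u) 0 := by
      refine (hψd.hasFDerivAt.clm_apply (hasFDerivAt_const u (0 : E4))).congr_fderiv ?_
      simp
    have h2 := (hasFDerivAt_chris 2 2 0 hF u v).add ((((hψu u).smul_const v).add
      ((hψu v).smul_const u)).sub ((hasFDerivAt_formG_zero u v).smul hXd.hasFDerivAt))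
    have h3 : (fun x => Γ x u v) = fun x => chris 2 2 x u v +
        (ψ x u • v + ψ x v • u - formG 2 2 x u v • X x) := by
      funext x
      show chris 2 2 x u v + conformalTensor (formG 2 2 x) (ψ x) u v = _
      rw [conformalTensor_apply]
    have h4 := congrArg (fun L : E4 →L[ℝ] E4 => L a) (h1.unique (h2.congr_of_eventuallyEq (Eventually.of_forall (congrFun h3))))
    have e₁ : formA₁ 2 2 0 = 0 := ContinuousLinearMap.ext formA₁_two_zero
    have e₂ : formA₂ 2 2 0 = 0 := ContinuousLinearMap.ext formA₂_two_zero
    simp only [e₁, e₂, funF_two_zero] at h4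
    simpa using h4
  have hΓ0 (u v : E4) : Γ 0 u v = ψ 0 u • v + ψ 0 v • u - formG 2 2 0 u v • X 0 := by
    show chris 2 2 0 u v + conformalTensor (formG 2 2 0) (ψ 0) u v = _
    rw [conformalTensor_apply, chris_apply]
    simp [formA₁_two_zero, formA₂_two_zero, hX]
  have hR' (u v w : E4) : fderiv ℝ Γ 0 u v w - fderiv ℝ Γ 0 v u w + Γ 0 u (Γ 0 v w) -
      Γ 0 v (Γ 0 u w) = 0 := by
    have h1 := congrArg (fun L : E4 →L[ℝ] E4 →L[ℝ] E4 →L[ℝ] E4 => L u v w) hR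
    simp only [curvature, chartCurvature, extChartAt_base, hΓ.fderiv_eq, hΓ.self_of_nhds] at h1
    simpa using h1
  have hB (u v : E4) : formB 2 2 u v = u.2 ⬝ᵥ v.1 := by
    rw [formB_apply, ins₀_dotProduct_ins₀]
  -- With u = e₁ and v = f₁, both components contain dψ(u, v) − dψ(v, u), and the quadratic terms in
  -- ψ drop out. The metric adds 1 on the point side and −1 on the line side, so both cannot be
  -- zero.
  have E1 := congrArg (fun z : E4 => z.1 1)
    (hR' (Pi.single 0 1, 0) (0, Pi.single 0 1) (Pi.single 1 1, 0))
  have E2 := congrArg (fun z : E4 => z.2 1)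
    (hR' (Pi.single 0 1, 0) (0, Pi.single 0 1) (0, Pi.single 1 1))
  simp [hD, hΓ0, hB, formG_two_zero, proj₁_apply, proj₂_apply] at E1 E2
  linarith

end M4

/-! ### Indecomposability -/

namespace M4

/-- The subspaces which are invariant under the curvature are the null planes, or trivial. -/
theorem IsAdapted.invariant_trichotomy {h : E4 →L[ℝ] E4 →L[ℝ] ℝ} {b : Module.Basis (Fin 4) ℝ E4}
    (Hb : IsAdapted h b) {D : Submodule ℝ E4}
    (hD : ∀ u v w, w ∈ D → (mixed h v u - mixed h u v) • proj₁ w + mixed h v w • proj₁ u -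
      mixed h u w • proj₁ v + (mixed h u v - mixed h v u) • proj₂ w + mixed h w v • proj₂ u -
      mixed h w u • proj₂ v ∈ D) :
    (∀ w ∈ D, proj₁ w = 0) ∨ (∀ w ∈ D, proj₂ w = 0) ∨ D = ⊤ := by
  -- The curvature operator for a point direction u and a line direction v, where only H(v, u) =
  -- −h(v, u) is nonzero.
  have key (u v w : E4) (hu : proj₁ u = u) (hv : proj₂ v = v) (hw : w ∈ D) :
      -h v u • proj₁ w - h v (proj₁ w) • u + h v u • proj₂ w + h (proj₂ w) u • v ∈ D := by
    have h1 := hD u v w hw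
    simp only [mixed, hu, hv, proj₂_of_proj₁ hu, proj₁_of_proj₂ hv, map_zero, zero_apply] at h1
    convert h1 using 1
    module
  have hsplit (w : E4) (hw : w ∈ D) : proj₁ w ∈ D ∧ proj₂ w ∈ D := by
    -- Summing the operators over the dual pairs (e_a, f_a) gives −3 on the first factor and 3 on
    -- the second. An invariant subspace therefore splits along the two factors.
    have h1 := D.add_mem (key _ _ w Hb.mem0 Hb.mem2 hw) (key _ _ w Hb.mem1 Hb.mem3 hw)
    have e1 := Hb.expand' (proj₁ w)
    have e2 := Hb.expand' (proj₂ w)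
    have z1 (v : E4) (hv : proj₁ v = v) : h (proj₁ w) v = 0 := by rw [← hv, Hb.null₁]
    have z2 (v : E4) (hv : proj₂ v = v) : h (proj₂ w) v = 0 := by rw [← hv, Hb.null₂]
    rw [z1 _ Hb.mem0, z1 _ Hb.mem1] at e1
    rw [z2 _ Hb.mem2, z2 _ Hb.mem3] at e2
    have e : -(3 : ℝ) • proj₁ w + (3 : ℝ) • proj₂ w ∈ D := by
      convert h1 using 1
      rw [Hb.symm (b 2) (b 0), Hb.symm (b 3) (b 1), Hb.h02, Hb.h13, Hb.symm (b 2), Hb.symm (b 3)]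
      linear_combination (norm := module) (-1 : ℝ) • e1 + (1 : ℝ) • e2
    have h2 : proj₁ w ∈ D := by
      have h3 := D.smul_mem (1 / 6 : ℝ) (D.sub_mem (D.smul_mem (3 : ℝ) hw) e)
      convert h3 using 1
      conv_rhs => rw [← proj₁_add_proj₂ w]
      simp only [map_add, proj₁_proj₁, proj₂_proj₁, proj₁_proj₂, proj₂_proj₂]
      module
    refine ⟨h2, ?_⟩
    have h3 := D.sub_mem hw h2
    rwa [sub_eq_iff_eq_add'.2 (proj₁_add_proj₂ w).symm] at h3
  by_contra! hne
  obtain ⟨⟨w₁, hw₁, h1⟩, ⟨w₂, hw₂, h2⟩, hT⟩ := hne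
  -- Once D contains a nonzero point direction w, choose a line direction v with h(v, w) ≠ 0. The
  -- curvature operators then produce every u of the first factor from w; the second factor is dual.
  have hL₁ (u : E4) (hu : proj₁ u = u) : u ∈ D := by
    obtain ⟨v, hv, hv0⟩ : ∃ v, proj₂ v = v ∧ h v (proj₁ w₁) ≠ 0 := by
      by_contra! hc
      apply h1
      have e1 := Hb.expand' (proj₁ w₁)
      rwa [Hb.symm _ (b 2), Hb.symm _ (b 3), hc _ Hb.mem2, hc _ Hb.mem3, ← Hb.mem0, ← Hb.mem1,
        Hb.null₁, Hb.null₁, zero_smul, zero_smul, zero_smul, zero_smul, add_zero, add_zero,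
        add_zero] at e1
    have h3 := key u v _ hu hv (hsplit w₁ hw₁).1
    rw [proj₁_proj₁, proj₂_proj₁, map_zero, zero_apply, smul_zero, zero_smul, add_zero,
      add_zero] at h3
    have h4 := D.sub_mem (D.smul_mem (-h v u) (hsplit w₁ hw₁).1) h3
    rw [sub_sub_cancel] at h4
    exact (D.smul_mem_iff hv0).1 h4
  have hL₂ (v : E4) (hv : proj₂ v = v) : v ∈ D := by
    obtain ⟨u, hu, hu0⟩ : ∃ u, proj₁ u = u ∧ h (proj₂ w₂) u ≠ 0 := by
      by_contra! hc
      apply h2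
      have e1 := Hb.expand' (proj₂ w₂)
      rwa [hc _ Hb.mem0, hc _ Hb.mem1, ← Hb.mem2, ← Hb.mem3,
        Hb.null₂, Hb.null₂, zero_smul, zero_smul, zero_smul, zero_smul, add_zero, add_zero,
        add_zero] at e1
    have h3 := key u v _ hu hv (hsplit w₂ hw₂).2
    rw [proj₂_proj₂, proj₁_proj₂, map_zero, smul_zero, zero_smul, sub_zero, zero_add] at h3
    exact (D.smul_mem_iff hu0).1 ((D.add_mem_iff_right (D.smul_mem _ (hsplit w₂ hw₂).2)).1 h3)
  exact hT (eq_top_iff.2 fun v _ => proj₁_add_proj₂ v ▸ D.add_mem (hL₁ _ rfl) (hL₂ _ rfl))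

theorem IsAdapted.apply_eq_zero₂ {h : E4 →L[ℝ] E4 →L[ℝ] ℝ} {b : Module.Basis (Fin 4) ℝ E4}
    (Hb : IsAdapted h b) {v w : E4} (hv : proj₁ v = 0) (hw : proj₁ w = 0) : h v w = 0 := by
  have e1 := proj₁_add_proj₂ v
  have e2 := proj₁_add_proj₂ w
  rw [hv, zero_add] at e1
  rw [hw, zero_add] at e2
  rw [← e1, ← e2, Hb.null₂]

theorem IsAdapted.apply_eq_zero₁ {h : E4 →L[ℝ] E4 →L[ℝ] ℝ} {b : Module.Basis (Fin 4) ℝ E4}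
    (Hb : IsAdapted h b) {v w : E4} (hv : proj₂ v = 0) (hw : proj₂ w = 0) : h v w = 0 := by
  have e1 := proj₁_add_proj₂ v
  have e2 := proj₁_add_proj₂ w
  rw [hv, add_zero] at e1
  rw [hw, add_zero] at e2
  rw [← e1, ← e2, Hb.null₁]

theorem extChartAt_congr {c c' : M4} (h₁ : RP2.chartIndex c.point = RP2.chartIndex c'.point)
    (h₂ : RP2.chartIndex c.line = RP2.chartIndex c'.line) : extChartAt I4 c = extChartAt I4 c' := by
  have h : chartAt (ModelProd (Fin 2 → ℝ) (Fin 2 → ℝ)) c.1 =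
      chartAt (ModelProd (Fin 2 → ℝ) (Fin 2 → ℝ)) c'.1 := by
    show (RP2.affineChart (RP2.chartIndex c.point)).prod
      (RP2.affineChart (RP2.chartIndex c.line)) = (RP2.affineChart (RP2.chartIndex c'.point)).prod
      (RP2.affineChart (RP2.chartIndex c'.line))
    rw [h₁, h₂]
  simp only [extChartAt, TopologicalSpace.Opens.chartAt_eq, h]

/-- Covariant derivatives are computed in the preferred chart at each point, so iterating them needs
this chart to be constant on an open set. The index jumps only across the lines at infinity, which
an open subset avoids unless it lies inside one of them. -/
theorem exists_chartIndex_eq {f : M4 → RP2} (hf : Continuous f) {U : Set M4} (hU : IsOpen U)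
    (hne : U.Nonempty) :
    ∃ V ⊆ U, IsOpen V ∧ V.Nonempty ∧ ∃ k, ∀ m ∈ V, RP2.chartIndex (f m) = k := by
  have ho (k : Fin 3) : IsOpen (U ∩ f ⁻¹' {q : RP2 | q.rep k ≠ 0}) :=
    hU.inter ((RP2.isOpen_source k).preimage hf)
  by_cases h2 : (U ∩ f ⁻¹' {q : RP2 | q.rep 2 ≠ 0}).Nonempty
  · exact ⟨_, inter_subset_left, ho 2, h2, 2, fun m hm => if_pos hm.2⟩
  have h2' (m : M4) (hm : m ∈ U) : ¬ (f m).rep 2 ≠ 0 := fun h => h2 ⟨m, hm, h⟩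
  by_cases h1 : (U ∩ f ⁻¹' {q : RP2 | q.rep 1 ≠ 0}).Nonempty
  · exact ⟨_, inter_subset_left, ho 1, h1, 1, fun m hm =>
      (if_neg (h2' m hm.1)).trans (if_pos hm.2)⟩
  exact ⟨U, Subset.rfl, hU, hne, 0, fun m hm =>
    (if_neg (h2' m hm)).trans (if_neg fun h => h1 ⟨m, hm, h⟩)⟩

theorem chartD_eq_id {c m : M4} (h : extChartAt I4 c = extChartAt I4 m) :
    chartD c m = ContinuousLinearMap.id ℝ E4 := by
  rw [chartD, h]
  exact mfderiv_extChartAt_self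

theorem contDiffAt_chartField {X : ∀ m : M4, TangentSpace I4 m} {V : Set M4} (hV : IsOpen V)
    (hX : SmoothFieldOn X V) {m : M4} (hm : m ∈ V) :
    ContDiffAt ℝ ∞ (chartField m X) (extChartAt I4 m m) := by
  have h1 := ((smoothFieldOn_iff X V).1 hX m hm).contMDiffAt (hV.mem_nhds hm)
  have h2 : ContMDiffAt 𝓘(ℝ, E4) I4 ∞ (extChartAt I4 m).symm (extChartAt I4 m m) :=
    (contMDiffOn_extChartAt_symm m).contMDiffAt
      ((isOpen_extChartAt_target m).mem_nhds (mem_extChartAt_target m))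
  have h3 := (h1.comp_of_eq h2 (extChartAt_to_inv m)).contDiffAt
  refine h3.congr_of_eventuallyEq ?_
  filter_upwards [(isOpen_extChartAt_target m).mem_nhds (mem_extChartAt_target (I := I4) m)]
    with y hy
  exact chartField_apply m X y hy

/-- A parallel distribution is invariant under the curvature, at least if the preferred chart is
locally constant. -/
theorem curvature_mem_of_isParallelOn {U : Set M4}
    {D : ∀ m : M4, Submodule ℝ (TangentSpace I4 m)} {r : ℕ} (hdist : IsDistributionOn D r U)
    (hpar : IsParallelOn dancingMetric D U) {c : M4} (hc : c ∈ U)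
    (hchart : ∀ m ∈ U, extChartAt I4 m = extChartAt I4 c) (u w v : E4) (hv : v ∈ D c) :
    (curvature dancingMetric c w u v : E4) ∈ D c := by
  obtain ⟨-, V, hVU, hVo, hcV, Xi, hXi, hspan⟩ := hdist c hc
  rw [← hspan c hcV] at hv
  obtain ⟨a, ha⟩ : ∃ a : Fin r → ℝ, ∑ i, a i • Xi i c = (v : TangentSpace I4 c) :=
    (Submodule.mem_span_range_iff_exists_fun (M := TangentSpace I4 c) ℝ).1 hv
  -- The vector v is extended to a section of D by constant combination of the local frame.
  set X : ∀ m : M4, TangentSpace I4 m := fun m => ∑ i, a i • Xi i m with hXdef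
  have hXs : SmoothFieldOn X V := ContMDiffOn.sum_section fun i _ => (hXi i).const_smul_section
  have hXD (m : M4) (hm : m ∈ V) : X m ∈ D m := by
    rw [← hspan m hm]
    exact Submodule.sum_mem _ fun i _ => Submodule.smul_mem _ _ (Submodule.subset_span ⟨i, rfl⟩)
  set k := RP2.chartIndex c.point with hk
  set l := RP2.chartIndex c.line with hl
  set f := chartField c X with hf
  have hsrc (m : M4) (hm : m ∈ V) : m ∈ (extChartAt I4 c).source := by
    rw [← hchart m (hVU hm)]; exact mem_extChartAt_source m
  have htar (m : M4) (hm : m ∈ V) : funF k l (extChartAt I4 c m) ≠ 0 :=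
    (mem_target_iff c _).1 ((extChartAt I4 c).map_source (hsrc m hm))
  have hfs (m : M4) (hm : m ∈ V) : ContDiffAt ℝ ∞ f (extChartAt I4 c m) := by
    have h1 := contDiffAt_chartField hVo hXs hm
    rw [hchart m (hVU hm)] at h1
    have h2 : chartField m X = chartField c X := by
      rw [chartField, chartField, hchart m (hVU hm)]
    rwa [h2] at h1
  -- F u is the chart expression of ∇_u X for the constant coordinate field u. By parallelism it is
  -- again a section of D and can be differentiated once more.
  let F : E4 → E4 → E4 := fun u y => fderiv ℝ f y u + chris k l y u (f y)
  have hcov (Y : ∀ m : M4, TangentSpace I4 m) (u : E4) : (covDeriv dancingMetric Y c u : E4) =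
      fderiv ℝ (chartField c Y) (extChartAt I4 c c) u +
        chris k l (extChartAt I4 c c) u (chartField c Y (extChartAt I4 c c)) :=
    covDeriv_dancingMetric Y c u
  have hcov' (m : M4) (hm : m ∈ V) (u : E4) : (covDeriv dancingMetric X m u : E4) =
      F u (extChartAt I4 c m) := by
    have h1 : (covDeriv dancingMetric X m u : E4) =
        fderiv ℝ (chartField m X) (extChartAt I4 m m) u +
          christoffel dancingMetric m (extChartAt I4 m m) u
            (chartField m X (extChartAt I4 m m)) := rfl
    have h2 : chartField m X = f := by
      rw [chartField, hf, chartField, hchart m (hVU hm)]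
    have h3 : christoffel dancingMetric m = christoffel dancingMetric c := by
      unfold christoffel chartMetric
      rw [hchart m (hVU hm)]
    rw [h1, h2, h3, hchart m (hVU hm),
      christoffel_dancingMetric c _ ((extChartAt I4 c).map_source (hsrc m hm))]
  have hFs (u : E4) (m : M4) (hm : m ∈ V) : ContDiffAt ℝ ∞ (F u) (extChartAt I4 c m) :=
    (((hfs m hm).fderiv_right (m := ∞) (by simp)).clm_apply contDiffAt_const).add
      (((contDiffAt_chris k l _ (htar m hm)).clm_apply contDiffAt_const).clm_apply (hfs m hm))
  have hZs (u : E4) : SmoothFieldOn (fieldOf c (F u)) V :=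
    smoothFieldOn_fieldOf c hsrc (hFs u)
  have hZ (u : E4) (m : M4) (hm : m ∈ V) :
      (fieldOf c (F u) m : E4) = F u (extChartAt I4 c m) := by
    have h1 := chartD_fieldOf (hsrc m hm) (F u)
    rwa [chartD_eq_id (hchart m (hVU hm)).symm] at h1
  have hZD (u : E4) (m : M4) (hm : m ∈ V) : fieldOf c (F u) m ∈ D m := by
    have h1 := hpar V hVU hVo X hXs hXD m hm u
    have h2 : fieldOf c (F u) m = covDeriv dancingMetric X m u :=
      (hZ u m hm).trans (hcov' m hm u).symm
    rwa [h2]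
  set x := extChartAt I4 c c with hx
  have hxt : x ∈ (extChartAt I4 c).target := mem_extChartAt_target c
  have hfx : f x = v := by
    have h1 : f x = chartD c c (X c) := by
      rw [hf, chartField_apply c X x hxt, extChartAt_to_inv]
      rfl
    rw [h1, chartD_eq_id rfl]
    exact ha
  -- The second covariant derivative ∇_w ∇_u X at c lies in D.
  have hA (u w : E4) : fderiv ℝ (F u) x w + chris k l x w (F u x) ∈ (D c : Submodule ℝ E4) := by
    have h1 : (covDeriv dancingMetric (fieldOf c (F u)) c w : E4) ∈ (D c : Submodule ℝ E4) :=
      hpar V hVU hVo _ (hZs u) (hZD u) c hcV w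
    have h2 : chartField c (fieldOf c (F u)) =ᶠ[𝓝 x] F u := by
      filter_upwards [(isOpen_extChartAt_target (I := I4) c).mem_nhds hxt] with y hy
      rw [chartField_apply c _ y hy]
      refine (chartD_fieldOf ((extChartAt I4 c).map_target hy) (F u)).trans ?_
      rw [(extChartAt I4 c).right_inv hy]
    rwa [hcov, h2.fderiv_eq, h2.self_of_nhds] at h1
  have hsymm : fderiv ℝ (fderiv ℝ f) x w u = fderiv ℝ (fderiv ℝ f) x u w :=
    ((hfs c hcV).isSymmSndFDerivAt (by simp [minSmoothness_of_isRCLikeNormedField,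
      ENat.LEInfty.out])).eq w u
  have hFd (u w : E4) : fderiv ℝ (F u) x w = fderiv ℝ (fderiv ℝ f) x w u +
      (fderiv ℝ (chris k l) x w u (f x) + chris k l x u (fderiv ℝ f x w)) := by
    have d1 : DifferentiableAt ℝ (fderiv ℝ f) x :=
      ((hfs c hcV).fderiv_right (m := ∞) (by simp)).differentiableAt (by simp)
    have d2 : DifferentiableAt ℝ f x := (hfs c hcV).differentiableAt (by simp)
    have d3 : DifferentiableAt ℝ (chris k l) x :=
      (contDiffAt_chris k l (n := 1) x (htar c hcV)).differentiableAt (by simp)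
    have h1 := (d1.hasFDerivAt.clm_apply (hasFDerivAt_const u x)).add
      ((d3.hasFDerivAt.clm_apply (hasFDerivAt_const u x)).clm_apply d2.hasFDerivAt)
    have h2 : fderiv ℝ (F u) x = _ := h1.fderiv
    rw [h2]
    simp
    abel
  -- Antisymmetrising in u and w cancels the symmetric second derivative of X, and the Ricci
  -- identity leaves the curvature. The coordinate fields commute, so there is no bracket term.
  have key : (curvature dancingMetric c w u v : E4) =
      fderiv ℝ (F u) x w + chris k l x w (F u x) -
        (fderiv ℝ (F w) x u + chris k l x u (F w x)) := by
    refine (chartCurvature_eq_chris c x hxt w u v).trans ?_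
    rw [hFd, hFd, hsymm]
    simp only [F, map_add, hfx, ← hk, ← hl]
    abel
  have h1 := (D c : Submodule ℝ E4).sub_mem (hA u w) (hA w u)
  exact (congrArg (· ∈ (D c : Submodule ℝ E4)) key).mpr h1

/-- A distribution inside one of the null planes can be non-degenerate only if it is zero, and the
remaining case is the full tangent space. Both are excluded by the rank. -/
theorem isIndecomposable_dancingMetric : IsIndecomposable dancingMetric := by
  intro U hU hne r hr0 hr D hdist hpar hnd
  obtain ⟨V₁, hV₁, hV₁o, hV₁ne, k, hk⟩ :=
    exists_chartIndex_eq (f := point) (continuous_fst.comp continuous_subtype_val) hU hne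
  obtain ⟨V, hV, hVo, ⟨c, hc⟩, l, hl⟩ :=
    exists_chartIndex_eq (f := line) (continuous_snd.comp continuous_subtype_val) hV₁o hV₁ne
  have hVU : V ⊆ U := hV.trans hV₁
  have hdist' : IsDistributionOn D r V := by
    intro m hm
    obtain ⟨h1, W, hW, hWo, hmW, X, hX, hs⟩ := hdist m (hVU hm)
    exact ⟨h1, W ∩ V, inter_subset_right, hWo.inter hVo, ⟨hmW, hm⟩, X,
      fun i => (hX i).mono inter_subset_left, fun x hx => hs x hx.1⟩
  have hpar' : IsParallelOn dancingMetric D V := fun W hW => hpar W (hW.trans hVU)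
  have hinv := curvature_mem_of_isParallelOn hdist' hpar' hc fun m hm =>
    extChartAt_congr ((hk m (hV hm)).trans (hk c (hV hc)).symm) ((hl m hm).trans (hl c hc).symm)
  obtain ⟨b, Hb⟩ := exists_isAdapted_metricAt c
  have hrank : Module.finrank ℝ (D c : Submodule ℝ E4) = r := (hdist c (hVU hc)).1
  have hnd' (v : E4) (hv : v ∈ D c) (h : ∀ w : E4, w ∈ D c → metricAt dancingMetric c v w = 0) :
      v = 0 := hnd c (hVU hc) v hv h
  have hbot : (D c : Submodule ℝ E4) ≠ ⊥ := by
    intro h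
    rw [h, finrank_bot] at hrank
    omega
  rcases Hb.invariant_trichotomy (D := D c) (fun u v w hw => by
    have h1 := hinv v u w hw
    rwa [curvature_dancingMetric] at h1) with h | h | h
  · exact hbot ((Submodule.eq_bot_iff _).2 fun (v : E4) hv => hnd' v hv fun (w : E4) hw =>
      Hb.apply_eq_zero₂ (h v hv) (h w hw))
  · exact hbot ((Submodule.eq_bot_iff _).2 fun (v : E4) hv => hnd' v hv fun (w : E4) hw =>
      Hb.apply_eq_zero₁ (h v hv) (h w hw))
  · refine hr.ne (hrank.symm.trans ?_)
    exact (congrArg (fun S : Submodule ℝ E4 => Module.finrank ℝ S) h).trans (finrank_top ℝ E4)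

end M4
-- Assembly of the theorem
theorem mainTheorem5 :
    (T2Space M4 ∧ SecondCountableTopology M4) ∧
    -- existence and uniqueness of the dancing metric and of the orientation
    (∃! g : BilinField I4 M4, M4.IsDancingMetric g) ∧
    ∀ g : BilinField I4 M4, M4.IsDancingMetric g →
    (∃! vol : M4 → M4.E4 [⋀^Fin 4]→ₗ[ℝ] ℝ, ∀ m, M4.IsOrientedVolume g m (vol m)) ∧
    ∀ vol : M4 → M4.E4 [⋀^Fin 4]→ₗ[ℝ] ℝ, (∀ m, M4.IsOrientedVolume g m (vol m)) →
    -- (1) `M⁴ = SL₃(ℝ) / H` with `H ≃ GL₂(ℝ)`, as a smooth manifold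
    ((∀ (A : Matrix.SpecialLinearGroup (Fin 3) ℝ) (z : (Fin 3 → ℝ) × (Fin 3 → ℝ)),
        z.2 ⬝ᵥ z.1 ≠ 0 → A • M4.ofHomogeneous z =
          M4.ofHomogeneous (A.1 *ᵥ z.1, z.2 ᵥ* (A⁻¹ : Matrix.SpecialLinearGroup (Fin 3) ℝ).1)) ∧
      (∃ F : (Fin 3 → Fin 3 → ℝ) × M4 → M4,
        ContMDiffOn (𝓘(ℝ, Fin 3 → Fin 3 → ℝ).prod I4) I4 ∞ F {x | (Matrix.of x.1).det ≠ 0} ∧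
        ∀ (A : Matrix.SpecialLinearGroup (Fin 3) ℝ) (m : M4),
          F (fun i j => A.1 i j, m) = A • m) ∧
      MulAction.stabilizer (Matrix.SpecialLinearGroup (Fin 3) ℝ) M4.base = M4.blockHom.range ∧
      Topology.IsEmbedding M4.blockHom ∧
      (∃ Φ : (Matrix.SpecialLinearGroup (Fin 3) ℝ ⧸ M4.blockHom.range) ≃ₜ M4,
        ∀ A : Matrix.SpecialLinearGroup (Fin 3) ℝ, Φ (QuotientGroup.mk A) = A • M4.base) ∧
      (∀ m : M4, ∃ U : Set M4, IsOpen U ∧ m ∈ U ∧ ∃ σ : M4 → Fin 3 → Fin 3 → ℝ,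
        ContMDiffOn I4 𝓘(ℝ, Fin 3 → Fin 3 → ℝ) ∞ σ U ∧
        ∀ x ∈ U, ∃ A : Matrix.SpecialLinearGroup (Fin 3) ℝ,
          (∀ i j, A.1 i j = σ x i j) ∧ A • M4.base = x) ∧
      -- invariance of the metric, symmetry
      (∀ A : Matrix.SpecialLinearGroup (Fin 3) ℝ, PreservesMetric g (fun m => A • m)) ∧
      (∃ τ : Matrix.SpecialLinearGroup (Fin 3) ℝ ≃* Matrix.SpecialLinearGroup (Fin 3) ℝ,
        Continuous τ ∧ τ ≠ MulEquiv.refl _ ∧ (∀ A, τ (τ A) = A) ∧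
        ∀ A, τ A = A ↔ A ∈ M4.blockHom.range) ∧
      IsSymmetricSpace g ∧
      -- the `GL₂(ℝ)`-structure and the para-Kähler structure
      IsParaKahler g M4.paraK ∧
      (∀ (A : Matrix.SpecialLinearGroup (Fin 3) ℝ) (m : M4) (v : TangentSpace I4 m),
        mfderiv I4 I4 (fun x : M4 => A • x) m (M4.paraK m v) =
          M4.paraK (A • m) (mfderiv I4 I4 (fun x : M4 => A • x) m v)) ∧
      (∀ L : TangentSpace I4 M4.base ≃L[ℝ] TangentSpace I4 M4.base,
        (∀ v w, g M4.base (L v) (L w) = g M4.base v w) →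
        (∀ v, L (M4.paraK M4.base v) = M4.paraK M4.base (L v)) →
        ∃! B : GL (Fin 2) ℝ, ∀ v : TangentSpace I4 M4.base,
          (⟨M4.blockHom B • M4.base, mfderiv I4 I4 (fun x : M4 => M4.blockHom B • x) M4.base v⟩ :
            TangentBundle I4 M4) = ⟨M4.base, L v⟩)) ∧
    -- (2) completeness and curvature
    (IsGeodesicallyComplete g ∧ IsEinstein g ∧ IsIndecomposable g ∧ HasSignature g 2 2 ∧
      (∀ m, WeylMinusVanishesAt g m (vol m)) ∧ ¬ IsConformallyFlat g ∧
      (∀ m, ¬ WeylPlusVanishesAt g m (vol m)) ∧ (∀ m, WeylPlusTypeDAt g m (vol m))) ∧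
    -- (3) the two self-dual foliations
    ((∀ m, IsCompl (M4.pointDir m) (M4.lineDir m)) ∧
      M4.IsDancingFoliation g vol M4.lineDir M4.point ∧
      M4.IsDancingFoliation g vol M4.pointDir M4.line) ∧
    -- (4) the family of anti-self-dual surfaces
    ((IsClosed {x : RP2 × RP2Dual | Incident x} ∧
        ∃ T : ∀ x : RP2 × RP2Dual, Submodule ℝ (TangentSpace I4 x),
          IsSubmanifold {x : RP2 × RP2Dual | Incident x} 1 T) ∧
      (∀ x : RP2 × RP2Dual, Incident x → IsConnected (M4.sigmaSurface x) ∧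
        ∃ T : ∀ m : M4, Submodule ℝ (TangentSpace I4 m),
          IsSubmanifold (M4.sigmaSurface x) 2 T ∧ IsTotallyGeodesic g (M4.sigmaSurface x) T ∧
          ∀ m ∈ M4.sigmaSurface x, IsNullSubspace g m (T m) ∧
            IsAntiSelfDualPlane (V := M4.E4) (metricAt g m) (vol m) (T m)) ∧
      (∀ x y : RP2 × RP2Dual, Incident x → Incident y →
        M4.sigmaSurface x = M4.sigmaSurface y → x = y)) := by 
  refine ⟨⟨inferInstance, inferInstance⟩, ⟨M4.dancingMetric, M4.isDancingMetric_dancingMetric,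
    fun g hg => hg.eq_dancingMetric⟩, fun g hg => ?_⟩
  obtain rfl := hg.eq_dancingMetric
  refine ⟨M4.existsUnique_orientedVolume, fun vol hvol => ⟨⟨M4.smul_ofHomogeneous,
    M4.exists_smooth_action, M4.stabilizer_base, M4.isEmbedding_blockHom, M4.exists_homeomorph,
    M4.exists_local_section, M4.preservesMetric_smul, M4.exists_involution,
    M4.isSymmetricSpace_dancingMetric, M4.isParaKahler_dancingMetric, M4.mfderiv_smul_paraK,
    M4.existsUnique_isotropy⟩,
    ⟨M4.isGeodesicallyComplete_dancingMetric, M4.isEinstein_dancingMetric,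
      M4.isIndecomposable_dancingMetric, M4.hasSignature_dancingMetric, fun m => ?_,
      M4.not_isConformallyFlat_dancingMetric, fun m => ?_, fun m => ?_⟩,
    ⟨M4.isCompl_pointDir_lineDir, M4.isDancingFoliation_point vol hvol,
      M4.isDancingFoliation_line vol hvol⟩,
    ⟨M4.isClosed_incident, M4.isSubmanifold_incident⟩,
    fun x hx => ⟨M4.isConnected_sigmaSurface hx, M4.sigmaTangent x,
      M4.isSubmanifold_sigmaSurface x, M4.isTotallyGeodesic_sigmaSurface x, fun m hm =>
        ⟨M4.isNullSubspace_sigmaTangent hx hm,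
          M4.isAntiSelfDualPlane_sigmaTangent hx hm (hvol m)⟩⟩,
    fun x y hx _ h => M4.sigmaSurface_injective hx h⟩⟩
  all_goals
    obtain ⟨b, hb, e⟩ := (M4.isOrientedVolume_iff m _).1 (hvol m)
    rw [e]
  · exact M4.weylMinusVanishesAt_dancingMetric m hb
  · exact M4.weylPlus_ne_zero m hb
  · exact M4.weylPlusTypeDAt_dancingMetric m hb
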